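/- **Problem.** An instance of QIB has variables $x\in\mathbb R^n$ ($n\ge 1$), whose indices are partitioned into a set $B$ of nonempty blocks $B_i$, and one binary variable $z_i$ per block; $x[i]$ is the restriction of $x$ to $B_i$. For $r=0,\dots,m$ let $$f_r(x,z)=\sum_i x[i]^TQ^r_i x[i]+\sum_j d^r_jx_j^2+\sum_j c^r_jx_j+\sum_i v^r_iz_i .$$ The problem is to minimize $f_0(x,z)$ subject to $f_r(x,z)\le p_r$ ($1\le r\le m$), $\ell_j\le x_j\le u_j$, $z_i\in\{0,1\}$, and $x[i]=0$ whenever $z_i=0$. Constraint $r$ is *mixed-integer* if some $Q^r_i$, or $d^r$, or $c^r$ is nonzero, and *combinatorial* otherwise. For $r=0$ and for mixed-integer $r$, $Q^r_i\succeq 0$ and $d^r\ge 0$; for combinatorial $r$, $v^r_i\in\{0,1,-1\}$. Scaling assumption: $\ell_j=0$, $u_j=1$ for all $j$, and $\sum_i\sum_{h,k}|(Q^r_i)_{hk}|+\sum_j(d^r_j+|c^r_j|)+\sum_i|v^r_i|=1$ for every mixed-integer $r$. Constraint $r$ and block $B_i$ are *incident* if $Q^r_i\ne 0$, or $\sum_{j\in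 B_i}(d^r_j+|c^r_j|)>0$, or $v^r_i\neq 0$; $\mathbb B^r$ is the set of blocks incident with $r$. The *constraint-block intersection graph* has the $m$ constraints as vertices, two of them being adjacent if some block is incident with both. Let $\omega$ be its treewidth (taken as $0$ if $m=0$), $m_c$ the number of combinatorial constraints, and $\kappa$ the maximum of $1$ and of the largest $|\mathbb B^r|$ over combinatorial $r$. **Computation.** The algorithm is one fixed program of a real random access machine (unit-cost addition, truncated subtraction and comparison of natural numbers; unit-cost field operations and comparison of reals; conversion of naturals to reals; indirect addressing). It is given $\epsilon$, the lists of constraints incident with each block, the types of the constraints, the numbers $p_r$ and $v^r_i$ $(r\ge1)$, and a tree-decomposition of the graph of width $\omega$ with at most $n+m$ nodes, in the form of a parent array with the bags. It has access to an exact solver for single-block problems: for a block $i$ and right-hand sides $(\rho_r)$ given by the algorithm, minimize $f_0$ restricted to block $i$ with $z_i=1$ over $0\le x[i]\le 1$ subject to $f_r\text{ restricted to block } i\text{ with }z_i=1\ \le \rho_r$ for all mixed-integer $r$ incident with $B_i$; the solver reports infeasibility or returns an optimal solution and the optimal value. **Theorem.** There are a program as above and a universal constant $C$ such that for every instance with the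 scaling assumption the following hold. A tree-decomposition of width $\omega$ with at most $n+m$ nodes exists, and every single-block problem is a convex QCQP with at most $\omega+1$ rows (besides the bounds). For every such tree-decomposition, every exact solver and every $0<\epsilon<1$, the program terminates after at most $$C^{\omega+1}\,(n+m)\,(2/\epsilon)^{2\omega+2}\,\kappa^{2\min\{m_c,\omega+1\}}$$ steps and at most $C^{\omega+1}\,|B|\,(2/\epsilon)^{\omega+1}$ calls of the solver, and it either reports, correctly, that the instance is infeasible, or computes a vector $(x,z)$ with $0\le x\le 1$, $z$ binary and $x[i]=0$ whenever $z_i=0$ that (a) is superoptimal: $f_0(x,z)\le f_0(x',z')$ for every feasible $(x',z')$; (b) satisfies all combinatorial constraints; and (c) satisfies $f_r(x,z)\le p_r+\epsilon\max_{s}|\mathbb B^{s}|$ for every mixed-integer constraint $r$. -/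

import Mathlib

/-! ## Quadratic problems with indicator blocks -/

/-- The coefficients of one function
`∑ i, x[i]ᵀ Q i x[i] + ∑ j, d j x j ^ 2 + ∑ j, c j x j + ∑ i, v i z i`,
where the variables are split into blocks `B i = {j | blk j = i}` and `x[i]` is the restriction
of `x` to `B i`. -/
structure BlockForm {n b : ℕ} (blk : Fin n → Fin b) where
  Q : (i : Fin b) → Matrix {j // blk j = i} {j // blk j = i} ℝ
  d : Fin n → ℝ
  c : Fin n → ℝ
  v : Fin b → ℝ

namespace BlockForm

variable {n b : ℕ} {blk : Fin n → Fin b}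

/-- The value of the function at `(x, z)`. -/
noncomputable def eval (F : BlockForm blk) (x : Fin n → ℝ) (z : Fin b → ℝ) : ℝ :=
  (∑ i, (fun j : {j // blk j = i} => x j) ⬝ᵥ (F.Q i).mulVec (fun j => x j))
    + ∑ j, F.d j * x j ^ 2 + ∑ j, F.c j * x j + ∑ i, F.v i * z i

/-- The part of the function that belongs to block `i`, with `z i = 1`, as a function of `x[i]`. -/
noncomputable def blockEval (F : BlockForm blk) (i : Fin b) (y : {j // blk j = i} → ℝ) : ℝ :=
  y ⬝ᵥ (F.Q i).mulVec y + ∑ j : {j // blk j = i}, F.d j * y j ^ 2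
    + ∑ j : {j // blk j = i}, F.c j * y j + F.v i

/-- The function involves the continuous variables. -/
def HasContinuous (F : BlockForm blk) : Prop :=
  (∃ i, F.Q i ≠ 0) ∨ F.d ≠ 0 ∨ F.c ≠ 0

/-- The function has at least one term related to block `i`. -/
def Incident (F : BlockForm blk) (i : Fin b) : Prop :=
  F.Q i ≠ 0 ∨ 0 < ∑ j : {j // blk j = i}, (F.d j + |F.c j|) ∨ 0 < |F.v i|

/-- The quadratic data are convex. -/
def IsConvex (F : BlockForm blk) : Prop :=
  (∀ i, (F.Q i).PosSemidef) ∧ ∀ j, 0 ≤ F.d j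

/-- The sum of the absolute values of all coefficients (`d` is nonnegative where this is used). -/
noncomputable def totalWeight (F : BlockForm blk) : ℝ :=
  (∑ i, ∑ h, ∑ k, |F.Q i h k|) + ∑ j, (F.d j + |F.c j|) + ∑ i, |F.v i|

end BlockForm

/-- An instance of QIB with `n` continuous variables, `b` blocks and `m` constraints: minimize
`obj` subject to `con r ≤ rhs r`, `lo ≤ x ≤ hi`, `z` binary, and `x[i] = 0` whenever `z i = 0`.
A constraint is mixed-integer if it involves the continuous variables and combinatorial
otherwise. The objective and the mixed-integer constraints are convex, and combinatorial
constraints have coefficients `0, 1, -1`. -/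
structure QIB (n b m : ℕ) where
  blk : Fin n → Fin b
  blk_surj : Function.Surjective blk
  obj : BlockForm blk
  con : Fin m → BlockForm blk
  rhs : Fin m → ℝ
  lo : Fin n → ℝ
  hi : Fin n → ℝ
  obj_convex : obj.IsConvex
  con_convex : ∀ r, (con r).HasContinuous → (con r).IsConvex
  con_comb : ∀ r, ¬ (con r).HasContinuous → ∀ i,
    (con r).v i = 0 ∨ (con r).v i = 1 ∨ (con r).v i = -1

namespace QIB

variable {n b m : ℕ}

/-- Constraint `r` is mixed-integer. -/
def IsMixed (P : QIB n b m) (r : Fin m) : Prop := (P.con r).HasContinuous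

/-- The constraints on `(x, z)` apart from the inequalities `con r ≤ rhs r`. -/
def InDomain (P : QIB n b m) (x : Fin n → ℝ) (z : Fin b → ℝ) : Prop :=
  (∀ j, P.lo j ≤ x j ∧ x j ≤ P.hi j) ∧ (∀ i, z i = 0 ∨ z i = 1) ∧
    ∀ j, z (P.blk j) = 0 → x j = 0

/-- `(x, z)` is feasible. -/
def Feasible (P : QIB n b m) (x : Fin n → ℝ) (z : Fin b → ℝ) : Prop :=
  P.InDomain x z ∧ ∀ r, (P.con r).eval x z ≤ P.rhs r

/-- The scaling assumption. -/
def Scaled (P : QIB n b m) : Prop :=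
  (∀ j, P.lo j = 0 ∧ P.hi j = 1) ∧ ∀ r, P.IsMixed r → (P.con r).totalWeight = 1

open Classical in
/-- The set of blocks incident with constraint `r`. -/
noncomputable def blocksOf (P : QIB n b m) (r : Fin m) : Finset (Fin b) :=
  {i | (P.con r).Incident i}

open Classical in
/-- The set of constraints incident with block `i`. -/
noncomputable def consOf (P : QIB n b m) (i : Fin b) : Finset (Fin m) :=
  {r | (P.con r).Incident i}

open Classical in
/-- The set of mixed-integer constraints incident with block `i`. -/
noncomputable def rows (P : QIB n b m) (i : Fin b) : Finset (Fin m) :=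
  {r | P.IsMixed r ∧ (P.con r).Incident i}

/-- The constraint-block intersection graph. -/
def graph (P : QIB n b m) : SimpleGraph (Fin m) where
  Adj r r' := r ≠ r' ∧ ∃ i, (P.con r).Incident i ∧ (P.con r').Incident i
  symm := ⟨fun _ _ h => ⟨h.1.symm, h.2.imp fun _ hi => ⟨hi.2, hi.1⟩⟩⟩
  loopless := ⟨fun _ h => h.1 rfl⟩

/-- The largest number of blocks incident with a constraint. -/
noncomputable def maxBlocks (P : QIB n b m) : ℕ :=
  Finset.univ.sup fun r => (P.blocksOf r).card

open Classical in
/-- The set of combinatorial constraints. -/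
noncomputable def combs (P : QIB n b m) : Finset (Fin m) := {r | ¬ P.IsMixed r}

/-- The largest support of a combinatorial constraint. -/
noncomputable def kappa (P : QIB n b m) : ℕ :=
  P.combs.sup fun r => (P.blocksOf r).card

/-! ### The single-block problems -/

/-- Feasibility for the restriction of the problem to block `i` with `z i = 1`, whose rows are the
mixed-integer constraints incident with the block, with right-hand sides `u`. -/
def BlockFeasible (P : QIB n b m) (i : Fin b) (u : P.rows i → ℝ)
    (y : {j // P.blk j = i} → ℝ) : Prop :=
  (∀ r : P.rows i, (P.con r).blockEval i y ≤ u r) ∧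
    ∀ j : {j // P.blk j = i}, P.lo j ≤ y j ∧ y j ≤ P.hi j

/-- `y` is an optimal solution of the single-block problem. -/
def BlockOptimal (P : QIB n b m) (i : Fin b) (u : P.rows i → ℝ)
    (y : {j // P.blk j = i} → ℝ) : Prop :=
  P.BlockFeasible i u y ∧
    ∀ y', P.BlockFeasible i u y' → P.obj.blockEval i y ≤ P.obj.blockEval i y'

/-- The single-block problems of block `i` are convex and have at most `k` rows. -/
def BlockConvexWithRows (P : QIB n b m) (i : Fin b) (k : ℕ) : Prop :=
  ConvexOn ℝ Set.univ (P.obj.blockEval i) ∧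
    (∀ r ∈ P.rows i, ConvexOn ℝ Set.univ ((P.con r).blockEval i)) ∧ (P.rows i).card ≤ k

/-- A procedure that answers a single-block problem by a vector, or by `none`. -/
abbrev Solver (P : QIB n b m) : Type :=
  (i : Fin b) → (P.rows i → ℝ) → Option ({j // P.blk j = i} → ℝ)

/-- The solver returns an optimal solution if there is a feasible one, and `none` otherwise. -/
def Solver.Exact {P : QIB n b m} (S : P.Solver) : Prop :=
  ∀ i u, (∀ y, S i u = some y → P.BlockOptimal i u y) ∧
    (S i u = none → ∀ y, ¬ P.BlockFeasible i u y)

end QIB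

/-! ## Tree-decompositions -/

/-- A tree-decomposition of `G` with node set `τ`. -/
structure TreeDecomposition {V : Type*} (G : SimpleGraph V) (τ : Type*) where
  T : SimpleGraph τ
  isTree : T.IsTree
  bag : τ → Finset V
  connected : ∀ v, (T.induce {t | v ∈ bag t}).Connected
  edge : ∀ u v, G.Adj u v → ∃ t, u ∈ bag t ∧ v ∈ bag t

/-- The width: the largest size of a bag, minus one. -/
def TreeDecomposition.width {V : Type*} {G : SimpleGraph V} {τ : Type*} [Fintype τ]
    (D : TreeDecomposition G τ) : ℕ :=
  (Finset.univ.sup fun t => (D.bag t).card) - 1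

/-- The treewidth of `G` (`0` for the graph without vertices). -/
noncomputable def treewidth {V : Type*} (G : SimpleGraph V) : ℕ :=
  sInf {w | ∃ (N : ℕ) (D : TreeDecomposition G (Fin N)), D.width = w}

/-- A tree-decomposition with `N` nodes whose tree is given by a parent array: node `0` is the
root, and every other node `t` is adjacent to its parent, which has a smaller number. -/
structure RootedDecomposition {V : Type*} (G : SimpleGraph V) (N : ℕ) extends
    TreeDecomposition G (Fin N) where
  par : Fin N → Fin N
  par_spec : ∀ t : Fin N, 0 < (t : ℕ) → par t < t ∧ T.Adj (par t) t

/-! ## A real random access machine with a solver for single-block problems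

The memory consists of arrays of natural numbers and arrays of real numbers, with two indices
that may be computed (indirect addressing). Natural numbers can be added, subtracted (cut off at
zero) and compared, real numbers can be added, subtracted, multiplied, divided and compared, and
natural numbers can be converted to real ones; there is no conversion in the other direction. -/

/-- A state of the memory: `nat a i k` is cell `(i, k)` of the array number `a` of natural numbers,
`real a i k` that of the array number `a` of real numbers. -/
structure Store where
  nat : ℕ → ℕ → ℕ → ℕ
  real : ℕ → ℕ → ℕ → ℝ

/-- Write into a cell of an array of natural numbers. -/
def Store.setNat (σ : Store) (a i k x : ℕ) : Store :=
  { σ with nat := fun a' i' k' => if a' = a ∧ i' = i ∧ k' = k then x else σ.nat a' i' k' }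

/-- Write into a cell of an array of real numbers. -/
noncomputable def Store.setReal (σ : Store) (a i k : ℕ) (x : ℝ) : Store :=
  { σ with real := fun a' i' k' => if a' = a ∧ i' = i ∧ k' = k then x else σ.real a' i' k' }

/-- Expressions for natural numbers. -/
inductive NExp : Type
  | lit (x : ℕ)
  | get (a : ℕ) (i k : NExp)
  | add (e f : NExp)
  | sub (e f : NExp)

/-- Expressions for real numbers. -/
inductive RExp : Type
  | ofNat (e : NExp)
  | get (a : ℕ) (i k : NExp)
  | add (e f : RExp)
  | sub (e f : RExp)
  | mul (e f : RExp)
  | div (e f : RExp)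

/-- Tests. -/
inductive Test : Type
  | natLE (e f : NExp)
  | realLE (e f : RExp)

def NExp.eval (σ : Store) : NExp → ℕ
  | lit x => x
  | get a i k => σ.nat a (i.eval σ) (k.eval σ)
  | add e f => e.eval σ + f.eval σ
  | sub e f => e.eval σ - f.eval σ

noncomputable def RExp.eval (σ : Store) : RExp → ℝ
  | ofNat e => (e.eval σ : ℝ)
  | get a i k => σ.real a (i.eval σ) (k.eval σ)
  | add e f => e.eval σ + f.eval σ
  | sub e f => e.eval σ - f.eval σ
  | mul e f => e.eval σ * f.eval σ
  | div e f => e.eval σ / f.eval σ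

def Test.Holds (σ : Store) : Test → Prop
  | natLE e f => e.eval σ ≤ f.eval σ
  | realLE e f => e.eval σ ≤ f.eval σ

/-- Programs. The command `solve i u f w y` calls the solver for block `i` with the right-hand
side of row `r` taken from cell `(r, 0)` of the real array `u`. It writes `1` or `0` (feasible or
not) into cell `(0, 0)` of the natural array `f`; in the feasible case it also writes the optimal
value into cell `(0, 0)` of the real array `w` and, for each variable `j` of the block, coordinate
`j` of the optimal solution into cell `(j, 0)` of the real array `y`. -/
inductive Cmd : Type
  | skip
  | setNat (a : ℕ) (i k : NExp) (e : NExp)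
  | setReal (a : ℕ) (i k : NExp) (e : RExp)
  | seq (p q : Cmd)
  | ite (t : Test) (p q : Cmd)
  | loop (t : Test) (p : Cmd)
  | solve (i : NExp) (u f w y : ℕ)

/-- Copy a vector on block `i` into a real array. -/
noncomputable def Store.writeBlock {n b : ℕ} (blk : Fin n → Fin b) (i : Fin b) (σ : Store)
    (a : ℕ) (y : {j // blk j = i} → ℝ) : Store :=
  { σ with real := fun a' j k =>
      if h : ∃ hj : j < n, blk ⟨j, hj⟩ = i then
        if a' = a ∧ k = 0 then y ⟨⟨j, h.1⟩, h.2⟩ else σ.real a' j k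
      else σ.real a' j k }

/-- The effect of a call of the solver `S` for block `i`. -/
noncomputable def Store.afterSolve {n b m : ℕ} {P : QIB n b m} (S : P.Solver) (i : Fin b)
    (u f w y : ℕ) (σ : Store) : Store :=
  match S i (fun r => σ.real u (r : Fin m) 0) with
  | none => σ.setNat f 0 0 0
  | some s => ((σ.setNat f 0 0 1).setReal w 0 0 (P.obj.blockEval i s)).writeBlock P.blk i y s

/-- `Exec S p σ σ' t q`: program `p`, started in `σ`, terminates in `σ'` after `t` steps and
`q` calls of the solver `S`. Every assignment, every evaluation of a test and every issuing of a
call is one step (the expressions in a fixed program have bounded size); the work of the solver is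
counted by `q`. -/
inductive Exec {n b m : ℕ} {P : QIB n b m} (S : P.Solver) :
    Cmd → Store → Store → ℕ → ℕ → Prop
  | skip (σ : Store) : Exec S .skip σ σ 1 0
  | setNat (σ : Store) (a : ℕ) (i k e : NExp) :
      Exec S (.setNat a i k e) σ (σ.setNat a (i.eval σ) (k.eval σ) (e.eval σ)) 1 0
  | setReal (σ : Store) (a : ℕ) (i k : NExp) (e : RExp) :
      Exec S (.setReal a i k e) σ (σ.setReal a (i.eval σ) (k.eval σ) (e.eval σ)) 1 0
  | seq {p p' : Cmd} {σ₁ σ₂ σ₃ : Store} {t t' q q' : ℕ} :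
      Exec S p σ₁ σ₂ t q → Exec S p' σ₂ σ₃ t' q' → Exec S (.seq p p') σ₁ σ₃ (t + t') (q + q')
  | iteTrue {c : Test} {p p' : Cmd} {σ σ' : Store} {t q : ℕ} :
      c.Holds σ → Exec S p σ σ' t q → Exec S (.ite c p p') σ σ' (t + 1) q
  | iteFalse {c : Test} {p p' : Cmd} {σ σ' : Store} {t q : ℕ} :
      ¬ c.Holds σ → Exec S p' σ σ' t q → Exec S (.ite c p p') σ σ' (t + 1) q
  | loopStop {c : Test} {p : Cmd} {σ : Store} :
      ¬ c.Holds σ → Exec S (.loop c p) σ σ 1 0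
  | loopStep {c : Test} {p : Cmd} {σ₁ σ₂ σ₃ : Store} {t t' q q' : ℕ} :
      c.Holds σ₁ → Exec S p σ₁ σ₂ t q → Exec S (.loop c p) σ₂ σ₃ t' q' →
        Exec S (.loop c p) σ₁ σ₃ (t + t' + 1) (q + q')
  | solve (σ : Store) (e : NExp) (u f w y : ℕ) (h : e.eval σ < b) :
      Exec S (.solve e u f w y) σ (σ.afterSolve S ⟨e.eval σ, h⟩ u f w y) 1 1

/-! ### Input and output -/

open Classical in
/-- The memory at the start; cells not mentioned hold `0`.

Natural arrays: `0` holds `n, m, b, N`; `1` the block of each variable; `2` whether each constraint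
is mixed-integer; `3` and `4` the number and the list of the constraints incident with each block;
`5` the parent of each node of the tree; `6` and `7` the size and the list of elements of each bag.

Real arrays: `0` holds `ε`; `1` the right-hand sides of the constraints; `2` the coefficients
`v` of the constraints, with indices (constraint, block).

A program has no access to `Q`, `d`, `c` and to the objective except through the solver. -/
noncomputable def inputStore {n b m N : ℕ} (P : QIB n b m) (D : RootedDecomposition P.graph N)
    (ε : ℝ) : Store where
  nat a i k :=
    match a with
    | 0 => if k = 0 then [n, m, b, N].getD i 0 else 0
    | 1 => if h : i < n ∧ k = 0 then P.blk ⟨i, h.1⟩ else 0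
    | 2 => if h : i < m ∧ k = 0 then (if P.IsMixed ⟨i, h.1⟩ then 1 else 0) else 0
    | 3 => if h : i < b ∧ k = 0 then (P.consOf ⟨i, h.1⟩).card else 0
    | 4 => if h : i < b then (((P.consOf ⟨i, h⟩).sort (· ≤ ·)).map Fin.val).getD k 0 else 0
    | 5 => if h : i < N ∧ k = 0 then D.par ⟨i, h.1⟩ else 0
    | 6 => if h : i < N ∧ k = 0 then (D.bag ⟨i, h.1⟩).card else 0
    | 7 => if h : i < N then (((D.bag ⟨i, h⟩).sort (· ≤ ·)).map Fin.val).getD k 0 else 0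
    | _ => 0
  real a i k :=
    match a with
    | 0 => if i = 0 ∧ k = 0 then ε else 0
    | 1 => if h : i < m ∧ k = 0 then P.rhs ⟨i, h.1⟩ else 0
    | 2 => if h : i < m ∧ k < b then (P.con ⟨i, h.1⟩).v ⟨k, h.2⟩ else 0
    | _ => 0

/-- The answer at the end: `0` (infeasible) or `1` (a vector was computed). -/
def Store.answer (σ : Store) : ℕ := σ.nat 8 0 0

/-- The continuous variables of the computed vector. -/
def Store.outX (σ : Store) (n : ℕ) : Fin n → ℝ := fun j => σ.real 3 j 0

/-- The binary variables of the computed vector. -/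
def Store.outZ (σ : Store) (b : ℕ) : Fin b → ℝ := fun i => (σ.nat 9 i 0 : ℝ)

/-- `(x, z)` is superoptimal, satisfies all constraints except the mixed-integer ones, and violates
each of those by at most `δ`. -/
def QIB.ApproxSolution {n b m : ℕ} (P : QIB n b m) (δ : ℝ) (x : Fin n → ℝ) (z : Fin b → ℝ) :
    Prop :=
  (∀ x' z', P.Feasible x' z' → P.obj.eval x z ≤ P.obj.eval x' z') ∧
    P.InDomain x z ∧
    (∀ r, ¬ P.IsMixed r → (P.con r).eval x z ≤ P.rhs r) ∧
    (∀ r, P.IsMixed r → (P.con r).eval x z ≤ P.rhs r + δ)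

/-!
The program is a dynamic program over the tree-decomposition in which the resource consumptions of
the blocks are rounded to a grid.

*Rounding.* With `K = ⌊1 / ε⌋ + 1`, the consumption of a mixed-integer constraint by a set of
blocks is recorded as an integer multiple of `ε` between `-K * ε` and `K * ε`; by the scaling
assumption no consumption leaves this range (`abs_sum_blockEval_le`). A combinatorial constraint is
recorded exactly, as an integer between `-κ` and `κ`. A block that is switched on gets one entry
for each grid vector for which its single-block problem, with right-hand sides one unit above the
grid vector, is feasible; so every solution is represented by an entry that rounds its consumptions
down, at no greater cost, and an entry underestimates the consumptions of its block by at most `ε`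
for each mixed-integer constraint incident with the block.

*Merging.* The constraints incident with one block are pairwise adjacent, so that a bag contains
them all, and the block becomes a leaf below this bag. The tables are merged along the tree,
children first; the table of a node has, for every vector of consumptions of the constraints in its
bag by the blocks below the node, the least cost found. A constraint is compared with its
right-hand side when its topmost bag is merged into the parent. Sums below the range are rounded up
to its lower end, which does no harm, since the true consumption is never below it; sums above the
range are discarded. Hence every feasible solution is represented in the last table
(`MergeTree.IsTable.final_entry`), which gives superoptimality, and the entries found by tracing
the last table back respect all right-hand sides (`MergeTree.IsTable.sum_entry_trace_le`), which
gives the bound on the violation: `ε` for each block incident with the constraint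
(`approxSolution_of_trace`).

*Running time.* A greedy colouring along the tree assigns to every constraint one of `L₁` slots, if
it is mixed-integer, or one of `L₂` further slots, if it is combinatorial, such that constraints
with a common bag have different slots. Here `L₁ ≤ ω + 1` is the largest size of a bag and `L₂` the
minimum of `L₁` and the number of combinatorial constraints. Vectors of consumptions are stored as
numbers with mixed-radix digits, one for each slot, so that there are `(2 K + 1) ^ L₁ * (2 κ + 1) ^
L₂` of them. A merge goes through all pairs of vectors, and there is one merge for each node and
each block. The solver is called for vectors of the slots of mixed-integer constraints only, and
once more for each block when the solution is written.

The machine-level part is a small calculus of total correctness with time bounds, `Runs`, in which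
each part of the program is verified against the combinatorial description of what it computes.
-/

/-! ### Tree-decompositions given by parent arrays -/

namespace RootedDecomposition

variable {V : Type*} {G : SimpleGraph V} {N : ℕ}

lemma pos (D : RootedDecomposition G N) : 0 < N := by
  obtain ⟨t⟩ := D.isTree.1.nonempty
  exact t.pos

/-- Counting edges: the pairs `{par t, t}` with `t ≠ 0` are all the edges of the tree. -/
lemma adj_par (D : RootedDecomposition G N) {u v : Fin N} (h : D.T.Adj u v) :
    (0 < (v : ℕ) ∧ D.par v = u) ∨ (0 < (u : ℕ) ∧ D.par u = v) := by
  classical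
  let f : {t : Fin N // 0 < (t : ℕ)} → Sym2 (Fin N) := fun t => s(D.par t, t)
  have hf : Function.Injective f := by
    intro a a' haa
    simp only [f, Sym2.eq_iff] at haa
    rcases haa with h | h
    · exact Subtype.ext h.2
    · have h1 := (D.par_spec a a.2).1
      have h2 := (D.par_spec a' a'.2).1
      rw [h.1] at h1
      rw [← h.2] at h2
      exact absurd h1 (lt_asymm h2)
  have hsub : Finset.univ.image f ⊆ D.T.edgeFinset := by
    intro e he
    obtain ⟨t, -, rfl⟩ := Finset.mem_image.1 he
    simpa [f] using (D.par_spec t t.2).2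
  have hcard : D.T.edgeFinset.card ≤ (Finset.univ.image f).card := by
    rw [Finset.card_image_of_injective _ hf]
    have h1 := D.isTree.card_edgeFinset
    rw [Fintype.card_fin] at h1
    have h2 : (Finset.univ : Finset {t : Fin N // 0 < (t : ℕ)}).card = N - 1 := by
      have : (Finset.univ : Finset {t : Fin N // 0 < (t : ℕ)}).card
          = (Finset.univ.erase (⟨0, D.pos⟩ : Fin N)).card := by
        rw [Finset.card_univ, Fintype.card_subtype]
        congr 1
        ext t
        simp [Fin.ext_iff, Nat.pos_iff_ne_zero]
      rw [this, Finset.card_erase_of_mem (Finset.mem_univ _), Finset.card_univ, Fintype.card_fin]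
    omega
  have heq := Finset.eq_of_subset_of_card_le hsub hcard
  have hm : s(u, v) ∈ D.T.edgeFinset := by simpa using h
  rw [← heq] at hm
  obtain ⟨t, -, ht⟩ := Finset.mem_image.1 hm
  simp only [f, Sym2.eq_iff] at ht
  rcases ht with ⟨h1, h2⟩ | ⟨h1, h2⟩
  · left; subst h2; exact ⟨t.2, h1⟩
  · right; subst h2; exact ⟨t.2, h1⟩

/-- The nodes whose bags contain a vertex `v` form a subtree: apart from its node of smallest
number, each of them has its parent in the subtree. -/
lemma mem_bag_par (D : RootedDecomposition G N) {v : V} {s t : Fin N} (hs : v ∈ D.bag s)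
    (ht : v ∈ D.bag t) (hst : s < t) : v ∈ D.bag (D.par t) := by
  by_contra hcon
  -- `u` lies in the branch of the tree that hangs at `t`
  let Below : Fin N → Prop := fun u => ∃ l, (D.par^[l] u = t) ∧ ∀ l' < l, 0 < (D.par^[l'] u : ℕ)
  have hle : ∀ u, Below u → t ≤ u := by
    rintro u ⟨l, hl, hl'⟩
    have : ∀ k ≤ l, D.par^[k] u ≤ u := by
      intro k
      induction k with
      | zero => intro _; exact le_rfl
      | succ k ih =>
        intro hk
        rw [Function.iterate_succ_apply']
        exact ((D.par_spec _ (hl' k (by omega))).1.le).trans (ih (by omega))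
    rw [← hl]; exact this l le_rfl
  have hstep : ∀ u w : Fin N, v ∈ D.bag u → v ∈ D.bag w → D.T.Adj u w → Below u → Below w := by
    rintro u w hu hw hadj ⟨l, hl, hl'⟩
    rcases D.adj_par hadj with ⟨h0, hp⟩ | ⟨h0, hp⟩
    · refine ⟨l + 1, by rw [Function.iterate_succ_apply, hp, hl], ?_⟩
      intro l' hll
      cases l' with
      | zero => simpa using h0
      | succ l' => rw [Function.iterate_succ_apply, hp]; exact hl' l' (by omega)
    · cases l with
      | zero =>
        simp only [Function.iterate_zero, id] at hl
        subst hl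
        rw [hp] at hcon
        exact absurd hw hcon
      | succ l =>
        refine ⟨l, by rw [Function.iterate_succ_apply, hp] at hl; exact hl, ?_⟩
        intro l' hll
        have := hl' (l' + 1) (by omega)
        rwa [Function.iterate_succ_apply, hp] at this
  obtain ⟨p⟩ := (D.connected v).preconnected ⟨t, ht⟩ ⟨s, hs⟩
  have key : ∀ (a c : {u // u ∈ {t | v ∈ D.bag t}}),
      (D.T.induce {t | v ∈ D.bag t}).Walk a c → Below a → Below c := by
    intro a c p
    induction p with
    | nil => exact id
    | @cons x y z h q ih => exact fun hx => ih (hstep _ _ x.2 y.2 (by simpa using h) hx)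
  exact absurd (hle _ (key _ _ p ⟨0, rfl, by simp⟩)) (not_le.2 hst)

/-- A parent array with bags such that the nodes of every vertex are closed under taking parents,
except for one of them, is a tree-decomposition. -/
lemma exists_of_par [DecidableEq V] (hN : 0 < N) (par : Fin N → Fin N) (bag : Fin N → Finset V)
    (hpar : ∀ t : Fin N, 0 < (t : ℕ) → par t < t)
    (hbag : ∀ v, ∃ s, v ∈ bag s ∧ ∀ t, v ∈ bag t → t ≠ s → 0 < (t : ℕ) ∧ v ∈ bag (par t))
    (hedge : ∀ u v, G.Adj u v → ∃ t, u ∈ bag t ∧ v ∈ bag t) :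
    ∃ D : RootedDecomposition G N, D.bag = bag ∧ D.par = par := by
  classical
  let T : SimpleGraph (Fin N) :=
    { Adj := fun u v => (0 < (v : ℕ) ∧ par v = u) ∨ (0 < (u : ℕ) ∧ par u = v)
      symm := ⟨fun _ _ h => h.symm⟩
      loopless := ⟨by
        rintro u (⟨h0, h⟩ | ⟨h0, h⟩) <;>
        · have := hpar u h0
          rw [h] at this
          exact lt_irrefl _ this⟩ }
  have hadj : ∀ t : Fin N, 0 < (t : ℕ) → T.Adj (par t) t := fun t ht => Or.inl ⟨ht, rfl⟩
  have hreach : ∀ k, ∀ t : Fin N, (t : ℕ) = k → T.Reachable t ⟨0, hN⟩ := by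
    intro k
    induction k using Nat.strong_induction_on with
    | _ k ih =>
      intro t ht
      rcases Nat.eq_zero_or_pos (t : ℕ) with h0 | h0
      · have : t = ⟨0, hN⟩ := Fin.ext h0
        rw [this]
      · have h1 := hpar t h0
        exact (hadj t h0).symm.reachable.trans (ih (par t) (by omega) _ rfl)
  have hconn : T.Connected :=
    { preconnected := fun u v => (hreach _ u rfl).trans (hreach _ v rfl).symm
      nonempty := ⟨⟨0, hN⟩⟩ }
  have hcard : T.edgeFinset.card ≤ N - 1 := by
    have hsub : T.edgeFinset ⊆
        (Finset.univ.erase (⟨0, hN⟩ : Fin N)).image (fun t => s(par t, t)) := by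
      intro e he
      induction e using Sym2.ind with
      | _ u v =>
        have he' : T.Adj u v := by simpa using he
        rw [Finset.mem_image]
        rcases he' with ⟨h0, h⟩ | ⟨h0, h⟩
        · exact ⟨v, by simp [Fin.ext_iff]; omega, by rw [h]⟩
        · exact ⟨u, by simp [Fin.ext_iff]; omega, by rw [h, Sym2.eq_swap]⟩
    refine (Finset.card_le_card hsub).trans (Finset.card_image_le.trans ?_)
    rw [Finset.card_erase_of_mem (Finset.mem_univ _), Finset.card_univ, Fintype.card_fin]
  have htree : T.IsTree := by
    rw [SimpleGraph.isTree_iff_connected_and_card]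
    refine ⟨hconn, le_antisymm ?_ hconn.card_vert_le_card_edgeSet_add_one⟩
    rw [Nat.card_eq_fintype_card, Nat.card_eq_fintype_card, Fintype.card_fin,
      ← SimpleGraph.edgeFinset_card]
    omega
  refine ⟨{ T := T, isTree := htree, bag := bag, connected := ?_, edge := hedge, par := par,
            par_spec := fun t ht => ⟨hpar t ht, hadj t ht⟩ }, rfl, rfl⟩
  intro v
  obtain ⟨s, hs, hcl⟩ := hbag v
  have hr : ∀ k, ∀ t : Fin N, (t : ℕ) = k → ∀ ht : v ∈ bag t,
      (T.induce {t | v ∈ bag t}).Reachable ⟨t, ht⟩ ⟨s, hs⟩ := by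
    intro k
    induction k using Nat.strong_induction_on with
    | _ k ih =>
      intro t htk ht
      by_cases hts : t = s
      · subst hts; exact SimpleGraph.Reachable.refl _
      · obtain ⟨h0, hm⟩ := hcl t ht hts
        have h1 := hpar t h0
        have h2 : (T.induce {t | v ∈ bag t}).Adj ⟨t, ht⟩ ⟨par t, hm⟩ := by
          simpa using (hadj t h0).symm
        exact h2.reachable.trans (ih (par t) (by omega) _ rfl hm)
  exact
    { preconnected := fun a c => (hr _ a.1 rfl a.2).trans (hr _ c.1 rfl c.2).symm
      nonempty := ⟨⟨s, hs⟩⟩ }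

end RootedDecomposition

namespace TreeDecomposition

variable {V : Type*} {G : SimpleGraph V} {N : ℕ}

/-- Renumbering the nodes by their distance from a root turns a tree-decomposition into one given by
a parent array. -/
lemma exists_rooted (D : TreeDecomposition G (Fin N)) :
    ∃ (D' : RootedDecomposition G N) (e : Equiv.Perm (Fin N)), ∀ t, D'.bag t = D.bag (e t) := by
  classical
  obtain ⟨r⟩ := D.isTree.1.nonempty
  let d : Fin N → ℕ := fun t => D.T.dist t r
  let e := Tuple.sort d
  have hmono : Monotone (d ∘ e) := Tuple.monotone_sort d
  have hpar : ∀ u, u ≠ r → ∃ w, D.T.Adj w u ∧ d w < d u := by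
    intro u hu
    obtain ⟨p, hp⟩ := D.isTree.1.exists_walk_length_eq_dist u r
    cases p with
    | nil => exact absurd rfl hu
    | @cons _ w _ h q =>
      refine ⟨w, h.symm, ?_⟩
      have : D.T.dist w r ≤ q.length := SimpleGraph.dist_le q
      simp only [SimpleGraph.Walk.length_cons] at hp
      simp only [d]; omega
  choose! p hp using hpar
  have hroot : ∀ t : Fin N, 0 < (t : ℕ) → e t ≠ r := by
    intro t ht hcon
    have h0 : d (e ⟨0, t.pos⟩) ≤ d (e t) := hmono (by simp [Fin.le_def])
    have h1 : d (e t) = 0 := by simp [d, hcon]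
    have h2 : e ⟨0, t.pos⟩ = r := by
      have : d (e ⟨0, t.pos⟩) = 0 := by omega
      exact (D.isTree.1.dist_eq_zero_iff).1 this
    have := e.injective (h2.trans hcon.symm)
    simp [Fin.ext_iff] at this
    omega
  have hiso : D.T.comap e ≃g D.T := SimpleGraph.Iso.comap e D.T
  refine ⟨{ T := D.T.comap e, isTree := hiso.isTree_iff.2 D.isTree, bag := fun t => D.bag (e t),
            connected := ?_, edge := ?_, par := fun t => e.symm (p (e t)), par_spec := ?_ }, e,
          fun t => rfl⟩
  · intro v
    have h := D.connected v
    let f : (D.T.comap e).induce {t | v ∈ D.bag (e t)} ≃g D.T.induce {t | v ∈ D.bag t} :=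
      { toEquiv := e.subtypeEquiv (by intro a; simp)
        map_rel_iff' := by intro a c; simp }
    exact f.connected_iff.2 h
  · intro u v huv
    obtain ⟨t, ht⟩ := D.edge u v huv
    exact ⟨e.symm t, by simpa using ht⟩
  · intro t ht
    obtain ⟨h1, h2⟩ := hp (e t) (hroot t ht)
    refine ⟨?_, by simpa using h1⟩
    by_contra hcon
    have := hmono (not_lt.1 hcon)
    simp at this
    omega

end TreeDecomposition

namespace RootedDecomposition

variable {V : Type*} {G : SimpleGraph V} {N : ℕ}

/-- Only the root and the topmost nodes of the vertices are needed in a tree-decomposition. -/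
lemma exists_small [Fintype V] [DecidableEq V] (D : RootedDecomposition G N) :
    ∃ (N' : ℕ) (D' : RootedDecomposition G N'), N' ≤ Fintype.card V + 1 ∧
      ∀ t, ∃ s, D'.bag t = D.bag s := by
  classical
  have hne : ∀ v, (Finset.univ.filter fun t => v ∈ D.bag t).Nonempty := by
    intro v
    obtain ⟨t⟩ := (D.connected v).nonempty
    exact ⟨t.1, Finset.mem_filter.2 ⟨Finset.mem_univ _, t.2⟩⟩
  let top : V → Fin N := fun v => (Finset.univ.filter fun t => v ∈ D.bag t).min' (hne v)
  have htop : ∀ v, v ∈ D.bag (top v) := by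
    intro v
    simpa using Finset.min'_mem _ (hne v)
  have hlow : ∀ v t, v ∈ D.bag t → top v ≤ t := by
    intro v t ht
    exact Finset.min'_le _ _ (by simpa using ht)
  let U : Finset (Fin N) := insert ⟨0, D.pos⟩ (Finset.univ.image top)
  have hU0 : (⟨0, D.pos⟩ : Fin N) ∈ U := Finset.mem_insert_self _ _
  have hUtop : ∀ v, top v ∈ U := fun v =>
    Finset.mem_insert_of_mem (Finset.mem_image_of_mem _ (Finset.mem_univ _))
  have hUcard : U.card ≤ Fintype.card V + 1 :=
    (Finset.card_insert_le _ _).trans (Nat.succ_le_succ Finset.card_image_le)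
  -- the nearest ancestor in `U`
  have hf : ∀ k, ∀ t : Fin N, (t : ℕ) = k → ∃ u, u ∈ U ∧ u ≤ t ∧ ∀ v ∈ D.bag t, v ∈ D.bag u := by
    intro k
    induction k using Nat.strong_induction_on with
    | _ k ih =>
      intro t htk
      by_cases htU : t ∈ U
      · exact ⟨t, htU, le_rfl, fun _ h => h⟩
      · have h0 : 0 < (t : ℕ) := by
          by_contra hcon
          apply htU
          have : t = ⟨0, D.pos⟩ := Fin.ext (by simpa using hcon)
          rw [this]; exact hU0
        have h1 := (D.par_spec t h0).1
        obtain ⟨u, hu, hut, hub⟩ := ih (D.par t) (by omega) _ rfl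
        refine ⟨u, hu, hut.trans h1.le, fun v hv => hub v (D.mem_bag_par (htop v) hv ?_)⟩
        refine lt_of_le_of_ne (hlow v t hv) ?_
        rintro rfl
        exact htU (hUtop v)
  choose f hfU hfle hfbag using fun t => hf _ t rfl
  let e : Fin U.card ≃o U := U.orderIsoOfFin rfl
  have hpos : 0 < U.card := Finset.card_pos.2 ⟨_, hU0⟩
  have he0 : ∀ t : Fin U.card, 0 < (t : ℕ) → 0 < ((e t : Fin N) : ℕ) := by
    intro t ht
    have h : e ⟨0, hpos⟩ < e t := e.strictMono (by simpa [Fin.lt_def] using ht)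
    have h' : ((e ⟨0, hpos⟩ : U) : Fin N) < (e t : Fin N) := h
    have := Fin.lt_def.1 h'
    omega
  suffices h : ∃ D' : RootedDecomposition G U.card, D'.bag = (fun t => D.bag (e t)) ∧
      D'.par = fun t => e.symm ⟨f (D.par (e t)), hfU _⟩ by
    obtain ⟨D', hbag, -⟩ := h
    exact ⟨_, D', hUcard, fun t => ⟨e t, by rw [hbag]⟩⟩
  refine exists_of_par hpos _ _ ?_ ?_ ?_
  · intro t ht
    have h1 := (D.par_spec _ (he0 t ht)).1
    rw [← e.lt_iff_lt, OrderIso.apply_symm_apply]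
    exact Subtype.coe_lt_coe.1 (lt_of_le_of_lt (hfle _) h1)
  · intro v
    refine ⟨e.symm ⟨top v, hUtop v⟩, by simpa using htop v, ?_⟩
    intro t ht hne
    have hlt : top v < e t := by
      refine lt_of_le_of_ne (hlow v _ ht) ?_
      intro h
      apply hne
      rw [← e.symm_apply_apply t]
      congr 1
      exact Subtype.ext h.symm
    have hbt : 0 < ((e t : Fin N) : ℕ) := by
      have := Fin.lt_def.1 hlt
      omega
    refine ⟨?_, by simpa using hfbag _ v (D.mem_bag_par (htop v) ht hlt)⟩
    by_contra hcon
    have ht0 : t = ⟨0, hpos⟩ := Fin.ext (by simpa using hcon)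
    have h2 : e t ≤ e (e.symm ⟨top v, hUtop v⟩) := e.monotone (by rw [ht0]; simp [Fin.le_def])
    rw [OrderIso.apply_symm_apply] at h2
    exact absurd hlt (not_lt.2 h2)
  · intro u v huv
    obtain ⟨t, hu, hv⟩ := D.edge u v huv
    exact ⟨e.symm ⟨f t, hfU t⟩, by simpa using hfbag t u hu, by simpa using hfbag t v hv⟩

/-- If a vertex shares a bag with `v` and its topmost node is not below that of `v`, then it is in
the topmost bag of `v`. -/
lemma mem_bag_of_share (D : RootedDecomposition G N) {u v : V} {a c : Fin N}
    (hc : v ∈ D.bag c) (hcmin : ∀ t, v ∈ D.bag t → c ≤ t)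
    (ha : u ∈ D.bag a) (hac : a ≤ c) {t : Fin N} (hu : u ∈ D.bag t) (hv : v ∈ D.bag t) :
    u ∈ D.bag c := by
  have : ∀ k, ∀ t : Fin N, (t : ℕ) = k → u ∈ D.bag t → v ∈ D.bag t → u ∈ D.bag c := by
    intro k
    induction k using Nat.strong_induction_on with
    | _ k ih =>
      intro t htk hu hv
      rcases eq_or_lt_of_le (hcmin t hv) with h | h
      · rwa [h]
      · have h0 : 0 < (t : ℕ) := by
          have := Fin.lt_def.1 h
          omega
        have h1 := (D.par_spec t h0).1
        exact ih (D.par t) (by omega) _ rfl (D.mem_bag_par ha hu (lt_of_le_of_lt hac h))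
          (D.mem_bag_par hc hv h)
  exact this _ t rfl hu hv

lemma card_bag_le (D : RootedDecomposition G N) (t : Fin N) : (D.bag t).card ≤ D.width + 1 := by
  have : (D.bag t).card ≤ Finset.univ.sup fun t => (D.bag t).card :=
    Finset.le_sup (f := fun t => (D.bag t).card) (Finset.mem_univ t)
  unfold TreeDecomposition.width
  omega

end RootedDecomposition

/-- The treewidth of a finite graph is attained by a small tree-decomposition. -/
lemma exists_rooted_width_eq_treewidth {V : Type*} [Fintype V] [DecidableEq V]
    (G : SimpleGraph V) :
    ∃ (N : ℕ) (D : RootedDecomposition G N), N ≤ Fintype.card V + 1 ∧ D.width = treewidth G := by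
  classical
  have hne : {w | ∃ (N : ℕ) (D : TreeDecomposition G (Fin N)), D.width = w}.Nonempty := by
    obtain ⟨D, -, -⟩ := RootedDecomposition.exists_of_par (G := G) (N := 1) one_pos id
      (fun _ => Finset.univ) (by intro t ht; omega)
      (fun v => ⟨0, Finset.mem_univ _, fun t _ ht => absurd (Subsingleton.elim _ _) ht⟩)
      (fun u v _ => ⟨0, Finset.mem_univ _, Finset.mem_univ _⟩)
    exact ⟨_, 1, D.toTreeDecomposition, rfl⟩
  obtain ⟨N, D, hD⟩ := Nat.sInf_mem hne
  obtain ⟨D₁, e, he⟩ := D.exists_rooted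
  obtain ⟨N', D', hN', hbag⟩ := D₁.exists_small
  refine ⟨N', D', hN', le_antisymm ?_ (Nat.sInf_le ⟨N', D'.toTreeDecomposition, rfl⟩)⟩
  have : treewidth G = D.width := hD.symm
  rw [this]
  unfold TreeDecomposition.width
  apply Nat.sub_le_sub_right
  apply Finset.sup_le
  intro t _
  obtain ⟨s, hs⟩ := hbag t
  rw [hs, he]
  exact Finset.le_sup (f := fun t => (D.bag t).card) (Finset.mem_univ _)

/-! ### Separability over the blocks -/

namespace BlockForm

variable {n b : ℕ} {blk : Fin n → Fin b}

lemma sum_fiber (blk : Fin n → Fin b) (g : Fin n → ℝ) :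
    ∑ j, g j = ∑ i, ∑ j : {j // blk j = i}, g j := by
  classical
  rw [← Finset.sum_fiberwise (s := Finset.univ) (g := blk)]
  refine Finset.sum_congr rfl fun i _ => ?_
  rw [Finset.sum_subtype]
  intro j; simp

/-- On the domain of the problem the function is the sum of its restrictions to the blocks that are
switched on. -/
lemma eval_eq_sum (F : BlockForm blk) (x : Fin n → ℝ) (z : Fin b → ℝ)
    (hz : ∀ i, z i = 0 ∨ z i = 1) (hx : ∀ j, z (blk j) = 0 → x j = 0) :
    F.eval x z = ∑ i, if z i = 1 then F.blockEval i (fun j => x j) else 0 := by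
  unfold eval
  rw [sum_fiber blk (fun j => F.d j * x j ^ 2), sum_fiber blk (fun j => F.c j * x j),
    ← Finset.sum_add_distrib, ← Finset.sum_add_distrib, ← Finset.sum_add_distrib]
  refine Finset.sum_congr rfl fun i _ => ?_
  rcases hz i with h | h
  · have h0 : (fun j : {j // blk j = i} => x j) = 0 := by
      funext j
      exact hx j (by rw [j.2, h])
    have h1 : ∀ j : {j // blk j = i}, x j = 0 := fun j => congrFun h0 j
    rw [h0]
    simp [h, h1]
  · simp [h, blockEval]

/-- The sum of the absolute values of the coefficients that belong to one block. -/
noncomputable def blockWeight (F : BlockForm blk) (i : Fin b) : ℝ :=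
  (∑ h, ∑ k, |F.Q i h k|) + ∑ j : {j // blk j = i}, (F.d j + |F.c j|) + |F.v i|

lemma sum_blockWeight (F : BlockForm blk) : ∑ i, F.blockWeight i = F.totalWeight := by
  unfold blockWeight totalWeight
  rw [sum_fiber blk (fun j => F.d j + |F.c j|), Finset.sum_add_distrib, Finset.sum_add_distrib]

lemma abs_blockEval_le (F : BlockForm blk) (hd : ∀ j, 0 ≤ F.d j) (i : Fin b)
    (y : {j // blk j = i} → ℝ) (hy : ∀ j, 0 ≤ y j ∧ y j ≤ 1) :
    |F.blockEval i y| ≤ F.blockWeight i := by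
  have habs : ∀ j, |y j| ≤ 1 := fun j => abs_le.2 ⟨by linarith [(hy j).1], (hy j).2⟩
  have h1 : |y ⬝ᵥ (F.Q i).mulVec y| ≤ ∑ h, ∑ k, |F.Q i h k| := by
    simp only [dotProduct, Matrix.mulVec]
    refine (Finset.abs_sum_le_sum_abs _ _).trans (Finset.sum_le_sum fun h _ => ?_)
    rw [abs_mul]
    refine (mul_le_of_le_one_left (abs_nonneg _) (habs h)).trans ?_
    refine (Finset.abs_sum_le_sum_abs _ _).trans (Finset.sum_le_sum fun k _ => ?_)
    rw [abs_mul]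
    exact mul_le_of_le_one_right (abs_nonneg _) (habs k)
  have h2 : |∑ j : {j // blk j = i}, F.d j * y j ^ 2 + ∑ j : {j // blk j = i}, F.c j * y j|
      ≤ ∑ j : {j // blk j = i}, (F.d j + |F.c j|) := by
    rw [← Finset.sum_add_distrib]
    refine (Finset.abs_sum_le_sum_abs _ _).trans (Finset.sum_le_sum fun j _ => ?_)
    refine (abs_add_le _ _).trans (add_le_add ?_ ?_)
    · rw [abs_mul, abs_of_nonneg (hd j), abs_pow]
      exact mul_le_of_le_one_right (hd j) (pow_le_one₀ (abs_nonneg _) (habs j))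
    · rw [abs_mul]
      exact mul_le_of_le_one_right (abs_nonneg _) (habs j)
  unfold blockEval blockWeight
  rw [add_assoc (y ⬝ᵥ (F.Q i).mulVec y)]
  exact (abs_add_le _ _).trans (add_le_add_left ((abs_add_le _ _).trans (add_le_add h1 h2)) _)

lemma blockEval_of_not_hasContinuous (F : BlockForm blk) (h : ¬ F.HasContinuous) (i : Fin b)
    (y : {j // blk j = i} → ℝ) : F.blockEval i y = F.v i := by
  simp only [HasContinuous, not_or, not_exists, not_not] at h
  simp [blockEval, h.1 i, h.2.1, h.2.2]

lemma blockEval_of_not_incident (F : BlockForm blk) (hd : ∀ j, 0 ≤ F.d j) {i : Fin b}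
    (h : ¬ F.Incident i) (y : {j // blk j = i} → ℝ) : F.blockEval i y = 0 := by
  simp only [Incident, not_or, not_not, not_lt, abs_nonpos_iff] at h
  obtain ⟨hQ, hs, hv⟩ := h
  have hnn : ∀ j ∈ (Finset.univ : Finset {j // blk j = i}), 0 ≤ F.d j + |F.c j| :=
    fun j _ => add_nonneg (hd j) (abs_nonneg _)
  have hz := (Finset.sum_eq_zero_iff_of_nonneg hnn).1 (le_antisymm hs (Finset.sum_nonneg hnn))
  have hd0 : ∀ j : {j // blk j = i}, F.d j = 0 := fun j => by
    have := hz j (Finset.mem_univ _)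
    linarith [hd j, abs_nonneg (F.c j)]
  have hc0 : ∀ j : {j // blk j = i}, F.c j = 0 := fun j => by
    have := hz j (Finset.mem_univ _)
    exact abs_eq_zero.1 (by linarith [hd j, abs_nonneg (F.c j)])
  simp [blockEval, hQ, hv, hd0, hc0]

lemma d_nonneg (F : BlockForm blk) (h : F.HasContinuous → F.IsConvex) (j : Fin n) : 0 ≤ F.d j := by
  by_cases hc : F.HasContinuous
  · exact (h hc).2 j
  · simp only [HasContinuous, not_or, not_exists, not_not] at hc
    simp [hc.2.1]

lemma convexOn_blockEval (F : BlockForm blk) (hF : F.IsConvex) (i : Fin b) :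
    ConvexOn ℝ Set.univ (F.blockEval i) := by
  have hquad : ConvexOn ℝ Set.univ fun y : {j // blk j = i} → ℝ => y ⬝ᵥ (F.Q i).mulVec y := by
    refine ⟨convex_univ, fun y _ w _ s t hs ht hst => ?_⟩
    have h := (hF.1 i).dotProduct_mulVec_nonneg (y - w)
    simp only [star_trivial, Matrix.mulVec_sub, sub_dotProduct, dotProduct_sub] at h
    simp only [Matrix.mulVec_add, Matrix.mulVec_smul, add_dotProduct, dotProduct_add,
      smul_dotProduct, dotProduct_smul, smul_eq_mul]
    have ht' : t = 1 - s := by linarith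
    subst ht'
    nlinarith [mul_nonneg (mul_nonneg hs ht) h]
  have hsq : ∀ j : {j // blk j = i},
      ConvexOn ℝ Set.univ fun y : {j // blk j = i} → ℝ => F.d j * y j ^ 2 := by
    intro j
    refine ⟨convex_univ, fun y _ w _ s t hs ht hst => ?_⟩
    have ht' : t = 1 - s := by linarith
    subst ht'
    simp only [Pi.add_apply, Pi.smul_apply, smul_eq_mul]
    nlinarith [mul_nonneg (mul_nonneg (mul_nonneg hs ht) (hF.2 j)) (sq_nonneg (y j - w j))]
  have hlin : ConvexOn ℝ Set.univ fun y : {j // blk j = i} → ℝ =>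
      ∑ j : {j // blk j = i}, F.c j * y j := by
    refine ⟨convex_univ, fun y _ w _ s t _ _ _ => le_of_eq ?_⟩
    simp only [Pi.add_apply, Pi.smul_apply, smul_eq_mul, Finset.mul_sum,
      ← Finset.sum_add_distrib]
    exact Finset.sum_congr rfl fun j _ => by ring
  have hsum : ConvexOn ℝ Set.univ fun y : {j // blk j = i} → ℝ =>
      ∑ j : {j // blk j = i}, F.d j * y j ^ 2 := by
    refine ⟨convex_univ, fun y hy w hw s t hs ht hst => ?_⟩
    simp only [smul_eq_mul, Finset.mul_sum, ← Finset.sum_add_distrib]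
    exact Finset.sum_le_sum fun j _ => by simpa using (hsq j).2 hy hw hs ht hst
  exact ((hquad.add hsum).add hlin).add (convexOn_const _ convex_univ)

end BlockForm

namespace QIB

variable {n b m : ℕ} (P : QIB n b m)

lemma mem_consOf {P : QIB n b m} {i : Fin b} {r : Fin m} :
    r ∈ P.consOf i ↔ (P.con r).Incident i := by
  simp [consOf]

lemma mem_blocksOf {P : QIB n b m} {i : Fin b} {r : Fin m} :
    i ∈ P.blocksOf r ↔ (P.con r).Incident i := by
  simp [blocksOf]

lemma con_d_nonneg (r : Fin m) (j : Fin n) : 0 ≤ (P.con r).d j :=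
  (P.con r).d_nonneg (P.con_convex r) j

/-- The constraints of one block are pairwise adjacent, so that one bag contains them all. -/
lemma consOf_subset_bag {N : ℕ} (D : RootedDecomposition P.graph N) (i : Fin b) :
    ∃ t, P.consOf i ⊆ D.bag t := by
  classical
  have hne : ∀ v, (Finset.univ.filter fun t => v ∈ D.bag t).Nonempty := by
    intro v
    obtain ⟨t⟩ := (D.connected v).nonempty
    exact ⟨t.1, Finset.mem_filter.2 ⟨Finset.mem_univ _, t.2⟩⟩
  let top : Fin m → Fin N := fun v => (Finset.univ.filter fun t => v ∈ D.bag t).min' (hne v)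
  have htop : ∀ v, v ∈ D.bag (top v) := by
    intro v
    simpa using Finset.min'_mem _ (hne v)
  have hlow : ∀ v t, v ∈ D.bag t → top v ≤ t := by
    intro v t ht
    exact Finset.min'_le _ _ (by simpa using ht)
  rcases (P.consOf i).eq_empty_or_nonempty with h | h
  · exact ⟨⟨0, D.pos⟩, by simp [h]⟩
  · obtain ⟨r, hr, hmax⟩ := (P.consOf i).exists_max_image top h
    refine ⟨top r, fun r' hr' => ?_⟩
    by_cases hrr : r' = r
    · rw [hrr]; exact htop r
    · obtain ⟨t, h1, h2⟩ := D.edge r' r ⟨hrr, i, mem_consOf.1 hr', mem_consOf.1 hr⟩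
      exact D.mem_bag_of_share (htop r) (hlow r) (htop r') (hmax r' hr') h1 h2

lemma card_consOf_le {N : ℕ} (D : RootedDecomposition P.graph N) (i : Fin b) :
    (P.consOf i).card ≤ D.width + 1 := by
  obtain ⟨t, ht⟩ := P.consOf_subset_bag D i
  exact (Finset.card_le_card ht).trans (D.card_bag_le t)

lemma rows_subset_consOf (i : Fin b) : P.rows i ⊆ P.consOf i := by
  intro r hr
  simp only [rows, Finset.mem_filter] at hr
  exact mem_consOf.2 hr.2.2

lemma mem_rows {P : QIB n b m} {i : Fin b} {r : Fin m} :
    r ∈ P.rows i ↔ P.IsMixed r ∧ (P.con r).Incident i := by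
  simp [rows]

lemma blockConvexWithRows (i : Fin b) : P.BlockConvexWithRows i (treewidth P.graph + 1) := by
  obtain ⟨N, D, -, hD⟩ := exists_rooted_width_eq_treewidth P.graph
  refine ⟨P.obj.convexOn_blockEval P.obj_convex i, fun r hr => ?_, ?_⟩
  · exact (P.con r).convexOn_blockEval (P.con_convex r (mem_rows.1 hr).1) i
  · rw [← hD]
    exact (Finset.card_le_card (P.rows_subset_consOf i)).trans (P.card_consOf_le D i)

end QIB

/-! ### Mixed-radix codes of resource vectors -/

/-- A vector with entries in `{-O c, …, O c}` is stored as a number whose digit `c`, in the radix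
`2 * O c + 1`, is the entry plus `O c`. The weight of digit `c`. -/
def digitWeight (O : ℕ → ℕ) (c : ℕ) : ℕ := ∏ c' ∈ Finset.range c, (2 * O c' + 1)

/-- Digit `c` of the code `e`. -/
def digit (O : ℕ → ℕ) (e c : ℕ) : ℕ := e / digitWeight O c % (2 * O c + 1)

/-- The code with the digits `d 0, …, d (L - 1)`. -/
def codeOf (O : ℕ → ℕ) (L : ℕ) (d : ℕ → ℕ) : ℕ := ∑ c ∈ Finset.range L, d c * digitWeight O c

section MixedRadix

variable (O : ℕ → ℕ)

lemma digitWeight_succ (c : ℕ) : digitWeight O (c + 1) = digitWeight O c * (2 * O c + 1) :=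
  Finset.prod_range_succ _ _

lemma digitWeight_pos (c : ℕ) : 0 < digitWeight O c := Finset.prod_pos fun _ _ => Nat.succ_pos _

lemma digitWeight_dvd {c c' : ℕ} (h : c ≤ c') : digitWeight O c ∣ digitWeight O c' :=
  Finset.prod_dvd_prod_of_subset _ _ _ (Finset.range_subset_range.2 h)

lemma digit_le (e c : ℕ) : digit O e c ≤ 2 * O c :=
  Nat.lt_succ_iff.1 (Nat.mod_lt _ (Nat.succ_pos _))

lemma codeOf_succ (L : ℕ) (d : ℕ → ℕ) :
    codeOf O (L + 1) d = codeOf O L d + d L * digitWeight O L := Finset.sum_range_succ _ _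

lemma codeOf_lt {L : ℕ} {d : ℕ → ℕ} (h : ∀ c < L, d c ≤ 2 * O c) :
    codeOf O L d < digitWeight O L := by
  induction L with
  | zero => simp [codeOf, digitWeight]
  | succ L ih =>
    rw [codeOf_succ, digitWeight_succ]
    have h1 := ih fun c hc => h c (by omega)
    have h2 := Nat.mul_le_mul_right (digitWeight O L) (h L (by omega))
    nlinarith

lemma digit_add_mul {c L : ℕ} (h : c < L) (e q : ℕ) :
    digit O (e + q * digitWeight O L) c = digit O e c := by
  obtain ⟨k, hk⟩ := digitWeight_dvd O (Nat.succ_le_of_lt h)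
  unfold digit
  rw [Nat.succ_eq_add_one, digitWeight_succ] at hk
  rw [hk, show e + q * (digitWeight O c * (2 * O c + 1) * k)
    = e + digitWeight O c * ((2 * O c + 1) * (k * q)) by ring,
    Nat.add_mul_div_left _ _ (digitWeight_pos O c), Nat.add_mul_mod_self_left]

lemma digit_codeOf {L : ℕ} {d : ℕ → ℕ} (h : ∀ c < L, d c ≤ 2 * O c) {c : ℕ} (hc : c < L) :
    digit O (codeOf O L d) c = d c := by
  induction L with
  | zero => omega
  | succ L ih =>
    have hlt := codeOf_lt O (L := L) (d := d) fun c hc => h c (by omega)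
    rw [codeOf_succ]
    rcases Nat.lt_succ_iff_lt_or_eq.1 hc with hc | rfl
    · rw [digit_add_mul O hc]
      exact ih (fun c hc => h c (by omega)) hc
    · unfold digit
      rw [Nat.add_mul_div_right _ _ (digitWeight_pos O c), Nat.div_eq_of_lt hlt, zero_add]
      exact Nat.mod_eq_of_lt (Nat.lt_succ_of_le (h c (by omega)))

lemma codeOf_digit (L e : ℕ) : codeOf O L (digit O e) = e % digitWeight O L := by
  induction L with
  | zero => simp [codeOf, digitWeight, Nat.mod_one]
  | succ L ih =>
    rw [codeOf_succ, ih, digitWeight_succ, Nat.mod_mul, mul_comm (digit O e L)]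
    rfl

lemma codeOf_congr {L : ℕ} {d d' : ℕ → ℕ} (h : ∀ c < L, d c = d' c) :
    codeOf O L d = codeOf O L d' :=
  Finset.sum_congr rfl fun c hc => by rw [h c (Finset.mem_range.1 hc)]

lemma eq_codeOf {L e : ℕ} (he : e < digitWeight O L) {d : ℕ → ℕ}
    (h : ∀ c < L, digit O e c = d c) : e = codeOf O L d := by
  rw [← codeOf_congr O h, codeOf_digit, Nat.mod_eq_of_lt he]

/-- The entry `c` of the vector with code `e`. -/
def entry (e c : ℕ) : ℤ := digit O e c - O c

lemma codeOf_self_lt (L : ℕ) : codeOf O L O < digitWeight O L :=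
  codeOf_lt O fun c _ => by omega

lemma entry_codeOf_self {L c : ℕ} (hc : c < L) : entry O (codeOf O L O) c = 0 := by
  unfold entry
  rw [digit_codeOf O (fun c _ => by omega) hc, sub_self]

end MixedRadix

/-! ### Merging resource tables along a tree -/

/-- The tree along which tables are merged. Its nodes are the nodes `0, …, N - 1` of a
tree-decomposition, a leaf `N + i` for every block `i`, and a node `N + b` above the root `0`. The
bag of a leaf is the set of constraints incident with the block. In the table of a node, the
resource consumption of a constraint in the bag is in its `slot`; `top` is the topmost node that
has the constraint in its bag. -/
structure MergeTree (m : ℕ) where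
  N : ℕ
  b : ℕ
  pr : ℕ → ℕ
  bag : ℕ → Finset (Fin m)
  top : Fin m → ℕ
  slot : Fin m → ℕ
  pr_zero : pr 0 = N + b
  pr_lt : ∀ k, 0 < k → k < N + b → pr k < k
  bag_root : bag (N + b) = ∅
  mem_pr : ∀ k r, k < N + b → r ∈ bag k → top r ≠ k → 0 < k ∧ r ∈ bag (pr k)
  top_le : ∀ k r, r ∈ bag k → top r ≤ k
  top_lt : ∀ r, top r < N
  slot_inj : ∀ k r r', r ∈ bag k → r' ∈ bag k → slot r = slot r' → r = r'

namespace MergeTree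

variable {m : ℕ} (T : MergeTree m)

/-- The number of merges: every node but the last one is merged into its parent. -/
abbrev M : ℕ := T.N + T.b

/-- The node that is merged into its parent at time `s`; children come before their parents. -/
abbrev node (s : ℕ) : ℕ := T.M - (s + 1)

/-- The node to which block `i` has been carried before time `s`. -/
def own : ℕ → Fin T.b → ℕ
  | 0, i => T.N + i
  | s + 1, i => if own s i = T.node s then T.pr (T.node s) else own s i

/-- The row that holds the table of node `j` before time `s`. The rows `0, …, M` hold the initial
tables, and the merge at time `s` writes its result into row `M + 1 + s`. -/
def ver : ℕ → ℕ → ℕ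
  | 0, j => j
  | s + 1, j => if j = T.pr (T.node s) then T.M + 1 + s else ver s j

/-- Slot `c` of the table of `k` belongs to a constraint that the parent has in its bag, too. -/
def Kept (k c : ℕ) : Prop := ∃ r ∈ T.bag k, T.top r ≠ k ∧ T.slot r = c

open Classical in
/-- The digits of the vector that results if entry `e₂` of the table of `k` is merged into entry
`e₁` of the table of its parent. The truncated subtraction rounds sums below the range up to its
lower end. -/
noncomputable def mergeDigit (O : ℕ → ℕ) (k e₁ e₂ c : ℕ) : ℕ :=
  digit O e₁ c + (if T.Kept k c then digit O e₂ c else O c) - O c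

/-- The entries `e₁` and `e₂` can be merged into `e`: the sums are in the range, and the right-hand
sides of the constraints whose topmost node is `k` are respected. -/
def Merges (O : ℕ → ℕ) (L : ℕ) (U : ℕ → ℝ) (rhs : Fin m → ℝ) (k e₁ e₂ e : ℕ) : Prop :=
  (∀ c < L, T.mergeDigit O k e₁ e₂ c ≤ 2 * O c) ∧
    (∀ r ∈ T.bag k, T.top r = k → U (T.slot r) * entry O e₂ (T.slot r) ≤ rhs r) ∧
      e = codeOf O L (T.mergeDigit O k e₁ e₂)

/-- The tables of the dynamic program. An entry is present if its flag `FL` is nonzero; then `WT` is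
its cost, and `B₁`, `B₂` tell from which entries the merge at time `s` has obtained it. -/
structure IsTable (O : ℕ → ℕ) (L : ℕ) (U : ℕ → ℝ) (rhs : Fin m → ℝ) (FL : ℕ → ℕ → ℕ)
    (WT : ℕ → ℕ → ℝ) (B₁ B₂ : ℕ → ℕ → ℕ) : Prop where
  flag_init : ∀ j, j < T.N ∨ j = T.M → ∀ e, FL j e ≠ 0 ↔ e = codeOf O L O
  cost_init : ∀ j, j < T.N ∨ j = T.M → WT j (codeOf O L O) = 0
  back : ∀ s < T.M, ∀ e, FL (T.M + 1 + s) e ≠ 0 →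
    FL (T.ver s (T.pr (T.node s))) (B₁ s e) ≠ 0 ∧ FL (T.ver s (T.node s)) (B₂ s e) ≠ 0 ∧
      T.Merges O L U rhs (T.node s) (B₁ s e) (B₂ s e) e ∧
        WT (T.M + 1 + s) e
          = WT (T.ver s (T.pr (T.node s))) (B₁ s e) + WT (T.ver s (T.node s)) (B₂ s e)
  best : ∀ s < T.M, ∀ e₁ < digitWeight O L, ∀ e₂ < digitWeight O L, ∀ e,
    FL (T.ver s (T.pr (T.node s))) e₁ ≠ 0 → FL (T.ver s (T.node s)) e₂ ≠ 0 →
      T.Merges O L U rhs (T.node s) e₁ e₂ e →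
        FL (T.M + 1 + s) e ≠ 0 ∧
          WT (T.M + 1 + s) e ≤ WT (T.ver s (T.pr (T.node s))) e₁ + WT (T.ver s (T.node s)) e₂

/-- Following the references back from the final entry: the entries in the tables of all nodes after
the last `τ` merges have been undone. -/
def trace (O : ℕ → ℕ) (L : ℕ) (B₁ B₂ : ℕ → ℕ → ℕ) : ℕ → ℕ → ℕ
  | 0, j => if j = T.M then codeOf O L O else 0
  | τ + 1, j =>
      if j = τ then B₂ (T.node τ) (trace O L B₁ B₂ τ (T.pr τ))
      else if j = T.pr τ then B₁ (T.node τ) (trace O L B₁ B₂ τ (T.pr τ))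
      else trace O L B₁ B₂ τ j

variable {T} {O : ℕ → ℕ} {L : ℕ} {U : ℕ → ℝ} {rhs : Fin m → ℝ} {FL : ℕ → ℕ → ℕ}
  {WT : ℕ → ℕ → ℝ} {B₁ B₂ : ℕ → ℕ → ℕ}

lemma pr_cases {k : ℕ} (hk : k < T.M) : T.pr k < k ∨ T.pr k = T.M := by
  rcases Nat.eq_zero_or_pos k with rfl | h
  · exact Or.inr T.pr_zero
  · exact Or.inl (T.pr_lt k h hk)

lemma pr_ne {k : ℕ} (hk : k < T.M) : T.pr k ≠ k := by
  rcases pr_cases hk with h | h <;> lia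

lemma filter_own_zero_empty {j : ℕ} (hj : j < T.N ∨ j = T.M) :
    (Finset.univ.filter fun i : Fin T.b => T.own 0 i = j) = ∅ := by
  rw [Finset.filter_false_of_mem]
  intro i _
  have := i.2
  simp only [own]
  lia

lemma filter_own_zero (i : Fin T.b) :
    (Finset.univ.filter fun i' : Fin T.b => T.own 0 i' = T.N + i) = {i} := by
  ext i'
  rw [Finset.mem_filter, Finset.mem_singleton, Fin.ext_iff]
  simp only [own, Finset.mem_univ, true_and]
  lia

lemma eq_leaf {j : ℕ} (hj : ¬ (j < T.N ∨ j = T.M)) (hj' : j < T.M - 0 ∨ j = T.M) :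
    ∃ i : Fin T.b, j = T.N + i := by
  have hjb : j - T.N < T.b := by lia
  exact ⟨⟨j - T.N, hjb⟩, by simp only; lia⟩

lemma own_lt (s : ℕ) (hs : s ≤ T.M) (i : Fin T.b) : T.own s i < T.M - s ∨ T.own s i = T.M := by
  induction s with
  | zero => have := i.2; simp only [own]; left; lia
  | succ s ih =>
    simp only [own]
    split_ifs with h
    · exact (pr_cases (by lia)).imp (fun h => h) id
    · rcases ih (by lia) with h' | h'
      · left; lia
      · exact Or.inr h'

lemma own_last (i : Fin T.b) : T.own T.M i = T.M := by
  rcases own_lt T.M le_rfl i with h | h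
  · lia
  · exact h

/-- A block stays in the bags of a constraint until it reaches the topmost of them. -/
lemma mem_bag_own {s : ℕ} {i : Fin T.b} {r : Fin m} (hs : T.top r < T.M - s)
    (hr : r ∈ T.bag (T.N + i)) : r ∈ T.bag (T.own s i) := by
  induction s with
  | zero => exact hr
  | succ s ih =>
    have h := ih (by lia)
    simp only [own]
    split_ifs with h'
    · rw [h'] at h
      exact (T.mem_pr _ r (by lia) h (by lia)).2
    · exact h

lemma own_top {i : Fin T.b} {r : Fin m} (hr : r ∈ T.bag (T.N + i)) :
    T.own (T.node (T.top r)) i = T.top r := by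
  have htop := T.top_lt r
  have h := mem_bag_own (T := T) (s := T.node (T.top r)) (by lia) hr
  have h1 := T.top_le _ _ h
  rcases own_lt (T.node (T.top r)) (by lia) i with h2 | h2
  · lia
  · rw [h2, T.bag_root] at h
    simp at h

/-- If slot `c` of the parent belongs to `r` but slot `c` of the child `k` is not carried over, then
the child is responsible for no block of `r`. -/
lemma not_mem_of_not_kept {s : ℕ} (hs : s < T.M) {r : Fin m} (hr : r ∈ T.bag (T.pr (T.node s)))
    (hk : ¬ T.Kept (T.node s) (T.slot r)) {i : Fin T.b} (hi : T.own s i = T.node s) :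
    r ∉ T.bag (T.N + i) := by
  intro hcon
  apply hk
  have h1 := T.top_le _ _ hr
  have h2 : T.pr (T.node s) < T.node s := by
    rcases pr_cases (T := T) (k := T.node s) (by lia) with h | h
    · exact h
    · rw [h, T.bag_root] at hr
      simp at hr
  have h3 := mem_bag_own (T := T) (s := s) (by lia) hcon
  rw [hi] at h3
  exact ⟨r, h3, by lia, rfl⟩

lemma Kept.mem {k : ℕ} (hk : k < T.M) {c : ℕ} (h : T.Kept k c) :
    ∃ r ∈ T.bag k, r ∈ T.bag (T.pr k) ∧ T.slot r = c := by
  obtain ⟨r, h1, h2, h3⟩ := h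
  exact ⟨r, h1, (T.mem_pr k r hk h1 h2).2, h3⟩

lemma mem_of_kept {k : ℕ} (hk : k < T.M) {r : Fin m} (h : T.Kept k (T.slot r))
    (hr : r ∈ T.bag (T.pr k)) : r ∈ T.bag k := by
  obtain ⟨r', h1, h2, h3⟩ := h.mem hk
  rwa [T.slot_inj _ _ _ hr h2 h3.symm]

open Classical in
lemma Merges.entry_eq {k e₁ e₂ e : ℕ} (h : T.Merges O L U rhs k e₁ e₂ e) {c : ℕ} (hc : c < L) :
    entry O e c = max (entry O e₁ c + if T.Kept k c then entry O e₂ c else 0) (-O c) := by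
  have h1 : digit O e c = T.mergeDigit O k e₁ e₂ c := by rw [h.2.2, digit_codeOf O h.1 hc]
  unfold entry
  rw [h1]
  unfold mergeDigit
  split_ifs <;> lia

lemma Merges.lt {k e₁ e₂ e : ℕ} (h : T.Merges O L U rhs k e₁ e₂ e) : e < digitWeight O L := by
  rw [h.2.2]
  exact codeOf_lt O h.1

/-- How sums over the blocks of a node change with a merge. -/
lemma sum_own_succ {s : ℕ} (hs : s < T.M) (f : Fin T.b → ℝ) (j : ℕ) (hj : j ≠ T.node s) :
    ∑ i with T.own (s + 1) i = j, f i = (∑ i with T.own s i = j, f i) +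
      if j = T.pr (T.node s) then ∑ i with T.own s i = T.node s, f i else 0 := by
  have hne := pr_ne (T := T) (k := T.node s) (by lia)
  rw [Finset.sum_filter, Finset.sum_filter, Finset.sum_filter]
  split_ifs with h
  · rw [← Finset.sum_add_distrib]
    refine Finset.sum_congr rfl fun i _ => ?_
    simp only [own]
    split_ifs <;> first | lia | simp
  · rw [add_zero]
    refine Finset.sum_congr rfl fun i _ => ?_
    simp only [own]
    split_ifs <;> lia

/-! #### The entries found by tracing back -/

namespace IsTable

variable (H : T.IsTable O L U rhs FL WT B₁ B₂)
include H

/-- The references lead to entries that are present. -/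
lemma flag_trace (hfin : FL (T.ver T.M T.M) (codeOf O L O) ≠ 0) (τ : ℕ) (hτ : τ ≤ T.M) (j : ℕ)
    (hj : j < τ ∨ j = T.M) : FL (T.ver (T.M - τ) j) (T.trace O L B₁ B₂ τ j) ≠ 0 := by
  induction τ generalizing j with
  | zero =>
    have : j = T.M := by lia
    subst this
    simpa [trace] using hfin
  | succ τ ih =>
    have hsucc : T.M - τ = T.node τ + 1 := by lia
    have hnode : T.node (T.node τ) = τ := by lia
    have hp := pr_cases (T := T) (k := τ) (by lia)
    have he := ih (by lia) (T.pr τ) hp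
    rw [hsucc, ver, hnode, if_pos rfl] at he
    have hb := H.back (T.node τ) (by lia) _ he
    rw [hnode] at hb
    simp only [trace]
    split_ifs with h1 h2
    · rw [h1]; exact hb.2.1
    · rw [h2]; exact hb.1
    · have := ih (by lia) j (by lia)
      rwa [hsucc, ver, hnode, if_neg h2] at this

/-- The references at the step from `τ` to `τ + 1`. -/
lemma back_trace (hfin : FL (T.ver T.M T.M) (codeOf O L O) ≠ 0) (τ : ℕ) (hτ : τ < T.M) :
    T.Merges O L U rhs τ (T.trace O L B₁ B₂ (τ + 1) (T.pr τ)) (T.trace O L B₁ B₂ (τ + 1) τ)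
        (T.trace O L B₁ B₂ τ (T.pr τ)) ∧
      WT (T.ver (T.M - τ) (T.pr τ)) (T.trace O L B₁ B₂ τ (T.pr τ))
        = WT (T.ver (T.node τ) (T.pr τ)) (T.trace O L B₁ B₂ (τ + 1) (T.pr τ))
          + WT (T.ver (T.node τ) τ) (T.trace O L B₁ B₂ (τ + 1) τ) := by
  have hsucc : T.M - τ = T.node τ + 1 := by lia
  have hnode : T.node (T.node τ) = τ := by lia
  have he := H.flag_trace hfin τ hτ.le (T.pr τ) (pr_cases hτ)
  rw [hsucc, ver, hnode, if_pos rfl] at he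
  have hb := H.back (T.node τ) (by lia) _ he
  rw [hnode] at hb
  have hne := pr_ne hτ
  simp only [trace, if_true, if_neg hne, hsucc, ver, hnode]
  exact ⟨hb.2.2.1, hb.2.2.2⟩

/-- The cost of a traced entry is the cost of the block entries it is made of. -/
lemma cost_trace (hfin : FL (T.ver T.M T.M) (codeOf O L O) ≠ 0) (s : ℕ) (hs : s ≤ T.M) (j : ℕ)
    (hj : j < T.M - s ∨ j = T.M) :
    WT (T.ver s j) (T.trace O L B₁ B₂ (T.M - s) j)
      = ∑ i with T.own s i = j, WT (T.N + i) (T.trace O L B₁ B₂ T.M (T.N + i)) := by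
  induction s generalizing j with
  | zero =>
    rw [Nat.sub_zero]
    simp only [ver]
    by_cases hN : j < T.N ∨ j = T.M
    · have hf := H.flag_trace hfin T.M le_rfl j (by lia)
      rw [Nat.sub_self] at hf
      have he := (H.flag_init j hN _).1 hf
      rw [he, H.cost_init j hN, filter_own_zero_empty hN, Finset.sum_empty]
    · obtain ⟨i, rfl⟩ := eq_leaf hN hj
      rw [filter_own_zero, Finset.sum_singleton]
  | succ s ih =>
    have hnode : T.node (T.node s) = s := by lia
    have htau : T.M - (s + 1) = T.node s := rfl
    have htau1 : T.M - s = T.node s + 1 := by lia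
    have hb := (H.back_trace hfin (T.node s) (by lia)).2
    have hs1 : T.M - T.node s = s + 1 := by lia
    rw [hs1, hnode] at hb
    rw [sum_own_succ (by lia) _ _ (by lia), htau]
    by_cases hjp : j = T.pr (T.node s)
    · have hp := pr_cases (T := T) (k := T.node s) (by lia)
      rw [hjp, hb, if_pos rfl, ← ih (by lia) _ (by lia), ← ih (by lia) _ (by lia), htau1]
    · rw [if_neg hjp, add_zero, ← ih (by lia) j (by lia), htau1]
      simp only [ver, if_neg hjp, trace, if_neg (show j ≠ T.node s by lia)]

/-- The traced entries dominate the sums of the block entries they are made of. -/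
lemma entry_trace (hfin : FL (T.ver T.M T.M) (codeOf O L O) ≠ 0) (r : Fin m)
    (hr : T.slot r < L) (s : ℕ) (hs : s ≤ T.M) (j : ℕ) (hj : j < T.M - s ∨ j = T.M)
    (hrj : r ∈ T.bag j) :
    ∑ i with T.own s i = j, (if r ∈ T.bag (T.N + i) then
        (entry O (T.trace O L B₁ B₂ T.M (T.N + i)) (T.slot r) : ℝ) else 0)
      ≤ entry O (T.trace O L B₁ B₂ (T.M - s) j) (T.slot r) := by
  classical
  induction s generalizing j with
  | zero =>
    rw [Nat.sub_zero]
    by_cases hN : j < T.N ∨ j = T.M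
    · have hf := H.flag_trace hfin T.M le_rfl j (by lia)
      rw [Nat.sub_self] at hf
      have he := (H.flag_init j hN _).1 hf
      rw [he, entry_codeOf_self O hr, filter_own_zero_empty hN, Finset.sum_empty, Int.cast_zero]
    · obtain ⟨i, rfl⟩ := eq_leaf hN hj
      rw [filter_own_zero, Finset.sum_singleton, if_pos hrj]
  | succ s ih =>
    have htau : T.M - (s + 1) = T.node s := rfl
    have htau1 : T.M - s = T.node s + 1 := by lia
    have hb := (H.back_trace hfin (T.node s) (by lia)).1
    rw [sum_own_succ (by lia) _ _ (by lia), htau]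
    by_cases hjp : j = T.pr (T.node s)
    · have hp := pr_cases (T := T) (k := T.node s) (by lia)
      rw [if_pos hjp]
      rw [hjp] at hrj ⊢
      have h1 := ih (by lia) _ (by lia) hrj
      rw [htau1] at h1
      have h3 := hb.entry_eq hr
      by_cases hk : T.Kept (T.node s) (T.slot r)
      · have h2 := ih (by lia) (T.node s) (by lia) (mem_of_kept (by lia) hk hrj)
        rw [htau1] at h2
        rw [if_pos hk] at h3
        refine (add_le_add h1 h2).trans ?_
        rw [h3]
        exact_mod_cast le_max_left _ _
      · have h2 : ∑ i with T.own s i = T.node s, (if r ∈ T.bag (T.N + i) then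
            (entry O (T.trace O L B₁ B₂ T.M (T.N + i)) (T.slot r) : ℝ) else 0) = 0 := by
          refine Finset.sum_eq_zero fun i hi => if_neg ?_
          exact not_mem_of_not_kept (by lia) hrj hk (Finset.mem_filter.1 hi).2
        rw [if_neg hk, add_zero] at h3
        rw [h2, add_zero]
        refine h1.trans ?_
        rw [h3]
        exact_mod_cast le_max_left _ _
    · rw [if_neg hjp, add_zero]
      have h1 := ih (by lia) j (by lia) hrj
      rw [htau1] at h1
      simpa only [trace, if_neg hjp, if_neg (show j ≠ T.node s by lia)] using h1

/-- The traced block entries respect the right-hand sides. -/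
theorem sum_entry_trace_le (hfin : FL (T.ver T.M T.M) (codeOf O L O) ≠ 0) (hU : ∀ c, 0 ≤ U c)
    (r : Fin m) (hr : T.slot r < L) (htop : r ∈ T.bag (T.top r)) :
    ∑ i : Fin T.b, (if r ∈ T.bag (T.N + i) then
        U (T.slot r) * (entry O (T.trace O L B₁ B₂ T.M (T.N + i)) (T.slot r) : ℝ) else 0)
      ≤ rhs r := by
  have hlt := T.top_lt r
  have h1 := H.entry_trace hfin r hr (T.node (T.top r)) (by lia) (T.top r) (by lia) htop
  have h2 := (H.back_trace hfin (T.top r) (by lia)).1.2.1 r htop rfl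
  have h3 : T.M - T.node (T.top r) = T.top r + 1 := by lia
  rw [h3] at h1
  refine le_trans (le_of_eq ?_) ((mul_le_mul_of_nonneg_left h1 (hU _)).trans h2)
  rw [Finset.mul_sum, Finset.sum_filter]
  refine Finset.sum_congr rfl fun i _ => ?_
  by_cases hi : r ∈ T.bag (T.N + i)
  · rw [if_pos hi, if_pos (own_top hi), if_pos hi]
  · simp [hi]

theorem cost_trace_last (hfin : FL (T.ver T.M T.M) (codeOf O L O) ≠ 0) :
    WT (T.ver T.M T.M) (codeOf O L O)
      = ∑ i : Fin T.b, WT (T.N + i) (T.trace O L B₁ B₂ T.M (T.N + i)) := by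
  have h := H.cost_trace hfin T.M le_rfl T.M (Or.inr rfl)
  rw [Nat.sub_self] at h
  simp only [trace, if_true] at h
  rw [h, Finset.filter_true_of_mem]
  exact fun i _ => own_last i

/-! #### Every solution is represented in the tables -/

/-- If the blocks have entries that underestimate the consumptions `a` and the costs `w` of a
solution, then so has every table. -/
lemma exists_entry (hL : ∀ r, T.slot r < L) (a : Fin T.b → Fin m → ℝ) (w : Fin T.b → ℝ)
    (hU : ∀ c, 0 < U c)
    (hbound : ∀ (r : Fin m) (A : Finset (Fin T.b)),
      |∑ i ∈ A, if r ∈ T.bag (T.N + i) then a i r else 0| ≤ U (T.slot r) * O (T.slot r))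
    (hrhs : ∀ r, (∑ i : Fin T.b, if r ∈ T.bag (T.N + i) then a i r else 0) ≤ rhs r)
    (hinit : ∀ i : Fin T.b, ∃ e < digitWeight O L, FL (T.N + i) e ≠ 0 ∧ WT (T.N + i) e ≤ w i ∧
      (∀ r ∈ T.bag (T.N + i), U (T.slot r) * entry O e (T.slot r) ≤ a i r) ∧
        ∀ c < L, (∀ r ∈ T.bag (T.N + i), T.slot r ≠ c) → entry O e c = 0)
    (s : ℕ) (hs : s ≤ T.M) (j : ℕ) (hj : j < T.M - s ∨ j = T.M) :
    ∃ e < digitWeight O L, FL (T.ver s j) e ≠ 0 ∧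
      WT (T.ver s j) e ≤ ∑ i with T.own s i = j, w i ∧
        (∀ r ∈ T.bag j, U (T.slot r) * entry O e (T.slot r)
          ≤ ∑ i with T.own s i = j, if r ∈ T.bag (T.N + i) then a i r else 0) ∧
          ∀ c < L, (∀ r ∈ T.bag j, T.slot r ≠ c) → entry O e c = 0 := by
  classical
  induction s generalizing j with
  | zero =>
    simp only [ver]
    by_cases hN : j < T.N ∨ j = T.M
    · refine ⟨codeOf O L O, codeOf_self_lt O L, (H.flag_init j hN _).2 rfl, ?_, ?_, ?_⟩
      · rw [H.cost_init j hN, filter_own_zero_empty hN, Finset.sum_empty]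
      · intro r _
        rw [entry_codeOf_self O (hL r), filter_own_zero_empty hN, Finset.sum_empty]
        simp
      · intro c hc _
        exact entry_codeOf_self O hc
    · obtain ⟨i, rfl⟩ := eq_leaf hN hj
      obtain ⟨e, h1, h2, h3, h4, h5⟩ := hinit i
      refine ⟨e, h1, h2, ?_, fun r hr => ?_, h5⟩
      · rwa [filter_own_zero, Finset.sum_singleton]
      · rw [filter_own_zero, Finset.sum_singleton, if_pos hr]
        exact h4 r hr
  | succ s ih =>
    by_cases hjp : j = T.pr (T.node s)
    · subst hjp
      have hp := pr_cases (T := T) (k := T.node s) (by lia)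
      have hne := pr_ne (T := T) (k := T.node s) (by lia)
      obtain ⟨e₁, h1, h2, h3, h4, h5⟩ := ih (by lia) (T.pr (T.node s)) (by lia)
      obtain ⟨e₂, k1, k2, k3, k4, k5⟩ := ih (by lia) (T.node s) (by lia)
      -- the sum of the two vectors before it is rounded up to the lower end of the range
      have hsum : ∀ r ∈ T.bag (T.pr (T.node s)),
          U (T.slot r) * ((entry O e₁ (T.slot r)
            + if T.Kept (T.node s) (T.slot r) then entry O e₂ (T.slot r) else 0 : ℤ) : ℝ)
          ≤ ∑ i with T.own (s + 1) i = T.pr (T.node s),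
              if r ∈ T.bag (T.N + i) then a i r else 0 := by
        intro r hr
        rw [sum_own_succ (by lia) _ _ hne, if_pos rfl, Int.cast_add, mul_add]
        refine add_le_add (h4 r hr) ?_
        split_ifs with hk
        · exact k4 r (mem_of_kept (by lia) hk hr)
        · rw [Finset.sum_eq_zero fun i hi => if_neg ?_]
          · simp
          · exact not_mem_of_not_kept (by lia) hr hk (Finset.mem_filter.1 hi).2
      have hzero : ∀ c < L, (∀ r ∈ T.bag (T.pr (T.node s)), T.slot r ≠ c) →
          (entry O e₁ c + if T.Kept (T.node s) c then entry O e₂ c else 0) = 0 := by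
        intro c hc hcr
        rw [h5 c hc hcr, if_neg, add_zero]
        intro hk
        obtain ⟨r, -, hr, hrc⟩ := hk.mem (by lia)
        exact hcr r hr hrc
      have hm : T.Merges O L U rhs (T.node s) e₁ e₂
          (codeOf O L (T.mergeDigit O (T.node s) e₁ e₂)) := by
        refine ⟨fun c hc => ?_, fun r hr htop => ?_, rfl⟩
        · have hrange : (entry O e₁ c + if T.Kept (T.node s) c then entry O e₂ c else 0)
              ≤ O c := by
            by_cases hcr : ∃ r ∈ T.bag (T.pr (T.node s)), T.slot r = c
            · obtain ⟨r, hr, rfl⟩ := hcr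
              have := (hsum r hr).trans ((le_abs_self _).trans (hbound r _))
              exact_mod_cast le_of_mul_le_mul_left this (hU _)
            · push Not at hcr
              rw [hzero c hc hcr]
              positivity
          unfold mergeDigit
          unfold entry at hrange
          split_ifs at hrange ⊢ <;> lia
        · -- all blocks of a constraint are below its topmost node
          refine (k4 r hr).trans (le_trans (le_of_eq ?_) (hrhs r))
          rw [Finset.sum_filter]
          refine Finset.sum_congr rfl fun i _ => ?_
          by_cases hi : r ∈ T.bag (T.N + i)
          · have h := own_top hi
            rw [htop] at h
            have hnode : T.node (T.node s) = s := by lia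
            rw [hnode] at h
            rw [if_pos h]
          · simp [hi]
      obtain ⟨b1, b2⟩ := H.best s (by lia) e₁ h1 e₂ k1 _ h2 k2 hm
      refine ⟨_, hm.lt, ?_, ?_, ?_, ?_⟩
      · simp only [ver, if_true]
        exact b1
      · rw [sum_own_succ (by lia) _ _ hne, if_pos rfl]
        simp only [ver, if_true]
        exact b2.trans (add_le_add h3 k3)
      · intro r hr
        rw [hm.entry_eq (hL r), Int.cast_max, mul_max_of_nonneg _ _ (hU _).le]
        -- rounding up to the lower end of the range respects the true consumption
        refine max_le (hsum r hr) ?_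
        have := neg_le_of_abs_le (hbound r (Finset.univ.filter
          fun i => T.own (s + 1) i = T.pr (T.node s)))
        push_cast
        linarith
      · intro c hc hcr
        rw [hm.entry_eq hc, hzero c hc hcr]
        simp
    · obtain ⟨e, h1, h2, h3, h4, h5⟩ := ih (by lia) j (by lia)
      refine ⟨e, h1, ?_, ?_, ?_, h5⟩
      · simpa only [ver, if_neg hjp] using h2
      · rw [sum_own_succ (by lia) _ _ (by lia), if_neg hjp, add_zero]
        simpa only [ver, if_neg hjp] using h3
      · intro r hr
        rw [sum_own_succ (by lia) _ _ (by lia), if_neg hjp, add_zero]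
        exact h4 r hr

theorem final_entry (hL : ∀ r, T.slot r < L) (a : Fin T.b → Fin m → ℝ) (w : Fin T.b → ℝ)
    (hU : ∀ c, 0 < U c)
    (hbound : ∀ (r : Fin m) (A : Finset (Fin T.b)),
      |∑ i ∈ A, if r ∈ T.bag (T.N + i) then a i r else 0| ≤ U (T.slot r) * O (T.slot r))
    (hrhs : ∀ r, (∑ i : Fin T.b, if r ∈ T.bag (T.N + i) then a i r else 0) ≤ rhs r)
    (hinit : ∀ i : Fin T.b, ∃ e < digitWeight O L, FL (T.N + i) e ≠ 0 ∧ WT (T.N + i) e ≤ w i ∧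
      (∀ r ∈ T.bag (T.N + i), U (T.slot r) * entry O e (T.slot r) ≤ a i r) ∧
        ∀ c < L, (∀ r ∈ T.bag (T.N + i), T.slot r ≠ c) → entry O e c = 0) :
    FL (T.ver T.M T.M) (codeOf O L O) ≠ 0 ∧
      WT (T.ver T.M T.M) (codeOf O L O) ≤ ∑ i, w i := by
  obtain ⟨e, h1, h2, h3, -, h5⟩ :=
    H.exists_entry hL a w hU hbound hrhs hinit T.M le_rfl T.M (Or.inr rfl)
  have he : e = codeOf O L O := by
    refine eq_codeOf O h1 fun c hc => ?_
    have := h5 c hc (by simp [T.bag_root])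
    unfold entry at this
    lia
  rw [he] at h2 h3
  rw [Finset.filter_true_of_mem (fun i _ => own_last i)] at h3
  exact ⟨h2, h3⟩

end IsTable

end MergeTree

/-! ### Total correctness of programs with time bounds -/

/-- Execute a list of commands in order. -/
def Cmd.block : List Cmd → Cmd
  | [] => .skip
  | p :: l => .seq p (Cmd.block l)

/-- A scalar variable is cell `(0, 0)` of its own array. -/
abbrev NExp.var (a : ℕ) : NExp := .get a (.lit 0) (.lit 0)

/-- Entry `i` of a one-dimensional array. -/
abbrev NExp.at (a : ℕ) (i : NExp) : NExp := .get a i (.lit 0)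

/-- The strict inequality `e < f`. -/
abbrev Test.natLT (e f : NExp) : Test := .natLE (.add e (.lit 1)) f

/-- Assign to a scalar variable. -/
abbrev Cmd.assign (a : ℕ) (e : NExp) : Cmd := .setNat a (.lit 0) (.lit 0) e

/-- Execute `p` for the values `0, 1, …` of the scalar `v` below `e`. -/
def Cmd.for (v : ℕ) (e : NExp) (p : Cmd) : Cmd :=
  .seq (.assign v (.lit 0))
    (.loop (.natLT (.var v) e) (.seq p (.assign v (.add (.var v) (.lit 1)))))

/-- The arrays of natural numbers into which a program may write. -/
def Cmd.natWrites : Cmd → List ℕ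
  | skip => []
  | setNat a _ _ _ => [a]
  | setReal _ _ _ _ => []
  | seq p q => p.natWrites ++ q.natWrites
  | ite _ p q => p.natWrites ++ q.natWrites
  | loop _ p => p.natWrites
  | solve _ _ f _ _ => [f]

/-- The arrays of real numbers into which a program may write. -/
def Cmd.realWrites : Cmd → List ℕ
  | skip => []
  | setNat _ _ _ _ => []
  | setReal a _ _ _ => [a]
  | seq p q => p.realWrites ++ q.realWrites
  | ite _ p q => p.realWrites ++ q.realWrites
  | loop _ p => p.realWrites
  | solve _ _ _ w y => [w, y]

/-- `σ` and `σ'` agree on the arrays into which `p` does not write. -/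
structure Frame (p : Cmd) (σ σ' : Store) : Prop where
  nat : ∀ a, a ∉ p.natWrites → σ'.nat a = σ.nat a
  real : ∀ a, a ∉ p.realWrites → σ'.real a = σ.real a

lemma Frame.refl (p : Cmd) (σ : Store) : Frame p σ σ := ⟨fun _ _ => rfl, fun _ _ => rfl⟩

lemma Frame.trans {p : Cmd} {σ₁ σ₂ σ₃ : Store} (h : Frame p σ₁ σ₂) (h' : Frame p σ₂ σ₃) :
    Frame p σ₁ σ₃ :=
  ⟨fun a ha => (h'.nat a ha).trans (h.nat a ha), fun a ha => (h'.real a ha).trans (h.real a ha)⟩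

lemma Frame.mono {p p' : Cmd} {σ σ' : Store} (h : Frame p σ σ')
    (hn : p.natWrites ⊆ p'.natWrites) (hr : p.realWrites ⊆ p'.realWrites) : Frame p' σ σ' :=
  ⟨fun a ha => h.nat a fun h' => ha (hn h'), fun a ha => h.real a fun h' => ha (hr h')⟩

section Store

variable (σ : Store)

@[simp] lemma Store.setNat_nat (a i k x a' i' k' : ℕ) : (σ.setNat a i k x).nat a' i' k'
    = if a' = a ∧ i' = i ∧ k' = k then x else σ.nat a' i' k' := rfl

@[simp] lemma Store.setNat_real (a i k x : ℕ) : (σ.setNat a i k x).real = σ.real := rfl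

@[simp] lemma Store.setReal_real (a i k : ℕ) (x : ℝ) (a' i' k' : ℕ) :
    (σ.setReal a i k x).real a' i' k'
      = if a' = a ∧ i' = i ∧ k' = k then x else σ.real a' i' k' := rfl

@[simp] lemma Store.setReal_nat (a i k : ℕ) (x : ℝ) : (σ.setReal a i k x).nat = σ.nat := rfl

lemma Store.setNat_nat_of_ne {a a' : ℕ} (h : a' ≠ a) (i k x : ℕ) :
    (σ.setNat a i k x).nat a' = σ.nat a' := by
  funext i' k'
  simp [h]

lemma Store.setReal_real_of_ne {a a' : ℕ} (h : a' ≠ a) (i k : ℕ) (x : ℝ) :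
    (σ.setReal a i k x).real a' = σ.real a' := by
  funext i' k'
  simp [h]

variable {n b m : ℕ} {P : QIB n b m} (S : P.Solver)

lemma Store.afterSolve_nat (i : Fin b) (u f w y a : ℕ) (ha : a ≠ f) :
    (σ.afterSolve S i u f w y).nat a = σ.nat a := by
  unfold Store.afterSolve
  split
  · exact σ.setNat_nat_of_ne ha _ _ _
  · exact σ.setNat_nat_of_ne ha _ _ _

lemma Store.writeBlock_real_of_ne (blk : Fin n → Fin b) (i : Fin b) {a a' : ℕ} (h : a' ≠ a)
    (y : {j // blk j = i} → ℝ) : (σ.writeBlock blk i a y).real a' = σ.real a' := by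
  funext j k
  simp [Store.writeBlock, h]

lemma Store.afterSolve_real (i : Fin b) (u f w y a : ℕ) (hw : a ≠ w) (hy : a ≠ y) :
    (σ.afterSolve S i u f w y).real a = σ.real a := by
  unfold Store.afterSolve
  split
  · rfl
  · rw [Store.writeBlock_real_of_ne _ _ _ hy, Store.setReal_real_of_ne _ hw]
    rfl

lemma Store.afterSolve_none {i : Fin b} {u f w y : ℕ}
    (h : S i (fun r => σ.real u (r : Fin m) 0) = none) :
    (σ.afterSolve S i u f w y).nat f 0 0 = 0 := by
  unfold Store.afterSolve
  rw [h]
  simp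

lemma Store.afterSolve_some {i : Fin b} {u f w y : ℕ} {s : {j // P.blk j = i} → ℝ}
    (h : S i (fun r => σ.real u (r : Fin m) 0) = some s) :
    σ.afterSolve S i u f w y
      = ((σ.setNat f 0 0 1).setReal w 0 0 (P.obj.blockEval i s)).writeBlock P.blk i y s := by
  unfold Store.afterSolve
  rw [h]

end Store

section Runs

variable {n b m : ℕ} {P : QIB n b m} {S : P.Solver}

lemma Exec.frame {p : Cmd} {σ σ' : Store} {t q : ℕ} (h : Exec S p σ σ' t q) : Frame p σ σ' := by
  induction h with
  | skip σ => exact Frame.refl _ _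
  | setNat σ a i k e =>
    refine ⟨fun a' ha => σ.setNat_nat_of_ne ?_ _ _ _, fun _ _ => rfl⟩
    simpa [Cmd.natWrites] using ha
  | setReal σ a i k e =>
    refine ⟨fun _ _ => rfl, fun a' ha => σ.setReal_real_of_ne ?_ _ _ _⟩
    simpa [Cmd.realWrites] using ha
  | seq _ _ ih ih' =>
    exact (ih.mono (List.subset_append_left _ _) (List.subset_append_left _ _)).trans
      (ih'.mono (List.subset_append_right _ _) (List.subset_append_right _ _))
  | iteTrue _ _ ih => exact ih.mono (List.subset_append_left _ _) (List.subset_append_left _ _)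
  | iteFalse _ _ ih => exact ih.mono (List.subset_append_right _ _) (List.subset_append_right _ _)
  | loopStop _ => exact Frame.refl _ _
  | @loopStep c p _ _ _ _ _ _ _ _ _ _ ih ih' =>
    exact Frame.trans (p := .loop c p) (ih.mono (fun _ h => h) (fun _ h => h)) ih'
  | solve σ e u f w y h =>
    refine ⟨fun a ha => σ.afterSolve_nat S _ u f w y a ?_, fun a ha => ?_⟩
    · simpa [Cmd.natWrites] using ha
    · simp only [Cmd.realWrites, List.mem_cons, List.not_mem_nil, or_false, not_or] at ha
      exact σ.afterSolve_real S _ u f w y a ha.1 ha.2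

variable (S) in
/-- Program `p`, started in `σ`, terminates after at most `t` steps and `q` calls of the solver in a
store with the property `Φ`. -/
def Runs (p : Cmd) (σ : Store) (t q : ℕ) (Φ : Store → Prop) : Prop :=
  ∃ σ' t' q', Exec S p σ σ' t' q' ∧ t' ≤ t ∧ q' ≤ q ∧ Φ σ'

namespace Runs

variable {p p' : Cmd} {l : List Cmd} {σ : Store} {t t' q q' : ℕ} {Φ Ψ : Store → Prop}

lemma mono (h : Runs S p σ t q Φ) (ht : t ≤ t') (hq : q ≤ q')
    (hΦ : ∀ σ', Frame p σ σ' → Φ σ' → Ψ σ') :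
    Runs S p σ t' q' Ψ := by
  obtain ⟨σ', t₁, q₁, h1, h2, h3, h4⟩ := h
  exact ⟨σ', t₁, q₁, h1, h2.trans ht, h3.trans hq, hΦ _ h1.frame h4⟩

lemma skip (h : Φ σ) : Runs S .skip σ (t + 1) q Φ :=
  ⟨σ, 1, 0, .skip σ, by omega, by omega, h⟩

lemma nil (h : Φ σ) : Runs S (.block []) σ (t + 1) q Φ := skip h

lemma setNat {a : ℕ} {i k e : NExp} (h : Φ (σ.setNat a (i.eval σ) (k.eval σ) (e.eval σ))) :
    Runs S (.setNat a i k e) σ (t + 1) q Φ :=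
  ⟨_, 1, 0, .setNat σ a i k e, by omega, by omega, h⟩

lemma setReal {a : ℕ} {i k : NExp} {e : RExp}
    (h : Φ (σ.setReal a (i.eval σ) (k.eval σ) (e.eval σ))) :
    Runs S (.setReal a i k e) σ (t + 1) q Φ :=
  ⟨_, 1, 0, .setReal σ a i k e, by omega, by omega, h⟩

lemma solve {e : NExp} {u f w y : ℕ} (he : e.eval σ < b)
    (h : Φ (σ.afterSolve S ⟨e.eval σ, he⟩ u f w y)) :
    Runs S (.solve e u f w y) σ (t + 1) (q + 1) Φ :=
  ⟨_, 1, 1, .solve σ e u f w y he, by omega, by omega, h⟩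

lemma ite {c : Test} (h : c.Holds σ → Runs S p σ t q Φ) (h' : ¬ c.Holds σ → Runs S p' σ t q Φ) :
    Runs S (.ite c p p') σ (t + 1) q Φ := by
  by_cases hc : c.Holds σ
  · obtain ⟨σ', t₁, q₁, h1, h2, h3, h4⟩ := h hc
    exact ⟨σ', _, _, .iteTrue hc h1, by omega, h3, h4⟩
  · obtain ⟨σ', t₁, q₁, h1, h2, h3, h4⟩ := h' hc
    exact ⟨σ', _, _, .iteFalse hc h1, by omega, h3, h4⟩

lemma seq {t₁ t₂ q₁ q₂ : ℕ} (h : Runs S p σ t₁ q₁ Ψ)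
    (h' : ∀ σ', Frame p σ σ' → Ψ σ' → Runs S p' σ' t₂ q₂ Φ) :
    Runs S (.seq p p') σ (t₁ + t₂) (q₁ + q₂) Φ := by
  obtain ⟨σ', s, r, h1, h2, h3, h4⟩ := h
  obtain ⟨σ'', s', r', k1, k2, k3, k4⟩ := h' σ' h1.frame h4
  exact ⟨σ'', _, _, .seq h1 k1, by omega, by omega, k4⟩

lemma cons {t₁ t₂ q₁ q₂ : ℕ} (h : Runs S p σ t₁ q₁ Ψ)
    (h' : ∀ σ', Frame p σ σ' → Ψ σ' → Runs S (.block l) σ' t₂ q₂ Φ) :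
    Runs S (.block (p :: l)) σ (t₁ + t₂) (q₁ + q₂) Φ := seq h h'

/-- The first command of a block, if it makes no call of the solver. -/
lemma cons' {t₁ t₂ : ℕ} (h : Runs S p σ t₁ 0 Ψ)
    (h' : ∀ σ', Frame p σ σ' → Ψ σ' → Runs S (.block l) σ' t₂ q Φ) :
    Runs S (.block (p :: l)) σ (t₁ + t₂) q Φ := by
  have := cons h h'
  rwa [zero_add] at this

lemma cons_setNat {a : ℕ} {i k e : NExp}
    (h : Runs S (.block l) (σ.setNat a (i.eval σ) (k.eval σ) (e.eval σ)) t q Φ) :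
    Runs S (.block (.setNat a i k e :: l)) σ (t + 1) q Φ := by
  obtain ⟨σ', s, r, h1, h2, h3, h4⟩ := h
  exact ⟨σ', _, _, .seq (.setNat σ a i k e) h1, by omega, by omega, h4⟩

lemma cons_setReal {a : ℕ} {i k : NExp} {e : RExp}
    (h : Runs S (.block l) (σ.setReal a (i.eval σ) (k.eval σ) (e.eval σ)) t q Φ) :
    Runs S (.block (.setReal a i k e :: l)) σ (t + 1) q Φ := by
  obtain ⟨σ', s, r, h1, h2, h3, h4⟩ := h
  exact ⟨σ', _, _, .seq (.setReal σ a i k e) h1, by omega, by omega, h4⟩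

lemma cons_setNat_eq {a i' k' x : ℕ} {i k e : NExp} (hi : i.eval σ = i') (hk : k.eval σ = k')
    (he : e.eval σ = x) (h : Runs S (.block l) (σ.setNat a i' k' x) t q Φ) :
    Runs S (.block (.setNat a i k e :: l)) σ (t + 1) q Φ := by
  subst hi hk he
  exact cons_setNat h

lemma cons_setReal_eq {a i' k' : ℕ} {x : ℝ} {i k : NExp} {e : RExp} (hi : i.eval σ = i')
    (hk : k.eval σ = k') (he : e.eval σ = x)
    (h : Runs S (.block l) (σ.setReal a i' k' x) t q Φ) :
    Runs S (.block (.setReal a i k e :: l)) σ (t + 1) q Φ := by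
  subst hi hk he
  exact cons_setReal h

/-- A loop that is left after at most `N` rounds, by an invariant with a round counter that cannot
exceed `N`. -/
lemma loop {c : Test} {I : ℕ → Store → Prop} (N : ℕ) (h0 : I 0 σ)
    (hN : ∀ k σ', Frame (.loop c p) σ σ' → I k σ' → c.Holds σ' → k < N)
    (hstep : ∀ k σ', Frame (.loop c p) σ σ' → I k σ' → c.Holds σ' → Runs S p σ' t q (I (k + 1)))
    (hend : ∀ k σ', Frame (.loop c p) σ σ' → I k σ' → ¬ c.Holds σ' → Φ σ') :
    Runs S (.loop c p) σ (N * (t + 1) + 1) (N * q) Φ := by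
  have key : ∀ r k σ', Frame (.loop c p) σ σ' → N - k = r → I k σ' →
      Runs S (.loop c p) σ' (r * (t + 1) + 1) (r * q) Φ := by
    intro r
    induction r with
    | zero =>
      intro k σ' hF hk hI
      have hc : ¬ c.Holds σ' := fun hc => by have := hN k σ' hF hI hc; omega
      exact ⟨σ', 1, 0, .loopStop hc, by omega, by omega, hend k σ' hF hI hc⟩
    | succ r ih =>
      intro k σ' hF hk hI
      by_cases hc : c.Holds σ'
      · obtain ⟨σ₁, t₁, q₁, h1, h2, h3, h4⟩ := hstep k σ' hF hI hc
        obtain ⟨σ₂, t₂, q₂, k1, k2, k3, k4⟩ := ih (k + 1) σ₁ (hF.trans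
          (h1.frame.mono (fun _ h => h) (fun _ h => h))) (by omega) h4
        exact ⟨σ₂, _, _, .loopStep hc h1 k1, by linarith, by linarith, k4⟩
      · exact ⟨σ', 1, 0, .loopStop hc, by omega, by omega, hend k σ' hF hI hc⟩
  refine (key N 0 σ (Frame.refl _ _) (by omega) h0)

/-- The rule for counting loops. The invariant speaks only of arrays that the body changes, since
the others are kept by the frame, and does not depend on the counter. -/
lemma forLoop {v : ℕ} {e : NExp} (I : ℕ → Store → Prop) (N : ℕ)
    (hv : v ∉ p.natWrites)
    (he : ∀ σ', Frame (.for v e p) σ σ' → e.eval σ' = N)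
    (hI : ∀ k σ' x, I k σ' → I k (σ'.setNat v 0 0 x))
    (h0 : I 0 σ)
    (hstep : ∀ k < N, ∀ σ', Frame (.for v e p) σ σ' → σ'.nat v 0 0 = k → I k σ' →
      Runs S p σ' t q (I (k + 1))) :
    Runs S (.for v e p) σ (N * (t + 2) + 2) (N * q) (I N) := by
  have hfor : ∀ σ', Frame (.loop (.natLT (.var v) e) (.seq p (.assign v (.add (.var v) (.lit 1)))))
      (σ.setNat v 0 0 0) σ' → Frame (.for v e p) σ σ' := by
    intro σ' h
    have h1 : Frame (.for v e p) σ (σ.setNat v 0 0 0) :=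
      ⟨fun a ha => σ.setNat_nat_of_ne (by simp [Cmd.for, Cmd.natWrites] at ha; tauto) _ _ _,
        fun a ha => rfl⟩
    exact h1.trans (h.mono (by simp [Cmd.for, Cmd.natWrites])
      (by simp [Cmd.for, Cmd.realWrites]))
  have hloop : Runs S (.loop (.natLT (.var v) e) (.seq p (.assign v (.add (.var v) (.lit 1)))))
      (σ.setNat v 0 0 0) (N * (t + 1 + 1) + 1) (N * q) (I N) := by
    refine loop (I := fun k σ' => k ≤ N ∧ σ'.nat v 0 0 = k ∧ I k σ' ∧ Frame (.for v e p) σ σ') N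
      ⟨Nat.zero_le _, by simp, hI _ _ _ h0, hfor _ (Frame.refl _ _)⟩ ?_ ?_ ?_
    · rintro k σ' - ⟨-, h1, -, h3⟩ hc
      have := he σ' h3
      simp only [Test.Holds, NExp.eval] at hc
      omega
    · rintro k σ' hF ⟨-, h1, h2, h3⟩ hc
      have hk : k < N := by
        have := he σ' h3
        simp only [Test.Holds, NExp.eval] at hc
        omega
      obtain ⟨σ₁, t₁, q₁, k1, k2, k3, k4⟩ := hstep k hk σ' h3 h1 h2
      have hv1 : σ₁.nat v 0 0 = k := by rw [k1.frame.nat v hv, h1]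
      refine ⟨_, _, _, .seq k1 (.setNat σ₁ v _ _ _), by omega, by omega, ?_⟩
      simp only [NExp.eval]
      refine ⟨hk, by simp [hv1], hI _ _ _ k4, hfor _ (hF.trans ?_)⟩
      refine (Frame.trans (σ₂ := σ₁) (k1.frame.mono ?_ ?_) ?_)
      · simp [Cmd.natWrites]
      · simp [Cmd.realWrites]
      · exact ⟨fun a ha => σ₁.setNat_nat_of_ne (by simp [Cmd.natWrites] at ha; tauto) _ _ _,
          fun a ha => rfl⟩
    · rintro k σ' - ⟨h0, h1, h2, h3⟩ hc
      have := he σ' h3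
      simp only [Test.Holds, NExp.eval] at hc
      have : k = N := by omega
      rwa [← this]
  obtain ⟨σ', s, r, h1, h2, h3, h4⟩ := hloop
  refine ⟨σ', _, _, .seq (.setNat σ v _ _ _) h1, ?_, ?_, h4⟩
  · have : N * (t + 1 + 1) = N * (t + 2) := by ring
    omega
  · omega

end Runs

/-! #### Loops over the elements of a set -/

/-- Element `k` of the increasing list of the elements of `A`, as in the input. -/
def listElem {m : ℕ} (A : Finset (Fin m)) (k : ℕ) : ℕ :=
  ((A.sort (· ≤ ·)).map Fin.val).getD k 0

lemma listElem_eq {m : ℕ} (A : Finset (Fin m)) {k : ℕ} (hk : k < A.card) :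
    listElem A k = ((A.sort (· ≤ ·))[k]'(by simpa using hk) : Fin m) := by
  unfold listElem
  rw [List.getD_eq_getElem _ _ (by simpa using hk)]
  simp

/-- Execute `p` for all elements `r`, in the variable `vr`, of a list of length `e`; the list is row
`i` of the array `a`. -/
def Cmd.forEach (v vr : ℕ) (e : NExp) (a : ℕ) (i : NExp) (p : Cmd) : Cmd :=
  .for v e (.seq (.assign vr (.get a i (.var v))) p)

namespace Runs

variable {p : Cmd} {σ : Store} {t q : ℕ}

lemma forEach {v vr a : ℕ} {e i : NExp} (A : Finset (Fin m)) (I : Finset (Fin m) → Store → Prop)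
    (hv : v ∉ vr :: p.natWrites)
    (he : ∀ σ', Frame (.forEach v vr e a i p) σ σ' → e.eval σ' = A.card)
    (ha : ∀ σ', Frame (.forEach v vr e a i p) σ σ' → ∀ k < A.card,
      σ'.nat a (i.eval σ') k = listElem A k)
    (hI : ∀ B σ' x, I B σ' → I B (σ'.setNat v 0 0 x) ∧ I B (σ'.setNat vr 0 0 x))
    (h0 : I ∅ σ)
    (hstep : ∀ B, ∀ r ∈ A, B ⊆ A → r ∉ B → ∀ σ', Frame (.forEach v vr e a i p) σ σ' →
      σ'.nat vr 0 0 = r → I B σ' → Runs S p σ' t q (I (insert r B))) :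
    Runs S (.forEach v vr e a i p) σ (A.card * (t + 3) + 2) (A.card * q) (I A) := by
  classical
  have hlen : (A.sort (· ≤ ·)).length = A.card := by simp
  let B : ℕ → Finset (Fin m) := fun k => ((A.sort (· ≤ ·)).take k).toFinset
  have hB0 : B 0 = ∅ := by simp [B]
  have hBlast : B A.card = A := by
    simp only [B]
    rw [List.take_of_length_le (by simp)]
    simp
  have hsub : ∀ k, B k ⊆ A := by
    intro k r hr
    have := List.mem_of_mem_take (List.mem_toFinset.1 hr)
    simpa using this
  have key : Runs S (.forEach v vr e a i p) σ (A.card * (t + 1 + 2) + 2) (A.card * q)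
      (fun σ' => I (B A.card) σ') := by
    refine Runs.forLoop (t := t + 1) (fun k σ' => I (B k) σ') A.card ?_ he
      (fun k σ' x h => (hI (B k) σ' x h).1) ?_ ?_
    · simpa [Cmd.natWrites] using hv
    · simpa only [hB0] using h0
    · intro k hk σ' hF hvk hIk
      have hr := ha σ' hF k hk
      rw [listElem_eq A hk] at hr
      set r : Fin m := (A.sort (· ≤ ·))[k]'(by simpa using hk) with hrdef
      have hsucc : B (k + 1) = insert r (B k) := by
        simp only [B]
        rw [List.take_succ_eq_append_getElem (by simpa using hk)]
        ext r'
        simp only [List.toFinset_append, Finset.mem_union, List.mem_toFinset, List.mem_singleton,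
          Finset.mem_insert, hrdef]
        exact or_comm
      have hmem : r ∈ A := by
        have : r ∈ A.sort (· ≤ ·) := List.getElem_mem _
        simpa using this
      have hnot : r ∉ B k := by
        intro hcon
        rw [List.mem_toFinset, List.mem_take_iff_getElem] at hcon
        obtain ⟨k', hk', h⟩ := hcon
        have hnd : (A.sort (· ≤ ·)).Nodup := Finset.sort_nodup _ _
        have := (hnd.getElem_inj_iff).1 (h.trans hrdef)
        omega
      have hvv : (NExp.get a i (.var v)).eval σ' = r := by
        simp only [NExp.eval, hvk]
        exact hr
      have hF2 : Frame (.forEach v vr e a i p) σ (σ'.setNat vr 0 0 r) := by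
        refine hF.trans ⟨fun a' ha' => σ'.setNat_nat_of_ne ?_ _ _ _, fun _ _ => rfl⟩
        simp [Cmd.for, Cmd.natWrites] at ha'
        tauto
      obtain ⟨σ₁, t₁, q₁, k1, k2, k3, k4⟩ :=
        hstep (B k) r hmem (hsub k) hnot _ hF2 (by simp) (hI _ _ _ hIk).2
      refine ⟨σ₁, 1 + t₁, 0 + q₁, .seq (.setNat σ' vr _ _ _) ?_, by omega, by omega, ?_⟩
      · rw [hvv]; exact k1
      · rw [hsucc]; exact k4
  rw [hBlast] at key
  exact key

end Runs

end Runs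

/-! ### The program -/

instance : Add NExp := ⟨NExp.add⟩
instance : Sub NExp := ⟨NExp.sub⟩
instance (x : ℕ) : OfNat NExp x := ⟨NExp.lit x⟩
instance : Add RExp := ⟨RExp.add⟩
instance : Sub RExp := ⟨RExp.sub⟩
instance : Mul RExp := ⟨RExp.mul⟩

section Eval

variable (σ : Store)

@[simp] lemma NExp.eval_add (e f : NExp) : (e + f).eval σ = e.eval σ + f.eval σ := rfl
@[simp] lemma NExp.eval_sub (e f : NExp) : (e - f).eval σ = e.eval σ - f.eval σ := rfl
@[simp] lemma NExp.eval_add' (e f : NExp) : (NExp.add e f).eval σ = e.eval σ + f.eval σ := rfl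
@[simp] lemma NExp.eval_lit (x : ℕ) : (NExp.lit x).eval σ = x := rfl
@[simp] lemma NExp.eval_zero : (0 : NExp).eval σ = 0 := rfl
@[simp] lemma NExp.eval_one : (1 : NExp).eval σ = 1 := rfl
@[simp] lemma NExp.eval_two : (2 : NExp).eval σ = 2 := rfl
@[simp] lemma NExp.eval_three : (3 : NExp).eval σ = 3 := rfl
@[simp] lemma NExp.eval_get (a : ℕ) (i k : NExp) :
    (NExp.get a i k).eval σ = σ.nat a (i.eval σ) (k.eval σ) := rfl
@[simp] lemma RExp.eval_add (e f : RExp) : (e + f).eval σ = e.eval σ + f.eval σ := rfl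
@[simp] lemma RExp.eval_sub (e f : RExp) : (e - f).eval σ = e.eval σ - f.eval σ := rfl
@[simp] lemma RExp.eval_mul (e f : RExp) : (e * f).eval σ = e.eval σ * f.eval σ := rfl
@[simp] lemma RExp.eval_nat (e : NExp) : (RExp.ofNat e).eval σ = (e.eval σ : ℝ) := rfl
@[simp] lemma RExp.eval_get (a : ℕ) (i k : NExp) :
    (RExp.get a i k).eval σ = σ.real a (i.eval σ) (k.eval σ) := rfl
@[simp] lemma Test.holds_natLE (e f : NExp) : (Test.natLE e f).Holds σ ↔ e.eval σ ≤ f.eval σ :=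
  Iff.rfl
@[simp] lemma Test.holds_realLE (e f : RExp) : (Test.realLE e f).Holds σ ↔ e.eval σ ≤ f.eval σ :=
  Iff.rfl

end Eval

notation "inN" => NExp.get 0 3 0
notation "inB" => NExp.get 0 2 0
notation "inM" => NExp.get 0 1 0

/-! The arrays of the program, besides those of the input and the output, are the following. Names
with `v` are scalars, that is, cell `(0, 0)` of an array of natural numbers, names with `a` are arrays
of natural numbers, and names with `r` are arrays of real numbers.

* `vK` the grid size, `vL1` and `vL2` the numbers of slots for mixed-integer and for combinatorial
  constraints, `vL` their sum, `vMc` the number of combinatorial constraints, `aCnt` the number of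
  blocks of each constraint, `vKap` the maximum of these over the combinatorial constraints.
* `aCol` the slot of each constraint plus one, `aTop` its topmost node.
* Row `k` of `aKeep` and of `aFin` holds, in the slots of the constraints in the bag of node `k` of the
  merge tree, the number of the constraint plus one: in `aFin` if `k` is the topmost node of the
  constraint, in `aKeep` otherwise. `aPar` holds the parents in the merge tree.
* `aOf` the range and `rUn` the unit of each slot, `aW` the weight of its digit and `aMul` the multiples
  of the weight, `vS` and `vS1` the number of codes for all slots and for the first `vL1` slots, `vZ0`
  the code of the zero vector, `aDig` the digits of all codes, `vLo` and `vDd` counters.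
* `aFl` the flags and `rWT` the costs of the entries of the tables, `aZf` whether an entry of a block
  switches it on, `vVC` the part of the code that belongs to combinatorial constraints.
* `rU`, `vF`, `rW` and `rScr` the right-hand sides, the answer, the value and the solution in calls of
  the solver.
* `aVer` the row that holds the current table of each node; `vk`, `vp`, `vX`, `vY` a node, its parent
  and the rows of their tables; `vCode`, `vBad`, `vD2` the code of the sum of two entries, whether they
  cannot be merged, and one digit; `aB1`, `aB2` the entries from which an entry was obtained; `aCur` the
  entries found by tracing back.

The others are loop variables. -/

notation "vK" => 10
notation "vL1" => 11
notation "vMc" => 12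
notation "vL2" => 13
notation "vKap" => 14
notation "aCnt" => 15
notation "aCol" => 16
notation "aTop" => 17
notation "aKeep" => 18
notation "aFin" => 19
notation "aPar" => 20
notation "vL" => 21
notation "aOf" => 22
notation "aW" => 23
notation "aMul" => 24
notation "vZ0" => 25
notation "vS" => 26
notation "vS1" => 27
notation "aDig" => 28
notation "vLo" => 29
notation "vDd" => 30
notation "aFl" => 31
notation "aZf" => 32
notation "vVC" => 33
notation "vF" => 34
notation "aVer" => 35
notation "vk" => 36
notation "vp" => 37
notation "vX" => 38
notation "vY" => 39
notation "vCode" => 40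
notation "vBad" => 41
notation "vD2" => 42
notation "aB1" => 43
notation "aB2" => 44
notation "aCur" => 45
notation "vT" => 50
notation "vJ" => 51
notation "vR" => 52
notation "vI" => 53
notation "vC" => 54
notation "vE" => 55
notation "vE2" => 56
notation "vD" => 57
notation "vQ" => 58

notation "rEps" => 0
notation "rU" => 4
notation "rW" => 5
notation "rScr" => 6
notation "rWT" => 7
notation "rUn" => 8

/-- The grid constant: `K` with `1 < K * ε`. -/
def progGrid : Cmd := .block [
  .assign vK 0,
  .loop (.realLE (.ofNat (.var vK) * .get rEps 0 0) (.ofNat 1)) (.assign vK (.var vK + 1))]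

/-- The numbers of slots for mixed-integer and for combinatorial constraints. -/
def progSlots : Cmd := .block [
  .for vT inN (.ite (.natLE (.var vL1) (.at 6 (.var vT))) (.assign vL1 (.at 6 (.var vT))) .skip),
  .for vT inM (.ite (.natLE (.at 2 (.var vT)) 0) (.assign vMc (.var vMc + 1)) .skip),
  .ite (.natLE (.var vMc) (.var vL1)) (.assign vL2 (.var vMc)) (.assign vL2 (.var vL1))]

/-- Record in row `vT` of `aKeep` the slots of the constraints of the bag that have one. -/
def progKeepBag : Cmd :=
  .forEach vJ vR (.at 6 (.var vT)) 7 (.var vT)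
    (.ite (.natLE 1 (.at aCol (.var vR)))
      (.setNat aKeep (.var vT) (.at aCol (.var vR) - 1) (.var vR + 1)) .skip)

/-- Give free slots to the constraints of the bag that have none. -/
def progNewBag : Cmd :=
  .forEach vJ vR (.at 6 (.var vT)) 7 (.var vT)
    (.ite (.natLE (.at aCol (.var vR)) 0)
      (.block [
        .ite (.natLE (.at 2 (.var vR)) 0) (.assign vC (.var vL1)) (.assign vC 0),
        .loop (.natLE 1 (.get aKeep (.var vT) (.var vC) + .get aFin (.var vT) (.var vC)))
          (.assign vC (.var vC + 1)),
        .setNat aCol (.var vR) 0 (.var vC + 1),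
        .setNat aFin (.var vT) (.var vC) (.var vR + 1),
        .setNat aTop (.var vR) 0 (.var vT)])
      .skip)

/-- Greedy colouring: constraints that share a bag get different slots. -/
def progColour : Cmd := .for vT inN (.block [progKeepBag, progNewBag])

/-- The leaves of the merge tree, and the largest support of a combinatorial constraint. -/
def progLeaves : Cmd :=
  .for vI inB (.forEach vJ vR (.at 3 (.var vI)) 4 (.var vI) (.block [
    .setNat aCnt (.var vR) 0 (.at aCnt (.var vR) + 1),
    .ite (.natLE (.at 2 (.var vR)) 0)
      (.ite (.natLE (.var vKap) (.at aCnt (.var vR))) (.assign vKap (.at aCnt (.var vR))) .skip)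
      .skip,
    .setNat aKeep (inN + .var vI) (.at aCol (.var vR) - 1) (.var vR + 1),
    .ite (.natLE (.at aPar (inN + .var vI)) (.at aTop (.var vR)))
      (.setNat aPar (inN + .var vI) 0 (.at aTop (.var vR))) .skip]))

/-- The parents of the inner nodes of the merge tree. -/
def progParents : Cmd := .block [
  .for vT inN (.setNat aPar (.var vT) 0 (.at 5 (.var vT))),
  .setNat aPar 0 0 (inN + inB)]

/-- The number of values of a digit in slot `vC`. -/
def radixExp : NExp := .at aOf (.var vC) + .at aOf (.var vC) + 1

/-- The mixed-radix system for the resource vectors. -/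
def progRadix : Cmd := .block [
  .assign vL (.var vL1 + .var vL2),
  .setNat aW 0 0 1,
  .for vC (.var vL) (.block [
    .ite (.natLT (.var vC) (.var vL1))
      (.block [.setNat aOf (.var vC) 0 (.var vK), .setReal rUn (.var vC) 0 (.get rEps 0 0)])
      (.block [.setNat aOf (.var vC) 0 (.var vKap), .setReal rUn (.var vC) 0 (.ofNat 1)]),
    .for vD radixExp
      (.setNat aMul (.var vC) (.var vD + 1)
        (.get aMul (.var vC) (.var vD) + .at aW (.var vC))),
    .setNat aW (.var vC + 1) 0 (.get aMul (.var vC) radixExp),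
    .assign vZ0 (.var vZ0 + .get aMul (.var vC) (.at aOf (.var vC)))]),
  .assign vS (.at aW (.var vL)),
  .assign vS1 (.at aW (.var vL1))]

/-- The table of all digits of all codes, by counting. -/
def progDigits : Cmd :=
  .for vC (.var vL) (.block [
    .assign vLo 0,
    .assign vDd 0,
    .for vE (.var vS) (.block [
      .setNat aDig (.var vE) (.var vC) (.var vDd),
      .assign vLo (.var vLo + 1),
      .ite (.natLE (.at aW (.var vC)) (.var vLo))
        (.block [
          .assign vLo 0,
          .assign vDd (.var vDd + 1),
          .ite (.natLE radixExp (.var vDd)) (.assign vDd 0) .skip])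
        .skip])])

/-- The right-hand sides of the single-block problem of block `vI` for the entry `vE`. -/
def progRhs : Cmd :=
  .for vC (.var vL1)
    (.ite (.natLE 1 (.get aKeep (inN + .var vI) (.var vC)))
      (.setReal rU (.get aKeep (inN + .var vI) (.var vC) - 1) 0
        (.get rEps 0 0 * (.ofNat (.get aDig (.var vE) (.var vC)) - .ofNat (.var vK) + .ofNat 1)))
      .skip)

/-- The digits of block `vI` in the slots of combinatorial constraints. -/
def progOffset : Cmd := .block [
  .assign vVC 0,
  .for vC (.var vL2) (.block [
    .ite (.natLE (.get aKeep (inN + .var vI) (.var vL1 + .var vC)) 0)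
      (.assign vDd (.var vKap))
      (.ite (.realLE (.get 2 (.get aKeep (inN + .var vI) (.var vL1 + .var vC) - 1) (.var vI))
          (.ofNat 0 - .ofNat 1))
        (.assign vDd (.var vKap - 1))
        (.ite (.realLE (.get 2 (.get aKeep (inN + .var vI) (.var vL1 + .var vC) - 1) (.var vI))
            (.ofNat 0))
          (.assign vDd (.var vKap))
          (.assign vDd (.var vKap + 1)))),
    .assign vVC (.var vVC + .get aMul (.var vL1 + .var vC) (.var vDd))])]

/-- The entry for switching block `vI` off. -/
def progOff : Cmd := .block [
  .setNat aFl (inN + .var vI) (.var vZ0) 1,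
  .setReal rWT (inN + .var vI) (.var vZ0) (.ofNat 0),
  .setNat aZf (.var vI) (.var vZ0) 0]

/-- The entries for switching block `vI` on. -/
def progOn : Cmd :=
  .for vE (.var vS1) (.block [
    progRhs,
    .solve (.var vI) rU vF rW rScr,
    .ite (.natLE 1 (.var vF))
      (.block [
        .setNat aFl (inN + .var vI) (.var vE + .var vVC) 1,
        .setReal rWT (inN + .var vI) (.var vE + .var vVC) (.get rW 0 0),
        .setNat aZf (.var vI) (.var vE + .var vVC) 1])
      .skip])

/-- The initial tables. -/
def progInit : Cmd := .block [
  .for vT (inN + inB + 1) (.setNat aVer (.var vT) 0 (.var vT)),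
  .for vT inN (.setNat aFl (.var vT) (.var vZ0) 1),
  .setNat aFl (inN + inB) (.var vZ0) 1,
  .for vI inB (.block [
    progOffset,
    progOn,
    .ite (.natLE 1 (.get aFl (inN + .var vI) (.var vZ0)))
      (.ite (.realLE (.get rWT (inN + .var vI) (.var vZ0)) (.ofNat 0)) .skip progOff)
      progOff])]

/-- Merge entry `vE2` of the table of node `vk` into entry `vE` of the table of its parent. -/
def progCombine : Cmd := .block [
  .assign vCode 0,
  .assign vBad 0,
  .for vC (.var vL) (.block [
    .ite (.natLE 1 (.get aKeep (.var vk) (.var vC)))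
      (.assign vD2 (.get aDig (.var vE2) (.var vC)))
      (.block [
        .assign vD2 (.at aOf (.var vC)),
        .ite (.natLE 1 (.get aFin (.var vk) (.var vC)))
          (.ite (.realLE (.get rUn (.var vC) 0 *
                (.ofNat (.get aDig (.var vE2) (.var vC)) - .ofNat (.at aOf (.var vC))))
              (.get 1 (.get aFin (.var vk) (.var vC) - 1) 0))
            .skip (.assign vBad 1))
          .skip]),
    .assign vD2 (.get aDig (.var vE) (.var vC) + .var vD2 - .at aOf (.var vC)),
    .ite (.natLE (.var vD2) (.at aOf (.var vC) + .at aOf (.var vC)))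
      (.assign vCode (.var vCode + .get aMul (.var vC) (.var vD2)))
      (.assign vBad 1)])]

/-- The row for the result of the merge number `vQ`. -/
def outRow : NExp := inN + inB + 1 + .var vQ

/-- The cost of the merged entry. -/
def sumExp : RExp := .get rWT (.var vY) (.var vE) + .get rWT (.var vX) (.var vE2)

/-- Store the merged entry. -/
def progStore : Cmd := .block [
  .setNat aFl outRow (.var vCode) 1,
  .setReal rWT outRow (.var vCode) sumExp,
  .setNat aB1 (.var vQ) (.var vCode) (.var vE),
  .setNat aB2 (.var vQ) (.var vCode) (.var vE2)]

/-- Store the merged entry if it is the first or a better one for its code. -/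
def progUpdate : Cmd :=
  .ite (.natLE (.get aFl outRow (.var vCode)) 0) progStore
    (.ite (.realLE sumExp (.get rWT outRow (.var vCode))) progStore .skip)

/-- Merge all pairs of entries. -/
def progPairs : Cmd :=
  .for vE (.var vS) (.ite (.natLE 1 (.get aFl (.var vY) (.var vE)))
    (.for vE2 (.var vS) (.ite (.natLE 1 (.get aFl (.var vX) (.var vE2)))
      (.block [progCombine, .ite (.natLE (.var vBad) 0) progUpdate .skip])
      .skip))
    .skip)

/-- Merge the tables of all nodes, children first. -/
def progMerge : Cmd :=
  .for vQ (inN + inB) (.block [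
    .assign vk (inN + inB - (.var vQ + 1)),
    .assign vp (.at aPar (.var vk)),
    .assign vX (.at aVer (.var vk)),
    .assign vY (.at aVer (.var vp)),
    progPairs,
    .setNat aVer (.var vp) 0 outRow])

/-- Follow the references back. -/
def progTrace : Cmd := .block [
  .setNat aCur (inN + inB) 0 (.var vZ0),
  .for vQ (inN + inB) (.block [
    .assign vp (.at aPar (.var vQ)),
    .assign vE (.at aCur (.var vp)),
    .setNat aCur (.var vp) 0 (.get aB1 (inN + inB - (.var vQ + 1)) (.var vE)),
    .setNat aCur (.var vQ) 0 (.get aB2 (inN + inB - (.var vQ + 1)) (.var vE))])]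

/-- Write the solution. -/
def progOutput : Cmd :=
  .for vI inB (.block [
    .assign vE (.at aCur (inN + .var vI)),
    .ite (.natLE 1 (.get aZf (.var vI) (.var vE)))
      (.block [.setNat 9 (.var vI) 0 1, progRhs, .solve (.var vI) rU vF rW 3])
      .skip])

/-- Report infeasibility, or compute a solution. -/
def progFinish : Cmd :=
  .ite (.natLE 1 (.get aFl (.at aVer (inN + inB)) (.var vZ0)))
    (.block [.assign 8 1, progTrace, progOutput]) .skip

/-- The algorithm. -/
def qibProgram : Cmd := .block [
  progGrid, progSlots, progColour, progLeaves, progParents, progRadix, progDigits, progInit,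
  progMerge, progFinish]

/-! ### The grid and the number of slots -/

/-- The rounding of resource consumptions is to multiples of `ε` between `-gridSize ε * ε` and
`gridSize ε * ε`. -/
noncomputable def gridSize (ε : ℝ) : ℕ := ⌊1 / ε⌋₊ + 1

lemma one_lt_gridSize_mul {ε : ℝ} (hε : 0 < ε) : 1 < gridSize ε * ε := by
  have := Nat.lt_floor_add_one (1 / ε)
  rw [div_lt_iff₀ hε] at this
  unfold gridSize
  push_cast
  exact this

section Specs

variable {n b m : ℕ} {P : QIB n b m} {S : P.Solver}

lemma runs_grid {σ : Store} {ε : ℝ} (hε : 0 < ε) (h : σ.real rEps 0 0 = ε) :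
    Runs S progGrid σ (2 * gridSize ε + 5) 0 fun σ' => σ'.nat vK 0 0 = gridSize ε := by
  unfold progGrid
  refine (Runs.cons_setNat (t := gridSize ε * 2 + 1 + 1) (Runs.cons' (Runs.loop (t := 1) (q := 0)
    (I := fun k σ' => σ'.nat vK 0 0 = k ∧ k ≤ gridSize ε ∧ σ'.real rEps 0 0 = ε) (gridSize ε) ?_ ?_
      ?_ ?_) fun σ' _ h' => Runs.nil (t := 0) h')).mono (q := 0) (by omega) (by omega) fun _ _ h => h
  · simp [h]
  · rintro k σ' - ⟨h1, h2, h3⟩ hc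
    simp only [Test.holds_realLE, RExp.eval_mul, RExp.eval_nat, RExp.eval_get, NExp.eval_get,
      NExp.eval_lit, NExp.eval_zero, NExp.eval_one, h1, h3, Nat.cast_one] at hc
    rw [← le_div_iff₀ hε] at hc
    exact Nat.lt_succ_of_le (Nat.le_floor hc)
  · rintro k σ' _ ⟨h1, h2, h3⟩ hc
    refine Runs.setNat ?_
    simp only [Test.holds_realLE, RExp.eval_mul, RExp.eval_nat, RExp.eval_get, NExp.eval_get,
      NExp.eval_lit, NExp.eval_zero, NExp.eval_one, h1, h3, Nat.cast_one] at hc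
    rw [← le_div_iff₀ hε] at hc
    have := Nat.lt_succ_of_le (Nat.le_floor hc)
    simpa [h1, h3, gridSize] using this
  · rintro k σ' - ⟨h1, h2, h3⟩ hc
    simp only [Test.holds_realLE, RExp.eval_mul, RExp.eval_nat, RExp.eval_get, NExp.eval_get,
      NExp.eval_lit, NExp.eval_zero, NExp.eval_one, h1, h3, Nat.cast_one, not_le] at hc
    rw [← div_lt_iff₀ hε] at hc
    have := (Nat.floor_lt (by positivity)).2 hc
    unfold gridSize at h2 ⊢
    omega

lemma runs_slots {σ : Store} {N : ℕ} (hN : σ.nat 0 3 0 = N) (hm : σ.nat 0 1 0 = m)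
    (h1 : σ.nat vL1 0 0 = 0) (h2 : σ.nat vMc 0 0 = 0) :
    Runs S progSlots σ (4 * N + 4 * m + 7) 0 fun σ' =>
      σ'.nat vL1 0 0 = (Finset.range N).sup (fun t => σ.nat 6 t 0) ∧
      σ'.nat vL2 0 0 = min ((Finset.range m).filter fun r => σ.nat 2 r 0 = 0).card
        ((Finset.range N).sup (fun t => σ.nat 6 t 0)) := by
  unfold progSlots
  refine (Runs.cons' (Runs.forLoop (t := 2) (q := 0)
    (fun k σ' => σ'.nat vL1 0 0 = (Finset.range k).sup fun t => σ.nat 6 t 0) N (by decide) ?_ ?_ ?_ ?_)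
    fun σ₁ F₁ I₁ => Runs.cons' (Runs.forLoop (t := 2) (q := 0)
      (fun k σ' => σ'.nat vMc 0 0 = ((Finset.range k).filter fun r => σ.nat 2 r 0 = 0).card) m
        (by decide) ?_ ?_ ?_ ?_)
      fun σ₂ F₂ I₂ => Runs.cons' (t₁ := 2) (Runs.ite (fun hc => Runs.setNat ?_)
        fun hc => Runs.setNat ?_) (fun σ₃ _ h => Runs.nil (t := 0) h)).mono (q := 0)
        (by omega) (by omega) fun _ _ h => h
  · intro σ' hF
    simp [hF.nat 0 (by decide), hN]
  · intro k σ' x h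
    simpa using h
  · simpa using h1
  · intro k hk σ' hF hv hI
    have h6 := hF.nat 6 (by decide)
    refine Runs.ite (fun hc => Runs.setNat ?_) fun hc => Runs.skip ?_
    · simp [hI, hv, h6, Finset.range_add_one] at hc ⊢
      simpa using hc
    · simp [hI, hv, h6, Finset.range_add_one] at hc ⊢
      obtain ⟨x, hx, hlt⟩ := hc
      exact hlt.le.trans (Finset.le_sup (f := fun t => σ.nat 6 t 0) (Finset.mem_range.2 hx))
  · intro σ' hF
    simp [hF.nat 0 (by decide), F₁.nat 0 (by decide), hm]
  · intro k σ' x h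
    simpa using h
  · simpa [F₁.nat 12 (by decide)] using h2
  · intro k hk σ' hF hv hI
    have h6 : σ'.nat 2 = σ.nat 2 := (hF.nat 2 (by decide)).trans (F₁.nat 2 (by decide))
    refine Runs.ite (fun hc => Runs.setNat ?_) fun hc => Runs.skip ?_
    · simp [hv, h6] at hc
      simp [hI, Finset.range_add_one, Finset.filter_insert, hc]
    · simp [hv, h6] at hc
      simp [hI, Finset.range_add_one, Finset.filter_insert, hc]
  · have h3 : σ₂.nat vL1 0 0 = _ := (congrFun (congrFun (F₂.nat vL1 (by decide)) 0) 0).trans I₁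
    simp [I₂, h3] at hc ⊢
    exact hc
  · have h3 : σ₂.nat vL1 0 0 = _ := (congrFun (congrFun (F₂.nat vL1 (by decide)) 0) 0).trans I₁
    simp only [Test.holds_natLE, NExp.eval_get, NExp.eval_lit, I₂, h3] at hc
    simp [h3]
    exact fun t ht => (Finset.le_sup (f := fun t => σ.nat 6 t 0) (Finset.mem_range.2 ht)).trans
      (not_le.1 hc).le

end Specs

/-! ### Colouring the constraints -/

namespace RootedDecomposition

variable {V : Type*} {G : SimpleGraph V} {N : ℕ} (D : RootedDecomposition G N)

/-- The bag of the node with number `t`. -/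
def bagN (t : ℕ) : Finset V := if h : t < N then D.bag ⟨t, h⟩ else ∅

/-- The number of the topmost node whose bag contains `v`. -/
noncomputable def topN (v : V) : ℕ := sInf {t | v ∈ D.bagN t}

variable {D}

lemma bagN_eq {t : ℕ} (h : t < N) : D.bagN t = D.bag ⟨t, h⟩ := dif_pos h

lemma lt_of_mem_bagN {t : ℕ} {v : V} (h : v ∈ D.bagN t) : t < N := by
  by_contra hcon
  simp [bagN, hcon] at h

lemma mem_bagN_topN (v : V) : v ∈ D.bagN (D.topN v) := by
  have hne : {t | v ∈ D.bagN t}.Nonempty := by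
    obtain ⟨t⟩ := (D.connected v).nonempty
    exact ⟨t.1, by rw [Set.mem_ofPred_eq, bagN_eq t.1.2]; exact t.2⟩
  exact Nat.sInf_mem hne

lemma topN_le {t : ℕ} {v : V} (h : v ∈ D.bagN t) : D.topN v ≤ t := Nat.sInf_le h

lemma topN_lt (v : V) : D.topN v < N := lt_of_mem_bagN (mem_bagN_topN v)

lemma mem_bagN_par {t : ℕ} {v : V} (ht : t < N) (h : v ∈ D.bagN t) (htop : D.topN v ≠ t) :
    0 < t ∧ v ∈ D.bagN (D.par ⟨t, ht⟩) := by
  have h1 := topN_le h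
  refine ⟨by omega, ?_⟩
  have h2 := mem_bagN_topN (D := D) v
  rw [bagN_eq (topN_lt v)] at h2
  rw [bagN_eq ht] at h
  rw [bagN_eq (D.par ⟨t, ht⟩).2]
  exact D.mem_bag_par h2 h (by rw [Fin.lt_def]; simp only; omega)

lemma mem_bagN_of_share {t : ℕ} {u v : V} (hu : u ∈ D.bagN t) (hv : v ∈ D.bagN t)
    (h : D.topN u ≤ D.topN v) : u ∈ D.bagN (D.topN v) := by
  have ht := lt_of_mem_bagN hu
  rw [bagN_eq ht] at hu hv
  have h1 := mem_bagN_topN (D := D) v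
  have h2 := mem_bagN_topN (D := D) u
  rw [bagN_eq (topN_lt v)] at h1 ⊢
  rw [bagN_eq (topN_lt u)] at h2
  refine D.mem_bag_of_share h1 (fun s hs => ?_) h2 (Fin.le_def.2 h) hu hv
  refine Fin.le_def.2 (topN_le ?_)
  rw [bagN_eq s.2]
  exact hs

end RootedDecomposition

/-- The row of a table in which the constraints of `A` are marked at their colours. Colours are
stored as positive numbers, with `0` for no colour yet, and so are constraints. -/
def MarksRow {m : ℕ} (A : Finset (Fin m)) (col row : ℕ → ℕ) : Prop :=
  (∀ r ∈ A, row (col r - 1) = r + 1) ∧ ∀ c, row c ≠ 0 → ∃ r ∈ A, col r = c + 1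

lemma MarksRow.empty {m : ℕ} {col row : ℕ → ℕ} (h : ∀ c, row c = 0) :
    MarksRow (∅ : Finset (Fin m)) col row :=
  ⟨by simp, fun c hc => absurd (h c) hc⟩

lemma MarksRow.congr {m : ℕ} {A : Finset (Fin m)} {col col' row : ℕ → ℕ} (h : MarksRow A col row)
    (hc : ∀ r ∈ A, col' r = col r) : MarksRow A col' row :=
  ⟨fun r hr => by rw [hc r hr]; exact h.1 r hr, fun c hne => by
    obtain ⟨r, hr, hrc⟩ := h.2 c hne
    exact ⟨r, hr, by rw [hc r hr]; exact hrc⟩⟩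

lemma MarksRow.insert {m : ℕ} {A : Finset (Fin m)} {col row row' : ℕ → ℕ} (h : MarksRow A col row)
    {r : Fin m} (hr : col r ≠ 0) (hA : ∀ r' ∈ A, col r' ≠ 0) (hne : ∀ r' ∈ A, col r' ≠ col r)
    (hrow : ∀ c, row' c = if c = col r - 1 then (r : ℕ) + 1 else row c) :
    MarksRow (insert r A) col row' := by
  refine ⟨fun r' hr' => ?_, fun c hc => ?_⟩
  · rw [hrow]
    rcases Finset.mem_insert.1 hr' with rfl | hr'
    · rw [if_pos rfl]
    · rw [if_neg, h.1 r' hr']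
      have h1 := hA r' hr'
      have h2 := hne r' hr'
      omega
  · rw [hrow] at hc
    split_ifs at hc with h1
    · exact ⟨r, Finset.mem_insert_self _ _, by omega⟩
    · obtain ⟨r', hr', h2⟩ := h.2 c hc
      exact ⟨r', Finset.mem_insert_of_mem hr', h2⟩

section Colour

variable {n b m : ℕ} {P : QIB n b m} {S : P.Solver} {G : SimpleGraph (Fin m)} {N : ℕ}
  {D : RootedDecomposition G N}

variable (D) in
/-- The constraints with the property `Cd` are coloured, the mixed-integer ones by `1, …, L₁` and
the combinatorial ones by `L₁ + 1, …, L₁ + L₂`, in such a way that two constraints in the same bag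
have different colours; and their topmost nodes are known. -/
structure Coloured (mx : Fin m → Prop) (L₁ L₂ : ℕ) (Cd : Fin m → Prop) (col tp : ℕ → ℕ) : Prop where
  iff : ∀ r : Fin m, col r ≠ 0 ↔ Cd r
  top : ∀ r : Fin m, Cd r → tp r = D.topN r
  mixed : ∀ r : Fin m, Cd r → mx r → col r ≤ L₁
  comb : ∀ r : Fin m, Cd r → ¬ mx r → L₁ < col r ∧ col r ≤ L₁ + L₂
  inj : ∀ (r r' : Fin m) (t : ℕ), Cd r → Cd r' → r ∈ D.bagN t → r' ∈ D.bagN t →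
    col r = col r' → r = r'

lemma Coloured.congr {mx : Fin m → Prop} {L₁ L₂ : ℕ} {Cd Cd' : Fin m → Prop} {col tp : ℕ → ℕ}
    (h : Coloured D mx L₁ L₂ Cd col tp) (hC : ∀ r, Cd' r ↔ Cd r) :
    Coloured D mx L₁ L₂ Cd' col tp := by
  have : Cd' = Cd := funext fun r => propext (hC r)
  rwa [this]

lemma Coloured.insert {mx : Fin m → Prop} {L₁ L₂ : ℕ} {Cd : Fin m → Prop} {col tp col' tp' : ℕ → ℕ}
    (h : Coloured D mx L₁ L₂ Cd col tp) {r : Fin m} (hr : ¬ Cd r) {c : ℕ}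
    (hmx : mx r → c < L₁) (hcb : ¬ mx r → L₁ ≤ c ∧ c < L₁ + L₂)
    (htop : ∀ r', Cd r' → D.topN r' ≤ D.topN r)
    (hfree : ∀ r', Cd r' → r' ∈ D.bagN (D.topN r) → col r' ≠ c + 1)
    (hcol : ∀ x, col' x = if x = r then c + 1 else col x)
    (htp : ∀ x, tp' x = if x = r then D.topN r else tp x) :
    Coloured D mx L₁ L₂ (fun r' => Cd r' ∨ r' = r) col' tp' := by
  have hself : col' r = c + 1 := by rw [hcol, if_pos rfl]
  have hoth : ∀ r' : Fin m, r' ≠ r → col' r' = col r' := fun r' hne => by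
    rw [hcol, if_neg]
    rwa [Fin.val_inj]
  have hneq : ∀ r', Cd r' → r' ≠ r := by
    rintro r' h' rfl
    exact hr h'
  have hcross : ∀ (r' : Fin m) (t : ℕ), Cd r' → r' ∈ D.bagN t → r ∈ D.bagN t →
      col r' ≠ c + 1 := fun r' t hr' h1 h2 =>
    hfree r' hr' (RootedDecomposition.mem_bagN_of_share h1 h2 (htop r' hr'))
  constructor
  · intro r'
    by_cases hrr : r' = r
    · subst hrr
      simp [hself]
    · rw [hoth r' hrr, h.iff]
      simp [hrr]
  · rintro r' (h' | rfl)
    · rw [htp, if_neg, h.top r' h']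
      rw [Fin.val_inj]
      exact hneq r' h'
    · rw [htp, if_pos rfl]
  · rintro r' (h' | rfl) hm
    · rw [hoth r' (hneq r' h')]
      exact h.mixed r' h' hm
    · rw [hself]
      exact hmx hm
  · rintro r' (h' | rfl) hm
    · rw [hoth r' (hneq r' h')]
      exact h.comb r' h' hm
    · rw [hself]
      have := hcb hm
      omega
  · rintro r₁ r₂ t (h₁ | rfl) (h₂ | rfl) m₁ m₂ heq
    · rw [hoth r₁ (hneq r₁ h₁), hoth r₂ (hneq r₂ h₂)] at heq
      exact h.inj r₁ r₂ t h₁ h₂ m₁ m₂ heq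
    · rw [hoth r₁ (hneq r₁ h₁), hself] at heq
      exact absurd heq (hcross r₁ t h₁ m₁ m₂)
    · rw [hoth r₂ (hneq r₂ h₂), hself] at heq
      exact absurd heq.symm (hcross r₂ t h₂ m₂ m₁)
    · rfl

lemma runs_keepBag {σ : Store} {t : ℕ} (A : Finset (Fin m)) (ht : σ.nat vT 0 0 = t)
    (hsize : σ.nat 6 t 0 = A.card) (hlist : ∀ k < A.card, σ.nat 7 t k = listElem A k)
    (hinj : ∀ r ∈ A, ∀ r' ∈ A, σ.nat aCol r 0 ≠ 0 → σ.nat aCol r 0 = σ.nat aCol r' 0 → r = r')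
    (hrow : ∀ c, σ.nat aKeep t c = 0) :
    Runs S progKeepBag σ (A.card * 5 + 2) 0 fun σ' =>
      MarksRow (A.filter fun r => σ.nat aCol r 0 ≠ 0) (fun r => σ.nat aCol r 0) (σ'.nat aKeep t) ∧
        ∀ t', t' ≠ t → σ'.nat aKeep t' = σ.nat aKeep t' := by
  unfold progKeepBag
  refine Runs.forEach (t := 2) (q := 0) A (fun B σ' =>
    MarksRow (B.filter fun r => σ.nat aCol r 0 ≠ 0) (fun r => σ.nat aCol r 0) (σ'.nat aKeep t) ∧
        ∀ t', t' ≠ t → σ'.nat aKeep t' = σ.nat aKeep t') (by decide) ?_ ?_ ?_ ?_ ?_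
  · intro σ' hF
    simp [hF.nat 6 (by decide), hF.nat vT (by decide), ht, hsize]
  · intro σ' hF k hk
    simp [hF.nat 7 (by decide), hF.nat vT (by decide), ht, hlist k hk]
  · intro B σ' x h
    rw [Store.setNat_nat_of_ne _ (by decide), Store.setNat_nat_of_ne _ (by decide)]
    exact ⟨h, h⟩
  · exact ⟨by simpa using MarksRow.empty hrow, fun _ _ => rfl⟩
  · rintro B r hr hB hrB σ' hF hv ⟨h1, h2⟩
    have hcol := hF.nat aCol (by decide)
    have hT := hF.nat vT (by decide)
    refine Runs.ite (fun hc => Runs.setNat ?_) fun hc => Runs.skip ?_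
    · simp only [Test.holds_natLE, NExp.eval_one, NExp.eval_get, NExp.eval_lit, hv, hcol] at hc
      have hc' : σ.nat aCol r 0 ≠ 0 := by omega
      rw [Finset.filter_insert, if_pos hc']
      refine ⟨h1.insert hc' (fun r' hr' => (Finset.mem_filter.1 hr').2) (fun r' hr' heq => ?_)
        fun c => ?_, fun t' ht' => ?_⟩
      · have h3 := Finset.mem_filter.1 hr'
        have := hinj r' (hB h3.1) r hr h3.2 heq
        subst this
        exact hrB h3.1
      · simp [hcol, hT, ht, hv]
      · funext c
        simp [hT, ht, ht', h2 t' ht']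
    · simp only [Test.holds_natLE, NExp.eval_one, NExp.eval_get, NExp.eval_lit, hv, hcol] at hc
      rw [Finset.filter_insert, if_neg (by omega)]
      exact ⟨h1, h2⟩

/-- Some slot for `r` is free in the bag, since the constraints of its kind in the bag are at most
as many as the slots. -/
lemma exists_free {mx : Fin m → Prop} {L₁ L₂ : ℕ} {Cd : Fin m → Prop} {col tp : ℕ → ℕ}
    (h : Coloured D mx L₁ L₂ Cd col tp) {A : Finset (Fin m)} {r : Fin m} (hrA : r ∈ A)
    (hr : ¬ Cd r) (hL₁ : A.card ≤ L₁)
    (hL₂ : ∀ A' ⊆ A, (∀ r ∈ A', ¬ mx r) → A'.card ≤ L₂) :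
    ∃ k c, (mx r → c = k ∧ c < L₁) ∧ (¬ mx r → c = L₁ + k ∧ c < L₁ + L₂) ∧
      ∀ r' ∈ A, Cd r' → col r' ≠ c + 1 := by
  classical
  obtain ⟨base, len, hmb, hcb⟩ : ∃ base len : ℕ, (mx r → base = 0 ∧ len = L₁) ∧
      (¬ mx r → base = L₁ ∧ len = L₂) := by
    by_cases hm : mx r
    · exact ⟨0, L₁, fun _ => ⟨rfl, rfl⟩, fun h => absurd hm h⟩
    · exact ⟨L₁, L₂, fun h => absurd h hm, fun _ => ⟨rfl, rfl⟩⟩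
  suffices hk : ∃ k < len, ∀ r' ∈ A, Cd r' → col r' ≠ base + k + 1 by
    obtain ⟨k, hk, hk'⟩ := hk
    refine ⟨k, base + k, fun hm => ?_, fun hm => ?_, hk'⟩
    · have := hmb hm
      omega
    · have := hcb hm
      omega
  by_contra hcon
  push Not at hcon
  have : Nonempty (Fin m) := ⟨r⟩
  choose! f hfA hfC hf using hcon
  have hinj : Set.InjOn f (Finset.range len : Set ℕ) := by
    intro k hk k' hk' hkk
    have h1 := hf k (by simpa using hk)
    have h2 := hf k' (by simpa using hk')
    rw [hkk] at h1
    omega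
  have hmaps : ∀ k ∈ Finset.range len, f k ∈ (A.filter fun r' => (mx r' ↔ mx r)).erase r := by
    intro k hk
    have hk' : k < len := by simpa using hk
    have hC := hfC k hk'
    have hcol := hf k hk'
    refine Finset.mem_erase.2 ⟨fun heq => hr (heq ▸ hC), Finset.mem_filter.2 ⟨hfA k hk', ?_⟩⟩
    by_cases hm : mx r
    · have := hmb hm
      simp only [hm, iff_true]
      by_contra hm'
      have := h.comb _ hC hm'
      omega
    · have := hcb hm
      simp only [hm, iff_false]
      intro hm'
      have := h.mixed _ hC hm'
      omega
  have hcard := Finset.card_le_card_of_injOn f hmaps hinj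
  have hmem : r ∈ A.filter fun r' => (mx r' ↔ mx r) := Finset.mem_filter.2 ⟨hrA, Iff.rfl⟩
  have hpos := Finset.card_pos.2 ⟨r, hmem⟩
  rw [Finset.card_erase_of_mem hmem, Finset.card_range] at hcard
  by_cases hm : mx r
  · have := hmb hm
    have := Finset.card_le_card (Finset.filter_subset (fun r' => (mx r' ↔ mx r)) A)
    omega
  · have := hcb hm
    have := hL₂ (A.filter fun r' => (mx r' ↔ mx r)) (Finset.filter_subset _ _) (by
      intro r' hr'
      simpa [hm] using (Finset.mem_filter.1 hr').2)
    omega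

/-- The constraints whose topmost node is `t` get slots. The slots of the other constraints in the bag
are occupied according to row `t` of `aKeep`, and those of the new ones are entered in `aFin`. -/
lemma runs_newBag {σ : Store} {t : ℕ} {mx : Fin m → Prop} {L₁ L₂ : ℕ} (ht : σ.nat vT 0 0 = t)
    (hsize : σ.nat 6 t 0 = (D.bagN t).card)
    (hlist : ∀ k < (D.bagN t).card, σ.nat 7 t k = listElem (D.bagN t) k)
    (hL : σ.nat vL1 0 0 = L₁) (hmx : ∀ r : Fin m, σ.nat 2 r 0 = 0 ↔ ¬ mx r)
    (hL₁ : (D.bagN t).card ≤ L₁)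
    (hL₂ : ∀ A' ⊆ D.bagN t, (∀ r ∈ A', ¬ mx r) → A'.card ≤ L₂) (hL₂₁ : L₂ ≤ L₁)
    (hcol : Coloured D mx L₁ L₂ (fun r => D.topN r < t) (fun r => σ.nat aCol r 0)
      (fun r => σ.nat aTop r 0))
    (hkeep : MarksRow ((D.bagN t).filter fun r => D.topN r < t) (fun r => σ.nat aCol r 0)
      (σ.nat aKeep t))
    (hfin : ∀ c, σ.nat aFin t c = 0) :
    Runs S progNewBag σ ((D.bagN t).card * (2 * L₁ + 13) + 2) 0 fun σ' =>
      Coloured D mx L₁ L₂ (fun r => D.topN r < t + 1) (fun r => σ'.nat aCol r 0)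
        (fun r => σ'.nat aTop r 0) ∧
      (∀ r : Fin m, D.topN r < t → σ'.nat aCol r 0 = σ.nat aCol r 0) ∧
      MarksRow ((D.bagN t).filter fun r => D.topN r = t) (fun r => σ'.nat aCol r 0)
        (σ'.nat aFin t) ∧
      ∀ t', t' ≠ t → σ'.nat aFin t' = σ.nat aFin t' := by
  unfold progNewBag
  refine (Runs.forEach (t := 2 * L₁ + 10) (q := 0) (D.bagN t) (fun B σ' =>
      Coloured D mx L₁ L₂ (fun r => D.topN r < t ∨ (D.topN r = t ∧ r ∈ B))
        (fun r => σ'.nat aCol r 0) (fun r => σ'.nat aTop r 0) ∧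
      (∀ r : Fin m, D.topN r < t → σ'.nat aCol r 0 = σ.nat aCol r 0) ∧
      MarksRow (B.filter fun r => D.topN r = t) (fun r => σ'.nat aCol r 0) (σ'.nat aFin t) ∧
      ∀ t', t' ≠ t → σ'.nat aFin t' = σ.nat aFin t') (by decide) ?_ ?_ ?_ ?_ ?_).mono
      le_rfl (by omega) ?_
  · intro σ' hF
    simp [hF.nat 6 (by decide), hF.nat vT (by decide), ht, hsize]
  · intro σ' hF k hk
    simp [hF.nat 7 (by decide), hF.nat vT (by decide), ht, hlist k hk]
  · intro B σ' x h
    simp only [Store.setNat_nat_of_ne _ (show aCol ≠ vJ by decide),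
      Store.setNat_nat_of_ne _ (show aTop ≠ vJ by decide),
      Store.setNat_nat_of_ne _ (show aFin ≠ vJ by decide),
      Store.setNat_nat_of_ne _ (show aCol ≠ vR by decide),
      Store.setNat_nat_of_ne _ (show aTop ≠ vR by decide),
      Store.setNat_nat_of_ne _ (show aFin ≠ vR by decide)]
    exact ⟨h, h⟩
  · exact ⟨hcol.congr (by simp), fun _ _ => rfl, by simpa using MarksRow.empty hfin,
      fun _ _ => rfl⟩
  · rintro B r hr hB hrB σ' hF hv ⟨h1, h2, h3, h4⟩
    have hT : σ'.nat vT 0 0 = t := by rw [hF.nat vT (by decide), ht]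
    have hK := hF.nat aKeep (by decide)
    have h2' := hF.nat 2 (by decide)
    have hL' : σ'.nat vL1 0 0 = L₁ := by rw [hF.nat vL1 (by decide), hL]
    refine Runs.ite (t := 2 * L₁ + 9) (fun hc => ?_) fun hc => Runs.skip ?_
    · simp only [Test.holds_natLE, NExp.eval_zero, NExp.eval_get, NExp.eval_lit, hv] at hc
      have htop : D.topN r = t := by
        have h5 := (h1.iff r).not.1 (by simpa using hc)
        have h6 := RootedDecomposition.topN_le hr
        by_contra hne
        exact h5 (Or.inl (by omega))
      have hnC : ¬ (D.topN r < t ∨ (D.topN r = t ∧ r ∈ B)) := by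
        rintro (h | h)
        · omega
        · exact hrB h.2
      obtain ⟨k, c, hkm, hkc, hfree⟩ := exists_free h1 hr hnC hL₁ hL₂
      have hocc : ∀ c, σ'.nat aKeep t c + σ'.nat aFin t c ≠ 0 →
          ∃ r' ∈ D.bagN t, (D.topN r' < t ∨ (D.topN r' = t ∧ r' ∈ B)) ∧
            σ'.nat aCol r' 0 = c + 1 := by
        intro c hne
        rcases Nat.eq_zero_or_pos (σ'.nat aKeep t c) with h0 | h0
        · obtain ⟨r', hr', hc'⟩ := h3.2 c (by omega)
          have := Finset.mem_filter.1 hr'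
          exact ⟨r', hB this.1, Or.inr ⟨this.2, this.1⟩, hc'⟩
        · rw [hK] at h0
          obtain ⟨r', hr', hc'⟩ := hkeep.2 c (by omega)
          have := Finset.mem_filter.1 hr'
          exact ⟨r', this.1, Or.inl this.2, by rw [h2 r' this.2]; exact hc'⟩
      have hocc' : ∀ c, σ'.nat aKeep t c + σ'.nat aFin t c = 0 →
          ∀ r' ∈ D.bagN t, (D.topN r' < t ∨ (D.topN r' = t ∧ r' ∈ B)) →
            σ'.nat aCol r' 0 ≠ c + 1 := by
        rintro c h0 r' hr' (hC | ⟨hC, hrB'⟩) heq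
        · have := hkeep.1 r' (Finset.mem_filter.2 ⟨hr', hC⟩)
          simp only [← h2 r' hC, heq, ← hK, Nat.add_sub_cancel] at this
          omega
        · have := h3.1 r' (Finset.mem_filter.2 ⟨hrB', hC⟩)
          simp only [heq, Nat.add_sub_cancel] at this
          omega
      -- the first slot of the kind of `r`
      obtain ⟨base, hbm, hbc⟩ : ∃ base, (mx r → base = 0) ∧ (¬ mx r → base = L₁) := by
        by_cases hm : mx r
        · exact ⟨0, fun _ => rfl, fun h => absurd hm h⟩
        · exact ⟨L₁, fun h => absurd h hm, fun _ => rfl⟩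
      have hck : c = base + k ∧ k ≤ L₁ := by
        by_cases hm : mx r
        · have := hkm hm
          have := hbm hm
          omega
        · have := hkc hm
          have := hbc hm
          omega
      refine (Runs.cons' (t₁ := 2) (Ψ := fun σ₁ => σ₁.nat vC 0 0 = base) (Runs.ite
        (fun hm => Runs.setNat ?_) fun hm => Runs.setNat ?_) fun σ₁ F₁ e₁ =>
        Runs.cons' (t₂ := 4) (Runs.loop (t := 1) (q := 0)
          (I := fun j σ₂ => σ₂.nat vC 0 0 = base + j ∧ j ≤ k) k ?_ ?_ ?_
            (Φ := fun σ₂ => ∃ j ≤ k, σ₂.nat vC 0 0 = base + j ∧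
              σ'.nat aKeep t (base + j) + σ'.nat aFin t (base + j) = 0) ?_)
          fun σ₂ F₂ e₂ => ?_).mono (q := 0) (by omega) le_rfl fun _ _ h => h
      · have : ¬ mx r := (hmx r).1 (by simpa [hv, h2'] using hm)
        simp [hL', hbc this]
      · have : mx r := by
          by_contra hcon
          exact hm (by simpa [hv, h2'] using (hmx r).2 hcon)
        simp [hbm this]
      · exact ⟨e₁, Nat.zero_le _⟩
      · rintro j σ₂ F₂ ⟨k1, k2⟩ hj
        simp only [Test.holds_natLE, NExp.eval_one, NExp.eval_add, NExp.eval_get, NExp.eval_lit, k1,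
          F₂.nat vT (by decide), F₂.nat aKeep (by decide), F₂.nat aFin (by decide),
          F₁.nat vT (by decide), F₁.nat aKeep (by decide), F₁.nat aFin (by decide), hT] at hj
        refine lt_of_le_of_ne k2 ?_
        rintro rfl
        obtain ⟨r', hr', hC, hc'⟩ := hocc (base + j) (by omega)
        exact hfree r' hr' hC (by rw [hc', hck.1])
      · rintro j σ₂ F₂ ⟨k1, k2⟩ hj
        refine Runs.setNat ?_
        simp only [Test.holds_natLE, NExp.eval_one, NExp.eval_add, NExp.eval_get, NExp.eval_lit, k1,
          F₂.nat vT (by decide), F₂.nat aKeep (by decide), F₂.nat aFin (by decide),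
          F₁.nat vT (by decide), F₁.nat aKeep (by decide), F₁.nat aFin (by decide), hT] at hj
        refine ⟨by simp [k1, add_assoc], lt_of_le_of_ne k2 ?_⟩
        rintro rfl
        obtain ⟨r', hr', hC, hc'⟩ := hocc (base + j) (by omega)
        exact hfree r' hr' hC (by rw [hc', hck.1])
      · rintro j σ₂ F₂ ⟨k1, k2⟩ hj
        simp only [Test.holds_natLE, NExp.eval_one, NExp.eval_add, NExp.eval_get, NExp.eval_lit, k1,
          F₂.nat vT (by decide), F₂.nat aKeep (by decide), F₂.nat aFin (by decide),
          F₁.nat vT (by decide), F₁.nat aKeep (by decide), F₁.nat aFin (by decide), hT] at hj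
        exact ⟨j, k2, k1, by omega⟩
      · obtain ⟨j, hj, hvC, hj0⟩ := e₂
        have hnat : ∀ a, a ≠ vC → σ₂.nat a = σ'.nat a := fun a ha =>
          (F₂.nat a (by simpa [Cmd.natWrites] using ha)).trans
            (F₁.nat a (by simpa [Cmd.natWrites] using ha))
        have hT₂ : σ₂.nat vT 0 0 = t := by rw [hnat _ (by decide), hT]
        have hv₂ : σ₂.nat vR 0 0 = r := by rw [hnat _ (by decide), hv]
        have hcol₂ := hnat aCol (by decide)
        have hfin₂ := hnat aFin (by decide)
        have htop₂ := hnat aTop (by decide)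
        refine Runs.cons_setNat_eq (i' := r) (k' := 0) (x := base + j + 1) (by simp [hv₂]) rfl
          (by simp [hvC]) (Runs.cons_setNat_eq (i' := t) (k' := base + j) (x := r + 1)
            (by simp [hT₂]) (by simp [hvC]) (by simp [hv₂]) (Runs.cons_setNat_eq (i' := r) (k' := 0)
              (x := t) (by simp [hv₂]) rfl (by simp [hT₂]) (Runs.nil (t := 0) ?_)))
        have key := h1.insert hnC (c := base + j) (col' := fun x => if x = r then base + j + 1
            else σ'.nat aCol x 0) (tp' := fun x => if x = r then D.topN r else σ'.nat aTop x 0)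
          (fun hm => by have := hkm hm; have := hbm hm; omega)
          (fun hm => by have := hkc hm; have := hbc hm; omega)
          (fun r' hC => by rcases hC with h | h <;> omega)
          (fun r' hC hr' => hocc' _ hj0 r' (by rwa [htop] at hr') hC) (fun _ => rfl) (fun _ => rfl)
        have hmark : MarksRow (insert r (B.filter fun r => D.topN r = t))
            (fun x => if x = r then base + j + 1 else σ'.nat aCol x 0)
            (fun c => if c = base + j then (r : ℕ) + 1 else σ'.nat aFin t c) := by
          have hne : ∀ r' ∈ B.filter (fun r => D.topN r = t), (r' : ℕ) ≠ r := by
            intro r' hr' heq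
            rw [Fin.val_inj] at heq
            exact hrB (heq ▸ (Finset.mem_filter.1 hr').1)
          have hcd : ∀ r' ∈ B.filter (fun r => D.topN r = t),
              (D.topN r' < t ∨ (D.topN r' = t ∧ r' ∈ B)) := by
            intro r' hr'
            have := Finset.mem_filter.1 hr'
            exact Or.inr ⟨this.2, this.1⟩
          refine (h3.congr (col' := fun x => if x = r then base + j + 1 else σ'.nat aCol x 0)
            fun r' hr' => if_neg (hne r' hr')).insert (by simp) (fun r' hr' => ?_)
            (fun r' hr' => ?_) fun c => by simp
          · rw [if_neg (hne r' hr')]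
            exact (h1.iff r').2 (hcd r' hr')
          · rw [if_neg (hne r' hr'), if_pos rfl]
            exact hocc' _ hj0 r' (hB (Finset.mem_filter.1 hr').1) (hcd r' hr')
        have e1 : ∀ x, (((σ₂.setNat aCol r 0 (base + j + 1)).setNat aFin t (base + j) (r + 1)).setNat
            aTop r 0 t).nat aCol x 0 = if x = r then base + j + 1 else σ'.nat aCol x 0 := by
          intro x
          simp [hcol₂]
        have e2 : ∀ x, (((σ₂.setNat aCol r 0 (base + j + 1)).setNat aFin t (base + j) (r + 1)).setNat
            aTop r 0 t).nat aTop x 0 = if x = r then D.topN r else σ'.nat aTop x 0 := by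
          intro x
          simp [htop₂, htop]
        have e3 : ∀ t' c, (((σ₂.setNat aCol r 0 (base + j + 1)).setNat aFin t (base + j)
            (r + 1)).setNat aTop r 0 t).nat aFin t' c
              = if t' = t ∧ c = base + j then (r : ℕ) + 1 else σ'.nat aFin t' c := by
          intro t' c
          simp [hfin₂]
        simp only [e1, e2]
        refine ⟨key.congr fun r' => ?_, fun r' hr' => ?_, ?_, fun t' ht' => ?_⟩
        · rw [Finset.mem_insert]
          constructor
          · rintro (h | ⟨h, rfl | h'⟩)
            · exact Or.inl (Or.inl h)
            · exact Or.inr rfl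
            · exact Or.inl (Or.inr ⟨h, h'⟩)
          · rintro ((h | ⟨h, h'⟩) | rfl)
            · exact Or.inl h
            · exact Or.inr ⟨h, Or.inr h'⟩
            · exact Or.inr ⟨htop, Or.inl rfl⟩
        · rw [if_neg, h2 r' hr']
          rw [Fin.val_inj]
          rintro rfl
          omega
        · rw [Finset.filter_insert, if_pos htop]
          convert hmark using 1
          funext c
          rw [e3]
          simp
        · rw [← h4 t' ht']
          funext c
          rw [e3, if_neg (by simp [ht'])]
    · simp only [Test.holds_natLE, NExp.eval_zero, NExp.eval_get, NExp.eval_lit, hv] at hc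
      have hC := (h1.iff r).1 (by simpa using hc)
      have htop : ¬ D.topN r = t := by
        intro h
        rcases hC with h' | h'
        · omega
        · exact hrB h'.2
      refine ⟨h1.congr fun r' => ?_, h2, ?_, h4⟩
      · rw [Finset.mem_insert]
        constructor
        · rintro (h | ⟨h, rfl | h'⟩)
          · exact Or.inl h
          · exact absurd h htop
          · exact Or.inr ⟨h, h'⟩
        · rintro (h | ⟨h, h'⟩)
          · exact Or.inl h
          · exact Or.inr ⟨h, Or.inr h'⟩
      · rwa [Finset.filter_insert, if_neg htop]
  · rintro σ' - ⟨h1, h2, h3, h4⟩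
    refine ⟨h1.congr fun r => ?_, h2, h3, h4⟩
    constructor
    · intro h
      rcases Nat.lt_succ_iff_lt_or_eq.1 h with h | h
      · exact Or.inl h
      · exact Or.inr ⟨h, h ▸ RootedDecomposition.mem_bagN_topN r⟩
    · rintro (h | h) <;> omega

end Colour

/-! ### The leaves and parents of the merge tree -/

section Leaves

variable {n b m : ℕ} {P : QIB n b m} {S : P.Solver} {N : ℕ}

lemma runs_colour {G : SimpleGraph (Fin m)} {D : RootedDecomposition G N} {σ : Store}
    {mx : Fin m → Prop} {L₁ L₂ : ℕ} (hN : σ.nat 0 3 0 = N)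
    (hsize : ∀ t < N, σ.nat 6 t 0 = (D.bagN t).card)
    (hlist : ∀ t < N, ∀ k < (D.bagN t).card, σ.nat 7 t k = listElem (D.bagN t) k)
    (hL : σ.nat vL1 0 0 = L₁) (hmx : ∀ r : Fin m, σ.nat 2 r 0 = 0 ↔ ¬ mx r)
    (hL₁ : ∀ t, (D.bagN t).card ≤ L₁)
    (hL₂ : ∀ t, ∀ A' ⊆ D.bagN t, (∀ r ∈ A', ¬ mx r) → A'.card ≤ L₂) (hL₂₁ : L₂ ≤ L₁)
    (hcol : ∀ r, σ.nat aCol r 0 = 0) (hkeep : ∀ t c, σ.nat aKeep t c = 0)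
    (hfin : ∀ t c, σ.nat aFin t c = 0) :
    Runs S progColour σ (N * (L₁ * (2 * L₁ + 18) + 7) + 2) 0 fun σ' =>
      Coloured D mx L₁ L₂ (fun _ => True) (fun r => σ'.nat aCol r 0) (fun r => σ'.nat aTop r 0) ∧
      (∀ t < N,
        MarksRow ((D.bagN t).filter fun r => D.topN r ≠ t) (fun r => σ'.nat aCol r 0)
          (σ'.nat aKeep t) ∧
        MarksRow ((D.bagN t).filter fun r => D.topN r = t) (fun r => σ'.nat aCol r 0)
          (σ'.nat aFin t)) ∧
      ∀ t, N ≤ t → ∀ c, σ'.nat aKeep t c = 0 ∧ σ'.nat aFin t c = 0 := by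
  unfold progColour
  refine (Runs.forLoop (t := L₁ * (2 * L₁ + 18) + 5) (q := 0) (fun k σ' =>
      Coloured D mx L₁ L₂ (fun r => D.topN r < k) (fun r => σ'.nat aCol r 0)
        (fun r => σ'.nat aTop r 0) ∧
      (∀ t < k,
        MarksRow ((D.bagN t).filter fun r => D.topN r ≠ t) (fun r => σ'.nat aCol r 0)
          (σ'.nat aKeep t) ∧
        MarksRow ((D.bagN t).filter fun r => D.topN r = t) (fun r => σ'.nat aCol r 0)
          (σ'.nat aFin t)) ∧
      ∀ t, k ≤ t → ∀ c, σ'.nat aKeep t c = 0 ∧ σ'.nat aFin t c = 0) N (by decide) ?_ ?_ ?_ ?_).mono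
      le_rfl (by omega) ?_
  · intro σ' hF
    simp [hF.nat 0 (by decide), hN]
  · intro k σ' x h
    simpa only [Store.setNat_nat_of_ne _ (show aCol ≠ vT by decide),
      Store.setNat_nat_of_ne _ (show aTop ≠ vT by decide),
      Store.setNat_nat_of_ne _ (show aFin ≠ vT by decide),
      Store.setNat_nat_of_ne _ (show aKeep ≠ vT by decide)] using h
  · refine ⟨⟨?_, ?_, ?_, ?_, ?_⟩, ?_, fun t _ c => ⟨hkeep t c, hfin t c⟩⟩ <;> simp [hcol]
  · rintro t ht σ' hF hv ⟨h1, h2, h3⟩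
    have h6 := hF.nat 6 (by decide)
    have h7 := hF.nat 7 (by decide)
    refine (Runs.cons' (runs_keepBag (D.bagN t) hv (by rw [h6, hsize t ht])
      (by rw [h7]; exact hlist t ht) ?_ fun c => (h3 t le_rfl c).1) fun σ₁ F₁ I₁ =>
      Runs.cons' (runs_newBag (D := D) (t := t) (mx := mx) (L₁ := L₁) (L₂ := L₂) ?_ ?_ ?_ ?_ ?_
        (hL₁ t) (hL₂ t) hL₂₁ ?_ ?_ ?_) fun σ₂ F₂ I₂ => Runs.nil (t := 0) ?_).mono (q := 0) ?_ le_rfl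
        fun _ _ h => h
    · intro r hr r' hr' hne heq
      have hC := (h1.iff r).1 hne
      have hC' := (h1.iff r').1 (by simpa only [heq] using hne)
      exact h1.inj r r' t hC hC' hr hr' heq
    · rw [F₁.nat vT (by decide), hv]
    · rw [F₁.nat 6 (by decide), h6, hsize t ht]
    · rw [F₁.nat 7 (by decide), h7]; exact hlist t ht
    · rw [F₁.nat vL1 (by decide), hF.nat vL1 (by decide), hL]
    · rw [F₁.nat 2 (by decide), hF.nat 2 (by decide)]; exact hmx
    · rw [F₁.nat aCol (by decide), F₁.nat aTop (by decide)]; exact h1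
    · rw [F₁.nat aCol (by decide)]
      convert I₁.1 using 1
      refine Finset.filter_congr fun r _ => (h1.iff r).symm
    · rw [F₁.nat aFin (by decide)]
      exact fun c => (h3 t le_rfl c).2
    · obtain ⟨k1, k2, k3, k4⟩ := I₂
      have hcol' : ∀ r : Fin m, D.topN r < t → σ₂.nat aCol r 0 = σ'.nat aCol r 0 := by
        intro r hr
        rw [k2 r hr, F₁.nat aCol (by decide)]
      have hK : σ₂.nat aKeep = σ₁.nat aKeep := F₂.nat aKeep (by decide)
      have hFn : ∀ t', t' ≠ t → σ₂.nat aFin t' = σ'.nat aFin t' := by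
        intro t' ht'
        rw [k4 t' ht', F₁.nat aFin (by decide)]
      have hbelow : ∀ t' < t + 1, ∀ r ∈ (D.bagN t').filter (fun r => D.topN r ≠ t'),
          D.topN r < t := by
        intro t' ht' r hr
        have h5 := Finset.mem_filter.1 hr
        have h6 := RootedDecomposition.topN_le h5.1
        have := h5.2
        omega
      refine ⟨k1, fun t' ht' => ?_, fun t' ht' c => ?_⟩
      · rcases Nat.lt_succ_iff_lt_or_eq.1 ht' with h | rfl
        · rw [hK, I₁.2 t' h.ne, hFn t' h.ne]
          refine ⟨(h2 t' h).1.congr fun r hr => hcol' r (hbelow t' ht' r hr),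
            (h2 t' h).2.congr fun r hr => hcol' r ?_⟩
          rw [(Finset.mem_filter.1 hr).2]
          exact h
        · refine ⟨?_, k3⟩
          rw [hK]
          have : (D.bagN t').filter (fun r => D.topN r ≠ t')
              = (D.bagN t').filter fun r : Fin m => σ'.nat aCol r 0 ≠ 0 := by
            refine Finset.filter_congr fun r hr => ?_
            have h5 := h1.iff r
            have h6 := RootedDecomposition.topN_le hr
            rw [h5]
            omega
          rw [this]
          refine I₁.1.congr fun r hr => hcol' r ?_
          rw [← this] at hr
          exact hbelow t' ht' r hr
      · rw [hK, I₁.2 t' (by omega), hFn t' (by omega)]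
        exact h3 t' (by omega) c
    · have := hL₁ t
      nlinarith [Nat.mul_le_mul_right (2 * L₁ + 18) this]
  · rintro σ' - ⟨h1, h2, h3⟩
    exact ⟨h1.congr fun r => by simp [RootedDecomposition.topN_lt], h2, h3⟩

variable (P) in
/-- The number of blocks below `i` that are incident with constraint `r`. -/
noncomputable def countBelow (i : ℕ) (r : Fin m) : ℕ :=
  (Finset.univ.filter fun i' : Fin b => (i' : ℕ) < i ∧ r ∈ P.consOf i').card

lemma countBelow_succ (i : Fin b) (r : Fin m) :
    countBelow P (i + 1) r = countBelow P i r + if r ∈ P.consOf i then 1 else 0 := by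
  unfold countBelow
  have : (Finset.univ.filter fun i' : Fin b => (i' : ℕ) < i + 1 ∧ r ∈ P.consOf i')
      = if r ∈ P.consOf i then insert i (Finset.univ.filter fun i' : Fin b =>
        (i' : ℕ) < i ∧ r ∈ P.consOf i')
        else Finset.univ.filter fun i' : Fin b => (i' : ℕ) < i ∧ r ∈ P.consOf i' := by
    ext i'
    split_ifs with h
    · simp only [Finset.mem_filter, Finset.mem_univ, true_and, Finset.mem_insert,
        Nat.lt_succ_iff_lt_or_eq,
        Fin.val_inj]
      constructor
      · rintro ⟨h1 | h1, h2⟩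
        · exact Or.inr ⟨h1, h2⟩
        · exact Or.inl h1
      · rintro (rfl | h1)
        · exact ⟨Or.inr rfl, h⟩
        · exact ⟨Or.inl h1.1, h1.2⟩
    · simp only [Finset.mem_filter, Finset.mem_univ, true_and, Nat.lt_succ_iff_lt_or_eq,
        Fin.val_inj]
      constructor
      · rintro ⟨h1 | rfl, h2⟩
        · exact ⟨h1, h2⟩
        · exact absurd h2 h
      · exact fun h1 => ⟨Or.inl h1.1, h1.2⟩
  rw [this]
  split_ifs with h
  · rw [Finset.card_insert_of_notMem (by simp)]
  · rfl

lemma countBelow_le (i : ℕ) (r : Fin m) : countBelow P i r ≤ (P.blocksOf r).card := by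
  refine Finset.card_le_card fun i' hi' => ?_
  exact QIB.mem_blocksOf.2 (QIB.mem_consOf.1 (Finset.mem_filter.1 hi').2.2)

lemma countBelow_last (r : Fin m) : countBelow P b r = (P.blocksOf r).card := by
  refine le_antisymm (countBelow_le b r) (Finset.card_le_card fun i' hi' => ?_)
  exact Finset.mem_filter.2 ⟨Finset.mem_univ _, i'.2,
    QIB.mem_consOf.2 (QIB.mem_blocksOf.1 hi')⟩

lemma blocksOf_card_le_kappa {r : Fin m} (hr : ¬ P.IsMixed r) : (P.blocksOf r).card ≤ P.kappa := by
  classical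
  exact Finset.le_sup (f := fun r => (P.blocksOf r).card) (by simpa [QIB.combs] using hr)

/-- What the loop over the constraints of one block does. -/
lemma runs_leaf {σ : Store} (i : Fin b) (hi : σ.nat vI 0 0 = i) (hN : σ.nat 0 3 0 = N)
    (hsize : σ.nat 3 i 0 = (P.consOf i).card)
    (hlist : ∀ k < (P.consOf i).card, σ.nat 4 i k = listElem (P.consOf i) k)
    (hmx : ∀ r : Fin m, σ.nat 2 r 0 = 0 ↔ ¬ P.IsMixed r)
    (hcol : ∀ r : Fin m, σ.nat aCol r 0 ≠ 0)
    (hinj : ∀ r ∈ P.consOf i, ∀ r' ∈ P.consOf i, σ.nat aCol r 0 = σ.nat aCol r' 0 → r = r')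
    (hkeep : ∀ c, σ.nat aKeep (N + i) c = 0) (hpar : σ.nat aPar (N + i) 0 = 0) :
    Runs S (.forEach vJ vR (.at 3 (.var vI)) 4 (.var vI) (.block [
      .setNat aCnt (.var vR) 0 (.at aCnt (.var vR) + 1),
      .ite (.natLE (.at 2 (.var vR)) 0)
        (.ite (.natLE (.var vKap) (.at aCnt (.var vR))) (.assign vKap (.at aCnt (.var vR))) .skip)
        .skip,
      .setNat aKeep (inN + .var vI) (.at aCol (.var vR) - 1) (.var vR + 1),
      .ite (.natLE (.at aPar (inN + .var vI)) (.at aTop (.var vR)))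
        (.setNat aPar (inN + .var vI) 0 (.at aTop (.var vR))) .skip])) σ
      ((P.consOf i).card * 11 + 2) 0 fun σ' =>
        (∀ r : Fin m, σ'.nat aCnt r 0 = σ.nat aCnt r 0 + if r ∈ P.consOf i then 1 else 0) ∧
        (σ.nat vKap 0 0 ≤ σ'.nat vKap 0 0 ∧
          (∀ r ∈ P.consOf i, ¬ P.IsMixed r → σ.nat aCnt r 0 + 1 ≤ σ'.nat vKap 0 0) ∧
          (σ'.nat vKap 0 0 = σ.nat vKap 0 0 ∨ ∃ r ∈ P.consOf i, ¬ P.IsMixed r ∧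
            σ'.nat vKap 0 0 = σ.nat aCnt r 0 + 1)) ∧
        (MarksRow (P.consOf i) (fun r => σ.nat aCol r 0) (σ'.nat aKeep (N + i)) ∧
          ∀ t, t ≠ N + i → σ'.nat aKeep t = σ.nat aKeep t) ∧
        (σ'.nat aPar (N + i) 0 = (P.consOf i).sup (fun r => σ.nat aTop r 0) ∧
          ∀ t, t ≠ N + i → σ'.nat aPar t = σ.nat aPar t) := by
  refine Runs.forEach (t := 8) (q := 0) (P.consOf i) (fun B σ' =>
        (∀ r : Fin m, σ'.nat aCnt r 0 = σ.nat aCnt r 0 + if r ∈ B then 1 else 0) ∧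
        (σ.nat vKap 0 0 ≤ σ'.nat vKap 0 0 ∧
          (∀ r ∈ B, ¬ P.IsMixed r → σ.nat aCnt r 0 + 1 ≤ σ'.nat vKap 0 0) ∧
          (σ'.nat vKap 0 0 = σ.nat vKap 0 0 ∨ ∃ r ∈ B, ¬ P.IsMixed r ∧
            σ'.nat vKap 0 0 = σ.nat aCnt r 0 + 1)) ∧
        (MarksRow B (fun r => σ.nat aCol r 0) (σ'.nat aKeep (N + i)) ∧
          ∀ t, t ≠ N + i → σ'.nat aKeep t = σ.nat aKeep t) ∧
        (σ'.nat aPar (N + i) 0 = B.sup (fun r => σ.nat aTop r 0) ∧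
          ∀ t, t ≠ N + i → σ'.nat aPar t = σ.nat aPar t)) (by decide) ?_ ?_ ?_ ?_ ?_
  · intro σ' hF
    simp [hF.nat 3 (by decide), hF.nat vI (by decide), hi, hsize]
  · intro σ' hF k hk
    simp [hF.nat 4 (by decide), hF.nat vI (by decide), hi, hlist k hk]
  · intro B σ' x h
    simp only [Store.setNat_nat_of_ne _ (show aCnt ≠ vJ by decide),
      Store.setNat_nat_of_ne _ (show vKap ≠ vJ by decide),
      Store.setNat_nat_of_ne _ (show aKeep ≠ vJ by decide),
      Store.setNat_nat_of_ne _ (show aPar ≠ vJ by decide),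
      Store.setNat_nat_of_ne _ (show aCnt ≠ vR by decide),
      Store.setNat_nat_of_ne _ (show vKap ≠ vR by decide),
      Store.setNat_nat_of_ne _ (show aKeep ≠ vR by decide),
      Store.setNat_nat_of_ne _ (show aPar ≠ vR by decide)]
    exact ⟨h, h⟩
  · exact ⟨by simp, ⟨le_rfl, by simp, Or.inl rfl⟩, ⟨MarksRow.empty hkeep, fun _ _ => rfl⟩,
      by simpa using hpar, fun _ _ => rfl⟩
  · rintro B r hr hB hrB σ₀ hF hv ⟨h1, ⟨h2, h3, h4⟩, ⟨h5, h6⟩, h7, h8⟩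
    have hI : σ₀.nat vI 0 0 = i := by rw [hF.nat vI (by decide), hi]
    have hN' : σ₀.nat 0 3 0 = N := by rw [hF.nat 0 (by decide), hN]
    have hc := hF.nat aCol (by decide)
    have ht := hF.nat aTop (by decide)
    have h2' := hF.nat 2 (by decide)
    have hcnt : σ₀.nat aCnt r 0 = σ.nat aCnt r 0 := by rw [h1, if_neg hrB, add_zero]
    refine Runs.cons_setNat_eq (t := 7) (i' := r) (k' := 0) (x := σ.nat aCnt r 0 + 1) (by simp [hv])
      rfl (by simp [hv, hcnt]) (Runs.cons' (t₁ := 3) (t₂ := 4) (Ψ := fun σ₁ =>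
        (∀ a, a ≠ vKap → σ₁.nat a = (σ₀.setNat aCnt r 0 (σ.nat aCnt r 0 + 1)).nat a) ∧
        σ.nat vKap 0 0 ≤ σ₁.nat vKap 0 0 ∧
          (∀ r' ∈ insert r B, ¬ P.IsMixed r' → σ.nat aCnt r' 0 + 1 ≤ σ₁.nat vKap 0 0) ∧
          (σ₁.nat vKap 0 0 = σ.nat vKap 0 0 ∨ ∃ r' ∈ insert r B, ¬ P.IsMixed r' ∧
            σ₁.nat vKap 0 0 = σ.nat aCnt r' 0 + 1)) ?_ fun σ₁ F₁ I₁ => ?_)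
    · have hold : (σ₀.setNat aCnt r 0 (σ.nat aCnt r 0 + 1)).nat vKap 0 0 = σ₀.nat vKap 0 0 := by
        simp
      refine Runs.ite (fun hm => Runs.ite (fun hk => Runs.setNat ?_) fun hk => Runs.skip ?_)
        fun hm => Runs.skip (t := 1) ?_
      · have hcomb : ¬ P.IsMixed r := (hmx r).1 (by simpa [hv, h2'] using hm)
        simp only [Test.holds_natLE, NExp.eval_get, NExp.eval_lit] at hk
        have hk' : σ₀.nat vKap 0 0 ≤ σ.nat aCnt r 0 + 1 := by simpa [hv] using hk
        simp only [NExp.eval_get, NExp.eval_lit]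
        have hx : (σ₀.setNat aCnt r 0 (σ.nat aCnt r 0 + 1)).nat aCnt
            ((σ₀.setNat aCnt r 0 (σ.nat aCnt r 0 + 1)).nat vR 0 0) 0 = σ.nat aCnt r 0 + 1 := by
          simp [hv]
        rw [hx]
        have hy : ((σ₀.setNat aCnt r 0 (σ.nat aCnt r 0 + 1)).setNat vKap 0 0
            (σ.nat aCnt r 0 + 1)).nat vKap 0 0 = σ.nat aCnt r 0 + 1 := by simp
        rw [hy]
        refine ⟨fun a ha => Store.setNat_nat_of_ne _ ha _ _ _, by omega, ?_,
          Or.inr ⟨r, Finset.mem_insert_self _ _, hcomb, rfl⟩⟩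
        intro r' hr' hm'
        rcases Finset.mem_insert.1 hr' with rfl | hr'
        · exact le_rfl
        · exact (h3 r' hr' hm').trans hk'
      · simp only [Test.holds_natLE, NExp.eval_get, NExp.eval_lit] at hk
        have hk' : ¬ σ₀.nat vKap 0 0 ≤ σ.nat aCnt r 0 + 1 := by simpa [hv] using hk
        rw [hold]
        refine ⟨fun _ _ => rfl, h2, ?_, h4.imp id ?_⟩
        · intro r' hr' hm'
          rcases Finset.mem_insert.1 hr' with rfl | hr'
          · omega
          · exact h3 r' hr' hm'
        · rintro ⟨r', hr', h⟩
          exact ⟨r', Finset.mem_insert_of_mem hr', h⟩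
      · have hcomb : P.IsMixed r := by
          by_contra hcon
          exact hm (by simpa [hv, h2'] using (hmx r).2 hcon)
        rw [hold]
        refine ⟨fun _ _ => rfl, h2, ?_, h4.imp id ?_⟩
        · intro r' hr' hm'
          rcases Finset.mem_insert.1 hr' with rfl | hr'
          · exact absurd hcomb hm'
          · exact h3 r' hr' hm'
        · rintro ⟨r', hr', h⟩
          exact ⟨r', Finset.mem_insert_of_mem hr', h⟩
    · obtain ⟨g, k2, k3, k4⟩ := I₁
      have g0 := g 0 (by decide)
      have gI := g vI (by decide)
      have gR := g vR (by decide)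
      have gcol := g aCol (by decide)
      have gtop := g aTop (by decide)
      have gpar := g aPar (by decide)
      have gkeep := g aKeep (by decide)
      have gcnt := g aCnt (by decide)
      rw [Store.setNat_nat_of_ne _ (by decide)] at g0 gI gR gcol gtop gpar gkeep
      have hcol1 : σ.nat aCol r 0 - 1 + 1 = σ.nat aCol r 0 := by
        have := hcol r
        omega
      have hcntr : ∀ r' : Fin m, σ₁.nat aCnt r' 0
          = σ.nat aCnt r' 0 + if r' ∈ insert r B then 1 else 0 := by
        intro r'
        rw [gcnt]
        simp only [Store.setNat_nat, true_and, and_true, Fin.val_inj, Finset.mem_insert]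
        by_cases hrr : r' = r
        · simp [hrr]
        · simp [hrr, h1]
      have hmark : MarksRow (insert r B) (fun r => σ.nat aCol r 0)
          (fun c => if c = σ.nat aCol r 0 - 1 then (r : ℕ) + 1 else σ₀.nat aKeep (N + i) c) :=
        h5.insert (hcol r) (fun r' _ => hcol r') (fun r' hr' heq => by
          have := hinj r' (hB hr') r hr heq
          subst this
          exact hrB hr') fun c => rfl
      refine Runs.cons_setNat_eq (t := 3) (i' := N + i) (k' := σ.nat aCol r 0 - 1) (x := r + 1)
        (by simp [g0, gI, hN', hI]) (by simp [gcol, gR, hv, hc]) (by simp [gR, hv]) ?_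
      refine Runs.cons' (t₁ := 2) (t₂ := 1) (Ψ := fun σ₂ => (∀ a, a ≠ aPar → σ₂.nat a
          = (σ₁.setNat aKeep (N + i) (σ.nat aCol r 0 - 1) (r + 1)).nat a) ∧
        σ₂.nat aPar (N + i) 0 = (insert r B).sup (fun r => σ.nat aTop r 0) ∧
          ∀ t, t ≠ N + i → σ₂.nat aPar t = σ.nat aPar t) ?_ fun σ₂ F₂ I₂ => Runs.nil (t := 0) ?_
      · refine Runs.ite (fun hk => Runs.setNat ?_) fun hk => Runs.skip ?_
        · have hk' : B.sup (fun r => σ.nat aTop r 0) ≤ σ.nat aTop r 0 := by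
            rw [← h7]
            simpa [g0, gI, gR, hN', hI, hv, gpar, gtop, ht] using hk
          simp only [NExp.eval_get, NExp.eval_lit, NExp.eval_add, NExp.eval_zero, NExp.eval_three]
          refine ⟨fun a ha => Store.setNat_nat_of_ne _ ha _ _ _, ?_, fun t ht' => ?_⟩
          · rw [Finset.sup_insert, sup_eq_left.2 hk']
            simp [g0, gI, gR, hN', hI, hv, gtop, ht]
          · rw [← h8 t ht', ← gpar]
            funext c
            simp [g0, gI, hN', hI, ht']
        · have hk' : ¬ B.sup (fun r => σ.nat aTop r 0) ≤ σ.nat aTop r 0 := by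
            rw [← h7]
            simpa [g0, gI, gR, hN', hI, hv, gpar, gtop, ht] using hk
          refine ⟨fun _ _ => rfl, ?_, fun t ht' => ?_⟩
          · rw [Finset.sup_insert, sup_eq_right.2 (not_le.1 hk').le, Store.setNat_nat_of_ne _ (by decide),
              gpar, h7]
          · rw [Store.setNat_nat_of_ne _ (by decide), gpar, h8 t ht']
      · obtain ⟨e, l1, l2⟩ := I₂
        have ecnt := e aCnt (by decide)
        have ekap := e vKap (by decide)
        have ekeep := e aKeep (by decide)
        rw [Store.setNat_nat_of_ne _ (by decide)] at ecnt ekap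
        refine ⟨by rw [ecnt]; exact hcntr, by rw [ekap]; exact ⟨k2, k3, k4⟩, ⟨?_, fun t ht' => ?_⟩,
          l1, l2⟩
        · convert hmark using 1
          funext c
          rw [ekeep]
          simp [gkeep]
        · rw [← h6 t ht', ekeep]
          funext c
          simp [gkeep, ht']

lemma runs_leaves {σ : Store} {L₁ : ℕ} (hN : σ.nat 0 3 0 = N) (hb : σ.nat 0 2 0 = b)
    (hsize : ∀ i : Fin b, σ.nat 3 i 0 = (P.consOf i).card)
    (hlist : ∀ i : Fin b, ∀ k < (P.consOf i).card, σ.nat 4 i k = listElem (P.consOf i) k)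
    (hmx : ∀ r : Fin m, σ.nat 2 r 0 = 0 ↔ ¬ P.IsMixed r)
    (hcol : ∀ r : Fin m, σ.nat aCol r 0 ≠ 0)
    (hinj : ∀ i : Fin b, ∀ r ∈ P.consOf i, ∀ r' ∈ P.consOf i,
      σ.nat aCol r 0 = σ.nat aCol r' 0 → r = r')
    (hL : ∀ i : Fin b, (P.consOf i).card ≤ L₁)
    (hkeep : ∀ t, N ≤ t → ∀ c, σ.nat aKeep t c = 0) (hpar : ∀ t, σ.nat aPar t 0 = 0)
    (hcnt : ∀ r : Fin m, σ.nat aCnt r 0 = 0) (hkap : σ.nat vKap 0 0 = 0) :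
    Runs S progLeaves σ (b * (L₁ * 11 + 4) + 2) 0 fun σ' =>
      ((∀ r, ¬ P.IsMixed r → (P.blocksOf r).card ≤ σ'.nat vKap 0 0) ∧
        σ'.nat vKap 0 0 ≤ P.kappa) ∧
      ((∀ i : Fin b, MarksRow (P.consOf i) (fun r => σ.nat aCol r 0) (σ'.nat aKeep (N + i))) ∧
        ∀ t, t < N ∨ N + b ≤ t → σ'.nat aKeep t = σ.nat aKeep t) ∧
      ∀ i : Fin b, σ'.nat aPar (N + i) 0 = (P.consOf i).sup fun r => σ.nat aTop r 0 := by
  unfold progLeaves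
  refine (Runs.forLoop (t := L₁ * 11 + 2) (q := 0) (fun k σ' =>
      (∀ r : Fin m, σ'.nat aCnt r 0 = countBelow P k r) ∧
      ((∀ r, ¬ P.IsMixed r → countBelow P k r ≤ σ'.nat vKap 0 0) ∧ σ'.nat vKap 0 0 ≤ P.kappa) ∧
      ((∀ i : Fin b, (i : ℕ) < k →
          MarksRow (P.consOf i) (fun r => σ.nat aCol r 0) (σ'.nat aKeep (N + i))) ∧
        ∀ t, t < N ∨ N + k ≤ t → σ'.nat aKeep t = σ.nat aKeep t) ∧
      (∀ i : Fin b, (i : ℕ) < k →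
        σ'.nat aPar (N + i) 0 = (P.consOf i).sup fun r => σ.nat aTop r 0) ∧
      ∀ t, N + k ≤ t → σ'.nat aPar t = σ.nat aPar t) b (by decide) ?_ ?_ ?_ ?_).mono
      le_rfl (by omega) ?_
  · intro σ' hF
    simp [hF.nat 0 (by decide), hb]
  · intro k σ' x h
    simpa only [Store.setNat_nat_of_ne _ (show aCnt ≠ vI by decide),
      Store.setNat_nat_of_ne _ (show vKap ≠ vI by decide),
      Store.setNat_nat_of_ne _ (show aKeep ≠ vI by decide),
      Store.setNat_nat_of_ne _ (show aPar ≠ vI by decide)] using h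
  · exact ⟨by simp [hcnt, countBelow], ⟨by simp [countBelow], by simp [hkap]⟩, ⟨by simp,
      fun _ _ => rfl⟩, by simp, fun _ _ => rfl⟩
  · rintro k hk σ' hF hv ⟨h1, ⟨h2, h3⟩, ⟨h4, h5⟩, h6, h7⟩
    have hc := hF.nat aCol (by decide)
    have htp := hF.nat aTop (by decide)
    refine (runs_leaf (P := P) (S := S) (N := N) ⟨k, hk⟩ hv ?_ ?_ ?_ ?_ ?_ ?_ ?_ ?_).mono ?_ le_rfl ?_
    · rw [hF.nat 0 (by decide), hN]
    · rw [hF.nat 3 (by decide), ← hsize]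
    · rw [hF.nat 4 (by decide)]
      exact hlist ⟨k, hk⟩
    · rw [hF.nat 2 (by decide)]
      exact hmx
    · rw [hc]
      exact hcol
    · rw [hc]
      exact hinj _
    · intro c
      rw [h5 (N + k) (Or.inr le_rfl)]
      exact hkeep _ (Nat.le_add_right _ _) c
    · rw [h7 (N + k) le_rfl]
      exact hpar _
    · have := hL ⟨k, hk⟩
      omega
    · rintro σ₁ - ⟨k1, ⟨k2, k3, k4⟩, ⟨k5, k6⟩, k7, k8⟩
      rw [hc] at k5
      rw [htp] at k7
      have hcount : ∀ r, countBelow P (k + 1) r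
          = countBelow P k r + if r ∈ P.consOf ⟨k, hk⟩ then 1 else 0 := countBelow_succ ⟨k, hk⟩
      refine ⟨fun r => by rw [k1, h1, hcount], ⟨fun r hr => ?_, ?_⟩, ⟨fun i hi => ?_,
        fun t ht => ?_⟩, fun i hi => ?_, fun t ht => ?_⟩
      · rw [hcount]
        split_ifs with hmem
        · have := k3 r hmem hr
          rwa [h1] at this
        · exact (h2 r hr).trans k2
      · rcases k4 with h | ⟨r, hr, hm, h⟩
        · rwa [h]
        · rw [h, h1]
          have h8 := hcount r
          rw [if_pos hr] at h8
          rw [← h8]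
          exact (countBelow_le _ r).trans (blocksOf_card_le_kappa hm)
      · rcases Nat.lt_succ_iff_lt_or_eq.1 hi with h | h
        · rw [k6 _ (by simp only; omega)]
          exact h4 i h
        · obtain rfl : i = ⟨k, hk⟩ := Fin.ext h
          exact k5
      · rw [k6 _ (by simp only; omega)]
        exact h5 t (by omega)
      · rcases Nat.lt_succ_iff_lt_or_eq.1 hi with h | h
        · rw [k8 _ (by simp only; omega)]
          exact h6 i h
        · obtain rfl : i = ⟨k, hk⟩ := Fin.ext h
          exact k7
      · rw [k8 _ (by simp only; omega)]
        exact h7 t (by omega)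
  · rintro σ' - ⟨h1, ⟨h2, h3⟩, ⟨h4, h5⟩, h6, h7⟩
    refine ⟨⟨fun r hr => ?_, h3⟩, ⟨fun i => h4 i i.2, h5⟩, fun i => h6 i i.2⟩
    rw [← countBelow_last]
    exact h2 r hr

lemma runs_parents {σ : Store} (hN : σ.nat 0 3 0 = N) (hb : σ.nat 0 2 0 = b) :
    Runs S progParents σ (N * 3 + 4) 0 fun σ' =>
      σ'.nat aPar 0 0 = N + b ∧ (∀ t, 0 < t → t < N → σ'.nat aPar t 0 = σ.nat 5 t 0) ∧
      ∀ t, 0 < t → N ≤ t → σ'.nat aPar t = σ.nat aPar t := by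
  unfold progParents
  refine (Runs.cons' (t₁ := N * 3 + 2) (t₂ := 2) (Runs.forLoop (t := 1) (q := 0) (fun k σ' =>
      (∀ t < k, σ'.nat aPar t 0 = σ.nat 5 t 0) ∧ ∀ t, k ≤ t → σ'.nat aPar t = σ.nat aPar t) N
      (by decide) ?_ ?_ ?_ ?_) fun σ₁ F₁ I₁ =>
      Runs.cons_setNat_eq (t := 1) (i' := 0) (k' := 0) (x := N + b) rfl rfl ?_
        (Runs.nil (t := 0) ?_)).mono (q := 0) (by omega) (by omega) fun _ _ h => h
  · intro σ' hF
    simp [hF.nat 0 (by decide), hN]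
  · intro k σ' x h
    simpa only [Store.setNat_nat_of_ne _ (show aPar ≠ vT by decide)] using h
  · exact ⟨by simp, fun _ _ => rfl⟩
  · rintro k hk σ' hF hv ⟨h1, h2⟩
    refine Runs.setNat ⟨fun t ht => ?_, fun t ht => ?_⟩
    · rcases Nat.lt_succ_iff_lt_or_eq.1 ht with h | rfl
      · simp [hv, h.ne, h1 t h]
      · simp [hv, hF.nat 5 (by decide)]
    · rw [← h2 t (by omega)]
      funext c
      simp [hv, show t ≠ k by omega]
  · simp [F₁.nat 0 (by decide), hN, hb]
  · obtain ⟨h1, h2⟩ := I₁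
    refine ⟨by simp, fun t h0 ht => ?_, fun t h0 ht => ?_⟩
    · simp [h0.ne', h1 t ht]
    · rw [← h2 t ht]
      funext c
      simp [h0.ne']

end Leaves

/-! ### The mixed-radix system -/

section Radix

variable {n b m : ℕ} {P : QIB n b m} {S : P.Solver}

/-- The range of the digits: `K` in the slots of mixed-integer constraints and `κ` in those of
combinatorial constraints. -/
def slotRange (L₁ K κ c : ℕ) : ℕ := if c < L₁ then K else κ

/-- The unit in which consumptions are measured: `ε` in the slots of mixed-integer constraints and
`1` in those of combinatorial constraints. -/
noncomputable def slotUnit (L₁ : ℕ) (ε : ℝ) (c : ℕ) : ℝ := if c < L₁ then ε else 1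

/-- What the memory holds when the mixed-radix system has been set up for the slots below `l`. -/
structure RadixTable (O : ℕ → ℕ) (U : ℕ → ℝ) (l : ℕ) (σ : Store) : Prop where
  range : ∀ c < l, σ.nat aOf c 0 = O c
  unit : ∀ c < l, σ.real rUn c 0 = U c
  weight : ∀ c ≤ l, σ.nat aW c 0 = digitWeight O c
  mul : ∀ c < l, ∀ d ≤ 2 * O c + 1, σ.nat aMul c d = d * digitWeight O c
  zero : σ.nat vZ0 0 0 = codeOf O l O

lemma RadixTable.congr {O : ℕ → ℕ} {U : ℕ → ℝ} {l : ℕ} {σ σ' : Store} (h : RadixTable O U l σ)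
    (h1 : σ'.nat aOf = σ.nat aOf) (h2 : σ'.real rUn = σ.real rUn) (h3 : σ'.nat aW = σ.nat aW)
    (h4 : σ'.nat aMul = σ.nat aMul) (h5 : σ'.nat vZ0 = σ.nat vZ0) : RadixTable O U l σ' := by
  refine ⟨?_, ?_, ?_, ?_, ?_⟩
  · rw [h1]; exact h.range
  · rw [h2]; exact h.unit
  · rw [h3]; exact h.weight
  · rw [h4]; exact h.mul
  · rw [h5]; exact h.zero

lemma runs_radix {σ : Store} {L₁ L₂ K κ R : ℕ} {ε : ℝ} (h1 : σ.nat vL1 0 0 = L₁)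
    (h2 : σ.nat vL2 0 0 = L₂) (hK : σ.nat vK 0 0 = K) (hκ : σ.nat vKap 0 0 = κ)
    (hε : σ.real rEps 0 0 = ε) (hmul : ∀ c, σ.nat aMul c 0 = 0) (hz : σ.nat vZ0 0 0 = 0)
    (hR : ∀ c, 2 * slotRange L₁ K κ c + 1 ≤ R) :
    Runs S progRadix σ ((L₁ + L₂) * (3 * R + 11) + 7) 0 fun σ' =>
      σ'.nat vL 0 0 = L₁ + L₂ ∧ RadixTable (slotRange L₁ K κ) (slotUnit L₁ ε) (L₁ + L₂) σ' ∧
      σ'.nat vS 0 0 = digitWeight (slotRange L₁ K κ) (L₁ + L₂) ∧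
      σ'.nat vS1 0 0 = digitWeight (slotRange L₁ K κ) L₁ := by
  set O := slotRange L₁ K κ with hO
  set L := L₁ + L₂ with hLdef
  unfold progRadix
  refine (Runs.cons_setNat_eq (i' := 0) (k' := 0) (x := L) rfl rfl (by simp [h1, h2, hLdef])
    (Runs.cons_setNat_eq (i' := 0) (k' := 0) (x := 1) rfl rfl rfl (Runs.cons' (t₂ := 3)
      (Runs.forLoop (t := 3 * R + 9) (q := 0) (fun k σ' => RadixTable O (slotUnit L₁ ε) k σ' ∧
        ∀ c, σ'.nat aMul c 0 = 0) L (by decide) ?_ ?_ ?_ ?_)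
      fun σ₁ F₁ I₁ => Runs.cons_setNat_eq (i' := 0) (k' := 0) (x := digitWeight O L) rfl rfl ?_
        (Runs.cons_setNat_eq (i' := 0) (k' := 0) (x := digitWeight O L₁) rfl rfl ?_
          (Runs.nil (t := 0) ?_))))).mono (q := 0) ?_ le_rfl fun _ _ h => h
  · intro σ' hF
    simp [hF.nat vL (by decide)]
  · intro k σ' x h
    refine ⟨h.1.congr ?_ rfl ?_ ?_ ?_, ?_⟩
    · exact Store.setNat_nat_of_ne _ (by decide) _ _ _
    · exact Store.setNat_nat_of_ne _ (by decide) _ _ _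
    · exact Store.setNat_nat_of_ne _ (by decide) _ _ _
    · exact Store.setNat_nat_of_ne _ (by decide) _ _ _
    · rw [Store.setNat_nat_of_ne _ (by decide)]
      exact h.2
  · refine ⟨⟨by simp, by simp, ?_, by simp, ?_⟩, by simpa using hmul⟩
    · intro c hc
      obtain rfl : c = 0 := by omega
      simp [digitWeight]
    · simp [hz, codeOf]
  · rintro k hk σ' hF hv ⟨I, hI⟩
    have g : ∀ a, a ∉ vC :: progRadix.natWrites → σ'.nat a = σ.nat a := by
      intro a ha
      rw [hF.nat a fun hcon => ha ?_, Store.setNat_nat_of_ne _ fun hcon => ha ?_,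
        Store.setNat_nat_of_ne _ fun hcon => ha ?_]
      · subst hcon; decide
      · subst hcon; decide
      · revert hcon
        simp [progRadix, Cmd.natWrites, Cmd.for, Cmd.block]
        tauto
    have g1 : σ'.nat vL1 0 0 = L₁ := by rw [g vL1 (by decide), h1]
    have gK : σ'.nat vK 0 0 = K := by rw [g vK (by decide), hK]
    have gκ : σ'.nat vKap 0 0 = κ := by rw [g vKap (by decide), hκ]
    have gε : σ'.real rEps 0 0 = ε := by rw [hF.real rEps (by decide)]; exact hε
    refine (Runs.cons' (t₁ := 4) (Ψ := fun σ₁ => (∀ a, a ≠ aOf → σ₁.nat a = σ'.nat a) ∧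
      (∀ c, σ₁.nat aOf c 0 = if c = k then O k else σ'.nat aOf c 0) ∧
      ∀ c, σ₁.real rUn c 0 = if c = k then slotUnit L₁ ε k else σ'.real rUn c 0)
      (Runs.ite (t := 3) (fun hc => ?_) fun hc => ?_) fun σ₁ F₁ I₁ => Runs.cons' (t₂ := 3)
      (Runs.forLoop (t := 1) (q := 0)
        (fun d σ₂ => (∀ d' ≤ d, σ₂.nat aMul k d' = d' * digitWeight O k) ∧
        ∀ c, c ≠ k → σ₂.nat aMul c = σ'.nat aMul c) (2 * O k + 1) (by decide) ?_ ?_ ?_ ?_)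
      fun σ₂ F₂ I₂ => Runs.cons_setNat_eq (i' := k + 1) (k' := 0) (x := digitWeight O (k + 1))
        ?_ rfl ?_ (Runs.cons_setNat_eq (i' := 0) (k' := 0) (x := codeOf O (k + 1) O) rfl rfl ?_
          (Runs.nil (t := 0) ?_))).mono (q := 0) ?_ le_rfl fun _ _ h => h
    · have hc' : k < L₁ := by simpa [hv, g1] using hc
      refine Runs.cons_setNat_eq (i' := k) (k' := 0) (x := O k) (by simp [hv]) rfl
        (by simp [gK, hO, slotRange, hc']) (Runs.cons_setReal_eq (i' := k) (k' := 0)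
          (x := slotUnit L₁ ε k) (by simp [hv]) rfl (by simp [gε, slotUnit, hc'])
            (Runs.nil (t := 0) ⟨?_, ?_, ?_⟩))
      · intro a ha
        exact Store.setNat_nat_of_ne _ ha _ _ _
      · intro c
        simp
      · intro c
        simp
    · have hc' : ¬ k < L₁ := by simpa [hv, g1] using hc
      refine Runs.cons_setNat_eq (i' := k) (k' := 0) (x := O k) (by simp [hv]) rfl
        (by simp [gκ, hO, slotRange, hc']) (Runs.cons_setReal_eq (i' := k) (k' := 0)
          (x := slotUnit L₁ ε k) (by simp [hv]) rfl (by simp [slotUnit, hc'])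
            (Runs.nil (t := 0) ⟨?_, ?_, ?_⟩))
      · intro a ha
        exact Store.setNat_nat_of_ne _ ha _ _ _
      · intro c
        simp
      · intro c
        simp
    · intro σ₂ hF₂
      simp only [radixExp, NExp.eval_add, NExp.eval_get, NExp.eval_lit, NExp.eval_one]
      rw [hF₂.nat aOf (by decide), hF₂.nat vC (by decide), I₁.1 vC (by decide), hv, I₁.2.1,
        if_pos rfl]
      omega
    · intro d σ₂ x h
      simpa only [Store.setNat_nat_of_ne _ (show aMul ≠ vD by decide)] using h
    · rw [I₁.1 aMul (by decide)]
      refine ⟨fun d' hd' => ?_, fun _ _ => rfl⟩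
      obtain rfl : d' = 0 := by omega
      simp [hI]
    · rintro d hd σ₂ hF₂ hvd ⟨i1, i2⟩
      have hvC : σ₂.nat vC 0 0 = k := by rw [hF₂.nat vC (by decide), I₁.1 vC (by decide), hv]
      have hW : σ₂.nat aW k 0 = digitWeight O k := by
        rw [hF₂.nat aW (by decide), I₁.1 aW (by decide), I.weight k le_rfl]
      refine Runs.setNat ⟨fun d' hd' => ?_, fun c hc => ?_⟩
      · rcases Nat.lt_succ_iff_lt_or_eq.1 (Nat.lt_succ_of_le hd') with h | rfl
        · simp [hvC, hvd, h.ne, i1 d' (by omega)]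
        · simp [hvC, hvd, hW, i1 d le_rfl, Nat.succ_mul]
      · rw [← i2 c hc]
        funext d'
        simp [hvC, hc]
    · simp only [NExp.eval_add, NExp.eval_get, NExp.eval_lit, NExp.eval_one]
      rw [F₂.nat vC (by decide), I₁.1 vC (by decide), hv]
    · simp only [radixExp, NExp.eval_add, NExp.eval_get, NExp.eval_lit, NExp.eval_one]
      rw [F₂.nat vC (by decide), F₂.nat aOf (by decide), I₁.1 vC (by decide), hv, I₁.2.1,
        if_pos rfl, I₂.1 _ (by omega), digitWeight_succ]
      ring
    · simp only [NExp.eval_add, NExp.eval_get, NExp.eval_lit]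
      rw [Store.setNat_nat_of_ne _ (by decide), Store.setNat_nat_of_ne _ (by decide),
        Store.setNat_nat_of_ne _ (by decide), Store.setNat_nat_of_ne _ (by decide),
        F₂.nat vC (by decide), F₂.nat aOf (by decide), F₂.nat vZ0 (by decide),
        I₁.1 vC (by decide), I₁.1 vZ0 (by decide), hv, I₁.2.1, if_pos rfl, I₂.1 _ (by omega),
        I.zero, codeOf_succ]
    · have hMul : ∀ c d, ((σ₂.setNat aW (k + 1) 0 (digitWeight O (k + 1))).setNat vZ0 0 0
          (codeOf O (k + 1) O)).nat aMul c d = σ₂.nat aMul c d := by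
        intro c d
        rw [Store.setNat_nat_of_ne _ (by decide), Store.setNat_nat_of_ne _ (by decide)]
      refine ⟨⟨fun c hc => ?_, fun c hc => ?_, fun c hc => ?_, fun c hc d hd => ?_, by simp⟩,
        fun c => ?_⟩
      · rw [Store.setNat_nat_of_ne _ (by decide), Store.setNat_nat_of_ne _ (by decide),
          F₂.nat aOf (by decide), I₁.2.1]
        split_ifs with h
        · rw [h]
        · exact I.range c (by omega)
      · rw [Store.setNat_real, Store.setNat_real, F₂.real rUn (by decide), I₁.2.2]
        split_ifs with h
        · rw [h]
        · exact I.unit c (by omega)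
      · rw [Store.setNat_nat_of_ne _ (by decide), Store.setNat_nat]
        split_ifs with h
        · rw [h.2.1]
        · rw [F₂.nat aW (by decide), I₁.1 aW (by decide)]
          exact I.weight c (by simp at h; omega)
      · rw [hMul]
        by_cases h : c = k
        · subst h
          exact I₂.1 d hd
        · rw [I₂.2 c h]
          exact I.mul c (by omega) d hd
      · rw [hMul]
        by_cases h : c = k
        · subst h
          rw [I₂.1 0 (by omega), zero_mul]
        · rw [I₂.2 c h]
          exact hI c
    · have := hR k
      omega
  · simp only [NExp.eval_get, NExp.eval_lit]
    rw [F₁.nat vL (by decide), Store.setNat_nat_of_ne _ (by decide)]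
    simpa using I₁.1.weight L le_rfl
  · simp only [NExp.eval_get, NExp.eval_lit]
    rw [Store.setNat_nat_of_ne _ (by decide), Store.setNat_nat_of_ne _ (by decide),
      F₁.nat vL1 (by decide), Store.setNat_nat_of_ne _ (by decide),
      Store.setNat_nat_of_ne _ (by decide), h1]
    exact I₁.1.weight L₁ (by omega)
  · refine ⟨?_, I₁.1.congr ?_ rfl ?_ ?_ ?_, by simp, by simp⟩
    · rw [Store.setNat_nat_of_ne _ (by decide), Store.setNat_nat_of_ne _ (by decide),
        F₁.nat vL (by decide), Store.setNat_nat_of_ne _ (by decide)]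
      simp
    all_goals rw [Store.setNat_nat_of_ne _ (by decide), Store.setNat_nat_of_ne _ (by decide)]
  · rw [show 3 * R + 9 + 2 = 3 * R + 11 from rfl]

lemma add_one_mod_eq {e w : ℕ} (hw : 0 < w) :
    (e + 1) % w = if w ≤ e % w + 1 then 0 else e % w + 1 := by
  have h := Nat.mod_lt e hw
  split_ifs with h'
  · have h2 : e + 1 = w * (e / w + 1) := by
      have := Nat.div_add_mod e w
      rw [mul_add]
      omega
    rw [h2, Nat.mul_mod_right]
  · rw [Nat.add_mod_of_add_mod_lt, Nat.mod_eq_of_lt (a := 1) (by omega)]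
    rw [Nat.mod_eq_of_lt (a := 1) (by omega)]
    omega

lemma add_one_div_eq {e w : ℕ} (hw : 0 < w) :
    (e + 1) / w = if w ≤ e % w + 1 then e / w + 1 else e / w := by
  have h := Nat.mod_lt e hw
  have h0 := Nat.div_add_mod e w
  split_ifs with h'
  · have h2 : e + 1 = w * (e / w + 1) := by
      rw [mul_add]
      omega
    rw [h2, Nat.mul_div_cancel_left _ hw]
  · rw [Nat.div_eq_iff hw]
    rw [mul_comm] at h0
    constructor
    · omega
    · omega

lemma runs_digits {σ : Store} {L s : ℕ} {O : ℕ → ℕ} {U : ℕ → ℝ} (hL : σ.nat vL 0 0 = L)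
    (hS : σ.nat vS 0 0 = s) (hT : RadixTable O U L σ) :
    Runs S progDigits σ (L * (11 * s + 7) + 2) 0 fun σ' =>
      ∀ c < L, ∀ e < s, σ'.nat aDig e c = digit O e c := by
  unfold progDigits
  refine Runs.forLoop (t := 11 * s + 5) (q := 0) (fun k σ' => ∀ c < k, ∀ e < s,
    σ'.nat aDig e c = digit O e c) L (by decide) ?_ ?_ (by simp) ?_
  · intro σ' hF
    simp [hF.nat vL (by decide), hL]
  · intro k σ' x h
    simpa only [Store.setNat_nat_of_ne _ (show aDig ≠ vC by decide)] using h
  · intro k hk σ' hF hv I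
    have hR : σ'.nat aOf k 0 = O k := by rw [hF.nat aOf (by decide), hT.range k hk]
    have hW : σ'.nat aW k 0 = digitWeight O k := by
      rw [hF.nat aW (by decide), hT.weight k hk.le]
    refine (Runs.cons_setNat_eq (i' := 0) (k' := 0) (x := 0) rfl rfl rfl (Runs.cons_setNat_eq
      (i' := 0) (k' := 0) (x := 0) rfl rfl rfl (Runs.cons' (t₂ := 1)
      (Runs.forLoop (t := 9) (q := 0) (fun e σ₁ => (σ₁.nat vLo 0 0 = e % digitWeight O k ∧
        σ₁.nat vDd 0 0 = digit O e k) ∧ (∀ c < k, ∀ e < s, σ₁.nat aDig e c = digit O e c) ∧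
          ∀ e' < e, σ₁.nat aDig e' k = digit O e' k) s (by decide) ?_ ?_ ?_ ?_)
      fun σ₁ F₁ I₁ => Runs.nil (t := 0) ?_))).mono (q := 0) (by omega) le_rfl fun _ _ h => h
    · intro σ₁ hF₁
      simp [hF₁.nat vS (by decide), hF.nat vS (by decide), hS]
    · intro e σ₁ x h
      simpa only [Store.setNat_nat_of_ne _ (show aDig ≠ vE by decide),
        Store.setNat_nat_of_ne _ (show vLo ≠ vE by decide),
        Store.setNat_nat_of_ne _ (show vDd ≠ vE by decide)] using h
    · exact ⟨⟨by simp, by simp [digit]⟩, by simpa using I, by simp⟩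
    · rintro e he σ₁ hF₁ hve ⟨⟨i1, i2⟩, i3, i4⟩
      have hvC : σ₁.nat vC 0 0 = k := by
        rw [hF₁.nat vC (by decide), Store.setNat_nat_of_ne _ (by decide),
          Store.setNat_nat_of_ne _ (by decide), hv]
      have gW : σ₁.nat aW k 0 = digitWeight O k := by
        rw [hF₁.nat aW (by decide), Store.setNat_nat_of_ne _ (by decide),
          Store.setNat_nat_of_ne _ (by decide), hW]
      have gR : σ₁.nat aOf k 0 = O k := by
        rw [hF₁.nat aOf (by decide), Store.setNat_nat_of_ne _ (by decide),
          Store.setNat_nat_of_ne _ (by decide), hR]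
      have hmod := add_one_mod_eq (e := e) (digitWeight_pos O k)
      have hdig : digit O (e + 1) k = if digitWeight O k ≤ e % digitWeight O k + 1 then
          (if 2 * O k + 1 ≤ digit O e k + 1 then 0 else digit O e k + 1) else digit O e k := by
        unfold digit
        rw [add_one_div_eq (digitWeight_pos O k)]
        split_ifs with h h' <;> first | rfl | skip
        · rw [add_one_mod_eq (by omega), if_pos h']
        · rw [add_one_mod_eq (by omega), if_neg h']
      refine Runs.cons_setNat_eq (t := 8) (i' := e) (k' := k) (x := digit O e k) (by simp [hve])
        (by simp [hvC]) (by simp [i2]) (Runs.cons_setNat_eq (t := 7) (i' := 0) (k' := 0)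
          (x := e % digitWeight O k + 1) rfl rfl (by simp [i1]) (Runs.cons' (t₁ := 6) (t₂ := 1)
          (Ψ := fun σ₂ => (σ₂.nat vLo 0 0 = (e + 1) % digitWeight O k ∧
            σ₂.nat vDd 0 0 = digit O (e + 1) k) ∧
            σ₂.nat aDig = (σ₁.setNat aDig e k (digit O e k)).nat aDig) ?_
          fun σ₂ F₂ I₂ => Runs.nil (t := 0) ?_))
      · rw [hdig, hmod]
        refine Runs.ite (fun hc => ?_) fun hc => ?_
        · have hc' : digitWeight O k ≤ e % digitWeight O k + 1 := by simpa [hvC, gW] using hc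
          rw [if_pos hc', if_pos hc']
          refine Runs.cons_setNat_eq (t := 4) (i' := 0) (k' := 0) (x := 0) rfl rfl rfl
            (Runs.cons_setNat_eq (t := 3) (i' := 0) (k' := 0) (x := digit O e k + 1) rfl rfl
              (by simp [i2]) (Runs.cons' (t₁ := 2) (t₂ := 1) (Ψ := fun σ₂ =>
              (σ₂.nat vLo 0 0 = 0 ∧ σ₂.nat vDd 0 0
                = (if 2 * O k + 1 ≤ digit O e k + 1 then 0 else digit O e k + 1)) ∧
              σ₂.nat aDig = (σ₁.setNat aDig e k (digit O e k)).nat aDig)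
              (Runs.ite (fun hd => Runs.setNat ?_) fun hd => Runs.skip ?_)
              fun σ₂ F₂ I₂ => Runs.nil (t := 0) I₂))
          · have hd' : 2 * O k + 1 ≤ digit O e k + 1 := by
              have : O k + O k + 1 ≤ digit O e k + 1 := by simpa [radixExp, hvC, gR] using hd
              omega
            rw [if_pos hd']
            refine ⟨by simp, ?_⟩
            simp only [Store.setNat_nat_of_ne _ (show aDig ≠ vDd by decide),
              Store.setNat_nat_of_ne _ (show aDig ≠ vLo by decide)]
          · have hd' : ¬ 2 * O k + 1 ≤ digit O e k + 1 := by
              have : ¬ O k + O k + 1 ≤ digit O e k + 1 := by simpa [radixExp, hvC, gR] using hd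
              omega
            rw [if_neg hd']
            refine ⟨by simp, ?_⟩
            simp only [Store.setNat_nat_of_ne _ (show aDig ≠ vDd by decide),
              Store.setNat_nat_of_ne _ (show aDig ≠ vLo by decide)]
        · have hc' : ¬ digitWeight O k ≤ e % digitWeight O k + 1 := by simpa [hvC, gW] using hc
          rw [if_neg hc', if_neg hc']
          refine Runs.skip (t := 4) ⟨by simp [i2], ?_⟩
          simp only [Store.setNat_nat_of_ne _ (show aDig ≠ vLo by decide)]
      · obtain ⟨k1, k2⟩ := I₂
        refine ⟨k1, fun c hc e' he' => ?_, fun e' he' => ?_⟩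
        · rw [k2]
          simp [hc.ne, i3 c hc e' he']
        · rw [k2]
          rcases Nat.lt_succ_iff_lt_or_eq.1 he' with h | rfl
          · simp [h.ne, i4 e' h]
          · simp
    · intro c hc e he
      rcases Nat.lt_succ_iff_lt_or_eq.1 hc with h | rfl
      · exact I₁.2.1 c h e he
      · exact I₁.2.2 e he

end Radix

/-! ### The tables of single blocks -/

section Init

variable {n b m : ℕ}

/-- Constraints have slots below `L₁` if they are mixed-integer and below `L₁ + L₂` otherwise;
constraints incident with the same block have different slots. -/
structure SlotMap (P : QIB n b m) (L₁ L₂ : ℕ) (slot : Fin m → ℕ) : Prop where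
  mixed : ∀ r, P.IsMixed r → slot r < L₁
  comb : ∀ r, ¬ P.IsMixed r → L₁ ≤ slot r ∧ slot r < L₁ + L₂
  inj : ∀ i, ∀ r ∈ P.consOf i, ∀ r' ∈ P.consOf i, slot r = slot r' → r = r'

/-- The arrays of natural numbers that do not change any more once the tables are initialized. -/
abbrev staticNat : List ℕ :=
  [0, vK, vL1, vL2, vKap, aKeep, aFin, aPar, vL, aOf, aW, aMul, vZ0, vS, vS1, aDig]

/-- The arrays of real numbers that do not change any more once the tables are initialized. -/
abbrev staticReal : List ℕ := [rEps, 1, 2, rUn]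

/-- The two stores agree on the arrays that do not change. -/
structure SameStatic (σ σ' : Store) : Prop where
  nat : ∀ a ∈ staticNat, σ'.nat a = σ.nat a
  real : ∀ a ∈ staticReal, σ'.real a = σ.real a

lemma Frame.same {p : Cmd} {σ σ' : Store} (h : Frame p σ σ')
    (hn : ∀ a ∈ staticNat, a ∉ p.natWrites) (hr : ∀ a ∈ staticReal, a ∉ p.realWrites) :
    SameStatic σ σ' :=
  ⟨fun a ha => h.nat a (hn a ha), fun a ha => h.real a (hr a ha)⟩

lemma SameStatic.trans {σ₁ σ₂ σ₃ : Store} (h : SameStatic σ₁ σ₂) (h' : SameStatic σ₂ σ₃) :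
    SameStatic σ₁ σ₃ :=
  ⟨fun a ha => (h'.nat a ha).trans (h.nat a ha), fun a ha => (h'.real a ha).trans (h.real a ha)⟩

lemma sameStatic_setNat (σ : Store) {a : ℕ} (ha : a ∉ staticNat) (i k x : ℕ) :
    SameStatic σ (σ.setNat a i k x) :=
  ⟨fun _ h => σ.setNat_nat_of_ne (by rintro rfl; exact ha h) _ _ _, fun _ _ => rfl⟩

/-- The memory holds the data of the problem, the digits and the slots. -/
structure Ready (P : QIB n b m) (N L₁ L₂ K κ : ℕ) (ε : ℝ) (slot : Fin m → ℕ) (σ : Store) :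
    Prop where
  nodes : σ.nat 0 3 0 = N
  blocks : σ.nat 0 2 0 = b
  eps : σ.real rEps 0 0 = ε
  rhs : ∀ r : Fin m, σ.real 1 r 0 = P.rhs r
  coeff : ∀ (r : Fin m) (i : Fin b), σ.real 2 r i = (P.con r).v i
  grid : σ.nat vK 0 0 = K
  support : σ.nat vKap 0 0 = κ
  slots₁ : σ.nat vL1 0 0 = L₁
  slots₂ : σ.nat vL2 0 0 = L₂
  slots : σ.nat vL 0 0 = L₁ + L₂
  size : σ.nat vS 0 0 = digitWeight (slotRange L₁ K κ) (L₁ + L₂)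
  size₁ : σ.nat vS1 0 0 = digitWeight (slotRange L₁ K κ) L₁
  radix : RadixTable (slotRange L₁ K κ) (slotUnit L₁ ε) (L₁ + L₂) σ
  digits : ∀ c < L₁ + L₂, ∀ e < digitWeight (slotRange L₁ K κ) (L₁ + L₂),
    σ.nat aDig e c = digit (slotRange L₁ K κ) e c
  leaf : ∀ i : Fin b, ∀ r ∈ P.consOf i, σ.nat aKeep (N + i) (slot r) = r + 1
  leaf_mem : ∀ (i : Fin b) (c : ℕ), σ.nat aKeep (N + i) c ≠ 0 → ∃ r ∈ P.consOf i, slot r = c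

variable {P : QIB n b m} {S : P.Solver} {N L₁ L₂ K κ : ℕ} {ε : ℝ} {slot : Fin m → ℕ} {σ σ' : Store}

lemma Ready.congr (h : Ready P N L₁ L₂ K κ ε slot σ) (h' : SameStatic σ σ') :
    Ready P N L₁ L₂ K κ ε slot σ' := by
  have hR := h.radix.congr (h'.nat aOf (by decide)) (h'.real rUn (by decide))
    (h'.nat aW (by decide)) (h'.nat aMul (by decide)) (h'.nat vZ0 (by decide))
  obtain ⟨h1, h2, h3, h4, h5, h6, h7, h8, h9, h10, h11, h12, -, h14, h15, h16⟩ := h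
  rw [← h'.nat _ (by decide)] at h1 h2 h6 h7 h8 h9 h10 h11 h12
  rw [← h'.real _ (by decide)] at h3 h4 h5
  rw [← h'.nat _ (by decide)] at h14 h15 h16
  exact ⟨h1, h2, h3, h4, h5, h6, h7, h8, h9, h10, h11, h12, hR, h14, h15, h16⟩

lemma digitWeight_mono (O : ℕ → ℕ) {c c' : ℕ} (h : c ≤ c') : digitWeight O c ≤ digitWeight O c' :=
  Nat.le_of_dvd (digitWeight_pos O _) (digitWeight_dvd O h)

variable (P) in
/-- The right-hand sides of the single-block problem for the entry with code `e`: they exceed the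
entry by one unit, so that every resource vector respects those of the entry below it. -/
noncomputable def entryRhs (L₁ K κ : ℕ) (ε : ℝ) (slot : Fin m → ℕ) (i : Fin b) (e : ℕ) :
    P.rows i → ℝ :=
  fun r => ε * (digit (slotRange L₁ K κ) e (slot r) - K + 1)

lemma runs_rhs (hS : SlotMap P L₁ L₂ slot) (hσ : Ready P N L₁ L₂ K κ ε slot σ) (i : Fin b)
    (hi : σ.nat vI 0 0 = i) {e : ℕ} (he : σ.nat vE 0 0 = e)
    (hes : e < digitWeight (slotRange L₁ K κ) (L₁ + L₂)) :
    Runs S progRhs σ (L₁ * 4 + 2) 0 fun σ' =>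
      (fun r : P.rows i => σ'.real rU (r : Fin m) 0) = entryRhs P L₁ K κ ε slot i e := by
  unfold progRhs
  refine (Runs.forLoop (t := 2) (q := 0) (fun k σ' => ∀ r ∈ P.consOf i, slot r < k →
    σ'.real rU r 0 = ε * (digit (slotRange L₁ K κ) e (slot r) - K + 1)) L₁ (by decide) ?_ ?_ ?_
      ?_).mono (q := 0) (by omega) (by omega) ?_
  · intro σ' hF
    simp [hF.nat vL1 (by decide), hσ.slots₁]
  · exact fun k σ' x h => h
  · intro r _ h
    omega
  · intro k hk σ' hF hv I
    have h' := hσ.congr (hF.same (by decide) (by decide))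
    have gi : σ'.nat vI 0 0 = i := by rw [hF.nat vI (by decide), hi]
    have ge : σ'.nat vE 0 0 = e := by rw [hF.nat vE (by decide), he]
    have hrow : (NExp.get aKeep (inN + .var vI) (.var vC)).eval σ' = σ'.nat aKeep (N + i) k := by
      simp [gi, hv, h'.nodes]
    refine Runs.ite (fun hc => Runs.setReal ?_) fun hc => Runs.skip ?_
    · have hne : σ'.nat aKeep (N + i) k ≠ 0 := by
        rw [Test.holds_natLE, hrow, NExp.eval_one] at hc
        omega
      obtain ⟨r₀, hr₀, hk₀⟩ := h'.leaf_mem i k hne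
      have hval := h'.leaf i r₀ hr₀
      rw [hk₀] at hval
      intro r hr hrk
      simp only [NExp.eval_sub, NExp.eval_one, hrow, hval, Nat.add_sub_cancel, Store.setReal_real,
        NExp.eval_zero, true_and, and_true, Fin.val_inj]
      by_cases hrr : r = r₀
      · subst hrr
        simp [ge, hv, h'.eps, h'.grid, h'.digits k (by omega) e hes, hk₀]
      · rw [if_neg hrr]
        refine I r hr (lt_of_le_of_ne (Nat.lt_succ_iff.1 hrk) fun h => hrr ?_)
        exact hS.inj i r hr r₀ hr₀ (h.trans hk₀.symm)
    · intro r hr hrk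
      refine I r hr (lt_of_le_of_ne (Nat.lt_succ_iff.1 hrk) fun h => hc ?_)
      rw [Test.holds_natLE, hrow, NExp.eval_one, ← h, h'.leaf i r hr]
      omega
  · intro σ' _ I
    funext r
    have hr := QIB.mem_rows.1 r.2
    exact I r (QIB.mem_consOf.2 hr.2) (hS.mixed r hr.1)

open Classical in
variable (P) in
/-- The digits of block `i`, if it is switched on, in the slots of combinatorial constraints. -/
noncomputable def offsetDigit (κ : ℕ) (slot : Fin m → ℕ) (i : Fin b) (c : ℕ) : ℕ :=
  if ∃ r ∈ P.consOf i, slot r = c ∧ (P.con r).v i = -1 then κ - 1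
  else if ∃ r ∈ P.consOf i, slot r = c ∧ (P.con r).v i = 1 then κ + 1 else κ

variable (P) in
/-- The part of the code that comes from the slots of combinatorial constraints. -/
noncomputable def offset (L₁ L₂ K κ : ℕ) (slot : Fin m → ℕ) (i : Fin b) : ℕ :=
  ∑ c ∈ Finset.range L₂, offsetDigit P κ slot i (L₁ + c) * digitWeight (slotRange L₁ K κ) (L₁ + c)

lemma offsetDigit_eq (hS : SlotMap P L₁ L₂ slot) {i : Fin b} {r : Fin m} (hr : r ∈ P.consOf i)
    {c : ℕ} (hc : slot r = c) :
    offsetDigit P κ slot i c = if (P.con r).v i = -1 then κ - 1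
      else if (P.con r).v i = 1 then κ + 1 else κ := by
  have h : ∀ x : ℝ, (∃ r' ∈ P.consOf i, slot r' = c ∧ (P.con r').v i = x) ↔ (P.con r).v i = x := by
    intro x
    constructor
    · rintro ⟨r', hr', h1, h2⟩
      rwa [hS.inj i r hr r' hr' (hc.trans h1.symm)]
    · exact fun h => ⟨r, hr, hc, h⟩
  unfold offsetDigit
  simp only [h]

lemma offsetDigit_of_empty {i : Fin b} {c : ℕ} (h : ∀ r ∈ P.consOf i, slot r ≠ c) :
    offsetDigit P κ slot i c = κ := by
  unfold offsetDigit
  rw [if_neg, if_neg]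
  · rintro ⟨r, hr, h1, -⟩
    exact h r hr h1
  · rintro ⟨r, hr, h1, -⟩
    exact h r hr h1

lemma offsetDigit_le (hκ : ∀ r, ¬ P.IsMixed r → (P.blocksOf r).card ≤ κ) (hS : SlotMap P L₁ L₂ slot)
    {i : Fin b} {c : ℕ} (hc : L₁ ≤ c) : offsetDigit P κ slot i c ≤ 2 * κ := by
  by_cases h : ∃ r ∈ P.consOf i, slot r = c
  · obtain ⟨r, hr, rfl⟩ := h
    have hm : ¬ P.IsMixed r := fun hm => absurd (hS.mixed r hm) (not_lt.2 hc)
    have h1 := hκ r hm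
    have h2 : 0 < (P.blocksOf r).card :=
      Finset.card_pos.2 ⟨i, QIB.mem_blocksOf.2 (QIB.mem_consOf.1 hr)⟩
    rw [offsetDigit_eq hS hr rfl]
    split_ifs <;> omega
  · push Not at h
    rw [offsetDigit_of_empty h]
    omega

lemma runs_offset (hS : SlotMap P L₁ L₂ slot) (hκ : ∀ r, ¬ P.IsMixed r → (P.blocksOf r).card ≤ κ)
    (hσ : Ready P N L₁ L₂ K κ ε slot σ) (i : Fin b) (hi : σ.nat vI 0 0 = i) :
    Runs S progOffset σ (L₂ * 8 + 4) 0 fun σ' => σ'.nat vVC 0 0 = offset P L₁ L₂ K κ slot i := by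
  unfold progOffset
  refine (Runs.cons_setNat_eq (i' := 0) (k' := 0) (x := 0) rfl rfl rfl (Runs.cons' (t₂ := 1)
    (Runs.forLoop (t := 6) (q := 0) (fun k σ' => σ'.nat vVC 0 0 = ∑ c ∈ Finset.range k,
      offsetDigit P κ slot i (L₁ + c) * digitWeight (slotRange L₁ K κ) (L₁ + c)) L₂ (by decide)
        ?_ ?_ (by simp) ?_) fun σ₁ F₁ I₁ => Runs.nil (t := 0) I₁)).mono (q := 0) (by omega) le_rfl
          fun _ _ h => h
  · intro σ' hF
    simp [hF.nat vL2 (by decide), hσ.slots₂]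
  · intro k σ' x h
    simpa only [Store.setNat_nat_of_ne _ (show vVC ≠ vC by decide)] using h
  · intro k hk σ' hF hv I
    have h' := hσ.congr ((sameStatic_setNat σ (by decide) _ _ _).trans
      (hF.same (by decide) (by decide)))
    have gi : σ'.nat vI 0 0 = i := by
      rw [hF.nat vI (by decide), Store.setNat_nat_of_ne _ (by decide), hi]
    have hrow : (NExp.get aKeep (inN + .var vI) (.var vL1 + .var vC)).eval σ'
        = σ'.nat aKeep (N + i) (L₁ + k) := by
      simp [gi, hv, h'.nodes, h'.slots₁]
    have hO : slotRange L₁ K κ (L₁ + k) = κ := by simp [slotRange]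
    refine Runs.cons' (t₁ := 4) (t₂ := 2) (Ψ := fun σ₁ =>
      σ₁.nat vDd 0 0 = offsetDigit P κ slot i (L₁ + k) ∧ ∀ a, a ≠ vDd → σ₁.nat a = σ'.nat a) ?_
      fun σ₁ F₁ I₁ => Runs.cons_setNat_eq (t := 1) (i' := 0) (k' := 0) rfl rfl ?_
        (Runs.nil (t := 0) ?_) (x := ∑ c ∈ Finset.range (k + 1),
          offsetDigit P κ slot i (L₁ + c) * digitWeight (slotRange L₁ K κ) (L₁ + c))
    · have hset : ∀ (e : NExp) (x : ℕ), e.eval σ' = x → x = offsetDigit P κ slot i (L₁ + k) →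
          (σ'.setNat vDd 0 0 (e.eval σ')).nat vDd 0 0 = offsetDigit P κ slot i (L₁ + k) ∧
            ∀ a, a ≠ vDd → (σ'.setNat vDd 0 0 (e.eval σ')).nat a = σ'.nat a := by
        intro e x h1 h2
        refine ⟨by simp [h1, h2], fun a ha => Store.setNat_nat_of_ne _ ha _ _ _⟩
      refine Runs.ite (fun hc => Runs.setNat (t := 2) (hset _ κ (by simp [h'.support]) ?_))
        fun hc => ?_
      · rw [Test.holds_natLE, hrow, NExp.eval_zero] at hc
        refine (offsetDigit_of_empty fun r hr h => ?_).symm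
        have := h'.leaf i r hr
        rw [h] at this
        omega
      · have hne : σ'.nat aKeep (N + i) (L₁ + k) ≠ 0 := by
          rw [Test.holds_natLE, hrow, NExp.eval_zero] at hc
          omega
        obtain ⟨r, hr, hrk⟩ := h'.leaf_mem i _ hne
        have hval := h'.leaf i r hr
        rw [hrk] at hval
        have hm : ¬ P.IsMixed r := fun hm => by
          have := hS.mixed r hm
          omega
        have hcoef : (RExp.get 2 (.get aKeep (inN + .var vI) (.var vL1 + .var vC) - 1)
            (.var vI)).eval σ' = (P.con r).v i := by
          rw [RExp.eval_get, NExp.eval_sub, hrow, hval, NExp.eval_one, Nat.add_sub_cancel,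
            NExp.eval_get, NExp.eval_lit, gi, h'.coeff]
        have hz : (RExp.ofNat 0).eval σ' = 0 := by simp
        have ho : (RExp.ofNat 0 - .ofNat 1).eval σ' = -1 := by simp
        have hd := offsetDigit_eq (κ := κ) hS hr hrk
        have hv3 := P.con_comb r hm i
        refine Runs.ite (fun h1 => Runs.setNat (t := 1) (hset _ (κ - 1) (by simp [h'.support]) ?_))
          fun h1 => Runs.ite (fun h2 => Runs.setNat (hset _ κ (by simp [h'.support]) ?_))
            fun h2 => Runs.setNat (hset _ (κ + 1) (by simp [h'.support]) ?_)
        all_goals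
          rw [Test.holds_realLE, hcoef, ho] at h1
          try rw [Test.holds_realLE, hcoef, hz] at h2
          rw [hd]
          rcases hv3 with h | h | h <;> rw [h] at h1 ⊢ <;> try rw [h] at h2
          all_goals norm_num at h1
          all_goals try norm_num at h2
          all_goals norm_num
    · rw [Finset.sum_range_succ, ← I]
      simp only [NExp.eval_add, NExp.eval_get, NExp.eval_lit]
      rw [I₁.1, I₁.2 vC (by decide), I₁.2 vVC (by decide), I₁.2 vL1 (by decide),
        I₁.2 aMul (by decide), hv, h'.slots₁, h'.radix.mul _ (by omega) _ ?_]
      rw [hO]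
      have := offsetDigit_le hκ hS (i := i) (show L₁ ≤ L₁ + k by omega)
      omega
    · simp

/-- The initial table of block `i`: entry `Z₀` for switching the block off, and entries for
switching it on, with the solutions of single-block problems. The flags `ZF` tell which is which.
-/
structure BlockTable (S : P.Solver) (L₁ L₂ K κ : ℕ) (ε : ℝ) (slot : Fin m → ℕ) (i : Fin b)
    (FL ZF : ℕ → ℕ) (WT : ℕ → ℝ) : Prop where
  sound : ∀ x, FL x ≠ 0 →
    (ZF x = 0 ∧ WT x = 0 ∧ x = codeOf (slotRange L₁ K κ) (L₁ + L₂) (slotRange L₁ K κ)) ∨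
    (ZF x ≠ 0 ∧ ∃ e < digitWeight (slotRange L₁ K κ) L₁, x = e + offset P L₁ L₂ K κ slot i ∧
      ∃ y, S i (entryRhs P L₁ K κ ε slot i e) = some y ∧ WT x = P.obj.blockEval i y)
  off : FL (codeOf (slotRange L₁ K κ) (L₁ + L₂) (slotRange L₁ K κ)) ≠ 0 ∧
    WT (codeOf (slotRange L₁ K κ) (L₁ + L₂) (slotRange L₁ K κ)) ≤ 0
  on : ∀ e < digitWeight (slotRange L₁ K κ) L₁, ∀ y,
    S i (entryRhs P L₁ K κ ε slot i e) = some y →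
      FL (e + offset P L₁ L₂ K κ slot i) ≠ 0 ∧
        WT (e + offset P L₁ L₂ K κ slot i) ≤ P.obj.blockEval i y

lemma runs_on (hS : SlotMap P L₁ L₂ slot) (hσ : Ready P N L₁ L₂ K κ ε slot σ) (i : Fin b)
    (hi : σ.nat vI 0 0 = i) {v : ℕ} (hv : σ.nat vVC 0 0 = v)
    (hfl : ∀ x, σ.nat aFl (N + i) x = 0) :
    Runs S progOn σ (digitWeight (slotRange L₁ K κ) L₁ * (L₁ * 4 + 11) + 2)
      (digitWeight (slotRange L₁ K κ) L₁) fun σ' =>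
      (∀ x, σ'.nat aFl (N + i) x ≠ 0 → σ'.nat aZf i x ≠ 0 ∧
        ∃ e < digitWeight (slotRange L₁ K κ) L₁, x = e + v ∧
          ∃ y, S i (entryRhs P L₁ K κ ε slot i e) = some y ∧
            σ'.real rWT (N + i) x = P.obj.blockEval i y) ∧
      (∀ e < digitWeight (slotRange L₁ K κ) L₁, ∀ y,
        S i (entryRhs P L₁ K κ ε slot i e) = some y → σ'.nat aFl (N + i) (e + v) ≠ 0) ∧
      (∀ j, j ≠ N + i → σ'.nat aFl j = σ.nat aFl j ∧ σ'.real rWT j = σ.real rWT j) ∧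
      ∀ i', i' ≠ (i : ℕ) → σ'.nat aZf i' = σ.nat aZf i' := by
  unfold progOn
  refine (Runs.forLoop (t := L₁ * 4 + 9) (q := 1) (fun k σ' =>
      (∀ x, σ'.nat aFl (N + i) x ≠ 0 → σ'.nat aZf i x ≠ 0 ∧
        ∃ e < k, x = e + v ∧
          ∃ y, S i (entryRhs P L₁ K κ ε slot i e) = some y ∧
            σ'.real rWT (N + i) x = P.obj.blockEval i y) ∧
      (∀ e < k, ∀ y,
        S i (entryRhs P L₁ K κ ε slot i e) = some y → σ'.nat aFl (N + i) (e + v) ≠ 0) ∧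
      (∀ j, j ≠ N + i → σ'.nat aFl j = σ.nat aFl j ∧ σ'.real rWT j = σ.real rWT j) ∧
      ∀ i', i' ≠ (i : ℕ) → σ'.nat aZf i' = σ.nat aZf i') _ (by decide) ?_ ?_ ?_ ?_).mono
        (by simp [Nat.add_assoc]) (by omega) fun _ _ h => h
  · intro σ' hF
    simp [hF.nat vS1 (by decide), hσ.size₁]
  · intro k σ' x h
    simpa only [Store.setNat_nat_of_ne _ (show aFl ≠ vE by decide),
      Store.setNat_nat_of_ne _ (show aZf ≠ vE by decide), Store.setNat_real] using h
  · exact ⟨fun x hx => absurd (hfl x) hx, by simp, fun _ _ => ⟨rfl, rfl⟩, fun _ _ => rfl⟩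
  · rintro k hk σ₀ hF hve ⟨i1, i2, i3, i4⟩
    have h0 := hσ.congr (hF.same (by decide) (by decide))
    have gi : σ₀.nat vI 0 0 = i := by rw [hF.nat vI (by decide), hi]
    have gv : σ₀.nat vVC 0 0 = v := by rw [hF.nat vVC (by decide), hv]
    have hks : k < digitWeight (slotRange L₁ K κ) (L₁ + L₂) :=
      hk.trans_le (digitWeight_mono _ (by omega))
    refine (Runs.cons (t₂ := 7) (q₂ := 1) (runs_rhs hS h0 i gi hve hks) fun σ₁ F₁ I₁ => Runs.cons
      (t₁ := 1) (t₂ := 6) (q₁ := 1) (q₂ := 0) (Ψ := fun σ₂ =>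
        (S i (entryRhs P L₁ K κ ε slot i k) = none ∧ σ₂.nat vF 0 0 = 0) ∨
        ∃ y, S i (entryRhs P L₁ K κ ε slot i k) = some y ∧ σ₂.nat vF 0 0 = 1 ∧
          σ₂.real rW 0 0 = P.obj.blockEval i y) ?_ fun σ₂ F₂ I₂ => ?_).mono (by omega) (by omega)
      fun _ _ h => h
    · have hev : (NExp.var vI).eval σ₁ = i := by
        simp [F₁.nat vI (by decide), gi]
      have hlt : (NExp.var vI).eval σ₁ < b := by
        rw [hev]
        exact i.2
      have hfin : (⟨(NExp.var vI).eval σ₁, hlt⟩ : Fin b) = i := Fin.ext hev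
      refine Runs.solve (t := 0) (q := 0) hlt ?_
      rw [hfin]
      cases hsol : S i (entryRhs P L₁ K κ ε slot i k) with
      | none => exact Or.inl ⟨rfl, σ₁.afterSolve_none S (by rw [I₁, hsol])⟩
      | some y =>
        refine Or.inr ⟨y, rfl, ?_⟩
        rw [σ₁.afterSolve_some S (by rw [I₁, hsol])]
        constructor
        · simp [Store.writeBlock]
        · rw [Store.writeBlock_real_of_ne _ _ _ (by decide)]
          simp
    · have h1 := h0.congr (F₁.same (by decide) (by decide))
      have h2 := h1.congr (F₂.same (by decide) (by decide))
      have ji : σ₂.nat vI 0 0 = i := by rw [F₂.nat vI (by decide), F₁.nat vI (by decide), gi]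
      have jv : σ₂.nat vVC 0 0 = v := by rw [F₂.nat vVC (by decide), F₁.nat vVC (by decide), gv]
      have je : σ₂.nat vE 0 0 = k := by rw [F₂.nat vE (by decide), F₁.nat vE (by decide), hve]
      have jf : σ₂.nat aFl = σ₀.nat aFl := by rw [F₂.nat aFl (by decide), F₁.nat aFl (by decide)]
      have jz : σ₂.nat aZf = σ₀.nat aZf := by rw [F₂.nat aZf (by decide), F₁.nat aZf (by decide)]
      have jw : σ₂.real rWT = σ₀.real rWT := by
        rw [F₂.real rWT (by decide), F₁.real rWT (by decide)]
      refine Runs.cons' (t₁ := 5) (t₂ := 1) (Ψ := fun σ' =>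
        (∀ x, σ'.nat aFl (N + i) x ≠ 0 → σ'.nat aZf i x ≠ 0 ∧
          ∃ e < k + 1, x = e + v ∧ ∃ y, S i (entryRhs P L₁ K κ ε slot i e) = some y ∧
            σ'.real rWT (N + i) x = P.obj.blockEval i y) ∧
        (∀ e < k + 1, ∀ y,
          S i (entryRhs P L₁ K κ ε slot i e) = some y → σ'.nat aFl (N + i) (e + v) ≠ 0) ∧
        (∀ j, j ≠ N + i → σ'.nat aFl j = σ.nat aFl j ∧ σ'.real rWT j = σ.real rWT j) ∧
        ∀ i', i' ≠ (i : ℕ) → σ'.nat aZf i' = σ.nat aZf i') ?_ fun σ₃ F₃ I₃ => Runs.nil (t := 0) I₃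
      refine Runs.ite (fun hc => ?_) fun hc => Runs.skip (t := 3) ?_
      · rcases I₂ with ⟨-, hno⟩ | ⟨y, hy, -, hwt⟩
        · simp [hno] at hc
        refine Runs.cons_setNat_eq (t := 3) (i' := N + i) (k' := k + v) (x := 1)
          (by simp [h2.nodes, ji]) (by simp [je, jv]) rfl
          (Runs.cons_setReal_eq (t := 2) (i' := N + i) (k' := k + v) (x := P.obj.blockEval i y)
            (by simp [h2.nodes, ji]) (by simp [je, jv]) (by simpa using hwt)
            (Runs.cons_setNat_eq (t := 1) (i' := i) (k' := k + v) (x := 1)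
              (by simp [ji]) (by simp [je, jv]) rfl (Runs.nil (t := 0) ?_)))
        refine ⟨fun x hx => ?_, fun e he y' hy' => ?_, fun j hj => ⟨?_, ?_⟩, fun i' hi' => ?_⟩
        · by_cases hxk : x = k + v
          · subst hxk
            exact ⟨by simp, k, by omega, rfl, y, hy, by simp⟩
          · have hx' : σ₀.nat aFl (N + i) x ≠ 0 := by simpa [hxk, jf] using hx
            obtain ⟨hz, e, he, hxe, y', hy', hwt'⟩ := i1 x hx'
            exact ⟨by simpa [hxk, jz] using hz, e, by omega, hxe, y', hy', by
              simpa [hxk, jw] using hwt'⟩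
        · by_cases hek : e = k
          · simp [hek]
          · have := i2 e (by omega) y' hy'
            simpa [hek, jf] using this
        · rw [← (i3 j hj).1]
          funext x
          simp [hj, jf]
        · rw [← (i3 j hj).2]
          funext x
          simp [hj, jw]
        · rw [← i4 i' hi']
          funext x
          simp [hi', jz]
      · rw [jf, jz, jw]
        refine ⟨fun x hx => ?_, fun e he y hy => ?_, i3, i4⟩
        · obtain ⟨hz, e, he, h⟩ := i1 x hx
          exact ⟨hz, e, by omega, h⟩
        · rcases Nat.lt_succ_iff_lt_or_eq.1 he with h | rfl
          · exact i2 e h y hy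
          · rcases I₂ with ⟨hno, -⟩ | ⟨y', -, hf, -⟩
            · rw [hy] at hno
              simp at hno
            · exact absurd (by simp [hf]) hc

/-- The initial table of one block. -/
lemma runs_blockInit (hS : SlotMap P L₁ L₂ slot)
    (hκ : ∀ r, ¬ P.IsMixed r → (P.blocksOf r).card ≤ κ)
    (hσ : Ready P N L₁ L₂ K κ ε slot σ) (i : Fin b) (hi : σ.nat vI 0 0 = i)
    (hfl : ∀ x, σ.nat aFl (N + i) x = 0) :
    Runs S (.block [progOffset, progOn,
      .ite (.natLE 1 (.get aFl (inN + .var vI) (.var vZ0)))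
        (.ite (.realLE (.get rWT (inN + .var vI) (.var vZ0)) (.ofNat 0)) .skip progOff) progOff]) σ
      (digitWeight (slotRange L₁ K κ) L₁ * (L₁ * 4 + 11) + L₂ * 8 + 13)
      (digitWeight (slotRange L₁ K κ) L₁) fun σ' =>
      BlockTable S L₁ L₂ K κ ε slot i (σ'.nat aFl (N + i)) (σ'.nat aZf i) (σ'.real rWT (N + i)) ∧
      (∀ j, j ≠ N + i → σ'.nat aFl j = σ.nat aFl j ∧ σ'.real rWT j = σ.real rWT j) ∧
      ∀ i', i' ≠ (i : ℕ) → σ'.nat aZf i' = σ.nat aZf i' := by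
  set O := slotRange L₁ K κ with hO
  set Z₀ := codeOf O (L₁ + L₂) O with hZ
  refine (Runs.cons (q₂ := digitWeight O L₁) (runs_offset hS hκ hσ i hi) fun σ₁ F₁ I₁ => Runs.cons
    (q₂ := 0) (runs_on hS (hσ.congr (F₁.same (by decide) (by decide))) i ?_ I₁ ?_) fun σ₂ F₂ I₂ =>
      Runs.cons' (t₁ := 6) (t₂ := 1) (Ψ := fun σ' =>
        BlockTable S L₁ L₂ K κ ε slot i (σ'.nat aFl (N + i)) (σ'.nat aZf i)
          (σ'.real rWT (N + i)) ∧
        (∀ j, j ≠ N + i → σ'.nat aFl j = σ.nat aFl j ∧ σ'.real rWT j = σ.real rWT j) ∧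
        ∀ i', i' ≠ (i : ℕ) → σ'.nat aZf i' = σ.nat aZf i') ?_ fun σ₃ F₃ I₃ =>
          Runs.nil (t := 0) I₃).mono (by rw [← hO]; omega) (by omega) fun _ _ h => h
  · rw [F₁.nat vI (by decide), hi]
  · rw [F₁.nat aFl (by decide)]
    exact hfl
  · obtain ⟨i1, i2, i3, i4⟩ := I₂
    rw [F₁.nat aFl (by decide), F₁.real rWT (by decide)] at i3
    rw [F₁.nat aZf (by decide)] at i4
    have h2 := (hσ.congr (F₁.same (by decide) (by decide))).congr (F₂.same (by decide) (by decide))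
    have ji : σ₂.nat vI 0 0 = i := by rw [F₂.nat vI (by decide), F₁.nat vI (by decide), hi]
    have jz : σ₂.nat vZ0 0 0 = Z₀ := h2.radix.zero
    have hon : ∀ e < digitWeight O L₁, ∀ y, S i (entryRhs P L₁ K κ ε slot i e) = some y →
        σ₂.nat aFl (N + i) (e + offset P L₁ L₂ K κ slot i) ≠ 0 ∧
        σ₂.real rWT (N + i) (e + offset P L₁ L₂ K κ slot i) ≤ P.obj.blockEval i y := by
      intro e he y hy
      have hf := i2 e he y hy
      obtain ⟨-, e', -, hee, y', hy', hw⟩ := i1 _ hf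
      obtain rfl : e = e' := Nat.add_right_cancel hee
      rw [hy] at hy'
      obtain rfl : y = y' := Option.some.inj hy'
      exact ⟨hf, hw.le⟩
    -- the entry for switching the block off replaces a worse one
    have hoff : ¬ (σ₂.nat aFl (N + i) Z₀ ≠ 0 ∧ σ₂.real rWT (N + i) Z₀ ≤ 0) →
        Runs S progOff σ₂ 4 0 fun σ' =>
          BlockTable S L₁ L₂ K κ ε slot i (σ'.nat aFl (N + i)) (σ'.nat aZf i)
            (σ'.real rWT (N + i)) ∧
          (∀ j, j ≠ N + i → σ'.nat aFl j = σ.nat aFl j ∧ σ'.real rWT j = σ.real rWT j) ∧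
          ∀ i', i' ≠ (i : ℕ) → σ'.nat aZf i' = σ.nat aZf i' := by
      intro hbad
      refine Runs.cons_setNat_eq (t := 3) (i' := N + i) (k' := Z₀) (x := 1)
          (by simp [h2.nodes, ji]) (by simp [jz]) rfl
          (Runs.cons_setReal_eq (t := 2) (i' := N + i) (k' := Z₀) (x := 0)
            (by simp [h2.nodes, ji]) (by simp [jz]) (by simp)
            (Runs.cons_setNat_eq (t := 1) (i' := i) (k' := Z₀) (x := 0)
              (by simp [ji]) (by simp [jz]) rfl (Runs.nil (t := 0) ?_)))
      refine ⟨⟨fun x hx => ?_, ⟨by simp [← hO, ← hZ], by simp [← hO, ← hZ]⟩, fun e he y hy => ?_⟩,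
        fun j hj => ⟨?_, ?_⟩, fun i' hi' => ?_⟩
      · by_cases hxz : x = Z₀
        · subst hxz
          exact Or.inl ⟨by simp, by simp, rfl⟩
        · have hx' : σ₂.nat aFl (N + i) x ≠ 0 := by simpa [hxz] using hx
          obtain ⟨hz, e, he, hxe, y', hy', hwt'⟩ := i1 x hx'
          exact Or.inr ⟨by simpa [hxz] using hz, e, he, hxe, y', hy', by simpa [hxz] using hwt'⟩
      · obtain ⟨k1, k2⟩ := hon e he y hy
        by_cases hez : e + offset P L₁ L₂ K κ slot i = Z₀
        · rw [hez] at k1 k2 ⊢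
          refine ⟨by simp, ?_⟩
          have : ¬ σ₂.real rWT (N + i) Z₀ ≤ 0 := fun h => hbad ⟨k1, h⟩
          simp only [Store.setNat_real, Store.setReal_real, and_self, if_true]
          linarith
        · exact ⟨by simpa [hez] using k1, by simpa [hez] using k2⟩
      · rw [← (i3 j hj).1]
        funext x
        simp [hj]
      · rw [← (i3 j hj).2]
        funext x
        simp [hj]
      · rw [← i4 i' hi']
        funext x
        simp [hi']
    refine Runs.ite (t := 5) (fun hc => Runs.ite (t := 4) (fun hd => Runs.skip (t := 3) ?_)
      fun hd => hoff ?_) fun hc => (hoff ?_).mono (by omega) le_rfl fun _ _ h => h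
    · have hc' : σ₂.nat aFl (N + i) Z₀ ≠ 0 := by
        have : 1 ≤ σ₂.nat aFl (N + i) Z₀ := by simpa [h2.nodes, ji, jz] using hc
        omega
      have hd' : σ₂.real rWT (N + i) Z₀ ≤ 0 := by simpa [h2.nodes, ji, jz] using hd
      refine ⟨⟨fun x hx => ?_, ⟨hc', hd'⟩, hon⟩, i3, i4⟩
      obtain ⟨hz, h⟩ := i1 x hx
      exact Or.inr ⟨hz, h⟩
    · rintro ⟨-, h⟩
      exact hd (by simpa [h2.nodes, ji, jz] using h)
    · rintro ⟨h, -⟩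
      refine hc ?_
      have : 1 ≤ σ₂.nat aFl (N + i) Z₀ := by omega
      simpa [h2.nodes, ji, jz] using this

end Init

section InitAll

variable {n b m : ℕ} {P : QIB n b m} {S : P.Solver} {N L₁ L₂ K κ : ℕ} {ε : ℝ} {slot : Fin m → ℕ}
  {σ : Store}

lemma runs_init (hS : SlotMap P L₁ L₂ slot) (hκ : ∀ r, ¬ P.IsMixed r → (P.blocksOf r).card ≤ κ)
    (hσ : Ready P N L₁ L₂ K κ ε slot σ) (hfl : ∀ j x, σ.nat aFl j x = 0)
    (hwt : ∀ j x, σ.real rWT j x = 0) :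
    Runs S progInit σ
      (b * (digitWeight (slotRange L₁ K κ) L₁ * (L₁ * 4 + 11) + L₂ * 8 + 15) + (N + b) * 6 + 11)
      (b * digitWeight (slotRange L₁ K κ) L₁) fun σ' =>
      (∀ j ≤ N + b, σ'.nat aVer j 0 = j) ∧
      (∀ j, j < N ∨ j = N + b →
        (∀ e, σ'.nat aFl j e ≠ 0 ↔
          e = codeOf (slotRange L₁ K κ) (L₁ + L₂) (slotRange L₁ K κ)) ∧
        ∀ e, σ'.real rWT j e = 0) ∧
      (∀ i : Fin b, BlockTable S L₁ L₂ K κ ε slot i (σ'.nat aFl (N + i)) (σ'.nat aZf i)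
        (σ'.real rWT (N + i))) ∧
      ∀ j, N + b < j → ∀ e, σ'.nat aFl j e = 0 := by
  set O := slotRange L₁ K κ with hO
  set Z₀ := codeOf O (L₁ + L₂) O with hZ
  unfold progInit
  refine (Runs.cons' (q := b * digitWeight O L₁) (Runs.forLoop (t := 1) (q := 0)
    (fun k σ' => ∀ j < k, σ'.nat aVer j 0 = j) (N + b + 1) ?_ ?_ ?_ (by simp) ?_)
    fun σ₁ F₁ I₁ => Runs.cons' (q := b * digitWeight O L₁) (Runs.forLoop (t := 1) (q := 0)
    (fun k σ' => ∀ j e, σ'.nat aFl j e = if j < k ∧ e = Z₀ then 1 else 0) N ?_ ?_ ?_ ?_ ?_)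
    fun σ₂ F₂ I₂ => Runs.cons_setNat_eq (i' := N + b) (k' := Z₀) (x := 1) ?_ ?_ rfl
    (Runs.cons (q₁ := b * digitWeight O L₁) (q₂ := 0) (Runs.forLoop
      (t := digitWeight O L₁ * (L₁ * 4 + 11) + L₂ * 8 + 13) (q := digitWeight O L₁)
      (fun k σ' => (∀ i : Fin b, (i : ℕ) < k →
          BlockTable S L₁ L₂ K κ ε slot i (σ'.nat aFl (N + i)) (σ'.nat aZf i)
            (σ'.real rWT (N + i))) ∧
        ∀ j, j < N ∨ N + k ≤ j → σ'.nat aFl j = (σ₂.setNat aFl (N + b) Z₀ 1).nat aFl j ∧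
          σ'.real rWT j = σ₂.real rWT j) b ?_ ?_ ?_ ?_ ?_)
      fun σ₃ F₃ I₃ => Runs.nil (t := 0) ?_)).mono ?_ ?_ fun _ _ h => h
  · decide
  · intro σ' hF
    simp [hF.nat 0 (by decide), hσ.nodes, hσ.blocks]
  · intro k σ' x h
    simpa only [Store.setNat_nat_of_ne _ (show aVer ≠ vT by decide)] using h
  · intro k hk σ' hF hv I
    refine Runs.setNat fun j hj => ?_
    rcases Nat.lt_succ_iff_lt_or_eq.1 hj with h | rfl
    · simp [hv, h.ne, I j h]
    · simp [hv]
  · decide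
  · intro σ' hF
    simp [hF.nat 0 (by decide), F₁.nat 0 (by decide), hσ.nodes]
  · intro k σ' x h
    simpa only [Store.setNat_nat_of_ne _ (show aFl ≠ vT by decide)] using h
  · intro j e
    simp [F₁.nat aFl (by decide), hfl]
  · intro k hk σ' hF hv I
    have hz : σ'.nat vZ0 0 0 = Z₀ := by
      rw [hF.nat vZ0 (by decide), F₁.nat vZ0 (by decide), hσ.radix.zero]
    refine Runs.setNat fun j e => ?_
    simp only [Store.setNat_nat, NExp.eval_get, NExp.eval_lit, hv, hz, true_and, I j e,
      NExp.eval_one]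
    have h3 : j < k + 1 ↔ j < k ∨ j = k := by omega
    by_cases h1 : j = k <;> by_cases h2 : e = Z₀ <;> simp [h1, h2, h3]
  · simp [F₂.nat 0 (by decide), F₁.nat 0 (by decide), hσ.nodes, hσ.blocks]
  · simp [F₂.nat vZ0 (by decide), F₁.nat vZ0 (by decide), hσ.radix.zero, ← hO, ← hZ]
  · decide
  · intro σ' hF
    simp [hF.nat 0 (by decide), F₂.nat 0 (by decide), F₁.nat 0 (by decide), hσ.blocks]
  · intro k σ' x h
    simpa only [Store.setNat_nat_of_ne _ (show aFl ≠ vI by decide),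
      Store.setNat_nat_of_ne _ (show aZf ≠ vI by decide), Store.setNat_real] using h
  · exact ⟨by simp, fun j _ => ⟨rfl, rfl⟩⟩
  · rintro k hk σ' hF hv ⟨i1, i2⟩
    have h' := (((hσ.congr (F₁.same (by decide) (by decide))).congr
      (F₂.same (by decide) (by decide))).congr (sameStatic_setNat σ₂ (a := aFl) (by decide) (N + b)
        Z₀ 1)).congr (hF.same (by decide) (by decide))
    refine (runs_blockInit (N := N) hS hκ h' ⟨k, hk⟩ hv fun x => ?_).mono le_rfl le_rfl ?_
    · rw [(i2 _ (Or.inr le_rfl)).1]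
      have : ¬ k = b := by omega
      simp [this, I₂]
    · rintro σ₄ F₄ ⟨k1, k2, k3⟩
      refine ⟨fun i hi => ?_, fun j hj => ?_⟩
      · rcases Nat.lt_succ_iff_lt_or_eq.1 hi with h | h
        · have hne : N + (i : ℕ) ≠ N + k := by omega
          rw [(k2 _ hne).1, (k2 _ hne).2, k3 _ h.ne]
          exact i1 i h
        · obtain rfl : i = ⟨k, hk⟩ := Fin.ext h
          exact k1
      · have hne : j ≠ N + k := by omega
        rw [(k2 j hne).1, (k2 j hne).2]
        exact i2 j (by omega)
  · obtain ⟨i1, i2⟩ := I₃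
    have hw : σ₂.real rWT = σ.real rWT := by rw [F₂.real rWT (by decide), F₁.real rWT (by decide)]
    refine ⟨fun j hj => ?_, fun j hj => ⟨fun e => ?_, fun e => ?_⟩, fun i => i1 i i.2,
      fun j hj e => ?_⟩
    · rw [F₃.nat aVer (by decide), Store.setNat_nat_of_ne _ (by decide), F₂.nat aVer (by decide)]
      exact I₁ j (by omega)
    · rw [(i2 j (by omega)).1, Store.setNat_nat, I₂]
      split_ifs with h1 h2
      · simp [h1.2.2]
      · simp [h2.2]
      · simp only [ne_eq, not_true_eq_false, false_iff]
        rintro rfl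
        simp at h1 h2
        omega
    · rw [(i2 j (by omega)).2, hw, hwt]
    · rw [(i2 j (by omega)).1, Store.setNat_nat, I₂, if_neg (by omega), if_neg (by omega)]
  · have : b * (digitWeight O L₁ * (L₁ * 4 + 11) + L₂ * 8 + 13 + 2)
      = b * (digitWeight O L₁ * (L₁ * 4 + 11) + L₂ * 8 + 15) := rfl
    omega
  · omega

end InitAll

/-! ### Merging, tracing back and output -/

section Merging

variable {n b m : ℕ} {P : QIB n b m} {S : P.Solver} {T : MergeTree m} {O : ℕ → ℕ} {L : ℕ}
  {U : ℕ → ℝ} {rhs : Fin m → ℝ} {σ σ' : Store}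

/-- The memory holds the merge tree and the mixed-radix system. -/
structure MergeReady (T : MergeTree m) (O : ℕ → ℕ) (L : ℕ) (U : ℕ → ℝ) (rhs : Fin m → ℝ)
    (σ : Store) : Prop where
  nodes : σ.nat 0 3 0 = T.N
  blocks : σ.nat 0 2 0 = T.b
  rhs : ∀ r : Fin m, σ.real 1 r 0 = rhs r
  slots : σ.nat vL 0 0 = L
  size : σ.nat vS 0 0 = digitWeight O L
  radix : RadixTable O U L σ
  digits : ∀ c < L, ∀ e < digitWeight O L, σ.nat aDig e c = digit O e c
  keep : ∀ k < T.M, ∀ c, σ.nat aKeep k c ≠ 0 ↔ T.Kept k c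
  fin : ∀ k < T.M, ∀ r ∈ T.bag k, T.top r = k → σ.nat aFin k (T.slot r) = r + 1
  fin_mem : ∀ k < T.M, ∀ c, σ.nat aFin k c ≠ 0 → ∃ r ∈ T.bag k, T.top r = k ∧ T.slot r = c
  par : ∀ k < T.M, σ.nat aPar k 0 = T.pr k

lemma MergeReady.congr (h : MergeReady T O L U rhs σ) (h' : SameStatic σ σ') :
    MergeReady T O L U rhs σ' := by
  have hR := h.radix.congr (h'.nat aOf (by decide)) (h'.real rUn (by decide))
    (h'.nat aW (by decide)) (h'.nat aMul (by decide)) (h'.nat vZ0 (by decide))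
  obtain ⟨h1, h2, h3, h4, h5, -, h7, h8, h9, h10, h11⟩ := h
  rw [← h'.nat _ (by decide)] at h1 h2 h4 h5 h7 h8 h9 h10 h11
  rw [← h'.real _ (by decide)] at h3
  exact ⟨h1, h2, h3, h4, h5, hR, h7, h8, h9, h10, h11⟩

open Classical in
lemma runs_combine (hσ : MergeReady T O L U rhs σ) {k e₁ e₂ : ℕ} (hk : k < T.M)
    (hvk : σ.nat vk 0 0 = k) (h1 : σ.nat vE 0 0 = e₁) (h2 : σ.nat vE2 0 0 = e₂)
    (he₁ : e₁ < digitWeight O L) (he₂ : e₂ < digitWeight O L) (hslot : ∀ r, T.slot r < L) :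
    Runs S progCombine σ (L * 12 + 5) 0 fun σ' =>
      (σ'.nat vBad 0 0 = 0 → T.Merges O L U rhs k e₁ e₂ (σ'.nat vCode 0 0)) ∧
      (σ'.nat vBad 0 0 ≠ 0 → ∀ e, ¬ T.Merges O L U rhs k e₁ e₂ e) := by
  have hprod : ∀ {l : ℕ} {x : ℕ}, x ≤ 2 * l → x ≤ 2 * l + 1 := fun h => by omega
  unfold progCombine
  refine (Runs.cons_setNat_eq (i' := 0) (k' := 0) (x := 0) rfl rfl rfl (Runs.cons_setNat_eq
    (i' := 0) (k' := 0) (x := 0) rfl rfl rfl (Runs.cons' (t₂ := 1) (Runs.forLoop (t := 10) (q := 0)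
    (fun l σ' =>
      (σ'.nat vBad 0 0 = 0 ↔ ∀ c < l, T.mergeDigit O k e₁ e₂ c ≤ 2 * O c ∧
        ∀ r ∈ T.bag k, T.top r = k → T.slot r = c → U c * entry O e₂ c ≤ rhs r) ∧
      (σ'.nat vBad 0 0 = 0 → σ'.nat vCode 0 0 = codeOf O l (T.mergeDigit O k e₁ e₂)))
      L (by decide) ?_ ?_ ?_ ?_)
      fun σ₁ F₁ I₁ => Runs.nil (t := 0) ?_))).mono (q := 0) (by omega) le_rfl fun _ _ h => h
  · intro σ' hF
    simp [hF.nat vL (by decide), hσ.slots]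
  · intro k σ' x h
    simpa only [Store.setNat_nat_of_ne _ (show vBad ≠ vC by decide),
      Store.setNat_nat_of_ne _ (show vCode ≠ vC by decide)] using h
  · simp [codeOf]
  · rintro l hl σ₀ hF hv ⟨i1, i2⟩
    have h0 := (hσ.congr ((sameStatic_setNat σ (a := vCode) (by decide) 0 0 0).trans
      (sameStatic_setNat _ (a := vBad) (by decide) 0 0 0))).congr
      (hF.same (by decide) (by decide))
    have g : ∀ a, a ∉ (progCombine).natWrites → σ₀.nat a = σ.nat a := by
      intro a ha
      rw [hF.nat a fun hcon => ha ?_, Store.setNat_nat_of_ne _ ?_, Store.setNat_nat_of_ne _ ?_]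
      · rintro rfl; exact ha (by decide)
      · rintro rfl; exact ha (by decide)
      · exact List.mem_append_right _ (List.mem_append_right _ (List.mem_append_left _ hcon))
    have gk : σ₀.nat vk 0 0 = k := by rw [g vk (by decide), hvk]
    have g1 : σ₀.nat vE 0 0 = e₁ := by rw [g vE (by decide), h1]
    have g2 : σ₀.nat vE2 0 0 = e₂ := by rw [g vE2 (by decide), h2]
    have d1 := h0.digits l hl e₁ he₁
    have d2 := h0.digits l hl e₂ he₂
    have gO := h0.radix.range l hl
    have gU := h0.radix.unit l hl
    have gK := h0.keep k hk l
    refine Runs.cons' (t₁ := 6) (t₂ := 4) (Ψ := fun σ₁ =>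
      σ₁.nat vD2 0 0 = (if T.Kept k l then digit O e₂ l else O l) ∧
      (σ₁.nat vBad 0 0 = 0 ↔ σ₀.nat vBad 0 0 = 0 ∧
        ∀ r ∈ T.bag k, T.top r = k → T.slot r = l → U l * entry O e₂ l ≤ rhs r)) ?_
      fun σ₁ F₁ I₁ => Runs.cons_setNat_eq (t := 3) (i' := 0) (k' := 0)
        (x := T.mergeDigit O k e₁ e₂ l) rfl rfl ?_ (Runs.cons' (t₁ := 2) (t₂ := 1)
          (Ψ := fun σ₂ => (σ₂.nat vBad 0 0 = 0 ↔ σ₁.nat vBad 0 0 = 0 ∧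
            T.mergeDigit O k e₁ e₂ l ≤ 2 * O l) ∧
          (σ₂.nat vBad 0 0 = 0 → σ₂.nat vCode 0 0
            = σ₀.nat vCode 0 0 + T.mergeDigit O k e₁ e₂ l * digitWeight O l)) ?_
          fun σ₂ F₂ I₂ => Runs.nil (t := 0) ?_)
    · refine Runs.ite (fun hc => Runs.setNat (t := 4) ?_) fun hc => ?_
      · have hkept : T.Kept k l := by
          have : 1 ≤ σ₀.nat aKeep k l := by simpa [gk, hv] using hc
          exact gK.1 (by omega)
        refine ⟨by simp [g2, hv, d2, hkept], ?_⟩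
        have : ∀ r ∈ T.bag k, T.top r = k → T.slot r ≠ l := by
          rintro r hr htop rfl
          obtain ⟨r', hr', htop', hs⟩ := hkept
          rw [T.slot_inj k r' r hr' hr hs] at htop'
          exact htop' htop
        simp only [NExp.eval_lit]
        rw [Store.setNat_nat_of_ne _ (by decide)]
        exact ⟨fun h => ⟨h, fun r hr ht hs => absurd hs (this r hr ht)⟩, fun h => h.1⟩
      · have hkept : ¬ T.Kept k l := by
          intro hcon
          have : ¬ 1 ≤ σ₀.nat aKeep k l := by simpa [gk, hv] using hc
          exact gK.2 hcon (by omega)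
        rw [if_neg hkept]
        refine Runs.cons_setNat_eq (t := 4) (i' := 0) (k' := 0) (x := O l) rfl rfl
          (by simp [hv, gO]) (Runs.cons' (t₁ := 3) (t₂ := 1) (Ψ := fun σ₁ =>
          σ₁.nat vD2 0 0 = O l ∧ (σ₁.nat vBad 0 0 = 0 ↔ σ₀.nat vBad 0 0 = 0 ∧
            ∀ r ∈ T.bag k, T.top r = k → T.slot r = l → U l * entry O e₂ l ≤ rhs r))
          ?_ fun σ₁ F₁ I₁ => Runs.nil (t := 0) I₁)
        refine Runs.ite (fun hf => ?_) fun hf => Runs.skip (t := 1) ?_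
        · have hne : σ₀.nat aFin k l ≠ 0 := by
            have : 1 ≤ σ₀.nat aFin k l := by simpa [gk, hv] using hf
            omega
          obtain ⟨r, hr, htop, hs⟩ := h0.fin_mem k hk l hne
          have hval := h0.fin k hk r hr htop
          rw [hs] at hval
          have hiff : (∀ r' ∈ T.bag k, T.top r' = k → T.slot r' = l →
              U l * (entry O e₂ l : ℝ) ≤ rhs r') ↔ U l * (digit O e₂ l - O l) ≤ rhs r := by
            have hen : (entry O e₂ l : ℝ) = digit O e₂ l - O l := by simp [entry]
            rw [hen]
            constructor
            · exact fun h => h r hr htop hs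
            · intro h r' hr' _ hs'
              rwa [T.slot_inj k r' r hr' hr (hs'.trans hs.symm)]
          rw [hiff]
          refine Runs.ite (fun ht => Runs.skip ?_) fun ht => Runs.setNat ?_
          · have ht' : U l * (digit O e₂ l - O l) ≤ rhs r := by
              simpa [gk, hv, g2, d2, gO, gU, hval, h0.rhs] using ht
            refine ⟨by simp, ?_⟩
            rw [Store.setNat_nat_of_ne _ (by decide)]
            exact ⟨fun h => ⟨h, ht'⟩, fun h => h.1⟩
          · have ht' : ¬ U l * (digit O e₂ l - O l) ≤ rhs r := by
              simpa [gk, hv, g2, d2, gO, gU, hval, h0.rhs] using ht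
            refine ⟨by simp, ?_⟩
            simp [ht']
        · have hno : ∀ r ∈ T.bag k, T.top r = k → T.slot r ≠ l := by
            rintro r hr htop rfl
            have h3 := h0.fin k hk r hr htop
            have : ¬ 1 ≤ σ₀.nat aFin k (T.slot r) := by simpa [gk, hv] using hf
            omega
          refine ⟨by simp, ?_⟩
          rw [Store.setNat_nat_of_ne _ (by decide)]
          exact ⟨fun h => ⟨h, fun r hr ht hs => absurd hs (hno r hr ht)⟩, fun h => h.1⟩
    · simp only [NExp.eval_sub, NExp.eval_add, NExp.eval_get, NExp.eval_lit]
      rw [F₁.nat aDig (by decide), F₁.nat vE (by decide), F₁.nat vC (by decide),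
        F₁.nat aOf (by decide), I₁.1, hv, g1, d1, gO]
      rfl
    · have jC : σ₁.nat vC 0 0 = l := by rw [F₁.nat vC (by decide), hv]
      have jO : σ₁.nat aOf l 0 = O l := by rw [F₁.nat aOf (by decide), gO]
      have jcode : σ₁.nat vCode = σ₀.nat vCode := F₁.nat vCode (by decide)
      refine Runs.ite (fun hc => Runs.setNat ?_) fun hc => Runs.setNat ?_
      · have hc' : T.mergeDigit O k e₁ e₂ l ≤ 2 * O l := by
          have : T.mergeDigit O k e₁ e₂ l ≤ O l + O l := by simpa [jC, jO] using hc
          omega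
        have hmul := h0.radix.mul l hl _ (hprod hc')
        rw [← F₁.nat aMul (by decide)] at hmul
        refine ⟨?_, fun _ => ?_⟩
        · simp [hc']
        · simp [jC, hmul, jcode]
      · have hc' : ¬ T.mergeDigit O k e₁ e₂ l ≤ 2 * O l := by
          have : ¬ T.mergeDigit O k e₁ e₂ l ≤ O l + O l := by simpa [jC, jO] using hc
          omega
        simp [hc']
    · refine ⟨?_, fun h => ?_⟩
      · rw [I₂.1, I₁.2, i1]
        constructor
        · rintro ⟨⟨h3, h4⟩, h5⟩ c hc
          rcases Nat.lt_succ_iff_lt_or_eq.1 hc with h | rfl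
          · exact h3 c h
          · exact ⟨h5, h4⟩
        · intro h
          exact ⟨⟨fun c hc => h c (by omega), (h l (by omega)).2⟩, (h l (by omega)).1⟩
      · have hb := (I₁.2.1 (I₂.1.1 h).1).1
        rw [I₂.2 h, i2 hb, codeOf_succ]
  · refine ⟨fun h => ⟨fun c hc => (I₁.1.1 h c hc).1, fun r hr htop => ?_, I₁.2 h⟩, fun h e he => ?_⟩
    · exact (I₁.1.1 h _ (hslot r)).2 r hr htop rfl
    · refine h (I₁.1.2 fun c hc => ⟨he.1 c hc, fun r hr htop hs => ?_⟩)
      subst hs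
      exact he.2.1 r hr htop

end Merging

section MergeLoops

variable {n b m : ℕ} {P : QIB n b m} {S : P.Solver} {T : MergeTree m} {O : ℕ → ℕ} {L : ℕ}
  {U : ℕ → ℝ} {rhs : Fin m → ℝ} {σ σ' : Store}

/-- The result of the merge at time `s`, as far as the pairs of entries in `D` have been treated. -/
structure MergeStep (T : MergeTree m) (O : ℕ → ℕ) (L : ℕ) (U : ℕ → ℝ) (rhs : Fin m → ℝ) (s : ℕ)
    (D : ℕ → ℕ → Prop) (FL : ℕ → ℕ → ℕ) (WT : ℕ → ℕ → ℝ) (B₁ B₂ : ℕ → ℕ) : Prop where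
  back : ∀ e, FL (T.M + 1 + s) e ≠ 0 →
    FL (T.ver s (T.pr (T.node s))) (B₁ e) ≠ 0 ∧ FL (T.ver s (T.node s)) (B₂ e) ≠ 0 ∧
      T.Merges O L U rhs (T.node s) (B₁ e) (B₂ e) e ∧
        WT (T.M + 1 + s) e
          = WT (T.ver s (T.pr (T.node s))) (B₁ e) + WT (T.ver s (T.node s)) (B₂ e)
  best : ∀ e₁ e₂, D e₁ e₂ → ∀ e,
    FL (T.ver s (T.pr (T.node s))) e₁ ≠ 0 → FL (T.ver s (T.node s)) e₂ ≠ 0 →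
      T.Merges O L U rhs (T.node s) e₁ e₂ e →
        FL (T.M + 1 + s) e ≠ 0 ∧
          WT (T.M + 1 + s) e ≤ WT (T.ver s (T.pr (T.node s))) e₁ + WT (T.ver s (T.node s)) e₂

lemma MergeTree.ver_le (s j : ℕ) (hj : j ≤ T.M) : T.ver s j ≤ T.M + s := by
  induction s with
  | zero => exact hj
  | succ s ih =>
    simp only [MergeTree.ver]
    split_ifs <;> lia

lemma MergeTree.pr_le {k : ℕ} (hk : k < T.M) : T.pr k ≤ T.M := by
  rcases pr_cases hk with h | h <;> lia

lemma MergeStep.mono {s : ℕ} {D D' : ℕ → ℕ → Prop} {FL : ℕ → ℕ → ℕ} {WT : ℕ → ℕ → ℝ}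
    {B₁ B₂ : ℕ → ℕ} (h : MergeStep T O L U rhs s D FL WT B₁ B₂)
    (hD : ∀ e₁ e₂, D' e₁ e₂ → FL (T.ver s (T.pr (T.node s))) e₁ ≠ 0 →
      FL (T.ver s (T.node s)) e₂ ≠ 0 → D e₁ e₂) :
    MergeStep T O L U rhs s D' FL WT B₁ B₂ :=
  ⟨h.back, fun e₁ e₂ hd e h1 h2 => h.best e₁ e₂ (hD e₁ e₂ hd h1 h2) e h1 h2⟩

lemma MergeStep.congr {s : ℕ} (hs : s < T.M) {D : ℕ → ℕ → Prop} {FL FL' : ℕ → ℕ → ℕ}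
    {WT WT' : ℕ → ℕ → ℝ} {B₁ B₂ : ℕ → ℕ} (h : MergeStep T O L U rhs s D FL WT B₁ B₂)
    (hF : ∀ j ≤ T.M + 1 + s, FL' j = FL j) (hW : ∀ j ≤ T.M + 1 + s, WT' j = WT j) :
    MergeStep T O L U rhs s D FL' WT' B₁ B₂ := by
  have h1 := MergeTree.ver_le (T := T) s (T.node s) (by lia)
  have h2 := MergeTree.ver_le (T := T) s (T.pr (T.node s)) (MergeTree.pr_le (by lia))
  refine ⟨?_, ?_⟩
  · rw [hF _ le_rfl, hF _ (h1.trans (by lia)), hF _ (h2.trans (by lia)), hW _ le_rfl,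
      hW _ (h1.trans (by lia)), hW _ (h2.trans (by lia))]
    exact h.back
  · rw [hF _ le_rfl, hF _ (h1.trans (by lia)), hF _ (h2.trans (by lia)), hW _ le_rfl,
      hW _ (h1.trans (by lia)), hW _ (h2.trans (by lia))]
    exact h.best

/-- Apart from the results of the merge at time `s`, the tables have not changed. -/
structure OtherTables (T : MergeTree m) (s : ℕ) (σ σ' : Store) : Prop where
  flag : ∀ j, j ≠ T.M + 1 + s → σ'.nat aFl j = σ.nat aFl j
  cost : ∀ j, j ≠ T.M + 1 + s → σ'.real rWT j = σ.real rWT j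
  back₁ : ∀ s', s' ≠ s → σ'.nat aB1 s' = σ.nat aB1 s'
  back₂ : ∀ s', s' ≠ s → σ'.nat aB2 s' = σ.nat aB2 s'

lemma OtherTables.refl (s : ℕ) (σ : Store) : OtherTables T s σ σ :=
  ⟨fun _ _ => rfl, fun _ _ => rfl, fun _ _ => rfl, fun _ _ => rfl⟩

lemma OtherTables.trans {s : ℕ} {σ₁ σ₂ σ₃ : Store} (h : OtherTables T s σ₁ σ₂)
    (h' : OtherTables T s σ₂ σ₃) : OtherTables T s σ₁ σ₃ :=
  ⟨fun j hj => (h'.flag j hj).trans (h.flag j hj), fun j hj => (h'.cost j hj).trans (h.cost j hj),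
    fun j hj => (h'.back₁ j hj).trans (h.back₁ j hj),
    fun j hj => (h'.back₂ j hj).trans (h.back₂ j hj)⟩

/-- The state of the tables during the merge at time `s`. -/
def MergeState (T : MergeTree m) (O : ℕ → ℕ) (L : ℕ) (U : ℕ → ℝ) (rhs : Fin m → ℝ) (s : ℕ)
    (D : ℕ → ℕ → Prop) (σ σ' : Store) : Prop :=
  MergeStep T O L U rhs s D (σ'.nat aFl) (σ'.real rWT) (σ'.nat aB1 s) (σ'.nat aB2 s) ∧
    OtherTables T s σ σ'

lemma MergeState.congr {s : ℕ} {D : ℕ → ℕ → Prop} {σ₀ σ σ' : Store}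
    (h : MergeState T O L U rhs s D σ₀ σ) (h1 : σ'.nat aFl = σ.nat aFl)
    (h2 : σ'.real rWT = σ.real rWT) (h3 : σ'.nat aB1 = σ.nat aB1) (h4 : σ'.nat aB2 = σ.nat aB2) :
    MergeState T O L U rhs s D σ₀ σ' := by
  obtain ⟨g1, ⟨g2, g3, g4, g5⟩⟩ := h
  rw [← h1] at g1 g2
  rw [← h2] at g1 g3
  rw [← h3] at g1 g4
  rw [← h4] at g1 g5
  exact ⟨g1, ⟨g2, g3, g4, g5⟩⟩

lemma MergeState.mono {s : ℕ} {D D' : ℕ → ℕ → Prop} {σ₀ σ : Store}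
    (h : MergeState T O L U rhs s D σ₀ σ)
    (hD : ∀ e₁ e₂, D' e₁ e₂ → σ.nat aFl (T.ver s (T.pr (T.node s))) e₁ ≠ 0 →
      σ.nat aFl (T.ver s (T.node s)) e₂ ≠ 0 → D e₁ e₂) :
    MergeState T O L U rhs s D' σ₀ σ :=
  ⟨h.1.mono hD, h.2⟩

/-- The scalars that control the merge at time `s`. -/
structure MergeControl (T : MergeTree m) (s : ℕ) (σ : Store) : Prop where
  time : σ.nat vQ 0 0 = s
  node : σ.nat vk 0 0 = T.node s
  child : σ.nat vX 0 0 = T.ver s (T.node s)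
  parent : σ.nat vY 0 0 = T.ver s (T.pr (T.node s))

lemma MergeControl.congr {s : ℕ} (h : MergeControl T s σ)
    (h' : ∀ a ∈ [vQ, vk, vX, vY], σ'.nat a = σ.nat a) : MergeControl T s σ' :=
  ⟨by rw [h' vQ (by decide)]; exact h.time, by rw [h' vk (by decide)]; exact h.node,
    by rw [h' vX (by decide)]; exact h.child, by rw [h' vY (by decide)]; exact h.parent⟩

lemma runs_update {s : ℕ} (hs : s < T.M) {D : ℕ → ℕ → Prop} {σ₀ : Store}
    (hN : σ.nat 0 3 0 = T.N) (hb : σ.nat 0 2 0 = T.b)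
    (hC : MergeControl T s σ) {e₁ e₂ e : ℕ} (h1 : σ.nat vE 0 0 = e₁) (h2 : σ.nat vE2 0 0 = e₂)
    (he : σ.nat vCode 0 0 = e) (hf₁ : σ.nat aFl (T.ver s (T.pr (T.node s))) e₁ ≠ 0)
    (hf₂ : σ.nat aFl (T.ver s (T.node s)) e₂ ≠ 0)
    (hm : T.Merges O L U rhs (T.node s) e₁ e₂ e) (hσ : MergeState T O L U rhs s D σ₀ σ) :
    Runs S progUpdate σ 7 0
      (MergeState T O L U rhs s (fun a a' => D a a' ∨ (a = e₁ ∧ a' = e₂)) σ₀) := by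
  have v1 := MergeTree.ver_le (T := T) s (T.node s) (by lia)
  have v2 := MergeTree.ver_le (T := T) s (T.pr (T.node s)) (MergeTree.pr_le (by lia))
  have hout : outRow.eval σ = T.M + 1 + s := by
    simp [outRow, hN, hb, hC.time]
  have hsum : sumExp.eval σ = σ.real rWT (T.ver s (T.pr (T.node s))) e₁
      + σ.real rWT (T.ver s (T.node s)) e₂ := by
    simp [sumExp, hC.child, hC.parent, h1, h2]
  set X := T.ver s (T.node s) with hX
  set Y := T.ver s (T.pr (T.node s)) with hY
  set o := T.M + 1 + s with ho
  have hXo : X ≠ o := by lia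
  have hYo : Y ≠ o := by lia
  have hcode : (NExp.var vCode).eval σ = e := by simp [he]
  have hstore : (σ.nat aFl o e ≠ 0 → σ.real rWT Y e₁ + σ.real rWT X e₂ ≤ σ.real rWT o e) →
      Runs S progStore σ 5 0
        (MergeState T O L U rhs s (fun a a' => D a a' ∨ (a = e₁ ∧ a' = e₂)) σ₀) := by
    intro hbetter
    refine Runs.cons_setNat_eq (t := 4) (i' := o) (k' := e) (x := 1) hout hcode rfl
      (Runs.cons_setReal_eq (t := 3) (i' := o) (k' := e)
        (x := σ.real rWT Y e₁ + σ.real rWT X e₂) ?_ ?_ ?_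
        (Runs.cons_setNat_eq (t := 2) (i' := s) (k' := e) (x := e₁) ?_ ?_ ?_
          (Runs.cons_setNat_eq (t := 1) (i' := s) (k' := e) (x := e₂) ?_ ?_ ?_
            (Runs.nil (t := 0) ?_))))
    · rw [← hout]; simp [outRow]
    · simp [he]
    · rw [← hsum]; simp [sumExp]
    · simp [hC.time]
    · simp [he]
    · simp [h1]
    · simp [hC.time]
    · simp [he]
    · simp [h2]
    · refine ⟨⟨fun x hx => ?_, fun a a' hD x hx1 hx2 hmx => ?_⟩, ?_⟩
      · rw [← ho] at hx ⊢
        by_cases hxe : x = e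
        · subst hxe
          simp only [Store.setNat_nat, Store.setNat_real, Store.setReal_real, Store.setReal_nat]
          simp only [← hX, ← hY, and_self, if_true, hXo, hYo, false_and, and_false, if_false]
          simpa using ⟨hf₁, hf₂, hm⟩
        · have hx' : σ.nat aFl o x ≠ 0 := by simpa [hxe] using hx
          have := hσ.1.back x hx'
          rw [← hX, ← hY, ← ho] at this
          simpa [hxe, ← hX, ← hY, hXo, hYo] using this
      · rw [← ho]
        rw [← hY] at hx1 ⊢
        rw [← hX] at hx2 ⊢
        have hx1' : σ.nat aFl Y a ≠ 0 := by simpa [hYo] using hx1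
        have hx2' : σ.nat aFl X a' ≠ 0 := by simpa [hXo] using hx2
        have hgoal : (σ.nat aFl o x ≠ 0 ∧ x ≠ e ∧
            σ.real rWT o x ≤ σ.real rWT Y a + σ.real rWT X a') ∨ (x = e ∧
              σ.real rWT Y e₁ + σ.real rWT X e₂ ≤ σ.real rWT Y a + σ.real rWT X a') := by
          rcases hD with hD | ⟨rfl, rfl⟩
          · have := hσ.1.best a a' hD x hx1' hx2' hmx
            rw [← hX, ← hY, ← ho] at this
            by_cases hxe : x = e
            · subst hxe
              exact Or.inr ⟨rfl, (hbetter this.1).trans this.2⟩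
            · exact Or.inl ⟨this.1, hxe, this.2⟩
          · exact Or.inr ⟨hmx.2.2.trans hm.2.2.symm, le_rfl⟩
        rcases hgoal with ⟨k1, k2, k3⟩ | ⟨rfl, k3⟩
        · simpa [k2, hXo, hYo] using ⟨k1, k3⟩
        · simpa [hXo, hYo] using k3
      · refine hσ.2.trans ⟨fun j hj => ?_, fun j hj => ?_, fun j hj => ?_, fun j hj => ?_⟩ <;>
        · rw [← ho] at *
          funext x
          simp [hj]
  refine Runs.ite (fun hc => (hstore ?_).mono (by omega) le_rfl fun _ _ h => h) fun hc =>
    Runs.ite (fun hd => hstore fun _ => ?_) fun hd => Runs.skip (t := 4) ?_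
  · intro hne
    rw [Test.holds_natLE, NExp.eval_get, hout, hcode, NExp.eval_zero] at hc
    omega
  · rw [Test.holds_realLE, hsum, RExp.eval_get, hout, hcode] at hd
    exact hd
  · rw [Test.holds_natLE, NExp.eval_get, hout, hcode, NExp.eval_zero] at hc
    rw [Test.holds_realLE, hsum, RExp.eval_get, hout, hcode, not_le] at hd
    refine ⟨⟨hσ.1.back, fun a a' hD x hx1 hx2 hmx => ?_⟩, hσ.2⟩
    rcases hD with hD | ⟨rfl, rfl⟩
    · exact hσ.1.best a a' hD x hx1 hx2 hmx
    · obtain rfl : x = e := hmx.2.2.trans hm.2.2.symm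
      exact ⟨by rw [← ho]; omega, by rw [← ho, ← hX, ← hY]; exact hd.le⟩

lemma runs_pairs {s : ℕ} (hs : s < T.M) (hσ : MergeReady T O L U rhs σ)
    (hslot : ∀ r, T.slot r < L) (hC : MergeControl T s σ)
    (hfl : ∀ e, σ.nat aFl (T.M + 1 + s) e = 0) :
    Runs S progPairs σ
      (digitWeight O L * (digitWeight O L * (L * 12 + 17) + 5) + 2) 0
      (MergeState T O L U rhs s (fun a a' => a < digitWeight O L ∧ a' < digitWeight O L) σ) := by
  set d := digitWeight O L with hd
  unfold progPairs
  refine (Runs.forLoop (t := d * (L * 12 + 17) + 3) (q := 0)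
    (fun k => MergeState T O L U rhs s (fun a a' => a < k ∧ a' < d) σ) d (by decide) ?_ ?_ ?_ ?_).mono
      (q := 0) le_rfl (by omega) fun _ _ h => h
  · intro σ' hF
    simp [hF.nat vS (by decide), hσ.size, hd]
  · intro k σ' x h
    exact h.congr (Store.setNat_nat_of_ne _ (by decide) _ _ _) rfl
      (Store.setNat_nat_of_ne _ (by decide) _ _ _) (Store.setNat_nat_of_ne _ (by decide) _ _ _)
  · exact ⟨⟨fun e he => absurd (hfl e) he, by simp⟩, OtherTables.refl _ _⟩
  · intro k hk σ₁ F₁ hv₁ I₁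
    have C₁ : MergeControl T s σ₁ := hC.congr fun a ha => F₁.nat a (by
      revert a; decide)
    refine Runs.ite (t := d * (L * 12 + 17) + 2) (fun hc => ?_) fun hc =>
      (Runs.skip (t := 0) ?_).mono (by omega) le_rfl fun _ _ h => h
    · have hf₁ : σ₁.nat aFl (T.ver s (T.pr (T.node s))) k ≠ 0 := by
        have : 1 ≤ σ₁.nat aFl (T.ver s (T.pr (T.node s))) k := by
          simpa [C₁.parent, hv₁] using hc
        omega
      refine (Runs.forLoop (t := L * 12 + 15) (q := 0)
        (fun l => MergeState T O L U rhs s (fun a a' => (a < k ∧ a' < d) ∨ (a = k ∧ a' < l)) σ) d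
        (by decide) ?_ ?_ ?_ ?_).mono (q := 0) le_rfl (by omega) fun _ _ h => h.mono ?_
      · intro σ' hF
        simp [hF.nat vS (by decide), F₁.nat vS (by decide), hσ.size, hd]
      · intro k σ' x h
        exact h.congr (Store.setNat_nat_of_ne _ (by decide) _ _ _) rfl
          (Store.setNat_nat_of_ne _ (by decide) _ _ _)
          (Store.setNat_nat_of_ne _ (by decide) _ _ _)
      · exact I₁.mono fun a a' h _ _ => by simpa using h
      · intro l hl σ₂ F₂ hv₂ I₂
        have C₂ : MergeControl T s σ₂ := C₁.congr fun a ha => F₂.nat a (by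
          revert a; decide)
        have h2 := (hσ.congr (F₁.same (by decide) (by decide))).congr
          (F₂.same (by decide) (by decide))
        have hvE : σ₂.nat vE 0 0 = k := by rw [F₂.nat vE (by decide), hv₁]
        have hf₁' : σ₂.nat aFl (T.ver s (T.pr (T.node s))) k ≠ 0 := by
          have v2 := MergeTree.ver_le (T := T) s (T.pr (T.node s)) (MergeTree.pr_le (by lia))
          rw [I₂.2.flag _ (by lia), ← I₁.2.flag _ (by lia)]
          exact hf₁
        refine Runs.ite (t := L * 12 + 14) (fun hc => ?_) fun hc =>
          (Runs.skip (t := 0) ?_).mono (by omega) le_rfl fun _ _ h => h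
        · have hf₂ : σ₂.nat aFl (T.ver s (T.node s)) l ≠ 0 := by
            have : 1 ≤ σ₂.nat aFl (T.ver s (T.node s)) l := by
              simpa [C₂.child, hv₂] using hc
            omega
          refine Runs.cons' (t₂ := 9) (runs_combine h2 (by lia) C₂.node hvE hv₂ hk hl hslot)
            fun σ₃ F₃ I₃ => Runs.cons' (t₁ := 8) (t₂ := 1) (Ψ := MergeState T O L U rhs s
              (fun a a' => (a < k ∧ a' < d) ∨ (a = k ∧ a' < l + 1)) σ)
              (Runs.ite (fun hb => ?_) fun hb => ?_) fun σ₄ _ I₄ => Runs.nil (t := 0) I₄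
          · have hbad : σ₃.nat vBad 0 0 = 0 := by simpa using hb
            have C₃ : MergeControl T s σ₃ := C₂.congr fun a ha => F₃.nat a (by
              revert a; decide)
            have h3 := h2.congr (F₃.same (by decide) (by decide))
            have st := I₂.congr (F₃.nat aFl (by decide)) (F₃.real rWT (by decide))
              (F₃.nat aB1 (by decide)) (F₃.nat aB2 (by decide))
            refine (runs_update hs h3.nodes h3.blocks C₃ (e₁ := k) (e₂ := l) ?_ ?_ rfl ?_ ?_
              (I₃.1 hbad) st).mono le_rfl le_rfl fun _ _ h => h.mono ?_
            · rw [F₃.nat vE (by decide), hvE]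
            · rw [F₃.nat vE2 (by decide), hv₂]
            · rw [F₃.nat aFl (by decide)]; exact hf₁'
            · rw [F₃.nat aFl (by decide)]; exact hf₂
            · intro a a' h _ _
              omega
          · have hbad : σ₃.nat vBad 0 0 ≠ 0 := by simpa using hb
            have st := I₂.congr (F₃.nat aFl (by decide)) (F₃.real rWT (by decide))
              (F₃.nat aB1 (by decide)) (F₃.nat aB2 (by decide))
            refine Runs.skip (t := 6) ⟨⟨st.1.back, fun a a' hD x hx1 hx2 hmx => ?_⟩, st.2⟩
            rcases hD with h | ⟨h1, h2⟩
            · exact st.1.best a a' (Or.inl h) x hx1 hx2 hmx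
            · rcases Nat.lt_succ_iff_lt_or_eq.1 h2 with h | h
              · exact st.1.best a a' (Or.inr ⟨h1, h⟩) x hx1 hx2 hmx
              · rw [h1, h] at hmx
                exact absurd hmx (I₃.2 hbad x)
        · have hf₂ : σ₂.nat aFl (T.ver s (T.node s)) l = 0 := by
            have : ¬ 1 ≤ σ₂.nat aFl (T.ver s (T.node s)) l := by
              simpa [C₂.child, hv₂] using hc
            omega
          refine I₂.mono fun a a' h _ h' => ?_
          rcases h with h | ⟨h1, h2⟩
          · exact Or.inl h
          · refine Or.inr ⟨h1, lt_of_le_of_ne (Nat.lt_succ_iff.1 h2) fun hh => h' ?_⟩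
            rw [hh, hf₂]
      · intro a a' h _ _
        omega
    · have hf₁ : σ₁.nat aFl (T.ver s (T.pr (T.node s))) k = 0 := by
        have : ¬ 1 ≤ σ₁.nat aFl (T.ver s (T.pr (T.node s))) k := by
          simpa [C₁.parent, hv₁] using hc
        omega
      refine I₁.mono fun a a' h h' _ => ?_
      refine ⟨lt_of_le_of_ne (Nat.lt_succ_iff.1 h.1) fun hh => h' ?_, h.2⟩
      rw [hh, hf₁]

lemma runs_merge (hσ : MergeReady T O L U rhs σ) (hslot : ∀ r, T.slot r < L)
    (hver : ∀ j ≤ T.M, σ.nat aVer j 0 = j)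
    (hinit : ∀ j, j < T.N ∨ j = T.M → (∀ e, σ.nat aFl j e ≠ 0 ↔ e = codeOf O L O) ∧
      ∀ e, σ.real rWT j e = 0)
    (hfl : ∀ j, T.M < j → ∀ e, σ.nat aFl j e = 0) :
    Runs S progMerge σ
      (T.M * (digitWeight O L * (digitWeight O L * (L * 12 + 17) + 5) + 10) + 2) 0 fun σ' =>
      T.IsTable O L U rhs (σ'.nat aFl) (σ'.real rWT) (σ'.nat aB1) (σ'.nat aB2) ∧
      (∀ j ≤ T.M, σ'.nat aVer j 0 = T.ver T.M j) ∧
      ∀ j ≤ T.M, σ'.nat aFl j = σ.nat aFl j ∧ σ'.real rWT j = σ.real rWT j := by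
  set d := digitWeight O L with hd
  unfold progMerge
  refine (Runs.forLoop (t := d * (d * (L * 12 + 17) + 5) + 8) (q := 0) (fun s σ' =>
    (∀ j ≤ T.M, σ'.nat aVer j 0 = T.ver s j) ∧
    (∀ j ≤ T.M, σ'.nat aFl j = σ.nat aFl j ∧ σ'.real rWT j = σ.real rWT j) ∧
    (∀ s', s ≤ s' → ∀ e, σ'.nat aFl (T.M + 1 + s') e = 0) ∧
    ∀ s' < s, MergeStep T O L U rhs s' (fun a a' => a < d ∧ a' < d) (σ'.nat aFl) (σ'.real rWT)
      (σ'.nat aB1 s') (σ'.nat aB2 s')) T.M (by decide) ?_ ?_ ?_ ?_).mono (q := 0) le_rfl (by omega) ?_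
  · intro σ' hF
    simp [hF.nat 0 (by decide), hσ.nodes, hσ.blocks]
  · intro k σ' x h
    simpa only [Store.setNat_nat_of_ne _ (show aFl ≠ vQ by decide),
      Store.setNat_nat_of_ne _ (show aVer ≠ vQ by decide),
      Store.setNat_nat_of_ne _ (show aB1 ≠ vQ by decide),
      Store.setNat_nat_of_ne _ (show aB2 ≠ vQ by decide), Store.setNat_real] using h
  · exact ⟨hver, fun _ _ => ⟨rfl, rfl⟩, fun s' _ e => hfl _ (by lia) e, by simp⟩
  · rintro s hs σ₁ F₁ hv ⟨i1, i2, i3, i4⟩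
    have h1 := hσ.congr (F₁.same (by decide) (by decide))
    have hnode : T.node s < T.M := by lia
    have hp := MergeTree.pr_le hnode
    refine (Runs.cons_setNat_eq (i' := 0) (k' := 0) (x := T.node s) rfl rfl ?_
      (Runs.cons_setNat_eq (i' := 0) (k' := 0) (x := T.pr (T.node s)) rfl rfl ?_
      (Runs.cons_setNat_eq (i' := 0) (k' := 0) (x := T.ver s (T.node s)) rfl rfl ?_
      (Runs.cons_setNat_eq (i' := 0) (k' := 0) (x := T.ver s (T.pr (T.node s))) rfl rfl ?_
      (Runs.cons' (t₂ := 2) (runs_pairs (s := s) hs ((((h1.congr (sameStatic_setNat _ ?_ _ _ _)).congr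
        (sameStatic_setNat _ ?_ _ _ _)).congr (sameStatic_setNat _ ?_ _ _ _)).congr
        (sameStatic_setNat _ ?_ _ _ _)) hslot ?_ ?_)
        fun σ₂ F₂ I₂ => Runs.cons_setNat_eq (i' := T.pr (T.node s)) (k' := 0)
          (x := T.M + 1 + s) ?_ rfl ?_ (Runs.nil (t := 0) ?_)))))).mono (q := 0) (by rw [← hd]) le_rfl
      fun _ _ h => h
    · simp [h1.nodes, h1.blocks, hv]
    · simpa using h1.par _ hnode
    · simpa using i1 _ hnode.le
    · simpa using i1 _ hp
    · decide
    · decide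
    · decide
    · decide
    · exact ⟨by simp [hv], by simp, by simp, by simp⟩
    · intro e
      simpa using i3 s le_rfl e
    · rw [NExp.eval_get, NExp.eval_lit, F₂.nat vp (by decide)]
      simp
    · have h2 : σ₂.nat 0 = σ₁.nat 0 := by
        rw [F₂.nat 0 (by decide)]
        funext i k
        simp
      have hq : σ₂.nat vQ 0 0 = s := by
        rw [F₂.nat vQ (by decide)]
        simp [hv]
      simp [outRow, h2, hq, h1.nodes, h1.blocks]
    · obtain ⟨st, ot⟩ := I₂
      have e1 : ∀ j, j ≠ T.M + 1 + s → σ₂.nat aFl j = σ₁.nat aFl j := by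
        intro j hj
        rw [ot.flag j hj]
        funext e
        simp
      have e2 : ∀ j, j ≠ T.M + 1 + s → σ₂.real rWT j = σ₁.real rWT j := by
        intro j hj
        rw [ot.cost j hj]
        rfl
      have e3 : ∀ j, j ≠ s → σ₂.nat aB1 j = σ₁.nat aB1 j := by
        intro j hj
        rw [ot.back₁ j hj]
        funext e
        simp
      have e4 : ∀ j, j ≠ s → σ₂.nat aB2 j = σ₁.nat aB2 j := by
        intro j hj
        rw [ot.back₂ j hj]
        funext e
        simp
      have e5 : σ₂.nat aVer = σ₁.nat aVer := by
        rw [F₂.nat aVer (by decide)]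
        funext i k
        simp
      rw [Store.setNat_nat_of_ne _ (show aFl ≠ aVer by decide),
        Store.setNat_nat_of_ne _ (show aB1 ≠ aVer by decide),
        Store.setNat_nat_of_ne _ (show aB2 ≠ aVer by decide), Store.setNat_real]
      refine ⟨fun j hj => ?_, fun j hj => ?_, fun s' hs' e => ?_, fun s' hs' => ?_⟩
      · simp only [Store.setNat_nat, MergeTree.ver, e5, i1 j hj, true_and, and_true]
      · rw [e1 j (by lia), e2 j (by lia)]
        exact i2 j hj
      · rw [e1 _ (by lia)]
        exact i3 s' (by omega) e
      · rcases Nat.lt_succ_iff_lt_or_eq.1 hs' with h | rfl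
        · rw [e3 s' h.ne, e4 s' h.ne]
          exact (i4 s' h).congr (by lia) (fun j hj => e1 j (by lia)) fun j hj => e2 j (by lia)
        · exact st
  · rintro σ' - ⟨i1, i2, i3, i4⟩
    refine ⟨⟨fun j hj e => ?_, fun j hj => ?_, fun s hs => (i4 s hs).back,
      fun s hs e₁ h1 e₂ h2 => (i4 s hs).best e₁ e₂ ⟨h1, h2⟩⟩, i1, i2⟩
    · rw [(i2 j (by lia)).1]
      exact (hinit j hj).1 e
    · rw [(i2 j (by lia)).2]
      exact (hinit j hj).2 _

lemma runs_trace (hσ : MergeReady T O L U rhs σ) (hcur : ∀ j, σ.nat aCur j 0 = 0) :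
    Runs S progTrace σ (T.M * 7 + 4) 0 fun σ' =>
      ∀ j, σ'.nat aCur j 0 = T.trace O L (σ.nat aB1) (σ.nat aB2) T.M j := by
  unfold progTrace
  refine (Runs.cons_setNat_eq (i' := T.M) (k' := 0) (x := codeOf O L O) ?_ rfl ?_
    (Runs.cons' (t₂ := 1) (Runs.forLoop (t := 5) (q := 0) (fun τ σ' => ∀ j, σ'.nat aCur j 0
      = T.trace O L (σ.nat aB1) (σ.nat aB2) τ j) T.M (by decide) ?_ ?_ ?_ ?_)
      fun σ' _ I => Runs.nil (t := 0) I)).mono (q := 0) (by omega) le_rfl fun _ _ h => h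
  · simp [hσ.nodes, hσ.blocks]
  · simpa using hσ.radix.zero
  · intro σ' hF
    simp [hF.nat 0 (by decide), hσ.nodes, hσ.blocks]
  · intro k σ' x h
    simpa only [Store.setNat_nat_of_ne _ (show aCur ≠ vQ by decide)] using h
  · intro j
    simp [MergeTree.trace, hcur]
  · intro τ hτ σ₁ F₁ hv I
    have h1 := (hσ.congr (sameStatic_setNat σ (a := aCur) (by decide) T.M 0 (codeOf O L O))).congr
      (F₁.same (by decide) (by decide))
    have g1 : σ₁.nat aB1 = σ.nat aB1 := by
      rw [F₁.nat aB1 (by decide), Store.setNat_nat_of_ne _ (by decide)]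
    have g2 : σ₁.nat aB2 = σ.nat aB2 := by
      rw [F₁.nat aB2 (by decide), Store.setNat_nat_of_ne _ (by decide)]
    have hne := MergeTree.pr_ne (T := T) hτ
    set x := T.trace O L (σ.nat aB1) (σ.nat aB2) τ (T.pr τ) with hx
    refine Runs.cons_setNat_eq (t := 4) (i' := 0) (k' := 0) (x := T.pr τ) rfl rfl ?_
      (Runs.cons_setNat_eq (t := 3) (i' := 0) (k' := 0) (x := x) rfl rfl ?_
      (Runs.cons_setNat_eq (t := 2) (i' := T.pr τ) (k' := 0) (x := σ.nat aB1 (T.node τ) x) ?_ rfl ?_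
      (Runs.cons_setNat_eq (t := 1) (i' := τ) (k' := 0) (x := σ.nat aB2 (T.node τ) x) ?_ rfl ?_
        (Runs.nil (t := 0) ?_))))
    · simpa [hv] using h1.par τ hτ
    · simp [I, hx]
    · simp
    · simp [h1.nodes, h1.blocks, hv, g1]
    · simp [hv]
    · simp [h1.nodes, h1.blocks, hv, g2]
    · intro j
      simp only [MergeTree.trace, ← hx]
      simp [I]

end MergeLoops

section Output

variable {n b m : ℕ} {P : QIB n b m} {S : P.Solver} {N L₁ L₂ K κ : ℕ} {ε : ℝ} {slot : Fin m → ℕ}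
  {σ : Store}

lemma runs_output (hS : SlotMap P L₁ L₂ slot) (hσ : Ready P N L₁ L₂ K κ ε slot σ)
    (hcur : ∀ i : Fin b,
      σ.nat aCur (N + i) 0 < digitWeight (slotRange L₁ K κ) (L₁ + L₂))
    (hz : ∀ i, σ.nat 9 i 0 = 0) (hx : ∀ j, σ.real 3 j 0 = 0) :
    Runs S progOutput σ (b * (L₁ * 4 + 10) + 2) b fun σ' =>
      (∀ a, a ≠ 9 → a ∉ progOutput.natWrites → σ'.nat a = σ.nat a) ∧
      ∀ i : Fin b,
        (σ.nat aZf i (σ.nat aCur (N + i) 0) ≠ 0 → σ'.nat 9 i 0 = 1 ∧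
          ∀ y, S i (entryRhs P L₁ K κ ε slot i (σ.nat aCur (N + i) 0)) = some y →
            ∀ j : {j // P.blk j = i}, σ'.real 3 (j : Fin n) 0 = y j) ∧
        (σ.nat aZf i (σ.nat aCur (N + i) 0) = 0 → σ'.nat 9 i 0 = 0 ∧
          ∀ j : Fin n, P.blk j = i → σ'.real 3 j 0 = 0) := by
  suffices h : Runs S progOutput σ (b * (L₁ * 4 + 10) + 2) b fun σ' =>
      (∀ i : Fin b, (i : ℕ) < b →
        (σ.nat aZf i (σ.nat aCur (N + i) 0) ≠ 0 → σ'.nat 9 i 0 = 1 ∧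
          ∀ y, S i (entryRhs P L₁ K κ ε slot i (σ.nat aCur (N + i) 0)) = some y →
            ∀ j : {j // P.blk j = i}, σ'.real 3 (j : Fin n) 0 = y j) ∧
        (σ.nat aZf i (σ.nat aCur (N + i) 0) = 0 → σ'.nat 9 i 0 = 0 ∧
          ∀ j : Fin n, P.blk j = i → σ'.real 3 j 0 = 0)) ∧
      ∀ i : Fin b, b ≤ (i : ℕ) → σ'.nat 9 i 0 = 0 ∧ ∀ j : Fin n, P.blk j = i → σ'.real 3 j 0 = 0 from
    h.mono le_rfl le_rfl fun σ' F h => ⟨fun a _ ha => F.nat a ha, fun i => h.1 i i.2⟩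
  unfold progOutput
  refine (Runs.forLoop (t := L₁ * 4 + 8) (q := 1) (fun k σ' =>
      (∀ i : Fin b, (i : ℕ) < k →
        (σ.nat aZf i (σ.nat aCur (N + i) 0) ≠ 0 → σ'.nat 9 i 0 = 1 ∧
          ∀ y, S i (entryRhs P L₁ K κ ε slot i (σ.nat aCur (N + i) 0)) = some y →
            ∀ j : {j // P.blk j = i}, σ'.real 3 (j : Fin n) 0 = y j) ∧
        (σ.nat aZf i (σ.nat aCur (N + i) 0) = 0 → σ'.nat 9 i 0 = 0 ∧
          ∀ j : Fin n, P.blk j = i → σ'.real 3 j 0 = 0)) ∧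
      ∀ i : Fin b, k ≤ (i : ℕ) → σ'.nat 9 i 0 = 0 ∧ ∀ j : Fin n, P.blk j = i → σ'.real 3 j 0 = 0) b
      ?_ ?_ ?_ ?_ ?_).mono le_rfl (by omega) fun _ _ h => h
  · decide
  · intro σ' hF
    simp [hF.nat 0 (by decide), hσ.blocks]
  · intro k σ' x h
    simpa only [Store.setNat_nat_of_ne _ (show 9 ≠ vI by decide), Store.setNat_real] using h
  · exact ⟨by simp, fun i _ => ⟨hz i, fun j _ => hx j⟩⟩
  · rintro k hk σ₁ F₁ hv ⟨i1, i2⟩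
    have h1 := hσ.congr (F₁.same (by decide) (by decide))
    set i₀ : Fin b := ⟨k, hk⟩ with hi₀
    set e := σ.nat aCur (N + k) 0 with he
    have ge : (NExp.at aCur (inN + .var vI)).eval σ₁ = e := by
      simp [h1.nodes, hv, F₁.nat aCur (by decide), he]
    -- what remains to be shown about block `k`
    have hfin : ∀ σ' : Store, (∀ i, i ≠ k → σ'.nat 9 i 0 = σ₁.nat 9 i 0) →
        (∀ j : Fin n, P.blk j ≠ i₀ → σ'.real 3 j 0 = σ₁.real 3 j 0) →
        ((σ.nat aZf k e ≠ 0 → σ'.nat 9 k 0 = 1 ∧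
          ∀ y, S i₀ (entryRhs P L₁ K κ ε slot i₀ e) = some y →
            ∀ j : {j // P.blk j = i₀}, σ'.real 3 (j : Fin n) 0 = y j) ∧
        (σ.nat aZf k e = 0 → σ'.nat 9 k 0 = 0 ∧
          ∀ j : Fin n, P.blk j = i₀ → σ'.real 3 j 0 = 0)) →
        (∀ i : Fin b, (i : ℕ) < k + 1 →
          (σ.nat aZf i (σ.nat aCur (N + i) 0) ≠ 0 → σ'.nat 9 i 0 = 1 ∧
            ∀ y, S i (entryRhs P L₁ K κ ε slot i (σ.nat aCur (N + i) 0)) = some y →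
              ∀ j : {j // P.blk j = i}, σ'.real 3 (j : Fin n) 0 = y j) ∧
          (σ.nat aZf i (σ.nat aCur (N + i) 0) = 0 → σ'.nat 9 i 0 = 0 ∧
            ∀ j : Fin n, P.blk j = i → σ'.real 3 j 0 = 0)) ∧
        ∀ i : Fin b, k + 1 ≤ (i : ℕ) → σ'.nat 9 i 0 = 0 ∧
          ∀ j : Fin n, P.blk j = i → σ'.real 3 j 0 = 0 := by
      intro σ' h9 h3 hk'
      refine ⟨fun i hi => ?_, fun i hi => ?_⟩
      · rcases Nat.lt_succ_iff_lt_or_eq.1 hi with h | h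
        · have hne : i ≠ i₀ := fun hh => by simp [hh, hi₀] at h
          obtain ⟨j1, j2⟩ := i1 i h
          rw [h9 i h.ne]
          refine ⟨fun hz => ⟨(j1 hz).1, fun y hy j => ?_⟩, fun hz => ⟨(j2 hz).1, fun j hj => ?_⟩⟩
          · rw [h3 j (by rw [j.2]; exact hne)]
            exact (j1 hz).2 y hy j
          · rw [h3 j (by rw [hj]; exact hne)]
            exact (j2 hz).2 j hj
        · obtain rfl : i = i₀ := Fin.ext h
          exact hk'
      · have hne : i ≠ i₀ := fun hh => by simp [hh, hi₀] at hi
        obtain ⟨j1, j2⟩ := i2 i (by omega)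
        rw [h9 i (by omega)]
        exact ⟨j1, fun j hj => by rw [h3 j (by rw [hj]; exact hne)]; exact j2 j hj⟩
    refine Runs.cons_setNat_eq (t := L₁ * 4 + 7) (i' := 0) (k' := 0) (x := e) rfl rfl ge
      (Runs.cons (t₁ := L₁ * 4 + 6) (t₂ := 1) (q₁ := 1) (q₂ := 0) (Ψ := fun σ' =>
        (∀ i, i ≠ k → σ'.nat 9 i 0 = σ₁.nat 9 i 0) ∧
        (∀ j : Fin n, P.blk j ≠ i₀ → σ'.real 3 j 0 = σ₁.real 3 j 0) ∧
        ((σ.nat aZf k e ≠ 0 → σ'.nat 9 k 0 = 1 ∧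
          ∀ y, S i₀ (entryRhs P L₁ K κ ε slot i₀ e) = some y →
            ∀ j : {j // P.blk j = i₀}, σ'.real 3 (j : Fin n) 0 = y j) ∧
        (σ.nat aZf k e = 0 → σ'.nat 9 k 0 = 0 ∧
          ∀ j : Fin n, P.blk j = i₀ → σ'.real 3 j 0 = 0)))
        (Runs.ite (fun hc => ?_) fun hc => (Runs.skip (t := 0) (q := 0) ?_).mono (by omega) (by omega)
          fun _ _ h => h)
        fun σ' _ I => Runs.nil (t := 0) (hfin σ' I.1 I.2.1 I.2.2))
    · have hzf : σ.nat aZf k e ≠ 0 := by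
        have : 1 ≤ σ.nat aZf k e := by simpa [hv, F₁.nat aZf (by decide)] using hc
        omega
      have h2 := (h1.congr (sameStatic_setNat σ₁ (a := vE) (by decide) 0 0 e)).congr
        (sameStatic_setNat _ (a := 9) (by decide) k 0 1)
      refine (Runs.cons_setNat_eq (i' := k) (k' := 0) (x := 1) (by simp [hv]) rfl rfl
        (Runs.cons (t₂ := 2) (q₂ := 1) (runs_rhs hS h2 i₀ (e := e) ?_ ?_ (hcur i₀))
          fun σ₂ F₂ I₂ => Runs.cons (t₁ := 1) (t₂ := 1) (q₁ := 1) (q₂ := 0)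
            (Ψ := fun σ' => σ'.nat 9 = σ₂.nat 9 ∧
              (∀ j : Fin n, P.blk j ≠ i₀ → σ'.real 3 j 0 = σ₂.real 3 j 0) ∧
              ∀ y, S i₀ (entryRhs P L₁ K κ ε slot i₀ e) = some y →
                ∀ j : {j // P.blk j = i₀}, σ'.real 3 (j : Fin n) 0 = y j) ?_
            fun σ₃ F₃ I₃ => Runs.nil (t := 0) ?_)).mono (q := 1) (by omega) le_rfl fun _ _ h => h
      · simp [hv, hi₀]
      · simp
      · have hev : (NExp.var vI).eval σ₂ = i₀ := by
          rw [NExp.eval_get, NExp.eval_lit, F₂.nat vI (by decide)]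
          simp [hv, hi₀]
        have hlt : (NExp.var vI).eval σ₂ < b := by
          rw [hev]
          exact hk
        have hfin : (⟨(NExp.var vI).eval σ₂, hlt⟩ : Fin b) = i₀ := Fin.ext hev
        refine Runs.solve (t := 0) (q := 0) hlt ?_
        rw [hfin]
        refine ⟨σ₂.afterSolve_nat S _ _ _ _ _ _ (by decide), ?_⟩
        cases hsol : S i₀ (entryRhs P L₁ K κ ε slot i₀ e) with
        | none =>
          refine ⟨fun j _ => ?_, by simp⟩
          unfold Store.afterSolve
          rw [I₂, hsol]
          rfl
        | some y =>
          rw [σ₂.afterSolve_some S (by rw [I₂, hsol])]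
          refine ⟨fun j hj => ?_, fun y' hy' j => ?_⟩
          · simp [Store.writeBlock, hj]
          · obtain rfl : y = y' := Option.some.inj hy'
            simp [Store.writeBlock, j.2]
      · obtain ⟨k1, k2, k3⟩ := I₃
        have g9 : ∀ i', σ₂.nat 9 i' 0 = if i' = k then 1 else σ₁.nat 9 i' 0 := by
          intro i'
          rw [F₂.nat 9 (by decide)]
          simp
        have g3 : σ₂.real 3 = σ₁.real 3 := by
          rw [F₂.real 3 (by decide)]
          rfl
        refine ⟨fun i' hi' => ?_, fun j hj => ?_, fun _ => ⟨?_, k3⟩, fun h => absurd h hzf⟩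
        · rw [k1, g9, if_neg hi']
        · rw [k2 j hj, g3]
        · rw [k1, g9, if_pos rfl]
    · have hzf : σ.nat aZf k e = 0 := by
        have : ¬ 1 ≤ σ.nat aZf k e := by simpa [hv, F₁.nat aZf (by decide)] using hc
        omega
      have hh := i2 i₀ le_rfl
      refine ⟨fun i' hi' => ?_, fun j hj => rfl, fun h => absurd hzf h, fun _ => ⟨?_, ?_⟩⟩
      · simp
      · simpa using hh.1
      · exact hh.2

end Output

/-! ### Correctness of the dynamic program -/

section Correctness

variable {n b m : ℕ} {P : QIB n b m}

namespace QIB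

variable {N : ℕ} (D : RootedDecomposition P.graph N)

/-- The bag of a node of the merge tree. -/
noncomputable def mergeBag (k : ℕ) : Finset (Fin m) :=
  if h : N ≤ k ∧ k - N < b then P.consOf ⟨k - N, h.2⟩ else D.bagN k

/-- The parent of a node of the merge tree. A block is attached to the lowest of the topmost nodes
of its constraints; the bag of this node contains all of them. -/
noncomputable def mergePar (k : ℕ) : ℕ :=
  if k = 0 then N + b
  else if h : k < N then D.par ⟨k, h⟩
  else if h : k - N < b then (P.consOf ⟨k - N, h⟩).sup D.topN else 0

variable {D}

lemma mergeBag_node {k : ℕ} (h : k < N) : mergeBag D k = D.bagN k :=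
  dif_neg fun hcon => absurd hcon.1 (not_le.2 h)

lemma mergeBag_leaf (i : Fin b) : mergeBag D (N + i) = P.consOf i := by
  unfold mergeBag
  rw [dif_pos ⟨Nat.le_add_right _ _, by rw [Nat.add_sub_cancel_left]; exact i.2⟩]
  congr
  simp

lemma mergePar_leaf (i : Fin b) : mergePar D (N + i) = (P.consOf i).sup D.topN := by
  have := D.pos
  unfold mergePar
  rw [if_neg (by omega), dif_neg (by omega), dif_pos (by rw [Nat.add_sub_cancel_left]; exact i.2)]
  congr
  simp

lemma exists_consOf_subset (i : Fin b) : ∃ t < N, P.consOf i ⊆ D.bagN t := by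
  obtain ⟨t, ht⟩ := P.consOf_subset_bag D i
  exact ⟨t, t.2, by rwa [RootedDecomposition.bagN_eq t.2]⟩

lemma eq_leaf_or {k : ℕ} (hk : k < N + b) : k < N ∨ ∃ i : Fin b, k = N + i := by
  by_cases h : k < N
  · exact Or.inl h
  · exact Or.inr ⟨⟨k - N, by omega⟩, by simp only; omega⟩

lemma consOf_subset_mergePar (i : Fin b) {r : Fin m} (hr : r ∈ P.consOf i) :
    r ∈ D.bagN ((P.consOf i).sup D.topN) := by
  obtain ⟨t, -, ht⟩ := exists_consOf_subset (D := D) i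
  obtain ⟨r₀, hr₀, hsup⟩ := Finset.exists_mem_eq_sup (P.consOf i) ⟨r, hr⟩ D.topN
  rw [hsup]
  refine RootedDecomposition.mem_bagN_of_share (ht hr) (ht hr₀) ?_
  rw [← hsup]
  exact Finset.le_sup hr

variable (D) in
/-- The merge tree of an instance. -/
noncomputable def mergeTree (slot : Fin m → ℕ)
    (hinj : ∀ t r r', r ∈ D.bagN t → r' ∈ D.bagN t → slot r = slot r' → r = r') : MergeTree m where
  N := N
  b := b
  pr := mergePar D
  bag := mergeBag D
  top := D.topN
  slot := slot
  pr_zero := if_pos rfl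
  pr_lt k h0 hk := by
    have hpos := D.pos
    rcases eq_leaf_or hk with h | ⟨i, rfl⟩
    · unfold mergePar
      rw [if_neg h0.ne', dif_pos h]
      exact (D.par_spec ⟨k, h⟩ h0).1
    · rw [mergePar_leaf]
      refine lt_of_lt_of_le ((Finset.sup_lt_iff hpos).2 fun r _ => RootedDecomposition.topN_lt r)
        (Nat.le_add_right _ _)
  bag_root := by
    unfold mergeBag
    rw [dif_neg (by omega)]
    exact dif_neg (by omega)
  mem_pr k r hk hr hne := by
    have hpos := D.pos
    rcases eq_leaf_or hk with h | ⟨i, rfl⟩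
    · rw [mergeBag_node h] at hr
      obtain ⟨h0, h1⟩ := RootedDecomposition.mem_bagN_par h hr hne
      refine ⟨h0, ?_⟩
      unfold mergePar
      rw [if_neg h0.ne', dif_pos h, mergeBag_node (D.par ⟨k, h⟩).2]
      exact h1
    · refine ⟨by omega, ?_⟩
      rw [mergeBag_leaf] at hr
      have := consOf_subset_mergePar (D := D) i hr
      rwa [mergePar_leaf, mergeBag_node (RootedDecomposition.lt_of_mem_bagN this)]
  top_le k r hr := by
    by_cases h : N ≤ k
    · exact (RootedDecomposition.topN_lt r).le.trans h
    · rw [mergeBag_node (by omega)] at hr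
      exact RootedDecomposition.topN_le hr
  top_lt r := RootedDecomposition.topN_lt r
  slot_inj k r r' hr hr' h := by
    unfold mergeBag at hr hr'
    split_ifs at hr hr' with hk
    · obtain ⟨t, -, ht⟩ := exists_consOf_subset (D := D) (⟨k - N, hk.2⟩ : Fin b)
      exact hinj t r r' (ht hr) (ht hr') h
    · exact hinj k r r' hr hr' h

end QIB

section Codes

variable {L₁ L₂ K κ : ℕ} {slot : Fin m → ℕ}

/-- The digits of an entry for switching on block `i` whose digits for mixed-integer constraints are
given by `dm`. -/
lemma add_offset_eq (hS : SlotMap P L₁ L₂ slot)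
    (hκ : ∀ r, ¬ P.IsMixed r → (P.blocksOf r).card ≤ κ) (i : Fin b) {e : ℕ}
    (he : e < digitWeight (slotRange L₁ K κ) L₁) :
    e + offset P L₁ L₂ K κ slot i < digitWeight (slotRange L₁ K κ) (L₁ + L₂) ∧
    (∀ c < L₁, digit (slotRange L₁ K κ) (e + offset P L₁ L₂ K κ slot i) c
      = digit (slotRange L₁ K κ) e c) ∧
    ∀ c, L₁ ≤ c → c < L₁ + L₂ →
      digit (slotRange L₁ K κ) (e + offset P L₁ L₂ K κ slot i) c = offsetDigit P κ slot i c := by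
  set O := slotRange L₁ K κ with hO
  set d : ℕ → ℕ := fun c => if c < L₁ then digit O e c else offsetDigit P κ slot i c with hd
  have hdle : ∀ c < L₁ + L₂, d c ≤ 2 * O c := by
    intro c _
    by_cases h : c < L₁
    · simp only [hd, if_pos h]
      exact digit_le O e c
    · simp only [hd, if_neg h, hO, slotRange]
      exact offsetDigit_le hκ hS (not_lt.1 h)
  have hcode : e + offset P L₁ L₂ K κ slot i = codeOf O (L₁ + L₂) d := by
    unfold codeOf
    rw [Finset.sum_range_add]
    congr 1
    · rw [← Nat.mod_eq_of_lt he, ← codeOf_digit]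
      refine Finset.sum_congr rfl fun c hc => ?_
      simp only [hd, if_pos (Finset.mem_range.1 hc)]
    · refine Finset.sum_congr rfl fun c _ => ?_
      simp [hd, hO]
  rw [hcode]
  refine ⟨codeOf_lt O hdle, fun c hc => ?_, fun c hc hc' => ?_⟩
  · rw [digit_codeOf O hdle (by omega)]
    simp [hd, hc]
  · rw [digit_codeOf O hdle hc']
    simp [hd, not_lt.2 hc]

lemma entryRhs_congr (hS : SlotMap P L₁ L₂ slot) {ε : ℝ} (i : Fin b) {e e' : ℕ}
    (h : ∀ c < L₁, digit (slotRange L₁ K κ) e c = digit (slotRange L₁ K κ) e' c) :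
    entryRhs P L₁ K κ ε slot i e = entryRhs P L₁ K κ ε slot i e' := by
  funext r
  unfold entryRhs
  rw [h _ (hS.mixed r (QIB.mem_rows.1 r.2).1)]

lemma entry_offset (hS : SlotMap P L₁ L₂ slot)
    (hκ : ∀ r, ¬ P.IsMixed r → (P.blocksOf r).card ≤ κ) {i : Fin b} {e : ℕ}
    (he : e < digitWeight (slotRange L₁ K κ) L₁) {r : Fin m} (hr : r ∈ P.consOf i)
    (hm : ¬ P.IsMixed r) :
    (entry (slotRange L₁ K κ) (e + offset P L₁ L₂ K κ slot i) (slot r) : ℝ) = (P.con r).v i := by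
  have hc := hS.comb r hm
  have h1 := hκ r hm
  have h2 : 0 < (P.blocksOf r).card :=
    Finset.card_pos.2 ⟨i, QIB.mem_blocksOf.2 (QIB.mem_consOf.1 hr)⟩
  unfold entry
  rw [(add_offset_eq hS hκ i he).2.2 _ hc.1 hc.2, offsetDigit_eq hS hr rfl]
  have hO : slotRange L₁ K κ (slot r) = κ := if_neg (not_lt.2 hc.1)
  rw [hO]
  rcases P.con_comb r hm i with h | h | h <;> rw [h] <;> norm_num
  rw [Nat.cast_sub (by omega)]
  simp

end Codes

section Solution

variable {S : P.Solver} {N L₁ L₂ K κ : ℕ} {ε : ℝ} {slot : Fin m → ℕ}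
  {D : RootedDecomposition P.graph N} {FL ZF B₁ B₂ : ℕ → ℕ → ℕ} {WT : ℕ → ℕ → ℝ}

lemma slotUnit_pos (hε : 0 < ε) (c : ℕ) : 0 < slotUnit L₁ ε c := by
  unfold slotUnit
  split_ifs
  · exact hε
  · exact one_pos

/-- The consumptions of a set of blocks fit into the range of the digits. -/
lemma abs_sum_blockEval_le (hP : P.Scaled) (hS : SlotMap P L₁ L₂ slot)
    (hκ : ∀ r, ¬ P.IsMixed r → (P.blocksOf r).card ≤ κ) (hK : 1 < K * ε) {x : Fin n → ℝ}
    (hx : ∀ j, 0 ≤ x j ∧ x j ≤ 1) (z : Fin b → ℝ) (r : Fin m) (A : Finset (Fin b)) :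
    |∑ i ∈ A, if r ∈ P.consOf i then
        (if z i = 1 then (P.con r).blockEval i (fun j => x j) else 0) else 0|
      ≤ slotUnit L₁ ε (slot r) * slotRange L₁ K κ (slot r) := by
  have habs : |∑ i ∈ A, if r ∈ P.consOf i then
        (if z i = 1 then (P.con r).blockEval i (fun j => x j) else 0) else 0|
      ≤ ∑ i, if r ∈ P.consOf i then |(P.con r).blockEval i (fun j => x j)| else 0 := by
    refine (Finset.abs_sum_le_sum_abs _ _).trans ((Finset.sum_le_sum fun i _ => ?_).trans
      (Finset.sum_le_sum_of_subset_of_nonneg (Finset.subset_univ A) fun i _ _ => ?_))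
    · split_ifs <;> simp
    · split_ifs
      · exact abs_nonneg _
      · exact le_rfl
  refine habs.trans ?_
  by_cases hm : P.IsMixed r
  · have hslot := hS.mixed r hm
    simp only [slotUnit, slotRange, if_pos hslot]
    have hsum : ∑ i, (if r ∈ P.consOf i then |(P.con r).blockEval i (fun j => x j)| else 0)
        ≤ ∑ i, (P.con r).blockWeight i := by
      refine Finset.sum_le_sum fun i _ => ?_
      have h := (P.con r).abs_blockEval_le (P.con_d_nonneg r) i (fun j => x j) fun j => hx j
      split_ifs
      · exact h
      · exact (abs_nonneg _).trans h
    rw [(P.con r).sum_blockWeight, hP.2 r hm] at hsum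
    linarith
  · have hslot := hS.comb r hm
    simp only [slotUnit, slotRange, if_neg (not_lt.2 hslot.1), one_mul]
    refine le_trans (le_of_eq_of_le (Finset.sum_ite _ _) ?_)
      (Nat.cast_le (α := ℝ).2 (hκ r hm))
    rw [Finset.sum_const_zero, add_zero]
    have hfil : (Finset.univ.filter fun i => r ∈ P.consOf i) = P.blocksOf r := by
      ext i
      simp [QIB.mem_consOf, QIB.mem_blocksOf]
    rw [hfil]
    refine (Finset.sum_le_card_nsmul _ _ 1 fun i _ => ?_).trans (by simp)
    rw [(P.con r).blockEval_of_not_hasContinuous hm]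
    rcases P.con_comb r hm i with h | h | h <;> rw [h] <;> norm_num

variable {hinj : ∀ t r r', r ∈ D.bagN t → r' ∈ D.bagN t → slot r = slot r' → r = r'}

/-- The entry of a block for a feasible solution in which the block is switched on. -/
lemma exists_on_entry (hP : P.Scaled) (hS : SlotMap P L₁ L₂ slot)
    (hκ : ∀ r, ¬ P.IsMixed r → (P.blocksOf r).card ≤ κ) (hε : 0 < ε) (hK : 1 < K * ε)
    (hE : S.Exact) {i : Fin b}
    (hB : BlockTable S L₁ L₂ K κ ε slot i (FL (N + i)) (ZF i) (WT (N + i))) {x : Fin n → ℝ}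
    (hx : ∀ j, 0 ≤ x j ∧ x j ≤ 1) :
    ∃ e < digitWeight (slotRange L₁ K κ) (L₁ + L₂), FL (N + i) e ≠ 0 ∧
      WT (N + i) e ≤ P.obj.blockEval i (fun j => x j) ∧
      (∀ r ∈ P.consOf i, slotUnit L₁ ε (slot r) * entry (slotRange L₁ K κ) e (slot r)
        ≤ (P.con r).blockEval i (fun j => x j)) ∧
      ∀ c < L₁ + L₂, (∀ r ∈ P.consOf i, slot r ≠ c) → entry (slotRange L₁ K κ) e c = 0 := by
  classical
  set O := slotRange L₁ K κ with hO
  set f : Fin m → ℤ := fun r => ⌊(P.con r).blockEval i (fun j => x j) / ε⌋ with hf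
  -- the digits round the consumptions of mixed-integer constraints down to multiples of `ε`
  set d : ℕ → ℕ := fun c =>
    if h : ∃ r ∈ P.consOf i, P.IsMixed r ∧ slot r = c then (f h.choose + K).toNat else K with hd
  have hdr : ∀ r ∈ P.consOf i, P.IsMixed r → d (slot r) = (f r + K).toNat := by
    intro r hr hm
    have h : ∃ r' ∈ P.consOf i, P.IsMixed r' ∧ slot r' = slot r := ⟨r, hr, hm, rfl⟩
    simp only [hd, dif_pos h]
    rw [hS.inj i _ h.choose_spec.1 r hr h.choose_spec.2.2]
  have hfb : ∀ r, P.IsMixed r → -(K : ℤ) ≤ f r ∧ f r ≤ K := by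
    intro r hm
    have h1 := (P.con r).abs_blockEval_le (P.con_d_nonneg r) i (fun j => x j) fun j => hx j
    have h2 : (P.con r).blockWeight i ≤ 1 := by
      rw [← hP.2 r hm, ← (P.con r).sum_blockWeight]
      refine Finset.single_le_sum (f := fun i => (P.con r).blockWeight i) (fun i' _ => ?_)
        (Finset.mem_univ i)
      exact (abs_nonneg _).trans ((P.con r).abs_blockEval_le (P.con_d_nonneg r) i' (fun j => x j)
        fun j => hx j)
    have h3 := abs_le.1 ((h1.trans h2).trans hK.le)
    constructor
    · rw [Int.le_floor, le_div_iff₀ hε]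
      push_cast
      linarith [h3.1]
    · have h4 : (f r : ℝ) ≤ K := (Int.floor_le _).trans ((div_le_iff₀ hε).2 h3.2)
      exact_mod_cast h4
  have hdle : ∀ c < L₁, d c ≤ 2 * O c := by
    intro c hc
    have hOc : O c = K := if_pos hc
    rw [hOc]
    by_cases h : ∃ r ∈ P.consOf i, P.IsMixed r ∧ slot r = c
    · obtain ⟨r, hr, hm, rfl⟩ := h
      rw [hdr r hr hm]
      have := hfb r hm
      omega
    · simp only [hd, dif_neg h]
      omega
  set e := codeOf O L₁ d with he
  have helt : e < digitWeight O L₁ := codeOf_lt O hdle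
  have hdig : ∀ c < L₁, digit O e c = d c := fun c hc => digit_codeOf O hdle hc
  have hentry : ∀ r ∈ P.consOf i, P.IsMixed r → (digit O e (slot r) : ℝ) - K = f r := by
    intro r hr hm
    rw [hdig _ (hS.mixed r hm), hdr r hr hm]
    have h1 := (hfb r hm).1
    have h2 : (((f r + K).toNat : ℤ) : ℝ) = ((f r + K : ℤ) : ℝ) := by
      rw [Int.toNat_of_nonneg (by omega)]
    push_cast at h2
    linarith
  -- rounding down loses less than the unit by which the right-hand sides exceed the entry
  have hfeas : P.BlockFeasible i (entryRhs P L₁ K κ ε slot i e) (fun j => x j) := by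
    refine ⟨fun r => ?_, fun j => ?_⟩
    · have hr := QIB.mem_rows.1 r.2
      unfold entryRhs
      rw [← hO, hentry r (QIB.mem_consOf.2 hr.2) hr.1]
      have := (div_lt_iff₀ hε).1 (Int.lt_floor_add_one ((P.con r).blockEval i (fun j => x j) / ε))
      rw [mul_comm]
      exact this.le
    · rw [(hP.1 j).1, (hP.1 j).2]
      exact hx j
  obtain ⟨k1, k2, k3⟩ := add_offset_eq (L₂ := L₂) (K := K) hS hκ i helt
  rw [← hO] at k1 k2 k3
  cases hsol : S i (entryRhs P L₁ K κ ε slot i e) with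
  | none => exact absurd hfeas ((hE i _).2 hsol _)
  | some y =>
    obtain ⟨h1, h2⟩ := hB.on e helt y hsol
    refine ⟨_, k1, h1, h2.trans (((hE i _).1 y hsol).2 _ hfeas), fun r hr => ?_, fun c hc hcr => ?_⟩
    · by_cases hm : P.IsMixed r
      · have hs := hS.mixed r hm
        unfold entry
        rw [k2 _ hs]
        have hOr : O (slot r) = K := if_pos hs
        rw [hOr]
        push_cast
        rw [hentry r hr hm]
        simp only [slotUnit, if_pos hs]
        rw [mul_comm]
        exact (le_div_iff₀ hε).1 (Int.floor_le _)
      · have hs := hS.comb r hm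
        rw [hO, entry_offset hS hκ helt hr hm, (P.con r).blockEval_of_not_hasContinuous hm]
        simp [slotUnit, not_lt.2 hs.1]
    · unfold entry
      by_cases hc1 : c < L₁
      · have hOc : O c = K := if_pos hc1
        rw [k2 c hc1, hdig c hc1, hOc]
        have h : ¬ ∃ r ∈ P.consOf i, P.IsMixed r ∧ slot r = c := by
          rintro ⟨r, hr, -, h⟩
          exact hcr r hr h
        simp [hd, dif_neg h]
      · have hOc : O c = κ := if_neg hc1
        rw [k3 c (not_lt.1 hc1) hc, offsetDigit_of_empty hcr, hOc, sub_self]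

/-- Every feasible solution is represented by the final entry. -/
lemma final_le_of_feasible (hP : P.Scaled) (hS : SlotMap P L₁ L₂ slot)
    (hκ : ∀ r, ¬ P.IsMixed r → (P.blocksOf r).card ≤ κ) (hε : 0 < ε) (hK : 1 < K * ε)
    (hE : S.Exact)
    (hT : (QIB.mergeTree D slot hinj).IsTable (slotRange L₁ K κ) (L₁ + L₂) (slotUnit L₁ ε) P.rhs
      FL WT B₁ B₂)
    (hB : ∀ i : Fin b, BlockTable S L₁ L₂ K κ ε slot i (FL (N + i)) (ZF i) (WT (N + i)))
    {x : Fin n → ℝ} {z : Fin b → ℝ} (hxz : P.Feasible x z) :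
    FL ((QIB.mergeTree D slot hinj).ver (N + b) (N + b))
        (codeOf (slotRange L₁ K κ) (L₁ + L₂) (slotRange L₁ K κ)) ≠ 0 ∧
      WT ((QIB.mergeTree D slot hinj).ver (N + b) (N + b))
        (codeOf (slotRange L₁ K κ) (L₁ + L₂) (slotRange L₁ K κ)) ≤ P.obj.eval x z := by
  obtain ⟨⟨hbd, hz, hxz0⟩, hcon⟩ := hxz
  have hx : ∀ j, 0 ≤ x j ∧ x j ≤ 1 := fun j => by
    have := hbd j
    rwa [(hP.1 j).1, (hP.1 j).2] at this
  have hbag : ∀ i : Fin b, (QIB.mergeTree D slot hinj).bag (N + i) = P.consOf i :=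
    fun i => QIB.mergeBag_leaf i
  have hlt : ∀ r, slot r < L₁ + L₂ := fun r => by
    by_cases hm : P.IsMixed r
    · have := hS.mixed r hm
      omega
    · exact (hS.comb r hm).2
  rw [P.obj.eval_eq_sum x z hz hxz0]
  refine hT.final_entry hlt
    (fun i r => if z i = 1 then (P.con r).blockEval i (fun j => x j) else 0)
    (fun i => if z i = 1 then P.obj.blockEval i (fun j => x j) else 0) (slotUnit_pos hε) ?_ ?_ ?_
  · intro r A
    have h := abs_sum_blockEval_le hP hS hκ hK hx z r A
    refine le_of_eq_of_le ?_ h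
    congr 1
    refine Finset.sum_congr rfl fun i _ => ?_
    rw [show (QIB.mergeTree D slot hinj).bag ((QIB.mergeTree D slot hinj).N + i) = P.consOf i from
      hbag i]
  · intro r
    refine le_of_eq_of_le ?_ (hcon r)
    rw [(P.con r).eval_eq_sum x z hz hxz0]
    refine Finset.sum_congr rfl fun i _ => ?_
    rw [show (QIB.mergeTree D slot hinj).bag ((QIB.mergeTree D slot hinj).N + i) = P.consOf i from
      hbag i]
    by_cases hr : r ∈ P.consOf i
    · rw [if_pos hr]
    · rw [if_neg hr, (P.con r).blockEval_of_not_incident (P.con_d_nonneg r)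
        fun h => hr (QIB.mem_consOf.2 h), ite_self]
  · intro i
    rw [show (QIB.mergeTree D slot hinj).bag ((QIB.mergeTree D slot hinj).N + i) = P.consOf i from
      hbag i]
    by_cases hi : z i = 1
    · simp only [if_pos hi]
      exact exists_on_entry hP hS hκ hε hK hE (hB i) hx
    · simp only [if_neg hi]
      refine ⟨_, codeOf_self_lt _ _, (hB i).off.1, (hB i).off.2, fun r _ => ?_, fun c hc _ =>
        entry_codeOf_self _ hc⟩
      rw [show (QIB.mergeTree D slot hinj).slot r = slot r from rfl, entry_codeOf_self _ (hlt r)]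
      simp

/-- The traced entries give a solution. -/
lemma approxSolution_of_trace (hP : P.Scaled) (hS : SlotMap P L₁ L₂ slot)
    (hκ : ∀ r, ¬ P.IsMixed r → (P.blocksOf r).card ≤ κ) (hε : 0 < ε) (hK : 1 < K * ε)
    (hE : S.Exact)
    (hT : (QIB.mergeTree D slot hinj).IsTable (slotRange L₁ K κ) (L₁ + L₂) (slotUnit L₁ ε) P.rhs
      FL WT B₁ B₂)
    (hB : ∀ i : Fin b, BlockTable S L₁ L₂ K κ ε slot i (FL (N + i)) (ZF i) (WT (N + i)))
    (hfin : FL ((QIB.mergeTree D slot hinj).ver (N + b) (N + b))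
      (codeOf (slotRange L₁ K κ) (L₁ + L₂) (slotRange L₁ K κ)) ≠ 0)
    {E : Fin b → ℕ} (hEt : ∀ i, E i = (QIB.mergeTree D slot hinj).trace (slotRange L₁ K κ) (L₁ + L₂)
      B₁ B₂ (N + b) (N + i)) {x : Fin n → ℝ} {z : Fin b → ℝ}
    (hon : ∀ i : Fin b, ZF i (E i) ≠ 0 → z i = 1 ∧
      ∀ y, S i (entryRhs P L₁ K κ ε slot i (E i)) = some y → ∀ j : {j // P.blk j = i}, x j = y j)
    (hoff : ∀ i : Fin b, ZF i (E i) = 0 → z i = 0 ∧ ∀ j, P.blk j = i → x j = 0) :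
    P.ApproxSolution (P.maxBlocks * ε) x z := by
  classical
  set T := QIB.mergeTree D slot hinj with hTdef
  set O := slotRange L₁ K κ with hO
  have hbag : ∀ i : Fin b, T.bag (N + i) = P.consOf i := fun i => QIB.mergeBag_leaf i
  have hlt : ∀ r, slot r < L₁ + L₂ := fun r => by
    by_cases hm : P.IsMixed r
    · have := hS.mixed r hm
      omega
    · exact (hS.comb r hm).2
  have hflag : ∀ i : Fin b, FL (N + i) (E i) ≠ 0 := by
    intro i
    have h := hT.flag_trace hfin (N + b) le_rfl (N + i) (Or.inl (by have := i.2; omega))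
    rw [show T.M - (N + b) = 0 from Nat.sub_self _] at h
    rw [hEt]
    exact h
  -- the solution on one block
  have hblock : ∀ i : Fin b, (z i = 0 ∧ (∀ j, P.blk j = i → x j = 0) ∧ WT (N + i) (E i) = 0 ∧
      ∀ c < L₁ + L₂, entry O (E i) c = 0) ∨
      (z i = 1 ∧ P.BlockFeasible i (entryRhs P L₁ K κ ε slot i (E i)) (fun j => x j) ∧
        WT (N + i) (E i) = P.obj.blockEval i (fun j => x j) ∧
        ∀ r ∈ P.consOf i, ¬ P.IsMixed r → (entry O (E i) (slot r) : ℝ) = (P.con r).v i) := by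
    intro i
    rcases (hB i).sound _ (hflag i) with ⟨h1, h2, h3⟩ | ⟨h1, e, he, h3, y, hy, h4⟩
    · obtain ⟨k1, k2⟩ := hoff i h1
      refine Or.inl ⟨k1, k2, h2, fun c hc => ?_⟩
      rw [h3]
      exact entry_codeOf_self O hc
    · obtain ⟨k1, k2⟩ := hon i h1
      have hrhs : entryRhs P L₁ K κ ε slot i (E i) = entryRhs P L₁ K κ ε slot i e := by
        rw [h3]
        exact entryRhs_congr hS i (add_offset_eq hS hκ i he).2.1
      have hxy : (fun j : {j // P.blk j = i} => x j) = y := funext (k2 y (by rw [hrhs, hy]))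
      refine Or.inr ⟨k1, ?_, ?_, fun r hr hm => ?_⟩
      · rw [hxy, hrhs]
        exact ((hE i _).1 y hy).1
      · rw [hxy, h4]
      · rw [h3]
        exact entry_offset hS hκ he hr hm
  have hz : ∀ i, z i = 0 ∨ z i = 1 := fun i => (hblock i).imp (fun h => h.1) fun h => h.1
  have hx0 : ∀ j, z (P.blk j) = 0 → x j = 0 := by
    intro j hj
    rcases hblock (P.blk j) with h | h
    · exact h.2.1 j rfl
    · rw [hj] at h
      exact absurd h.1 (by norm_num)
  have hcost : P.obj.eval x z = WT (T.ver (N + b) (N + b)) (codeOf O (L₁ + L₂) O) := by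
    rw [P.obj.eval_eq_sum x z hz hx0]
    refine Eq.trans ?_ (hT.cost_trace_last hfin).symm
    refine Finset.sum_congr rfl fun i _ => ?_
    refine Eq.trans ?_ (congrArg (WT (N + i)) (hEt i))
    rcases hblock i with h | h
    · rw [h.1, h.2.2.1]
      simp
    · rw [h.1, h.2.2.1, if_pos rfl]
  -- the consumptions exceed the traced entries by at most one unit, and not at all for
  -- combinatorial constraints
  have hterm : ∀ r i, (if z i = 1 then (P.con r).blockEval i (fun j => x j) else 0)
      ≤ (if r ∈ P.consOf i then slotUnit L₁ ε (slot r) * (entry O (E i) (slot r) : ℝ) else 0)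
        + if P.IsMixed r ∧ r ∈ P.consOf i then ε else 0 := by
    intro r i
    by_cases hr : r ∈ P.consOf i
    · rw [if_pos hr]
      rcases hblock i with h | h
      · rw [h.1, h.2.2.2 _ (hlt r), if_neg (by norm_num)]
        split_ifs <;> simp [hε.le]
      · rw [if_pos h.1]
        by_cases hm : P.IsMixed r
        · have hrow : r ∈ P.rows i := QIB.mem_rows.2 ⟨hm, QIB.mem_consOf.1 hr⟩
          have h5 := h.2.1.1 ⟨r, hrow⟩
          have hs := hS.mixed r hm
          have hOr : O (slot r) = K := if_pos hs
          rw [if_pos ⟨hm, hr⟩]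
          refine h5.trans (le_of_eq ?_)
          simp only [entryRhs, slotUnit, if_pos hs, entry, hOr]
          push_cast
          ring
        · have hs := hS.comb r hm
          rw [h.2.2.2 r hr hm, (P.con r).blockEval_of_not_hasContinuous hm]
          simp [slotUnit, not_lt.2 hs.1, hm]
    · have h0 := (P.con r).blockEval_of_not_incident (P.con_d_nonneg r)
        (fun h => hr (QIB.mem_consOf.2 h)) (fun j : {j // P.blk j = i} => x j)
      simp [h0, hr]
  have hsum : ∀ r, (P.con r).eval x z
      ≤ P.rhs r + ∑ i, if P.IsMixed r ∧ r ∈ P.consOf i then ε else 0 := by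
    intro r
    rw [(P.con r).eval_eq_sum x z hz hx0]
    refine (Finset.sum_le_sum fun i _ => hterm r i).trans ?_
    rw [Finset.sum_add_distrib]
    refine add_le_add ?_ le_rfl
    have htop : r ∈ T.bag (T.top r) := by
      change r ∈ QIB.mergeBag D (D.topN r)
      rw [QIB.mergeBag_node (RootedDecomposition.topN_lt r)]
      exact RootedDecomposition.mem_bagN_topN r
    have h := hT.sum_entry_trace_le hfin (fun c => (slotUnit_pos hε c).le) r (hlt r) htop
    refine le_of_eq_of_le (Finset.sum_congr rfl fun i _ => ?_) h
    rw [hEt i]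
    rw [show T.bag (T.N + i) = P.consOf i from hbag i]
    rfl
  refine ⟨fun x' z' hf => ?_, ⟨fun j => ?_, hz, hx0⟩, fun r hm => ?_, fun r hm => ?_⟩
  · rw [hcost]
    exact (final_le_of_feasible hP hS hκ hε hK hE hT hB hf).2
  · rcases hblock (P.blk j) with h | h
    · rw [h.2.1 j rfl, (hP.1 j).1, (hP.1 j).2]
      norm_num
    · exact h.2.1.2 ⟨j, rfl⟩
  · refine (hsum r).trans (le_of_eq ?_)
    simp [hm]
  · refine (hsum r).trans (add_le_add le_rfl ?_)
    have hfil : (Finset.univ.filter fun i => P.IsMixed r ∧ r ∈ P.consOf i) = P.blocksOf r := by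
      ext i
      simp [QIB.mem_consOf, QIB.mem_blocksOf, hm]
    rw [← Finset.sum_filter, hfil, Finset.sum_const, nsmul_eq_mul]
    refine mul_le_mul_of_nonneg_right (Nat.cast_le.2 ?_) hε.le
    exact Finset.le_sup (f := fun r => (P.blocksOf r).card) (Finset.mem_univ r)

end Solution

end Correctness

/-! ### From the tables to the output -/

section Assembly

variable {n b m : ℕ} {P : QIB n b m} {S : P.Solver} {N L₁ L₂ K κ : ℕ} {ε : ℝ} {slot : Fin m → ℕ}
  {D : RootedDecomposition P.graph N} {σ σ' : Store}

/-- The arrays for the tables and for the output have not been used. -/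
structure Blank (σ : Store) : Prop where
  nat : ∀ a ∈ [8, 9, aFl, aCur], ∀ i k, σ.nat a i k = 0
  real : ∀ a ∈ [3, rWT], ∀ i k, σ.real a i k = 0

lemma Blank.congr {p : Cmd} (h : Blank σ) (h' : Frame p σ σ')
    (hn : ∀ a ∈ [8, 9, aFl, aCur], a ∉ p.natWrites) (hr : ∀ a ∈ [3, rWT], a ∉ p.realWrites) :
    Blank σ' :=
  ⟨fun a ha i k => by rw [h'.nat a (hn a ha)]; exact h.nat a ha i k,
    fun a ha i k => by rw [h'.real a (hr a ha)]; exact h.real a ha i k⟩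

/-- What the algorithm has to achieve. -/
def Correct (P : QIB n b m) (ε : ℝ) (σ : Store) : Prop :=
  (σ.answer = 0 ∧ ¬ ∃ x z, P.Feasible x z) ∨
    (σ.answer = 1 ∧ P.ApproxSolution (P.maxBlocks * ε) (σ.outX n) (σ.outZ b))

lemma BlockTable.lt (hS : SlotMap P L₁ L₂ slot)
    (hκ : ∀ r, ¬ P.IsMixed r → (P.blocksOf r).card ≤ κ) {i : Fin b} {FL ZF : ℕ → ℕ} {WT : ℕ → ℝ}
    (h : BlockTable S L₁ L₂ K κ ε slot i FL ZF WT) {x : ℕ} (hx : FL x ≠ 0) :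
    x < digitWeight (slotRange L₁ K κ) (L₁ + L₂) := by
  rcases h.sound x hx with h | ⟨-, e, he, rfl, -⟩
  · rw [h.2.2]
    exact codeOf_self_lt _ _
  · exact (add_offset_eq hS hκ i he).1

lemma runs_tables (hP : P.Scaled) (hS : SlotMap P L₁ L₂ slot)
    (hκ : ∀ r, ¬ P.IsMixed r → (P.blocksOf r).card ≤ κ) (hε : 0 < ε) (hK : 1 < K * ε)
    (hE : S.Exact)
    {hinj : ∀ t r r', r ∈ D.bagN t → r' ∈ D.bagN t → slot r = slot r' → r = r'}
    (hσ : Ready P N L₁ L₂ K κ ε slot σ)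
    (hM : MergeReady (QIB.mergeTree D slot hinj) (slotRange L₁ K κ) (L₁ + L₂) (slotUnit L₁ ε)
      P.rhs σ) (hblank : Blank σ) {d d₁ : ℕ}
    (hd : digitWeight (slotRange L₁ K κ) (L₁ + L₂) = d)
    (hd₁ : digitWeight (slotRange L₁ K κ) L₁ = d₁) :
    Runs S (.block [progInit, progMerge, progFinish]) σ
      ((b * (d₁ * (L₁ * 4 + 11) + L₂ * 8 + 15) + (N + b) * 6 + 11)
        + ((N + b) * (d * (d * ((L₁ + L₂) * 12 + 17) + 5) + 10) + 2)
        + ((N + b) * 7 + b * (L₁ * 4 + 10) + 10)) (b * d₁ + b) (Correct P ε) := by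
  subst hd hd₁
  set T := QIB.mergeTree D slot hinj with hT
  have hlt : ∀ r, T.slot r < L₁ + L₂ := fun r => by
    by_cases h : P.IsMixed r
    · have := hS.mixed r h
      change slot r < _
      omega
    · exact (hS.comb r h).2
  have hTM : T.M = N + b := rfl
  refine (Runs.cons (q₂ := b) (runs_init hS hκ hσ (hblank.nat aFl (by decide))
    (hblank.real rWT (by decide))) fun σ₁ F₁ ⟨I₁, I₂, I₃, I₄⟩ => ?_).mono
      (t := (b * (digitWeight (slotRange L₁ K κ) L₁ * (L₁ * 4 + 11) + L₂ * 8 + 15)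
          + (N + b) * 6 + 11)
        + (((N + b) * (digitWeight (slotRange L₁ K κ) (L₁ + L₂) *
          (digitWeight (slotRange L₁ K κ) (L₁ + L₂) * ((L₁ + L₂) * 12 + 17) + 5) + 10) + 2)
        + ((N + b) * 7 + b * (L₁ * 4 + 10) + 10))) (by omega) le_rfl fun _ _ h => h
  have S₁ : SameStatic σ σ₁ := F₁.same (by decide) (by decide)
  have hM₁ := hM.congr S₁
  refine Runs.cons' (runs_merge hM₁ hlt I₁ I₂ I₄) fun σ₂ F₂ ⟨J₁, J₂, J₃⟩ => ?_
  have S₂ : SameStatic σ₁ σ₂ := F₂.same (by decide) (by decide)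
  have hM₂ := hM₁.congr S₂
  have hσ₂ := hσ.congr (S₁.trans S₂)
  have hblocks : ∀ i : Fin b, BlockTable S L₁ L₂ K κ ε slot i (σ₂.nat aFl (N + i)) (σ₂.nat aZf i)
      (σ₂.real rWT (N + i)) := fun i => by
    have h := J₃ (N + i) (by rw [hTM]; have := i.2; omega)
    rw [h.1, h.2, F₂.nat aZf (by decide)]
    exact I₃ i
  have hnat₂ : ∀ a ∈ [8, 9, aCur], ∀ i k, σ₂.nat a i k = 0 := fun a ha i k => by
    rw [F₂.nat a (by revert a; decide), F₁.nat a (by revert a; decide)]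
    exact hblank.nat a (by revert a; decide) i k
  have hreal₂ : ∀ i k, σ₂.real 3 i k = 0 := fun i k => by
    rw [F₂.real 3 (by decide), F₁.real 3 (by decide)]
    exact hblank.real 3 (by decide) i k
  have hfinal : σ₂.nat aFl (σ₂.nat aVer (N + b) 0) (σ₂.nat vZ0 0 0)
      = σ₂.nat aFl (T.ver (N + b) (N + b)) (codeOf (slotRange L₁ K κ) (L₁ + L₂)
        (slotRange L₁ K κ)) := by
    rw [J₂ (N + b) le_rfl, hM₂.radix.zero, hTM]
  have hN₂ := hσ₂.nodes
  have hb₂ := hσ₂.blocks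
  refine (Runs.cons (t₁ := (N + b) * 7 + b * (L₁ * 4 + 10) + 9) (t₂ := 1) (q₁ := b) (q₂ := 0)
    (Ψ := Correct P ε) (Runs.ite (t := (N + b) * 7 + b * (L₁ * 4 + 10) + 8) (fun hc => ?_)
      fun hc => ?_) fun σ₃ _ h => Runs.nil h).mono le_rfl le_rfl fun _ _ h => h
  · simp only [Test.holds_natLE, NExp.eval_get, NExp.eval_add, NExp.eval_lit, NExp.eval_zero,
      NExp.eval_one, NExp.eval_two, NExp.eval_three, hN₂, hb₂, hfinal] at hc
    have hfin : σ₂.nat aFl (T.ver (N + b) (N + b)) (codeOf (slotRange L₁ K κ) (L₁ + L₂)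
        (slotRange L₁ K κ)) ≠ 0 := by omega
    refine (Runs.cons_setNat_eq (t := (N + b) * 7 + b * (L₁ * 4 + 10) + 7) (i' := 0) (k' := 0)
      (x := 1) rfl rfl rfl ?_).mono le_rfl le_rfl fun _ _ h => h
    have S₃ : SameStatic σ₂ (σ₂.setNat 8 0 0 1) := sameStatic_setNat σ₂ (by decide) 0 0 1
    refine (Runs.cons' (t₂ := b * (L₁ * 4 + 10) + 3) (runs_trace (hM₂.congr S₃) fun j => ?_)
      fun σ₄ F₄ K₄ => ?_).mono (q := b) (by rw [hTM]; omega) le_rfl fun _ _ h => h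
    · rw [σ₂.setNat_nat_of_ne (by decide)]
      exact hnat₂ aCur (by decide) j 0
    have S₄ : SameStatic (σ₂.setNat 8 0 0 1) σ₄ := F₄.same (by decide) (by decide)
    have hK₄ : ∀ j, σ₄.nat aCur j 0 = T.trace (slotRange L₁ K κ) (L₁ + L₂) (σ₂.nat aB1)
        (σ₂.nat aB2) T.M j := K₄
    have h4 : ∀ a ∈ [9, aZf], σ₄.nat a = σ₂.nat a := fun a ha => by
      rw [F₄.nat a (by revert a; decide), σ₂.setNat_nat_of_ne (by revert a; decide)]
    have hflag : ∀ i : Fin b, σ₂.nat aFl (N + i) (T.trace (slotRange L₁ K κ) (L₁ + L₂)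
        (σ₂.nat aB1) (σ₂.nat aB2) T.M (N + i)) ≠ 0 := fun i => by
      have h := J₁.flag_trace hfin T.M le_rfl (N + i) (Or.inl (by rw [hTM]; have := i.2; omega))
      rwa [Nat.sub_self] at h
    refine (Runs.cons (t₂ := 1) (q₁ := b) (q₂ := 0) (runs_output hS (hσ₂.congr (S₃.trans S₄))
      (fun i => ?_) (fun i => ?_) fun j => ?_) fun σ₅ F₅ ⟨K₅, K₆⟩ => Runs.nil (Or.inr ⟨?_, ?_⟩)).mono
        le_rfl le_rfl fun _ _ h => h
    · rw [hK₄]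
      exact (hblocks i).lt hS hκ (hflag i)
    · rw [h4 9 (by decide)]
      exact hnat₂ 9 (by decide) i 0
    · rw [F₄.real 3 (by decide)]
      exact hreal₂ j 0
    · change σ₅.nat 8 0 0 = 1
      rw [K₅ 8 (by decide) (by decide), F₄.nat 8 (by decide)]
      simp [Store.setNat]
    · refine approxSolution_of_trace hP hS hκ hε hK hE J₁ hblocks hfin
        (E := fun i => σ₄.nat aCur (N + i) 0) (fun i => hK₄ _) (fun i hi => ?_) fun i hi => ?_
      · rw [← h4 aZf (by decide)] at hi
        refine ⟨?_, fun y hy j => ((K₆ i).1 hi).2 y hy j⟩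
        change ((σ₅.nat 9 i 0 : ℕ) : ℝ) = 1
        rw [((K₆ i).1 hi).1, Nat.cast_one]
      · rw [← h4 aZf (by decide)] at hi
        refine ⟨?_, fun j hj => ((K₆ i).2 hi).2 j hj⟩
        change ((σ₅.nat 9 i 0 : ℕ) : ℝ) = 0
        rw [((K₆ i).2 hi).1, Nat.cast_zero]
  · simp only [Test.holds_natLE, NExp.eval_get, NExp.eval_add, NExp.eval_lit, NExp.eval_zero,
      NExp.eval_one, NExp.eval_two, NExp.eval_three, hN₂, hb₂, hfinal] at hc
    refine (Runs.skip (t := 0) (Or.inl ⟨hnat₂ 8 (by decide) 0 0, ?_⟩)).mono (q := 0)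
      (by omega) (by omega) fun _ _ h => h
    rintro ⟨x, z, hxz⟩
    exact (final_le_of_feasible hP hS hκ hε hK hE J₁ hblocks hxz).1 (Nat.lt_one_iff.1 (not_le.1 hc))

end Assembly

/-! ### From the merge tree to the output -/

section Layout

variable {n b m : ℕ} {P : QIB n b m} {S : P.Solver} {N L₁ L₂ K κ : ℕ} {ε : ℝ}
  {D : RootedDecomposition P.graph N} {σ σ' : Store}

/-- The memory holds the slots of the constraints and the merge tree. Slots are stored as positive
numbers. -/
structure Layout (D : RootedDecomposition P.graph N) (L₁ L₂ : ℕ) (σ : Store) : Prop where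
  coloured : Coloured D P.IsMixed L₁ L₂ (fun _ => True) (fun r => σ.nat aCol r 0)
    (fun r => σ.nat aTop r 0)
  keep : ∀ t < N, MarksRow ((D.bagN t).filter fun r => D.topN r ≠ t) (fun r => σ.nat aCol r 0)
    (σ.nat aKeep t)
  fin : ∀ t < N, MarksRow ((D.bagN t).filter fun r => D.topN r = t) (fun r => σ.nat aCol r 0)
    (σ.nat aFin t)
  fin_leaf : ∀ t, N ≤ t → ∀ c, σ.nat aFin t c = 0
  leaf : ∀ i : Fin b, MarksRow (P.consOf i) (fun r => σ.nat aCol r 0) (σ.nat aKeep (N + i))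
  par : ∀ k < N + b, σ.nat aPar k 0 = QIB.mergePar D k

namespace Layout

lemma congr (h : Layout D L₁ L₂ σ)
    (h' : ∀ a ∈ [aCol, aTop, aKeep, aFin, aPar], σ'.nat a = σ.nat a) : Layout D L₁ L₂ σ' := by
  have h1 := h' aCol (by decide)
  have h2 := h' aTop (by decide)
  have h3 := h' aKeep (by decide)
  have h4 := h' aFin (by decide)
  have h5 := h' aPar (by decide)
  refine ⟨?_, ?_, ?_, ?_, ?_, ?_⟩
  · rw [h1, h2]; exact h.coloured
  · rw [h1, h3]; exact h.keep
  · rw [h1, h4]; exact h.fin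
  · rw [h4]; exact h.fin_leaf
  · rw [h1, h3]; exact h.leaf
  · rw [h5]; exact h.par

variable (h : Layout D L₁ L₂ σ)
include h

lemma col_ne_zero (r : Fin m) : σ.nat aCol r 0 ≠ 0 := (h.coloured.iff r).2 trivial

lemma slot_inj (t : ℕ) (r r' : Fin m) (hr : r ∈ D.bagN t) (hr' : r' ∈ D.bagN t)
    (he : σ.nat aCol r 0 - 1 = σ.nat aCol r' 0 - 1) : r = r' := by
  have h1 := h.col_ne_zero r
  have h2 := h.col_ne_zero r'
  exact h.coloured.inj r r' t trivial trivial hr hr' (by omega)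

lemma slotMap : SlotMap P L₁ L₂ fun r => σ.nat aCol r 0 - 1 where
  mixed r hr := by
    have h1 := h.col_ne_zero r
    have h2 := h.coloured.mixed r trivial hr
    omega
  comb r hr := by
    have h2 := h.coloured.comb r trivial hr
    omega
  inj i r hr r' hr' he := by
    obtain ⟨t, -, ht⟩ := QIB.exists_consOf_subset (D := D) i
    exact h.slot_inj t r r' (ht hr) (ht hr') he

/-- The merge tree with the slots that the memory holds. -/
noncomputable abbrev tree : MergeTree m := QIB.mergeTree D (fun r => σ.nat aCol r 0 - 1) h.slot_inj

lemma keep_iff {k : ℕ} (hk : k < N + b) (c : ℕ) : σ.nat aKeep k c ≠ 0 ↔ h.tree.Kept k c := by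
  have key : ∀ A : Finset (Fin m), MarksRow A (fun r => σ.nat aCol r 0) (σ.nat aKeep k) →
      (∀ r, r ∈ A ↔ r ∈ QIB.mergeBag D k ∧ D.topN r ≠ k) →
        (σ.nat aKeep k c ≠ 0 ↔ h.tree.Kept k c) := by
    intro A hA hmem
    constructor
    · intro hc
      obtain ⟨r, hr, he⟩ := hA.2 c hc
      exact ⟨r, ((hmem r).1 hr).1, ((hmem r).1 hr).2, Nat.pred_eq_of_eq_succ he⟩
    · rintro ⟨r, hr, htop, rfl⟩
      have := hA.1 r ((hmem r).2 ⟨hr, htop⟩)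
      change σ.nat aKeep k (σ.nat aCol r 0 - 1) ≠ 0
      rw [this]
      exact Nat.succ_ne_zero _
  rcases QIB.eq_leaf_or hk with hk' | ⟨i, rfl⟩
  · refine key _ (h.keep k hk') fun r => ?_
    rw [QIB.mergeBag_node hk', Finset.mem_filter]
  · refine key _ (h.leaf i) fun r => ?_
    rw [QIB.mergeBag_leaf]
    have := RootedDecomposition.topN_lt (D := D) r
    exact ⟨fun hr => ⟨hr, by omega⟩, fun hr => hr.1⟩

lemma mergeReady (hN : σ.nat 0 3 0 = N) (hb : σ.nat 0 2 0 = b)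
    (hrhs : ∀ r : Fin m, σ.real 1 r 0 = P.rhs r) (hL : σ.nat vL 0 0 = L₁ + L₂)
    (hS : σ.nat vS 0 0 = digitWeight (slotRange L₁ K κ) (L₁ + L₂))
    (hR : RadixTable (slotRange L₁ K κ) (slotUnit L₁ ε) (L₁ + L₂) σ)
    (hdig : ∀ c < L₁ + L₂, ∀ e < digitWeight (slotRange L₁ K κ) (L₁ + L₂),
      σ.nat aDig e c = digit (slotRange L₁ K κ) e c) :
    MergeReady h.tree (slotRange L₁ K κ) (L₁ + L₂) (slotUnit L₁ ε) P.rhs σ where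
  nodes := hN
  blocks := hb
  rhs := hrhs
  slots := hL
  size := hS
  radix := hR
  digits := hdig
  keep k hk c := h.keep_iff hk c
  fin k hk r hr htop := by
    have hkN : k < N := htop ▸ RootedDecomposition.topN_lt (D := D) r
    change r ∈ QIB.mergeBag D k at hr
    rw [QIB.mergeBag_node hkN] at hr
    exact (h.fin k hkN).1 r (Finset.mem_filter.2 ⟨hr, htop⟩)
  fin_mem k hk c hc := by
    by_cases hkN : k < N
    · obtain ⟨r, hr, he⟩ := (h.fin k hkN).2 c hc
      rw [Finset.mem_filter] at hr
      refine ⟨r, ?_, hr.2, Nat.pred_eq_of_eq_succ he⟩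
      change r ∈ QIB.mergeBag D k
      rw [QIB.mergeBag_node hkN]
      exact hr.1
    · exact absurd (h.fin_leaf k (not_lt.1 hkN) c) hc
  par k hk := h.par k hk

end Layout

/-- A bound on the number of steps once the merge tree is known, in terms of the number `d` of
codes, the number `d₁` of codes for the slots of mixed-integer constraints, and the largest radix
`R`. -/
def solveBound (N b L₁ L₂ d d₁ R : ℕ) : ℕ :=
  ((L₁ + L₂) * (3 * R + 11) + 7) + (((L₁ + L₂) * (11 * d + 7) + 2) +
    ((b * (d₁ * (L₁ * 4 + 11) + L₂ * 8 + 15) + (N + b) * 6 + 11) +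
      ((N + b) * (d * (d * ((L₁ + L₂) * 12 + 17) + 5) + 10) + 2) +
        ((N + b) * 7 + b * (L₁ * 4 + 10) + 10)))

lemma solveBound_mono (N b L₁ L₂ : ℕ) {d d' : ℕ} (d₁ R : ℕ) (h : d ≤ d') :
    solveBound N b L₁ L₂ d d₁ R ≤ solveBound N b L₁ L₂ d' d₁ R := by
  unfold solveBound
  gcongr

lemma runs_solve (hP : P.Scaled) (hκ : ∀ r, ¬ P.IsMixed r → (P.blocksOf r).card ≤ κ) (hε : 0 < ε)
    (hK : 1 < K * ε) (hE : S.Exact) (h : Layout D L₁ L₂ σ) (hblank : Blank σ)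
    (hN : σ.nat 0 3 0 = N) (hb : σ.nat 0 2 0 = b) (heps : σ.real rEps 0 0 = ε)
    (hrhs : ∀ r : Fin m, σ.real 1 r 0 = P.rhs r)
    (hcoeff : ∀ (r : Fin m) (i : Fin b), σ.real 2 r i = (P.con r).v i)
    (hgrid : σ.nat vK 0 0 = K) (hkap : σ.nat vKap 0 0 = κ) (h1 : σ.nat vL1 0 0 = L₁)
    (h2 : σ.nat vL2 0 0 = L₂) (hmul : ∀ c, σ.nat aMul c 0 = 0) (hz : σ.nat vZ0 0 0 = 0)
    {d d₁ R : ℕ} (hd : digitWeight (slotRange L₁ K κ) (L₁ + L₂) = d)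
    (hd₁ : digitWeight (slotRange L₁ K κ) L₁ = d₁) (hR : ∀ c, 2 * slotRange L₁ K κ c + 1 ≤ R) :
    Runs S (.block [progRadix, progDigits, progInit, progMerge, progFinish]) σ
      (solveBound N b L₁ L₂ d d₁ R) (b * d₁ + b) (Correct P ε) := by
  refine Runs.cons' (runs_radix h1 h2 hgrid hkap heps hmul hz hR) fun σ₁ F₁ ⟨I₁, I₂, I₃, I₄⟩ => ?_
  rw [hd] at I₃
  refine Runs.cons' (runs_digits I₁ I₃ I₂) fun σ₂ F₂ I₅ => ?_
  have hn : ∀ a ∈ [0, vK, vL1, vL2, vKap, aCol, aTop, aKeep, aFin, aPar], σ₂.nat a = σ.nat a :=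
    fun a ha => (F₂.nat a (by revert a; decide)).trans (F₁.nat a (by revert a; decide))
  have hr : ∀ a ∈ [rEps, 1, 2], σ₂.real a = σ.real a :=
    fun a ha => (F₂.real a (by revert a; decide)).trans (F₁.real a (by revert a; decide))
  have hL : Layout D L₁ L₂ σ₂ := h.congr fun a ha => hn a (by revert a; decide)
  have hrad : RadixTable (slotRange L₁ K κ) (slotUnit L₁ ε) (L₁ + L₂) σ₂ :=
    I₂.congr (F₂.nat _ (by decide)) (F₂.real _ (by decide)) (F₂.nat _ (by decide))
      (F₂.nat _ (by decide)) (F₂.nat _ (by decide))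
  have hsize : σ₂.nat vS 0 0 = digitWeight (slotRange L₁ K κ) (L₁ + L₂) := by
    rw [F₂.nat vS (by decide), I₃, hd]
  have hvL : σ₂.nat vL 0 0 = L₁ + L₂ := by rw [F₂.nat vL (by decide), I₁]
  rw [← hd] at I₅
  have hN₂ : σ₂.nat 0 3 0 = N := by rw [hn 0 (by decide), hN]
  have hb₂ : σ₂.nat 0 2 0 = b := by rw [hn 0 (by decide), hb]
  have hrhs₂ : ∀ r : Fin m, σ₂.real 1 r 0 = P.rhs r := by rwa [hr 1 (by decide)]
  refine runs_tables hP hL.slotMap hκ hε hK hE ?_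
    (hL.mergeReady hN₂ hb₂ hrhs₂ hvL hsize hrad I₅)
    ((hblank.congr F₁ (by decide) (by decide)).congr F₂ (by decide) (by decide)) hd hd₁
  exact {
    nodes := hN₂
    blocks := hb₂
    eps := by rw [hr rEps (by decide), heps]
    rhs := hrhs₂
    coeff := by rwa [hr 2 (by decide)]
    grid := by rw [hn vK (by decide), hgrid]
    support := by rw [hn vKap (by decide), hkap]
    slots₁ := by rw [hn vL1 (by decide), h1]
    slots₂ := by rw [hn vL2 (by decide), h2]
    slots := hvL
    size := hsize
    size₁ := by rw [F₂.nat vS1 (by decide), I₄]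
    radix := hrad
    digits := I₅
    leaf := fun i r hr => (hL.leaf i).1 r hr
    leaf_mem := fun i c hc => by
      obtain ⟨r, hr, he⟩ := (hL.leaf i).2 c hc
      exact ⟨r, hr, Nat.pred_eq_of_eq_succ he⟩ }

end Layout

/-! ### The number of steps of the program -/

section Total

variable {n b m : ℕ} {P : QIB n b m} {S : P.Solver} {N L₁ L₂ K κ : ℕ} {ε : ℝ}
  {D : RootedDecomposition P.graph N}

lemma digitWeight_slotRange_left (L₁ K κ : ℕ) :
    digitWeight (slotRange L₁ K κ) L₁ = (2 * K + 1) ^ L₁ := by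
  unfold digitWeight
  rw [Finset.prod_congr rfl fun c hc => by rw [slotRange, if_pos (Finset.mem_range.1 hc)]]
  simp

lemma digitWeight_slotRange (L₁ L₂ K κ : ℕ) :
    digitWeight (slotRange L₁ K κ) (L₁ + L₂) = (2 * K + 1) ^ L₁ * (2 * κ + 1) ^ L₂ := by
  rw [← digitWeight_slotRange_left L₁ K κ]
  unfold digitWeight
  rw [Finset.prod_range_add, Finset.prod_congr (s₁ := Finset.range L₂) rfl fun c _ => by
    rw [slotRange, if_neg (by omega : ¬ L₁ + c < L₁)]]
  simp

/-- A bound on the number of steps of the program in terms of the number `d` of codes, the number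
`d₁` of codes for the slots of mixed-integer constraints, and the largest radix `R`. -/
def stepBound (N b m L₁ L₂ d d₁ R : ℕ) : ℕ :=
  (R + 5) + ((4 * N + 4 * m + 7) + ((N * (L₁ * (2 * L₁ + 18) + 7) + 2) +
    ((b * (L₁ * 11 + 4) + 2) + ((N * 3 + 4) + solveBound N b L₁ L₂ d d₁ R))))

theorem runs_qibProgram (hP : P.Scaled) (hε : 0 < ε) (hE : S.Exact)
    (hL₁ : (Finset.univ.sup fun t => (D.bag t).card) = L₁) (hL₂ : min P.combs.card L₁ = L₂) :
    Runs S qibProgram (inputStore P D ε)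
      (stepBound N b m L₁ L₂ ((2 * gridSize ε + 1) ^ L₁ * (2 * P.kappa + 1) ^ L₂)
        ((2 * gridSize ε + 1) ^ L₁) (2 * gridSize ε + 2 * P.kappa + 1))
      (b * (2 * gridSize ε + 1) ^ L₁ + b) (Correct P ε) := by
  set σ := inputStore P D ε with hσ
  have hzn : ∀ a, 8 ≤ a → ∀ j k, σ.nat a j k = 0 := by
    intro a ha j k
    match a, ha with
    | a + 8, _ => rfl
  have hzr : ∀ a, 3 ≤ a → ∀ j k, σ.real a j k = 0 := by
    intro a ha j k
    match a, ha with
    | a + 3, _ => rfl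
  have hN : σ.nat 0 3 0 = N := rfl
  have hb : σ.nat 0 2 0 = b := rfl
  have hm : σ.nat 0 1 0 = m := rfl
  have hmx : ∀ r : Fin m, σ.nat 2 r 0 = 0 ↔ ¬ P.IsMixed r := by
    intro r
    by_cases h : P.IsMixed r <;> simp [hσ, inputStore, h]
  have hcsize : ∀ i : Fin b, σ.nat 3 i 0 = (P.consOf i).card := fun i => by simp [hσ, inputStore]
  have hclist : ∀ i : Fin b, ∀ k < (P.consOf i).card, σ.nat 4 i k = listElem (P.consOf i) k :=
    fun i k _ => by simp [hσ, inputStore, listElem]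
  have hpar : ∀ t (ht : t < N), σ.nat 5 t 0 = D.par ⟨t, ht⟩ := fun t ht => by
    simp [hσ, inputStore, ht]
  have hbsize : ∀ t < N, σ.nat 6 t 0 = (D.bagN t).card := fun t ht => by
    simp [hσ, inputStore, ht, RootedDecomposition.bagN]
  have hblist : ∀ t < N, ∀ k < (D.bagN t).card, σ.nat 7 t k = listElem (D.bagN t) k :=
    fun t ht k _ => by simp [hσ, inputStore, listElem, ht, RootedDecomposition.bagN]
  have heps : σ.real 0 0 0 = ε := by simp [hσ, inputStore]
  have hrhs : ∀ r : Fin m, σ.real 1 r 0 = P.rhs r := fun r => by simp [hσ, inputStore]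
  have hcoeff : ∀ (r : Fin m) (i : Fin b), σ.real 2 r i = (P.con r).v i := fun r i => by
    simp [hσ, inputStore]
  have hsup : (Finset.range N).sup (fun t => σ.nat 6 t 0) = L₁ := by
    rw [← hL₁]
    refine le_antisymm (Finset.sup_le fun t ht => ?_) (Finset.sup_le fun t _ => ?_)
    · have ht := Finset.mem_range.1 ht
      rw [hbsize t ht, RootedDecomposition.bagN_eq ht]
      exact Finset.le_sup (f := fun t => (D.bag t).card) (Finset.mem_univ _)
    · refine le_trans (le_of_eq ?_) (Finset.le_sup (Finset.mem_range.2 t.2))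
      rw [hbsize t t.2, RootedDecomposition.bagN_eq t.2]
  have hbag : ∀ t, (D.bagN t).card ≤ L₁ := fun t => by
    by_cases ht : t < N
    · rw [← hsup, ← hbsize t ht]
      exact Finset.le_sup (f := fun t => σ.nat 6 t 0) (Finset.mem_range.2 ht)
    · simp [RootedDecomposition.bagN, ht]
  have hcombs : ((Finset.range m).filter fun r => σ.nat 2 r 0 = 0).card = P.combs.card := by
    symm
    refine Finset.card_bij (fun r _ => (r : ℕ)) (fun r hr => ?_) (fun r _ r' _ h => Fin.ext h)
      fun r hr => ?_
    · simp only [QIB.combs, Finset.mem_filter, Finset.mem_univ, true_and] at hr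
      exact Finset.mem_filter.2 ⟨Finset.mem_range.2 r.2, (hmx r).2 hr⟩
    · rw [Finset.mem_filter, Finset.mem_range] at hr
      exact ⟨⟨r, hr.1⟩, by simpa [QIB.combs] using (hmx ⟨r, hr.1⟩).1 hr.2, rfl⟩
  have hcomb : ∀ t, ∀ A ⊆ D.bagN t, (∀ r ∈ A, ¬ P.IsMixed r) → A.card ≤ L₂ := by
    intro t A hA hA'
    rw [← hL₂]
    refine le_min (Finset.card_le_card fun r hr => ?_)
      ((Finset.card_le_card hA).trans (hbag t))
    simpa [QIB.combs] using hA' r hr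
  have hL₂₁ : L₂ ≤ L₁ := hL₂ ▸ min_le_right _ _
  refine (Runs.cons' (runs_grid hε heps) fun σ₁ F₁ I₁ => Runs.cons'
    (runs_slots (N := N) (m := m) (by rw [F₁.nat 0 (by decide), hN])
      (by rw [F₁.nat 0 (by decide), hm])
      (by rw [F₁.nat vL1 (by decide)]; exact hzn _ (by decide) 0 0)
      (by rw [F₁.nat vMc (by decide)]; exact hzn _ (by decide) 0 0))
    fun σ₂ F₂ ⟨I₂, I₃⟩ => ?_).mono
      (t := (2 * gridSize ε + 5) + ((4 * N + 4 * m + 7) +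
        ((N * (L₁ * (2 * L₁ + 18) + 7) + 2) + ((b * (L₁ * 11 + 4) + 2) + ((N * 3 + 4) +
          solveBound N b L₁ L₂ ((2 * gridSize ε + 1) ^ L₁ * (2 * P.kappa + 1) ^ L₂)
            ((2 * gridSize ε + 1) ^ L₁) (2 * gridSize ε + 2 * P.kappa + 1))))))
      (by unfold stepBound; omega) le_rfl fun _ _ h => h
  rw [F₁.nat 6 (by decide), hsup] at I₂
  rw [F₁.nat 6 (by decide), F₁.nat 2 (by decide), hsup, hcombs, hL₂] at I₃
  have E₂ : ∀ a ∈ [0, 2, 3, 4, 5, 6, 7, 8, 9, vKap, aCnt, aCol, aKeep, aFin, aPar, aMul, vZ0, aFl,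
      aCur], σ₂.nat a = σ.nat a := fun a ha =>
    (F₂.nat a (by revert a; decide)).trans (F₁.nat a (by revert a; decide))
  refine Runs.cons' (runs_colour (D := D) (mx := P.IsMixed) (L₁ := L₁) (L₂ := L₂)
    (by rw [E₂ 0 (by decide), hN]) (by rw [E₂ 6 (by decide)]; exact hbsize)
    (by rw [E₂ 7 (by decide)]; exact hblist) I₂ (by rw [E₂ 2 (by decide)]; exact hmx) hbag hcomb
    hL₂₁ (by rw [E₂ aCol (by decide)]; exact fun r => hzn aCol (by decide) r 0)
    (by rw [E₂ aKeep (by decide)]; exact hzn aKeep (by decide))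
    (by rw [E₂ aFin (by decide)]; exact hzn aFin (by decide))) fun σ₃ F₃ ⟨J₁, J₂, J₃⟩ => ?_
  have E₃ : ∀ a ∈ [0, 2, 3, 4, 5, 8, 9, vKap, aCnt, aPar, aMul, vZ0, aFl, aCur],
      σ₃.nat a = σ.nat a := fun a ha =>
    (F₃.nat a (by revert a; decide)).trans (E₂ a (by revert a; decide))
  have hcol : ∀ r : Fin m, σ₃.nat aCol r 0 ≠ 0 := fun r => (J₁.iff r).2 trivial
  refine Runs.cons' (runs_leaves (P := P) (N := N) (L₁ := L₁) (by rw [E₃ 0 (by decide), hN])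
    (by rw [E₃ 0 (by decide), hb]) (by rw [E₃ 3 (by decide)]; exact hcsize)
    (by rw [E₃ 4 (by decide)]; exact hclist) (by rw [E₃ 2 (by decide)]; exact hmx) hcol
    (fun i r hr r' hr' he => ?_) (fun i => ?_) (fun t ht c => (J₃ t ht c).1)
    (by rw [E₃ aPar (by decide)]; exact fun t => hzn aPar (by decide) t 0)
    (by rw [E₃ aCnt (by decide)]; exact fun r => hzn aCnt (by decide) r 0)
    (by rw [E₃ vKap (by decide)]; exact hzn vKap (by decide) 0 0)) fun σ₄ F₄ ⟨K₁, K₂, K₃⟩ => ?_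
  · obtain ⟨t, -, ht⟩ := QIB.exists_consOf_subset (D := D) i
    exact J₁.inj r r' t trivial trivial (ht hr) (ht hr') he
  · obtain ⟨t, -, ht⟩ := QIB.exists_consOf_subset (D := D) i
    exact (Finset.card_le_card ht).trans (hbag t)
  refine Runs.cons' (runs_parents (N := N) (b := b)
    (by rw [F₄.nat 0 (by decide), E₃ 0 (by decide), hN])
    (by rw [F₄.nat 0 (by decide), E₃ 0 (by decide), hb])) fun σ₅ F₅ ⟨M₁, M₂, M₃⟩ => ?_
  have E₅ : ∀ a ∈ [0, 2, 5, 8, 9, aMul, vZ0, aFl, aCur], σ₅.nat a = σ.nat a := fun a ha =>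
    (F₅.nat a (by revert a; decide)).trans ((F₄.nat a (by revert a; decide)).trans
      (E₃ a (by revert a; decide)))
  have R₅ : ∀ a, σ₅.real a = σ.real a := fun a => by
    rw [F₅.real a List.not_mem_nil, F₄.real a List.not_mem_nil, F₃.real a List.not_mem_nil,
      F₂.real a List.not_mem_nil, F₁.real a List.not_mem_nil]
  have hcol₅ : σ₅.nat aCol = σ₃.nat aCol :=
    (F₅.nat aCol (by decide)).trans (F₄.nat aCol (by decide))
  have htop₅ : σ₅.nat aTop = σ₃.nat aTop :=
    (F₅.nat aTop (by decide)).trans (F₄.nat aTop (by decide))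
  have hkeep₅ : σ₅.nat aKeep = σ₄.nat aKeep := F₅.nat aKeep (by decide)
  have hfin₅ : σ₅.nat aFin = σ₃.nat aFin :=
    (F₅.nat aFin (by decide)).trans (F₄.nat aFin (by decide))
  have hlay : Layout D L₁ L₂ σ₅ := by
    refine ⟨by rwa [hcol₅, htop₅], fun t ht => ?_, fun t ht => ?_, fun t ht c => ?_, fun i => ?_,
      fun k hk => ?_⟩
    · rw [hcol₅, hkeep₅, K₂.2 t (Or.inl ht)]
      exact (J₂ t ht).1
    · rw [hcol₅, hfin₅]
      exact (J₂ t ht).2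
    · rw [hfin₅]
      exact (J₃ t ht c).2
    · rw [hcol₅, hkeep₅]
      exact K₂.1 i
    · have hpos := D.pos
      rcases Nat.eq_zero_or_pos k with rfl | h0
      · rw [M₁, QIB.mergePar, if_pos rfl]
      rcases QIB.eq_leaf_or hk with hkN | ⟨i, rfl⟩
      · rw [M₂ k h0 hkN, F₄.nat 5 (by decide), E₃ 5 (by decide), hpar k hkN, QIB.mergePar,
          if_neg h0.ne', dif_pos hkN]
      · rw [M₃ _ h0 (Nat.le_add_right _ _), K₃, QIB.mergePar_leaf]
        exact Finset.sup_congr rfl fun r _ => J₁.top r trivial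
  have hkap₅ : σ₅.nat vKap = σ₄.nat vKap := F₅.nat vKap (by decide)
  refine (runs_solve (K := gridSize ε) (κ := σ₄.nat vKap 0 0)
    (R := 2 * gridSize ε + 2 * P.kappa + 1)
    hP K₁.1 hε (one_lt_gridSize_mul hε) hE hlay ⟨fun a ha i k => ?_, fun a ha i k => ?_⟩
    (by rw [E₅ 0 (by decide), hN]) (by rw [E₅ 0 (by decide), hb]) (by rw [R₅, heps])
    (by rwa [R₅]) (by rwa [R₅]) ?_ (by rw [hkap₅]) ?_ ?_
    (by rw [E₅ aMul (by decide)]; exact fun c => hzn aMul (by decide) c 0)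
    (by rw [E₅ vZ0 (by decide)]; exact hzn vZ0 (by decide) 0 0) (digitWeight_slotRange _ _ _ _)
    (digitWeight_slotRange_left _ _ _) fun c => ?_).mono (solveBound_mono _ _ _ _ _ _ ?_) le_rfl
      fun _ _ h => h
  · rw [E₅ a (by revert a; decide)]
    exact hzn a (by revert a; decide) i k
  · rw [R₅]
    exact hzr a (by revert a; decide) i k
  · rw [F₅.nat vK (by decide), F₄.nat vK (by decide), F₃.nat vK (by decide), F₂.nat vK (by decide),
      I₁]
  · rw [F₅.nat vL1 (by decide), F₄.nat vL1 (by decide), F₃.nat vL1 (by decide), I₂]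
  · rw [F₅.nat vL2 (by decide), F₄.nat vL2 (by decide), F₃.nat vL2 (by decide), I₃]
  · have := K₁.2
    unfold slotRange
    split_ifs <;> omega
  · have := K₁.2
    gcongr

end Total

/-! ### Estimates of the running time -/

lemma stepBound_le {N b m L₁ L₂ d d₁ R s W : ℕ} (hN : N ≤ s) (hb : b ≤ s) (hm : m ≤ s) (hs : 0 < s)
    (h₁ : L₁ ≤ W) (h₂ : L₂ ≤ W) (hW : 0 < W) (hd : 0 < d) (hd₁ : d₁ ≤ d) :
    stepBound N b m L₁ L₂ d d₁ R ≤ 400 * (s * W ^ 2 * (d * d + R)) := by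
  set Z := d * d + R with hZ
  have hRZ : R ≤ Z := by omega
  have hdd : d * d ≤ Z := by omega
  have hdZ : d ≤ Z := (Nat.le_mul_of_pos_left d hd).trans hdd
  have hZ0 : 0 < Z := hd.trans_le hdZ
  have hd₁Z : d₁ ≤ Z := hd₁.trans hdZ
  have hmain : d * (d * ((L₁ + L₂) * 12 + 17) + 5) + 10 ≤ Z * ((W + W) * 12 + 17) + 5 * Z + 10 := by
    calc d * (d * ((L₁ + L₂) * 12 + 17) + 5) + 10
        = (d * d) * ((L₁ + L₂) * 12 + 17) + 5 * d + 10 := by ring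
      _ ≤ _ := by gcongr
  have hle : stepBound N b m L₁ L₂ d d₁ R ≤ (Z + 5) + ((4 * s + 4 * s + 7) +
      ((s * (W * (2 * W + 18) + 7) + 2) + ((s * (W * 11 + 4) + 2) + ((s * 3 + 4) +
        (((W + W) * (3 * Z + 11) + 7) + (((W + W) * (11 * Z + 7) + 2) +
          ((s * (Z * (W * 4 + 11) + W * 8 + 15) + (s + s) * 6 + 11) +
            ((s + s) * (Z * ((W + W) * 12 + 17) + 5 * Z + 10) + 2) +
              ((s + s) * 7 + s * (W * 4 + 10) + 10)))))))) := by
    unfold stepBound solveBound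
    gcongr
  refine hle.trans ?_
  -- every monomial of the bound is dominated by the leading one
  have key : ∀ i ≤ 1, ∀ j ≤ 2, ∀ k ≤ 1, s ^ i * W ^ j * Z ^ k ≤ s * W ^ 2 * Z := by
    intro i hi j hj k hk
    calc s ^ i * W ^ j * Z ^ k ≤ s ^ 1 * W ^ 2 * Z ^ 1 := by
          gcongr
      _ = s * W ^ 2 * Z := by ring
  have e0 := key 0 (by decide) 0 (by decide) 0 (by decide)
  have e1 := key 0 (by decide) 0 (by decide) 1 (by decide)
  have e2 := key 0 (by decide) 1 (by decide) 0 (by decide)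
  have e3 := key 0 (by decide) 1 (by decide) 1 (by decide)
  have e4 := key 1 (by decide) 0 (by decide) 0 (by decide)
  have e5 := key 1 (by decide) 0 (by decide) 1 (by decide)
  have e6 := key 1 (by decide) 1 (by decide) 0 (by decide)
  have e7 := key 1 (by decide) 1 (by decide) 1 (by decide)
  have e8 := key 1 (by decide) 2 (by decide) 0 (by decide)
  linarith

lemma two_gridSize_add_one_le {ε : ℝ} (hε : 0 < ε) (hε1 : ε < 1) :
    ((2 * gridSize ε + 1 : ℕ) : ℝ) ≤ 3 * (2 / ε) := by
  have h1 : (⌊1 / ε⌋₊ : ℝ) ≤ 1 / ε := Nat.floor_le (by positivity)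
  have h2 : 1 ≤ 1 / ε := by rw [le_div_iff₀ hε]; linarith
  have h3 : 2 / ε = 2 * (1 / ε) := by ring
  rw [h3]
  unfold gridSize
  push_cast
  linarith

/-- The bound of the theorem on the number of steps, with `W = ω + 1`, `X = 2 / ε`, `A` and `2 * κ
+ 1` the radices, `k = max κ 1` and `c` the number of combinatorial constraints. -/
lemma cast_stepBound_le {N b m L₁ L₂ A κ s W c : ℕ} {X : ℝ} (hN : N ≤ s) (hb : b ≤ s) (hm : m ≤ s)
    (hs : 0 < s) (h₁ : L₁ ≤ W) (h₂ : L₂ ≤ min c W) (hW : 0 < W) (hA : 0 < A) (hX : 1 ≤ X)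
    (hAX : (A : ℝ) ≤ 3 * X) (hκ : c = 0 → κ = 0) :
    (stepBound N b m L₁ L₂ (A ^ L₁ * (2 * κ + 1) ^ L₂) (A ^ L₁) (A + 2 * κ) : ℝ)
      ≤ 777600 ^ W * (s * X ^ (2 * W) * ((max κ 1 : ℕ) : ℝ) ^ (2 * min c W)) := by
  set k : ℝ := ((max κ 1 : ℕ) : ℝ) with hk
  set M := min c W with hM
  have hk1 : 1 ≤ k := by rw [hk]; exact_mod_cast le_max_right κ 1
  have hκk : (κ : ℝ) ≤ k := by rw [hk]; exact_mod_cast le_max_left κ 1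
  have hMW : M ≤ W := min_le_right _ _
  set d := A ^ L₁ * (2 * κ + 1) ^ L₂ with hd
  have hd0 : 0 < d := by positivity
  have hmain := stepBound_le (N := N) (b := b) (m := m) (L₁ := L₁) (L₂ := L₂) (d := d)
    (d₁ := A ^ L₁) (R := A + 2 * κ) (s := s) (W := W) hN hb hm hs h₁ (h₂.trans hMW) hW hd0
    (Nat.le_mul_of_pos_right _ (by positivity))
  have hcast : (stepBound N b m L₁ L₂ d (A ^ L₁) (A + 2 * κ) : ℝ)
      ≤ 400 * (s * (W : ℝ) ^ 2 * ((d : ℝ) * d + (A + 2 * κ))) := by exact_mod_cast hmain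
  have hdle : (d : ℝ) ≤ 9 ^ W * X ^ W * k ^ M := by
    have e1 : (A : ℝ) ^ L₁ ≤ (3 * X) ^ W :=
      (pow_le_pow_left₀ (by positivity) hAX _).trans (pow_le_pow_right₀ (by linarith) h₁)
    have e2 : (2 * (κ : ℝ) + 1) ^ L₂ ≤ (3 * k) ^ M :=
      (pow_le_pow_left₀ (by positivity) (by linarith) _).trans (pow_le_pow_right₀ (by linarith) h₂)
    have e3 : (3 : ℝ) ^ M ≤ 3 ^ W := pow_le_pow_right₀ (by norm_num) hMW
    calc (d : ℝ) = (A : ℝ) ^ L₁ * (2 * κ + 1) ^ L₂ := by rw [hd]; push_cast; ring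
      _ ≤ (3 * X) ^ W * (3 * k) ^ M := by gcongr
      _ = 3 ^ W * X ^ W * (3 ^ M * k ^ M) := by rw [mul_pow, mul_pow]
      _ ≤ 3 ^ W * X ^ W * (3 ^ W * k ^ M) := by gcongr
      _ = (3 * 3) ^ W * X ^ W * k ^ M := by rw [mul_pow]; ring
      _ = _ := by norm_num
  set Y := X ^ (2 * W) * k ^ (2 * M) with hY
  have hdd : (d : ℝ) * d ≤ 81 ^ W * Y := by
    calc (d : ℝ) * d ≤ (9 ^ W * X ^ W * k ^ M) * (9 ^ W * X ^ W * k ^ M) := by gcongr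
      _ = (9 * 9) ^ W * Y := by rw [hY, mul_pow, two_mul W, two_mul M, pow_add, pow_add]; ring
      _ = _ := by norm_num
  have hXW : X ≤ X ^ (2 * W) := le_self_pow₀ hX (by omega)
  -- if there are no combinatorial constraints, the power of `k` is trivial
  have hkM : (κ : ℝ) ≤ k ^ (2 * M) := by
    rcases Nat.eq_zero_or_pos c with h | h
    · rw [hκ h, Nat.cast_zero]; positivity
    · exact hκk.trans (le_self_pow₀ hk1 (by omega))
  have hX1 : 1 ≤ X ^ (2 * W) := one_le_pow₀ hX
  have hkM1 : 1 ≤ k ^ (2 * M) := one_le_pow₀ hk1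
  have h81 : (1 : ℝ) ≤ 81 ^ W := one_le_pow₀ (by norm_num)
  have hR : (A : ℝ) + 2 * κ ≤ 81 ^ W * (5 * Y) := by
    have e1 : X ^ (2 * W) ≤ Y := le_mul_of_one_le_right (by positivity) hkM1
    have e2 : k ^ (2 * M) ≤ Y := le_mul_of_one_le_left (by positivity) hX1
    calc (A : ℝ) + 2 * κ ≤ 5 * Y := by linarith
      _ ≤ _ := le_mul_of_one_le_left (by positivity) h81
  have hW2 : (W : ℝ) ^ 2 ≤ 4 ^ W := by
    have : (W : ℝ) ≤ 2 ^ W := by exact_mod_cast (Nat.lt_two_pow_self (n := W)).le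
    calc (W : ℝ) ^ 2 ≤ (2 ^ W) ^ 2 := by gcongr
      _ = 4 ^ W := by rw [← pow_mul, mul_comm, pow_mul]; norm_num
  calc (stepBound N b m L₁ L₂ d (A ^ L₁) (A + 2 * κ) : ℝ)
      ≤ 400 * (s * (W : ℝ) ^ 2 * ((d : ℝ) * d + (A + 2 * κ))) := hcast
    _ ≤ 400 * (s * 4 ^ W * (81 ^ W * Y + 81 ^ W * (5 * Y))) := by gcongr
    _ = 2400 * (4 * 81) ^ W * (s * Y) := by rw [mul_pow]; ring
    _ ≤ 2400 ^ W * (4 * 81) ^ W * (s * Y) := by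
        gcongr
        exact le_self_pow₀ (by norm_num) hW.ne'
    _ = 777600 ^ W * (s * Y) := by rw [← mul_pow]; norm_num
    _ = _ := by rw [hY]; ring

lemma cast_calls_le {b L₁ A W : ℕ} {X : ℝ} (h₁ : L₁ ≤ W) (hW : 0 < W) (hX : 1 ≤ X)
    (hAX : (A : ℝ) ≤ 3 * X) :
    ((b * A ^ L₁ + b : ℕ) : ℝ) ≤ 777600 ^ W * (b * X ^ W) := by
  have e1 : (A : ℝ) ^ L₁ ≤ (3 * X) ^ W :=
    (pow_le_pow_left₀ (by positivity) hAX _).trans (pow_le_pow_right₀ (by linarith) h₁)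
  have e2 : 1 ≤ (3 * X) ^ W := one_le_pow₀ (by linarith)
  calc ((b * A ^ L₁ + b : ℕ) : ℝ) = b * ((A : ℝ) ^ L₁ + 1) := by push_cast; ring
    _ ≤ b * (2 * (3 * X) ^ W) := by gcongr; linarith
    _ = 2 * 3 ^ W * (b * X ^ W) := by rw [mul_pow]; ring
    _ ≤ 2 ^ W * 3 ^ W * (b * X ^ W) := by
        gcongr
        exact le_self_pow₀ (by norm_num) hW.ne'
    _ = (2 * 3) ^ W * (b * X ^ W) := by rw [mul_pow]
    _ ≤ _ := by gcongr; norm_num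

theorem theorem1 :
    ∃ (prog : Cmd) (C : ℝ), 0 < C ∧
      ∀ (n b m : ℕ) (P : QIB n b m), 0 < n → P.Scaled →
        -- the treewidth is attained with at most `n + m` nodes
        (∃ (N : ℕ) (D : RootedDecomposition P.graph N),
          N ≤ n + m ∧ D.width = treewidth P.graph) ∧
        -- the single-block problems are convex with at most `ω + 1` rows
        (∀ i, P.BlockConvexWithRows i (treewidth P.graph + 1)) ∧
        ∀ (N : ℕ) (D : RootedDecomposition P.graph N),
          N ≤ n + m → D.width = treewidth P.graph →
          ∀ (S : P.Solver), S.Exact → ∀ ε : ℝ, 0 < ε → ε < 1 →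
            ∃ (σ : Store) (t q : ℕ),
              Exec S prog (inputStore P D ε) σ t q ∧
              (t : ℝ) ≤ C ^ (treewidth P.graph + 1) *
                ((n + m) * (2 / ε) ^ (2 * treewidth P.graph + 2) *
                  (max P.kappa 1 : ℕ) ^ (2 * min P.combs.card (treewidth P.graph + 1))) ∧
              (q : ℝ) ≤ C ^ (treewidth P.graph + 1) *
                (b * (2 / ε) ^ (treewidth P.graph + 1)) ∧
              ((σ.answer = 0 ∧ ¬ ∃ x z, P.Feasible x z) ∨
                (σ.answer = 1 ∧
                  P.ApproxSolution (P.maxBlocks * ε) (σ.outX n) (σ.outZ b))) := by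
  refine ⟨qibProgram, 777600, by norm_num, fun n b m P hn hP => ⟨?_, P.blockConvexWithRows, ?_⟩⟩
  · obtain ⟨N, D, hN, hD⟩ := exists_rooted_width_eq_treewidth P.graph
    rw [Fintype.card_fin] at hN
    exact ⟨N, D, by omega, hD⟩
  intro N D hN hD S hE ε hε hε1
  obtain ⟨σ, t, q, hex, ht, hq, hσ⟩ := runs_qibProgram (D := D) hP hε hE rfl rfl
  have hL : (Finset.univ.sup fun t => (D.bag t).card) ≤ treewidth P.graph + 1 :=
    Finset.sup_le fun t _ => hD ▸ D.card_bag_le t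
  have hb : b ≤ n := by simpa using Fintype.card_le_of_surjective P.blk P.blk_surj
  have hX : 1 ≤ 2 / ε := by rw [le_div_iff₀ hε]; linarith
  have hA := two_gridSize_add_one_le hε hε1
  have hκ : P.combs.card = 0 → P.kappa = 0 := fun h => by
    rw [QIB.kappa, Finset.card_eq_zero.1 h, Finset.sup_empty, Nat.bot_eq_zero]
  refine ⟨σ, t, q, hex, ?_, ?_, hσ⟩
  · have h := cast_stepBound_le (b := b) (m := m) (κ := P.kappa) (c := P.combs.card) hN
      (by omega : b ≤ n + m) (by omega) (by omega) hL (min_le_min le_rfl hL) (Nat.succ_pos _)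
      (Nat.succ_pos _) hX hA hκ
    rw [add_right_comm] at ht
    refine (Nat.cast_le.2 ht).trans (h.trans (le_of_eq ?_))
    push_cast
    ring_nf
  · exact (Nat.cast_le.2 hq).trans (cast_calls_le hL (Nat.succ_pos _) hX hA)
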